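/- Let $0<\alpha<1$ and let $1\le m\le k\le 6$ be integers. Then there is a constant $c>0$, depending only on $\alpha,k,m$, with the following property. Let $\Omega\subset\mathbb R^d$ ($d\ge1$) be a bounded convex polyhedral domain and let $A=\Delta$ be the Dirichlet Laplacian on $L^2(\Omega)$ with domain $\mathcal D(A)=H^1_0(\Omega)\cap H^2(\Omega)$; write $\|\cdot\|$ for the norm of $L^2(\Omega)$. Let $T>0$, $v\in L^2(\Omega)$ and $g\in C^{k-1}([0,T];L^2(\Omega))$, let $g^{(k-1)}$ be the indefinite integral of an integrable function $g^{(k)}:(0,T)\to L^2(\Omega)$ (the weak $k$-th derivative of $g$), and suppose $\int_0^t(t-s)^{\alpha-1}\|g^{(k)}(s)\|\,ds<\infty$ for $0<t\le T$. Write $J^\beta\varphi(t)=\frac1{\Gamma(\beta)}\int_0^t(t-s)^{\beta-1}\varphi(s)\,ds$ and $\partial_t^\alpha=\frac{d}{dt}J^{1-\alpha}$ (the Riemann–Liouville derivative). Let $V\in C([0,T];L^2(\Omega))$, $V(0)=0$, be the solution of $$\partial_t^\alpha V(t)-AV(t)=Av+g(t),\qquad 0<t\le T .$$ For $N\ge1$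 let $\tau=T/N$, $t_n=n\tau$, $G^n=J^mg(t_n)$, and for $\beta>0$ let $$\partial_{\tau,k}^{\beta}\varphi^n=\tau^{-\beta}\sum_{j=0}^n\omega_j^{(\beta,k)}\varphi^{n-j},\qquad \Big(\sum_{j=1}^k\tfrac1j(1-\xi)^j\Big)^{\beta}=\sum_{j\ge0}\omega_j^{(\beta,k)}\xi^j .$$ Let $V^0=0$ and let $V^1,\dots,V^N\in L^2(\Omega)$ be the solution of the ID$m$-BDF$k$ scheme $$\partial_{\tau,k}^{\alpha}V^n-AV^n=\partial_{\tau,k}^{m}\Big(\frac{t_n^m}{m!}Av+G^n\Big),\qquad 1\le n\le N .$$ Since $v$ need not lie in $\mathcal D(A)$, in both problems the terms containing $A$ are collected: $AV(t)+Av$ is read as $A(V(t)+v)$ with $V(t)+v\in\mathcal D(A)$, and $AV^n+\partial_{\tau,k}^m\big(\frac{t_n^m}{m!}\big)Av$ as $A\big(V^n+\partial_{\tau,k}^m\big(\frac{t_n^m}{m!}\big)v\big)$ with the argument of $A$ in $\mathcal D(A)$. Then for all $1\le n\le N$ $$\|V^n-V(t_n)\|\le c\,j_v\,\|v\|+c\sum_{l=0}^{k-1}j_{g,l}\,\|g^{(l)}(0)\|+c\,\tau^k\int_0^{t_n}(t_n-s)^{\alpha-1}\|g^{(k)}(s)\|\,ds,$$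 where $$j_v=\begin{cases}\tau^{m+1}t_n^{-m-1}+\tau^kt_n^{-k}, & m \text{ odd},\\ \tau^{m+2}t_n^{-m-2}+\tau^kt_n^{-k}, & m\text{ even},\end{cases}$$ $$j_{g,l}=\begin{cases}\tau^{l+m+1}t_n^{\alpha-m-1}+\tau^kt_n^{\alpha+l-k}, & l+m\text{ odd},\\ \tau^{l+m+2}t_n^{\alpha-m-2}+\tau^kt_n^{\alpha+l-k}, & l+m\text{ even}.\end{cases}$$ Here $L^2(\Omega)$ may consist of real-valued or of complex-valued functions. -/

import Mathlib

open Set Filter Topology MeasureTheory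
open scoped ContDiff Distributions

noncomputable section

namespace Subdiffusion

/-! ### Convex polyhedral domains and the Dirichlet Laplacian on `L²(Ω)` -/

/-- `Ω ⊂ ℝᵈ` is a (bounded) convex polyhedral domain: a nonempty set which is the interior of the
convex hull of finitely many points. -/
def IsConvexPolyhedralDomain {d : ℕ} (Ω : TopologicalSpace.Opens (EuclideanSpace ℝ (Fin d))) :
    Prop :=
  (Ω : Set (EuclideanSpace ℝ (Fin d))).Nonempty ∧
    ∃ S : Set (EuclideanSpace ℝ (Fin d)), S.Finite ∧
      (Ω : Set (EuclideanSpace ℝ (Fin d))) = interior (convexHull ℝ S)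

/-- The Hilbert space `L²(Ω)` of square integrable functions, real valued for `𝕜 = ℝ` and
complex valued for `𝕜 = ℂ`, with Lebesgue measure on `Ω`. -/
abbrev L2 (𝕜 : Type*) [RCLike 𝕜] {d : ℕ}
    (Ω : TopologicalSpace.Opens (EuclideanSpace ℝ (Fin d))) : Type _ :=
  Lp 𝕜 2 (volume.restrict (Ω : Set (EuclideanSpace ℝ (Fin d))))

section Laplacian

variable {𝕜 : Type*} [RCLike 𝕜] {d : ℕ}
  {Ω : TopologicalSpace.Opens (EuclideanSpace ℝ (Fin d))}

/-- `w ∈ L²(Ω)` is the weak partial derivative `∂ᵢ u` of `u ∈ L²(Ω)`: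
`∫_Ω (∂ᵢ φ) u = - ∫_Ω φ w` for all `φ ∈ C_c^∞(Ω)`. -/
def HasWeakPartial (i : Fin d) (u w : L2 𝕜 Ω) : Prop :=
  ∀ φ : 𝓓(Ω, ℝ),
    ∫ x in (Ω : Set (EuclideanSpace ℝ (Fin d))),
        (fderiv ℝ φ x (EuclideanSpace.single i 1)) • u x =
      - ∫ x in (Ω : Set (EuclideanSpace ℝ (Fin d))), (φ x) • w x

/-- `u ∈ H¹₀(Ω)`: `u` lies in the closure of `C_c^∞(Ω)` in the `H¹`-norm, that is, for some
`w = (w₁, …, w_d)` in `L²(Ω)ᵈ` the pair `(u, w)` is a limit in `L²(Ω) × L²(Ω)ᵈ` of pairs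
`(φ, ∇φ)` with `φ ∈ C_c^∞(Ω)`. -/
def MemH10 (u : L2 𝕜 Ω) : Prop :=
  ∃ w : Fin d → L2 𝕜 Ω,
    (u, w) ∈ closure {p : L2 𝕜 Ω × (Fin d → L2 𝕜 Ω) | ∃ φ : 𝓓(Ω, 𝕜),
      (p.1 =ᵐ[volume.restrict (Ω : Set (EuclideanSpace ℝ (Fin d)))] φ) ∧
      ∀ i, p.2 i =ᵐ[volume.restrict (Ω : Set (EuclideanSpace ℝ (Fin d)))]
        fun x => fderiv ℝ φ x (EuclideanSpace.single i 1)}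

/-- The graph of the Dirichlet Laplacian `A = Δ` with domain `D(A) = H¹₀(Ω) ∩ H²(Ω)`:
`u ∈ D(A)` and `A u = f`. Here `u ∈ H²(Ω)` means that all weak partial derivatives `w i = ∂ᵢ u`
and `h i j = ∂ⱼ ∂ᵢ u` exist in `L²(Ω)`, and `Δ u = ∑ᵢ ∂ᵢ ∂ᵢ u`. -/
def IsDirichletLaplacian (u f : L2 𝕜 Ω) : Prop :=
  MemH10 u ∧
    ∃ (w : Fin d → L2 𝕜 Ω) (h : Fin d → Fin d → L2 𝕜 Ω),
      (∀ i, HasWeakPartial i u (w i)) ∧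
      (∀ i j, HasWeakPartial j (w i) (h i j)) ∧
      f = ∑ i, h i i

end Laplacian

/-! ### Fractional calculus and BDF convolution quadrature -/

section Calculus

variable {X : Type*} [NormedAddCommGroup X] [NormedSpace ℝ X]

/-- The Riemann–Liouville integral `(J^β φ)(t) = Γ(β)⁻¹ ∫₀ᵗ (t - s)^{β-1} φ(s) ds`, `β > 0`;
for an integer `β = m` it is the `m`-fold integral of `φ`. -/
def rlIntegral (β : ℝ) (φ : ℝ → X) (t : ℝ) : X :=
  (Real.Gamma β)⁻¹ • ∫ s in (0 : ℝ)..t, ((t - s) ^ (β - 1)) • φ s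

/-- `δ_k(ξ) = ∑_{j=1}^k (1/j) (1 - ξ)^j`, the generating polynomial of the `k`-step BDF method
(for step size `1`). -/
def bdfSymbol (k : ℕ) (ξ : ℝ) : ℝ :=
  ∑ j ∈ Finset.Icc 1 k, (1 / (j : ℝ)) * (1 - ξ) ^ j

/-- The weights `ω_j^{(β,k)}`: the coefficients of the power series
`δ_k(ξ)^β = ∑_j ω_j^{(β,k)} ξ^j` at `ξ = 0`, where `δ_k(0) > 0`. -/
def bdfWeight (β : ℝ) (k j : ℕ) : ℝ :=
  iteratedDeriv j (fun ξ : ℝ => bdfSymbol k ξ ^ β) 0 / (j.factorial : ℝ)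

/-- The convolution quadrature
`∂^β_{τ,k} φⁿ = τ^{-β} ∑_{j=0}^n ω_j^{(β,k)} φ^{n-j}` generated by the `k`-step BDF method. -/
def bdfQuadrature (τ β : ℝ) (k : ℕ) (φ : ℕ → X) (n : ℕ) : X :=
  (τ ^ (-β)) • ∑ j ∈ Finset.range (n + 1), bdfWeight β k j • φ (n - j)

/-- Regularity of the source `g` on `[0,T]`: `g ∈ C^{k-1}([0,T]; X)`, the function `gk` is its
`k`-th (weak) derivative `g^{(k)}`, i.e. `g^{(k-1)}` is the indefinite integral of `gk`, and
`∫₀ᵗ (t - s)^{α-1} ‖g^{(k)}(s)‖ ds < ∞` for `0 < t ≤ T`. -/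
structure SourceRegularity (α T : ℝ) (k : ℕ) (g gk : ℝ → X) : Prop where
  contDiffOn : ContDiffOn ℝ ((k - 1 : ℕ) : ℕ∞) g (Icc 0 T)
  integrable : IntervalIntegrable gk volume 0 T
  weakDeriv : ∀ t ∈ Icc (0 : ℝ) T,
    iteratedDerivWithin (k - 1) g (Icc 0 T) t =
      iteratedDerivWithin (k - 1) g (Icc 0 T) 0 + ∫ s in (0 : ℝ)..t, gk s
  weighted : ∀ t ∈ Ioc (0 : ℝ) T,
    IntervalIntegrable (fun s => (t - s) ^ (α - 1) * ‖gk s‖) volume 0 t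

end Calculus

/-! ### The continuous and the discrete problem -/

section Problems

variable {𝕜 : Type*} [RCLike 𝕜] {d : ℕ}
  {Ω : TopologicalSpace.Opens (EuclideanSpace ℝ (Fin d))}

/-- `V` is the solution on `[0,T]` of the subdiffusion equation
`∂ₜ^α V(t) - A V(t) = A v + g(t)`, `0 < t ≤ T`, with `V(0) = 0`. Here
`∂ₜ^α V = d/dt J^{1-α} V` is the Riemann–Liouville derivative. As `v` need not lie in `D(A)`,
`A V(t) + A v` is read as `A (V(t) + v)`. -/
structure IsSolution (α T : ℝ) (v : L2 𝕜 Ω) (g V : ℝ → L2 𝕜 Ω) : Prop where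
  continuousOn : ContinuousOn V (Icc 0 T)
  initial : V 0 = 0
  equation : ∀ t ∈ Ioc (0 : ℝ) T, ∃ DV AV : L2 𝕜 Ω,
    HasDerivWithinAt (rlIntegral (1 - α) V) DV (Icc 0 T) t ∧
    IsDirichletLaplacian (V t + v) AV ∧
    DV - AV = g t

/-- `V⁰, …, V^N` is the solution of the IDm-BDFk scheme with step size `τ`:
`∂^α_{τ,k} Vⁿ - A Vⁿ = ∂^m_{τ,k} ((tₙ^m / m!) A v + Gⁿ)`, `1 ≤ n ≤ N`, with `V⁰ = 0`, where
`tₙ = n τ`, `Gⁿ = (J^m g)(tₙ)`. As `v` need not lie in `D(A)`, the two terms with `A` are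
collected in `A (Vⁿ + (∂^m_{τ,k} tₙ^m / m!) v)`. -/
structure IsDiscreteSolution (α τ : ℝ) (N k m : ℕ) (v : L2 𝕜 Ω) (g : ℝ → L2 𝕜 Ω)
    (V : ℕ → L2 𝕜 Ω) : Prop where
  initial : V 0 = 0
  equation : ∀ n : ℕ, 1 ≤ n → n ≤ N → ∃ AV : L2 𝕜 Ω,
    IsDirichletLaplacian
      (V n + bdfQuadrature τ m k (fun i => (i * τ) ^ m / (m.factorial : ℝ)) n • v) AV ∧
    bdfQuadrature τ α k V n - AV =
      bdfQuadrature τ m k (fun i => rlIntegral m g (i * τ)) n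

end Problems

/-! ### The error terms (up to the constant `c`) -/

/-- `τ^{m+1} t^{-m-1} + τ^k t^{-k}` for odd `m`, `τ^{m+2} t^{-m-2} + τ^k t^{-k}` for even `m`. -/
def initialFactor (k m : ℕ) (τ t : ℝ) : ℝ :=
  (if Odd m then τ ^ (m + 1) / t ^ (m + 1) else τ ^ (m + 2) / t ^ (m + 2)) + τ ^ k / t ^ k

/-- `τ^{l+m+1} t^{α-m-1} + τ^k t^{α+l-k}` for odd `l + m`,
`τ^{l+m+2} t^{α-m-2} + τ^k t^{α+l-k}` for even `l + m`. -/
def sourceFactor (α : ℝ) (k m l : ℕ) (τ t : ℝ) : ℝ :=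
  (if Odd (l + m) then τ ^ (l + m + 1) * t ^ (α - m - 1)
    else τ ^ (l + m + 2) * t ^ (α - m - 2)) + τ ^ k * t ^ (α + l - k)

end Subdiffusion

end

/-! Let R = (1 - Δ)⁻¹ be the Dirichlet resolvent. It is a symmetric injective operator with 0 ≤ R ≤
1. Multiplying both problems by R removes the unbounded operator. With x the spectral variable of R,
the continuous problem has the symbol (1 - x) + x s^α, and convolution quadrature replaces s by
δ_k(ξ)/τ. The function x / ((1 - x) + x s^α) is a Stieltjes function of s: it equals ∫₀^∞ σ_r(x) /
(s + r) dr with a nonnegative density σ_r(x) (`integral_spectralDensity`). So both solution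
operators are superpositions, with the same density, of solution operators of scalar equations y' +
r y = f. The error is the superposition of the errors of the ordinary BDF method for these equations
with ρ = rτ (`dataKernel_sub`).

The scalar error is resolvent kernel times defect (`odeError_eq`). Stability rests on the fact that,
for k ≤ 6, δ_k maps the closed unit disc minus {1} off (-∞, 0]. The quantitative form
`exists_sector_bound` and Cauchy estimates make the coefficients of 1/(δ_k + ρ) decay like e^{-cρn}
for ρ ≤ 1 and like ρ⁻¹ e^{-cn} for ρ ≥ 1 (`exists_kernel_bounds`). Consistency is read off formal
power series at ξ = e^{-z}: there δ_k = z + O(z^{k+1}), and the generating function of n^j/j! is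
z^{-j-1} plus a regular part whose constant term is a multiple of the Bernoulli number with index j
+ 1. This number vanishes for even j ≥ 2, which is the origin of the extra order for even l + m
(`exists_quadrature_difference_eq`). The outcome is the factor ρ^m or ρ^{m+1}, plus ρ^{k-l-1}, times
e^{-cρn}, up to an initial layer e^{-cn} (`exists_odeError_zero_le`).

Integrating over r with σ_r(x) ≤ C r^{-α} turns ρ^p e^{-cρn} into τ^{p+1} t^{α-p-1}, up to the
factor τ^l of the data. These are the source terms. For the initial value one uses (1 - x) σ_r(x) ≤
C x instead, which gives τ^{p+1} t^{-p-1} with a factor x to spare.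

Back in the Hilbert space, a functional calculus for R built from polynomials (`funCalc`) turns sup
bounds over x ∈ [0,1] into operator bounds. The solutions are only identified after multiplication
by R (`apply_solution_eq`, `apply_discrete_solution_eq`). The source part of the error is in the
range of the calculus directly. The part due to v is an e with R e = f(R) v, and the spare factor x,
that is |f(x)| ≤ M x, gives ‖e‖ ≤ M ‖v‖ (`IsSymmContraction.norm_le_of_apply_eq`). Everything is
assembled in `norm_error_le`. -/

noncomputable section

namespace Subdiffusion

/-! ### The BDF polynomial on the closed unit disc -/

/-- The polynomial `δ_k(ξ) = ∑_{j=1}^k (1/j) (1 - ξ)^j`. -/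
def bdfPoly (k : ℕ) : Polynomial ℝ :=
  ∑ j ∈ Finset.Icc 1 k, Polynomial.C (1 / (j : ℝ)) * (1 - Polynomial.X) ^ j

/-- The cofactor `μ_k` in `δ_k(ξ) = (1 - ξ) μ_k(ξ)`. -/
def bdfCofactor (k : ℕ) : Polynomial ℝ :=
  ∑ j ∈ Finset.Icc 1 k, Polynomial.C (1 / (j : ℝ)) * (1 - Polynomial.X) ^ (j - 1)

lemma bdfPoly_eq_mul (k : ℕ) : bdfPoly k = (1 - Polynomial.X) * bdfCofactor k := by
  unfold bdfPoly bdfCofactor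
  rw [Finset.mul_sum]
  refine Finset.sum_congr rfl fun j hj => ?_
  obtain ⟨i, rfl⟩ : ∃ i, j = i + 1 := ⟨j - 1, by have := (Finset.mem_Icc.1 hj).1; omega⟩
  simp only [Nat.add_sub_cancel]
  ring

lemma eval_bdfPoly (k : ℕ) (x : ℝ) : (bdfPoly k).eval x = bdfSymbol k x := by
  simp [bdfPoly, bdfSymbol, Polynomial.eval_finsetSum]

lemma aeval_bdfPoly (k : ℕ) (z : ℂ) :
    Polynomial.aeval z (bdfPoly k) = ∑ j ∈ Finset.Icc 1 k, (1 / (j : ℂ)) * (1 - z) ^ j := by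
  simp [bdfPoly]

lemma eval_one_bdfCofactor {k : ℕ} (hk : 1 ≤ k) : (bdfCofactor k).eval 1 = 1 := by
  unfold bdfCofactor
  rw [Polynomial.eval_finsetSum, Finset.sum_eq_single 1]
  · simp
  · intro j hj hj1
    have : j - 1 ≠ 0 := by have := (Finset.mem_Icc.1 hj).1; omega
    simp [this]
  · intro h
    exact absurd (Finset.mem_Icc.2 ⟨le_rfl, hk⟩) h

/-- On the unit circle minus `1` the BDF polynomial avoids the negative real axis. -/
lemma aeval_bdfPoly_add_ne_zero_of_norm_eq {k : ℕ} (hk1 : 1 ≤ k) (hk : k ≤ 6) {z : ℂ}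
    (hz : ‖z‖ = 1) (hz1 : z ≠ 1) {ρ : ℝ} (hρ : 0 ≤ ρ) :
    Polynomial.aeval z (bdfPoly k) + (ρ : ℂ) ≠ 0 := by
  rw [aeval_bdfPoly]
  obtain ⟨e, rfl⟩ : ∃ e : ℂ, z = 1 - e := ⟨1 - z, by ring⟩
  have hsq : e.re ^ 2 + e.im ^ 2 = 2 * e.re := by
    have h := Complex.sq_norm (1 - e)
    rw [hz, Complex.normSq_apply] at h
    simp at h
    nlinarith
  have ha0 : 0 ≤ e.re := by nlinarith [sq_nonneg e.re, sq_nonneg e.im]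
  have ha2 : e.re ≤ 2 := by
    by_contra h
    push Not at h
    nlinarith [sq_nonneg e.im]
  -- On the circle |e|² = 2 Re e, so e and its conjugate are the roots of X² - 2aX + 2a with a = Re
  -- e. Hence every power of e reduces to A + B e with A and B real polynomials in a.
  have hrec : e ^ 2 = 2 * (e.re : ℂ) * e - 2 * (e.re : ℂ) := by
    apply Complex.ext
    · simp [pow_two]; nlinarith
    · simp [pow_two]; ring
  simp only [sub_sub_cancel]
  set a := e.re with ha
  -- The imaginary part of A + B e + ρ is B Im e. If B > 0, a zero forces e to be real, so e = 0
  -- (that is z = 1, excluded) or e = 2 (that is z = -1, where the value is A + 2B + ρ).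
  have key : ∀ A B : ℝ, 0 < B → (e = 2 → 0 < A + 2 * B) →
      (A : ℂ) + (B : ℂ) * e + (ρ : ℂ) ≠ 0 := by
    intro A B hB hAB h
    have him := congrArg Complex.im h
    simp at him
    rcases him with him | him
    · exact hB.ne' him
    · have hre := congrArg Complex.re h
      simp [him] at hre
      have h2 : a = 0 ∨ a = 2 := by
        rw [him] at hsq
        have : a * (a - 2) = 0 := by nlinarith
        rcases mul_eq_zero.1 this with h | h
        · exact Or.inl h
        · exact Or.inr (by linarith)
      rcases h2 with h2 | h2
      · apply hz1
        have : e = 0 := Complex.ext (by simp [← ha, h2]) (by simp [him])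
        simp [this]
      · have he2 : e = 2 := Complex.ext (by simp [← ha, h2]) (by simp [him])
        have := hAB he2
        rw [← ha, h2] at hre
        linarith
  have h3 : e ^ 3 = (4 * a ^ 2 - 2 * a : ℂ) * e - 4 * a ^ 2 := by
    linear_combination (e + 2 * a) * hrec
  have h4 : e ^ 4 = (8 * a ^ 3 - 8 * a ^ 2 : ℂ) * e - (8 * a ^ 3 - 4 * a ^ 2) := by
    linear_combination e * h3 + (4 * a ^ 2 - 2 * a) * hrec
  have h5 : e ^ 5 = (16 * a ^ 4 - 24 * a ^ 3 + 4 * a ^ 2 : ℂ) * e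
      - (16 * a ^ 4 - 16 * a ^ 3) := by
    linear_combination e * h4 + (8 * a ^ 3 - 8 * a ^ 2) * hrec
  have h6 : e ^ 6 = (32 * a ^ 5 - 64 * a ^ 4 + 24 * a ^ 3 : ℂ) * e
      - (32 * a ^ 5 - 48 * a ^ 4 + 8 * a ^ 3) := by
    linear_combination e * h5 + (16 * a ^ 4 - 24 * a ^ 3 + 4 * a ^ 2) * hrec
  have hae : e = 2 → a = 2 := fun h => by rw [ha, h]; simp
  have h2' : 0 ≤ 2 - a := by linarith
  -- The bound k ≤ 6 enters here: in each case the coefficient B of the reduced polynomial is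
  -- positive on 0 ≤ a ≤ 2.
  interval_cases k
  · have := key 0 1 (by norm_num) (by norm_num)
    simpa using this
  · have := key (-a) (1 + a) (by linarith) (fun h => by rw [hae h]; norm_num)
    convert this using 2
    simp [Finset.sum_Icc_succ_top]
    linear_combination hrec / 2
  · have := key (-a - 4 / 3 * a ^ 2) (1 + a / 3 + 4 / 3 * a ^ 2) (by positivity)
      (fun h => by rw [hae h]; norm_num)
    convert this using 2
    simp [Finset.sum_Icc_succ_top]
    linear_combination hrec / 2 + h3 / 3
  · have := key (-a - 1 / 3 * a ^ 2 - 2 * a ^ 3) (1 + a / 3 - 2 / 3 * a ^ 2 + 2 * a ^ 3)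
      (by nlinarith [mul_nonneg ha0 (sq_nonneg (a - 1 / 3))])
      (fun h => by rw [hae h]; norm_num)
    convert this using 2
    simp [Finset.sum_Icc_succ_top]
    linear_combination hrec / 2 + h3 / 3 + h4 / 4
  · have := key (-a - 1 / 3 * a ^ 2 + 6 / 5 * a ^ 3 - 16 / 5 * a ^ 4)
      (1 + a / 3 + 2 / 15 * a ^ 2 - 14 / 5 * a ^ 3 + 16 / 5 * a ^ 4)
      (by nlinarith [sq_nonneg (a ^ 2 - 7 / 16 * a - 1 / 4), sq_nonneg (a - 1 / 2), sq_nonneg a,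
            mul_nonneg ha0 (sq_nonneg (a - 1 / 2)), sq_nonneg (a ^ 2 - a / 2)])
      (fun h => by rw [hae h]; norm_num)
    convert this using 2
    simp [Finset.sum_Icc_succ_top]
    linear_combination hrec / 2 + h3 / 3 + h4 / 4 + h5 / 5
  · have := key (-a - 1 / 3 * a ^ 2 - 2 / 15 * a ^ 3 + 24 / 5 * a ^ 4 - 16 / 3 * a ^ 5)
      (1 + a / 3 + 2 / 15 * a ^ 2 + 6 / 5 * a ^ 3 - 112 / 15 * a ^ 4 + 16 / 3 * a ^ 5)
      (by
        have h1 : 0 ≤ a ^ 3 * (a - 7 / 10) ^ 2 := by positivity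
        have h2 : 0 ≤ a * (a - 1) ^ 2 := by positivity
        nlinarith [mul_nonneg ha0 (sq_nonneg (a * (a - 7 / 10) )), sq_nonneg (a ^ 2 - a),
          mul_nonneg ha0 (sq_nonneg (a ^ 2 - 7 / 10 * a - 1 / 5)), sq_nonneg (a - 1), sq_nonneg a,
          mul_nonneg ha0 (sq_nonneg (a - 1)), sq_nonneg (a ^ 2 - 1)])
      (fun h => by rw [hae h]; norm_num)
    convert this using 2
    simp [Finset.sum_Icc_succ_top]
    linear_combination hrec / 2 + h3 / 3 + h4 / 4 + h5 / 5 + h6 / 6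

lemma aeval_bdfPoly_ofReal (k : ℕ) (x : ℝ) :
    Polynomial.aeval (x : ℂ) (bdfPoly k) = ((bdfSymbol k x : ℝ) : ℂ) := by
  rw [aeval_bdfPoly, bdfSymbol]
  push_cast
  rfl

lemma aeval_one_bdfPoly (k : ℕ) : Polynomial.aeval (1 : ℂ) (bdfPoly k) = 0 := by
  rw [bdfPoly_eq_mul]; simp

lemma bdfSymbol_zero_pos {k : ℕ} (hk : 1 ≤ k) {x : ℝ} (hx : x < 1) : 0 < bdfSymbol k x := by
  unfold bdfSymbol
  have : 0 < 1 - x := by linarith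
  refine Finset.sum_pos (fun j hj => ?_) ⟨1, Finset.mem_Icc.2 ⟨le_rfl, hk⟩⟩
  have : 1 ≤ j := (Finset.mem_Icc.1 hj).1
  positivity

lemma continuous_aeval_poly (P : Polynomial ℝ) : Continuous fun z : ℂ => Polynomial.aeval z P := by
  fun_prop

lemma differentiable_aeval_poly (P : Polynomial ℝ) :
    Differentiable ℂ fun z : ℂ => Polynomial.aeval z P := by
  intro z
  exact (Polynomial.hasDerivAt_aeval P z).differentiableAt

/-- No point of the open unit disc is mapped by the BDF polynomial to `(-∞, 0]`. -/
lemma aeval_bdfPoly_add_ne_zero_of_norm_lt {k : ℕ} (hk1 : 1 ≤ k) (hk : k ≤ 6) {z : ℂ}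
    (hz : ‖z‖ < 1) {ρ : ℝ} (hρ : 0 ≤ ρ) :
    Polynomial.aeval z (bdfPoly k) + (ρ : ℂ) ≠ 0 := by
  intro h0
  set f : ℂ → ℂ := fun w => Polynomial.aeval w (bdfPoly k) with hf
  have hfc : Continuous f := continuous_aeval_poly _
  -- the set of the real numbers `r ≥ ρ` with `-r` in the image of the closed disc
  set S : Set ℝ := {r : ℝ | ρ ≤ r ∧ ∃ w ∈ Metric.closedBall (0 : ℂ) 1, f w = -(r : ℂ)} with hS
  have hne : S.Nonempty := ⟨ρ, le_rfl, z, by simpa using hz.le, by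
    rw [hf]; linear_combination h0⟩
  have hcomp : IsCompact (f '' Metric.closedBall (0 : ℂ) 1) :=
    (isCompact_closedBall _ _).image hfc
  have hScl : IsCompact S := by
    obtain ⟨B, hB⟩ := hcomp.isBounded.subset_closedBall 0
    refine (isCompact_Icc (a := ρ) (b := B)).of_isClosed_subset ?_ ?_
    · have : S = Ici ρ ∩ (fun r : ℝ => -(r : ℂ)) ⁻¹' (f '' Metric.closedBall (0 : ℂ) 1) := by
        ext r; simp [hS]
      rw [this]
      exact isClosed_Ici.inter (hcomp.isClosed.preimage (by fun_prop))
    · rintro r ⟨hr, w, hw, hwr⟩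
      refine ⟨hr, ?_⟩
      have := hB (mem_image_of_mem f hw)
      rw [hwr] at this
      simp at this
      exact (le_abs_self r).trans this
  obtain ⟨R, hR⟩ := hScl.exists_isGreatest hne
  have hRρ : ρ ≤ R := hR.1.1
  have hR0 : 0 ≤ R := hρ.trans hRρ
  -- an interior point over `-R` contradicts maximality by the open mapping theorem
  have hint : ∀ w : ℂ, ‖w‖ < 1 → f w = -(R : ℂ) → False := by
    intro w hw hwR
    have hfa : AnalyticOnNhd ℂ f univ :=
      (differentiable_aeval_poly _).differentiableOn.analyticOnNhd isOpen_univ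
    rcases hfa.is_constant_or_isOpen isPreconnected_univ with hcst | hop
    · obtain ⟨v, hv⟩ := hcst
      have h1 := hv 1 (mem_univ _)
      have h2 := hv 0 (mem_univ _)
      have h3 : f 1 = 0 := aeval_one_bdfPoly k
      have h4 : f 0 = ((bdfSymbol k 0 : ℝ) : ℂ) := by
        have := aeval_bdfPoly_ofReal k 0
        simpa using this
      rw [h3] at h1
      rw [h4, ← h1] at h2
      have := bdfSymbol_zero_pos hk1 (x := 0) (by norm_num)
      exact this.ne' (by exact_mod_cast h2)
    · have hopen := hop (Metric.ball 0 1) (subset_univ _) Metric.isOpen_ball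
      have hmem : -(R : ℂ) ∈ f '' Metric.ball 0 1 := ⟨w, by simpa using hw, hwR⟩
      obtain ⟨e, he, hball⟩ := Metric.isOpen_iff.1 hopen _ hmem
      obtain ⟨w', hw', hfw'⟩ := hball (show -((R + e / 2 : ℝ) : ℂ) ∈ Metric.ball (-(R : ℂ)) e by
        rw [Metric.mem_ball, Complex.dist_eq]
        have : -((R + e / 2 : ℝ) : ℂ) - -(R : ℂ) = ((-(e / 2) : ℝ) : ℂ) := by push_cast; ring
        rw [this, Complex.norm_real, Real.norm_eq_abs, abs_neg, abs_of_pos (by linarith)]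
        linarith)
      have : R + e / 2 ≤ R := hR.2 ⟨by linarith, w', Metric.ball_subset_closedBall hw', hfw'⟩
      linarith
  obtain ⟨w, hw, hwR⟩ := hR.1.2
  have hw1 : ‖w‖ ≤ 1 := by simpa using hw
  rcases hw1.lt_or_eq with hlt | heq
  · exact hint w hlt hwR
  -- A maximal value on the circle contradicts the circle case, except at w = 1. There R = 0, hence
  -- ρ = 0, and the given interior point z itself lies over -R.
  · by_cases hw1 : w = 1
    · have : f 1 = 0 := aeval_one_bdfPoly k
      rw [hw1, this] at hwR
      have hR00 : R = 0 := by
        have := congrArg Complex.re hwR; simp at this; linarith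
      have hρ0 : ρ = 0 := by linarith
      refine hint z hz ?_
      rw [hR00]
      rw [hρ0] at h0
      simpa [hf] using h0
    · exact aeval_bdfPoly_add_ne_zero_of_norm_eq hk1 hk heq hw1 hR0 (by
        have : f w + (R : ℂ) = 0 := by rw [hwR]; ring
        exact this)

lemma aeval_bdfPoly_add_ne_zero {k : ℕ} (hk1 : 1 ≤ k) (hk : k ≤ 6) {z : ℂ}
    (hz : ‖z‖ ≤ 1) {ρ : ℝ} (hρ : 0 ≤ ρ) (h : z ≠ 1 ∨ 0 < ρ) :
    Polynomial.aeval z (bdfPoly k) + (ρ : ℂ) ≠ 0 := by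
  rcases hz.lt_or_eq with hlt | heq
  · exact aeval_bdfPoly_add_ne_zero_of_norm_lt hk1 hk hlt hρ
  · by_cases hz1 : z = 1
    · rw [hz1, aeval_one_bdfPoly, zero_add]
      have : ρ ≠ 0 := by
        rcases h with h | h
        · exact absurd hz1 h
        · exact h.ne'
      exact_mod_cast this
    · exact aeval_bdfPoly_add_ne_zero_of_norm_eq hk1 hk heq hz1 hρ

/-- The cofactor of `1 - ξ` in `δ_k(ξ) - (1 - ξ)` is bounded on the closed disc by a constant
times `‖1 - ξ‖`. -/
lemma exists_norm_aeval_bdfPoly_sub_le (k : ℕ) (hk : 1 ≤ k) (R : ℝ) :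
    ∃ C : ℝ, 0 < C ∧ ∀ z : ℂ, ‖z‖ ≤ R →
      ‖Polynomial.aeval z (bdfPoly k) - (1 - z)‖ ≤ C * ‖1 - z‖ ^ 2 := by
  obtain ⟨Q, hQ⟩ : ∃ Q : Polynomial ℝ, bdfCofactor k - 1 = (Polynomial.X - Polynomial.C 1) * Q :=
    Polynomial.dvd_iff_isRoot.2 (by simp [eval_one_bdfCofactor hk])
  obtain ⟨B, hB⟩ := (isCompact_closedBall (0 : ℂ) R).exists_bound_of_continuousOn
    (continuous_aeval_poly Q).continuousOn
  refine ⟨|B| + 1, by positivity, fun z hz => ?_⟩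
  have h1 : Polynomial.aeval z (bdfPoly k) - (1 - z) = -((1 - z) ^ 2 * Polynomial.aeval z Q) := by
    have h2 : Polynomial.aeval z (bdfCofactor k) - 1 = (z - 1) * Polynomial.aeval z Q := by
      have := congrArg (Polynomial.aeval z) hQ
      simpa using this
    rw [bdfPoly_eq_mul, map_mul]
    simp only [map_sub, map_one, Polynomial.aeval_X]
    linear_combination (1 - z) * h2
  rw [h1, norm_neg, norm_mul, norm_pow, mul_comm]
  gcongr
  have := hB z (by simpa using hz)
  linarith [le_abs_self B]

/-- Sector condition of the BDF methods of order at most six. -/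
lemma exists_sector_bound {k : ℕ} (hk1 : 1 ≤ k) (hk : k ≤ 6) :
    ∃ c : ℝ, 0 < c ∧ c ≤ 1 ∧ ∀ z : ℂ, ‖z‖ ≤ 1 → ∀ ρ : ℝ, 0 ≤ ρ →
      c * (‖1 - z‖ + ρ) ≤ ‖Polynomial.aeval z (bdfPoly k) + (ρ : ℂ)‖ := by
  obtain ⟨C, hC, hCb⟩ := exists_norm_aeval_bdfPoly_sub_le k hk1 1
  set f : ℂ → ℂ := fun w => Polynomial.aeval w (bdfPoly k) with hf
  have hfc : Continuous f := continuous_aeval_poly _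
  -- near `1`
  have hnear : ∀ z : ℂ, ‖z‖ ≤ 1 → ∀ ρ : ℝ, 0 ≤ ρ → ‖1 - z‖ ≤ 1 / (4 * C) →
      (1 / 4) * (‖1 - z‖ + ρ) ≤ ‖f z + (ρ : ℂ)‖ := by
    intro z hz ρ hρ hzC
    have hre : 0 ≤ (1 - z).re := by
      simp; exact (Complex.re_le_norm z).trans hz
    -- Since Re(1 - z) ≥ 0, |1 - z + ρ|² ≥ |1 - z|² + ρ². Near 1 the quadratic remainder δ_k - (1 -
    -- z) costs at most |1 - z|/4 of this, which leaves the constant 1/4.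
    have h1 : (1 / 2) * (‖1 - z‖ + ρ) ≤ ‖1 - z + (ρ : ℂ)‖ := by
      apply abs_le_of_sq_le_sq' _ (norm_nonneg _) |>.2
      rw [Complex.sq_norm, Complex.normSq_apply]
      have h2 : ‖1 - z‖ ^ 2 = (1 - z).re ^ 2 + (1 - z).im ^ 2 := by
        rw [Complex.sq_norm, Complex.normSq_apply]; ring
      have h3 : (1 - z + (ρ : ℂ)).re = (1 - z).re + ρ := by simp
      have h4 : (1 - z + (ρ : ℂ)).im = (1 - z).im := by simp
      rw [h3, h4]
      nlinarith [sq_nonneg (‖1 - z‖ - ρ), mul_nonneg hre hρ]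
    have h2 := hCb z hz
    have h3 : C * ‖1 - z‖ ^ 2 ≤ (1 / 4) * ‖1 - z‖ := by
      have : C * ‖1 - z‖ ≤ 1 / 4 := by
        calc C * ‖1 - z‖ ≤ C * (1 / (4 * C)) := by gcongr
          _ = 1 / 4 := by field_simp
      nlinarith [norm_nonneg (1 - z)]
    have h4 : ‖1 - z + (ρ : ℂ)‖ ≤ ‖f z + (ρ : ℂ)‖ + ‖f z - (1 - z)‖ := by
      have : 1 - z + (ρ : ℂ) = (f z + (ρ : ℂ)) - (f z - (1 - z)) := by ring
      rw [this]; exact norm_sub_le _ _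
    have : ‖f z - (1 - z)‖ ≤ (1 / 4) * ‖1 - z‖ := h2.trans h3
    linarith
  -- large `ρ`
  obtain ⟨B, hB⟩ := (isCompact_closedBall (0 : ℂ) 1).exists_bound_of_continuousOn hfc.continuousOn
  have hlarge : ∀ z : ℂ, ‖z‖ ≤ 1 → ∀ ρ : ℝ, 2 * |B| + 2 ≤ ρ →
      (1 / 4) * (‖1 - z‖ + ρ) ≤ ‖f z + (ρ : ℂ)‖ := by
    intro z hz ρ hρ
    have h1 : ‖f z‖ ≤ |B| := (hB z (by simpa using hz)).trans (le_abs_self B)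
    have h2 : ‖(ρ : ℂ)‖ ≤ ‖f z + (ρ : ℂ)‖ + ‖f z‖ := by
      have : (ρ : ℂ) = (f z + (ρ : ℂ)) - f z := by ring
      conv_lhs => rw [this]
      exact norm_sub_le _ _
    have h3 : ‖1 - z‖ ≤ 2 := by
      calc ‖1 - z‖ ≤ ‖(1 : ℂ)‖ + ‖z‖ := norm_sub_le _ _
        _ ≤ 2 := by rw [norm_one]; linarith
    have h0 : 0 ≤ |B| := abs_nonneg B
    rw [Complex.norm_real, Real.norm_eq_abs, abs_of_nonneg (by linarith)] at h2
    linarith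
  -- the remaining compact set
  set K : Set (ℂ × ℝ) := (Metric.closedBall 0 1 ∩ {z | 1 / (4 * C) ≤ ‖1 - z‖}) ×ˢ
    Icc 0 (2 * |B| + 2) with hK
  have hKc : IsCompact K :=
    ((isCompact_closedBall _ _).inter_right
      (isClosed_le continuous_const (by fun_prop))).prod isCompact_Icc
  have hpos : ∀ p ∈ K, 0 < ‖f p.1 + (p.2 : ℂ)‖ := by
    rintro ⟨z, ρ⟩ ⟨⟨hz, hz1⟩, hρ⟩
    refine norm_pos_iff.2 (aeval_bdfPoly_add_ne_zero hk1 hk (by simpa using hz) hρ.1 (Or.inl ?_))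
    rintro rfl
    simp at hz1
    have : 0 < C⁻¹ * 4⁻¹ := by positivity
    linarith
  obtain ⟨e, he, heb⟩ : ∃ e : ℝ, 0 < e ∧ ∀ p ∈ K, e ≤ ‖f p.1 + (p.2 : ℂ)‖ := by
    rcases K.eq_empty_or_nonempty with hE | hE
    · exact ⟨1, one_pos, by simp [hE]⟩
    · obtain ⟨p, hp, hmin⟩ := hKc.exists_isMinOn hE
        (f := fun p : ℂ × ℝ => ‖f p.1 + (p.2 : ℂ)‖) (by fun_prop)
      exact ⟨_, hpos p hp, fun q hq => hmin hq⟩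
  have hB0 : 0 ≤ |B| := abs_nonneg B
  refine ⟨min (1 / 4) (e / (2 * |B| + 4)), by positivity,
    (min_le_left _ _).trans (by norm_num), fun z hz ρ hρ => ?_⟩
  have hnn : 0 ≤ ‖1 - z‖ + ρ := by positivity
  by_cases h1 : ‖1 - z‖ ≤ 1 / (4 * C)
  · exact (mul_le_mul_of_nonneg_right (min_le_left _ _) hnn).trans (hnear z hz ρ hρ h1)
  by_cases h2 : 2 * |B| + 2 ≤ ρ
  · exact (mul_le_mul_of_nonneg_right (min_le_left _ _) hnn).trans (hlarge z hz ρ h2)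
  push Not at h1 h2
  have h3 : ‖1 - z‖ ≤ 2 := by
    calc ‖1 - z‖ ≤ ‖(1 : ℂ)‖ + ‖z‖ := norm_sub_le _ _
      _ ≤ 2 := by rw [norm_one]; linarith
  refine (mul_le_mul_of_nonneg_right (min_le_right _ _) hnn).trans ?_
  refine le_trans ?_ (heb (z, ρ) ⟨⟨by simpa using hz, h1.le⟩, hρ, h2.le⟩)
  rw [div_mul_eq_mul_div, div_le_iff₀ (by positivity)]
  exact mul_le_mul_of_nonneg_left (by linarith) he.le

/-! ### Taylor coefficients and Cauchy estimates -/

/-- The `n`-th Taylor coefficient at `0`. -/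
def taylorCoeff {𝕜 : Type*} [NontriviallyNormedField 𝕜] (f : 𝕜 → 𝕜) (n : ℕ) : 𝕜 :=
  iteratedDeriv n f 0 / (n.factorial : 𝕜)

lemma taylorCoeff_mul {𝕜 : Type*} [RCLike 𝕜] {f g : 𝕜 → 𝕜}
    (hf : ContDiffAt 𝕜 ∞ f 0) (hg : ContDiffAt 𝕜 ∞ g 0) (n : ℕ) :
    taylorCoeff (f * g) n =
      ∑ i ∈ Finset.range (n + 1), taylorCoeff f i * taylorCoeff g (n - i) := by
  unfold taylorCoeff
  rw [iteratedDeriv_mul (hf.of_le (by exact_mod_cast le_top)) (hg.of_le (by exact_mod_cast le_top)),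
    Finset.sum_div]
  refine Finset.sum_congr rfl fun i hi => ?_
  have hin : i ≤ n := Nat.lt_succ_iff.1 (Finset.mem_range.1 hi)
  rw [Nat.cast_choose 𝕜 hin]
  have h1 : (n.factorial : 𝕜) ≠ 0 := by exact_mod_cast n.factorial_ne_zero
  have h2 : (i.factorial : 𝕜) ≠ 0 := by exact_mod_cast i.factorial_ne_zero
  have h3 : ((n - i).factorial : 𝕜) ≠ 0 := by exact_mod_cast (n - i).factorial_ne_zero
  field_simp

lemma taylorCoeff_congr {𝕜 : Type*} [NontriviallyNormedField 𝕜] {f g : 𝕜 → 𝕜}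
    (h : f =ᶠ[𝓝 0] g) (n : ℕ) : taylorCoeff f n = taylorCoeff g n := by
  unfold taylorCoeff
  rw [h.iteratedDeriv_eq]

lemma iteratedDeriv_aeval {𝕜 : Type*} [RCLike 𝕜] (P : Polynomial ℝ) (n : ℕ) :
    iteratedDeriv n (fun z : 𝕜 => Polynomial.aeval z P) =
      fun z : 𝕜 => Polynomial.aeval z (Polynomial.derivative^[n] P) := by
  induction n with
  | zero => simp
  | succ n ih =>
    rw [iteratedDeriv_succ, ih, Function.iterate_succ_apply']
    funext z
    exact (Polynomial.hasDerivAt_aeval _ z).deriv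

lemma taylorCoeff_aeval {𝕜 : Type*} [RCLike 𝕜] (P : Polynomial ℝ) (n : ℕ) :
    taylorCoeff (fun z : 𝕜 => Polynomial.aeval z P) n = ((P.coeff n : ℝ) : 𝕜) := by
  unfold taylorCoeff
  rw [iteratedDeriv_aeval]
  have h : (n.factorial : 𝕜) ≠ 0 := by exact_mod_cast n.factorial_ne_zero
  rw [div_eq_iff h]
  change Polynomial.aeval (0 : 𝕜) _ = _
  rw [← Polynomial.coeff_zero_eq_aeval_zero', Polynomial.coeff_iterate_derivative]
  simp [Nat.descFactorial_self]
  ring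

/-- Cauchy estimate for the coefficients of the power series of `P / Q`. -/
lemma abs_coeff_le_of_mul_eq {P Q : Polynomial ℝ} {f : PowerSeries ℝ}
    (h : (Q : PowerSeries ℝ) * f = P) {R M : ℝ} (hR : 0 < R)
    (hQ : ∀ z : ℂ, ‖z‖ ≤ R → Polynomial.aeval z Q ≠ 0)
    (hM : ∀ z : ℂ, ‖z‖ = R → ‖Polynomial.aeval z P‖ ≤ M * ‖Polynomial.aeval z Q‖) (n : ℕ) :
    |PowerSeries.coeff n f| ≤ M / R ^ n := by
  set p : ℂ → ℂ := fun z => Polynomial.aeval z P with hp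
  set q : ℂ → ℂ := fun z => Polynomial.aeval z Q with hq
  set F : ℂ → ℂ := fun z => p z / q z with hF
  have hpd : Differentiable ℂ p := differentiable_aeval_poly P
  have hqd : Differentiable ℂ q := differentiable_aeval_poly Q
  have hFd : ∀ z : ℂ, ‖z‖ ≤ R → DifferentiableAt ℂ F z := fun z hz =>
    (hpd z).div (hqd z) (hQ z hz)
  have hFcd : ContDiffAt ℂ ∞ F 0 := by
    refine (hpd.contDiff.contDiffAt).div (hqd.contDiff.contDiffAt) (hQ 0 (by simpa using hR.le))
  have hqF : (fun z => q z) * F =ᶠ[𝓝 0] p := by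
    filter_upwards [Metric.ball_mem_nhds (0 : ℂ) hR] with z hz
    have := hQ z (by simpa using (Metric.mem_ball.1 hz).le)
    simp only [Pi.mul_apply, hF]
    rw [mul_div_assoc', mul_div_cancel_left₀ _ this]
  have hg : ((Q.map (algebraMap ℝ ℂ) : Polynomial ℂ) : PowerSeries ℂ) *
      PowerSeries.mk (taylorCoeff F) = ((P.map (algebraMap ℝ ℂ) : Polynomial ℂ) : PowerSeries ℂ) := by
    ext n
    rw [PowerSeries.coeff_mul, Finset.Nat.sum_antidiagonal_eq_sum_range_succ_mk]
    simp only [Polynomial.coeff_coe, Polynomial.coeff_map, PowerSeries.coeff_mk]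
    have h1 := taylorCoeff_mul (f := q) hqd.contDiff.contDiffAt hFcd n
    rw [taylorCoeff_congr hqF, hp, hq] at h1
    simp only [taylorCoeff_aeval] at h1
    exact h1.symm
  have hf : ((Q.map (algebraMap ℝ ℂ) : Polynomial ℂ) : PowerSeries ℂ) *
      PowerSeries.map (algebraMap ℝ ℂ) f = ((P.map (algebraMap ℝ ℂ) : Polynomial ℂ) : PowerSeries ℂ) := by
    have := congrArg (PowerSeries.map (algebraMap ℝ ℂ)) h
    rwa [map_mul, ← Polynomial.polynomial_map_coe, ← Polynomial.polynomial_map_coe] at this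
  have hQ0 : ((Q.map (algebraMap ℝ ℂ) : Polynomial ℂ) : PowerSeries ℂ) ≠ 0 := by
    intro h0
    have : Q.map (algebraMap ℝ ℂ) = 0 := by exact_mod_cast h0
    have h2 := hQ 0 (by simpa using hR.le)
    rw [Polynomial.aeval_def, ← Polynomial.eval_map, this] at h2
    simp at h2
  -- Over ℂ, both the formal quotient and the Taylor series of P/Q solve Q · F = P; formal power
  -- series form a domain, so they agree and the analytic Cauchy estimate applies to f.
  have heq := mul_left_cancel₀ hQ0 (hf.trans hg.symm)
  have hc := congrArg (PowerSeries.coeff n) heq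
  rw [PowerSeries.coeff_map, PowerSeries.coeff_mk] at hc
  have hbound : ∀ z ∈ Metric.sphere (0 : ℂ) R, ‖F z‖ ≤ M := by
    intro z hz
    have hz' : ‖z‖ = R := by simpa using hz
    rw [hF]
    simp only
    rw [norm_div, div_le_iff₀ (norm_pos_iff.2 (hQ z hz'.le))]
    exact hM z hz'
  have hdc : DiffContOnCl ℂ F (Metric.ball 0 R) := by
    apply DifferentiableOn.diffContOnCl
    rw [closure_ball _ hR.ne']
    intro z hz
    exact (hFd z (by simpa using hz)).differentiableWithinAt
  have hC := Complex.norm_iteratedDeriv_le_of_forall_mem_sphere_norm_le n hR hdc hbound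
  have h3 : |PowerSeries.coeff n f| = ‖taylorCoeff F n‖ := by
    rw [← hc]; simp
  rw [h3, taylorCoeff, norm_div, Complex.norm_natCast, div_le_iff₀ (by positivity)]
  calc _ ≤ _ := hC
    _ = _ := by ring

/-! ### The resolvent kernel of the BDF method -/

/-- The generating power series `1 / (δ_k(ξ) + ρ)`. -/
def bdfResolvent (k : ℕ) (ρ : ℝ) : PowerSeries ℝ :=
  ((bdfPoly k + Polynomial.C ρ : Polynomial ℝ) : PowerSeries ℝ)⁻¹

lemma coeff_zero_bdfPoly (k : ℕ) : (bdfPoly k).coeff 0 = bdfSymbol k 0 := by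
  rw [Polynomial.coeff_zero_eq_eval_zero, eval_bdfPoly]

lemma bdfPoly_mul_bdfResolvent {k : ℕ} (hk : 1 ≤ k) {ρ : ℝ} (hρ : 0 ≤ ρ) :
    ((bdfPoly k + Polynomial.C ρ : Polynomial ℝ) : PowerSeries ℝ) * bdfResolvent k ρ = 1 := by
  refine PowerSeries.mul_inv_cancel _ ?_
  rw [← PowerSeries.coeff_zero_eq_constantCoeff_apply, Polynomial.coeff_coe, Polynomial.coeff_add,
    coeff_zero_bdfPoly, Polynomial.coeff_C_zero]
  have := bdfSymbol_zero_pos hk (x := 0) (by norm_num)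
  positivity

lemma exp_le_one_add_two_mul {x : ℝ} (hx : 0 ≤ x) (hx2 : x ≤ 1 / 2) :
    Real.exp x ≤ 1 + 2 * x := by
  have h := Real.exp_bound_div_one_sub_of_interval hx (by linarith)
  refine h.trans ?_
  rw [div_le_iff₀ (by linarith)]
  nlinarith

/-- A polynomial changes by at most a multiple of `s` when passing from the closed disc of radius
`e^s` to the closed unit disc. -/
lemma exists_norm_aeval_sub_le (P : Polynomial ℝ) :
    ∃ L : ℝ, 0 < L ∧ ∀ s : ℝ, 0 ≤ s → s ≤ 1 / 2 → ∀ z : ℂ, ‖z‖ ≤ Real.exp s →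
      ‖((Real.exp (-s) : ℝ) : ℂ) * z‖ ≤ 1 ∧ ‖z - ((Real.exp (-s) : ℝ) : ℂ) * z‖ ≤ 2 * s ∧
      ‖Polynomial.aeval z P - Polynomial.aeval (((Real.exp (-s) : ℝ) : ℂ) * z) P‖ ≤ L * s := by
  obtain ⟨B, hB⟩ := (isCompact_closedBall (0 : ℂ) 2).exists_bound_of_continuousOn
    (continuous_aeval_poly P.derivative).continuousOn
  refine ⟨2 * (|B| + 1), by positivity, fun s hs hs2 z hz => ?_⟩
  have hes : Real.exp s ≤ 1 + 2 * s := exp_le_one_add_two_mul hs hs2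
  have h1 : ‖((Real.exp (-s) : ℝ) : ℂ) * z‖ ≤ 1 := by
    rw [norm_mul, Complex.norm_real, Real.norm_eq_abs, abs_of_pos (Real.exp_pos _)]
    calc Real.exp (-s) * ‖z‖ ≤ Real.exp (-s) * Real.exp s := by gcongr
      _ = 1 := by rw [← Real.exp_add]; simp
  have h2 : ‖z - ((Real.exp (-s) : ℝ) : ℂ) * z‖ ≤ 2 * s := by
    have : z - ((Real.exp (-s) : ℝ) : ℂ) * z = ((1 - Real.exp (-s) : ℝ) : ℂ) * z := by
      push_cast; ring
    have h0 : 0 ≤ 1 - Real.exp (-s) := by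
      have := Real.exp_le_one_iff.2 (neg_nonpos.2 hs); linarith
    rw [this, norm_mul, Complex.norm_real, Real.norm_eq_abs, abs_of_nonneg h0]
    calc (1 - Real.exp (-s)) * ‖z‖ ≤ (1 - Real.exp (-s)) * Real.exp s := by gcongr
      _ = Real.exp s - 1 := by rw [sub_mul, ← Real.exp_add]; simp
      _ ≤ 2 * s := by linarith
  refine ⟨h1, h2, ?_⟩
  have h3 : ‖Polynomial.aeval z P - Polynomial.aeval (((Real.exp (-s) : ℝ) : ℂ) * z) P‖ ≤
      (|B| + 1) * ‖z - ((Real.exp (-s) : ℝ) : ℂ) * z‖ := by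
    refine (convex_closedBall (0 : ℂ) 2).norm_image_sub_le_of_norm_hasDerivWithin_le
      (f := fun w : ℂ => Polynomial.aeval w P) (f' := fun w => Polynomial.aeval w P.derivative)
      (fun w _ => (Polynomial.hasDerivAt_aeval P w).hasDerivWithinAt) (fun w hw => ?_) ?_ ?_
    · exact (hB w hw).trans (by linarith [le_abs_self B])
    · simp only [Metric.mem_closedBall, dist_zero_right]; linarith
    · simp only [Metric.mem_closedBall, dist_zero_right]; linarith
  calc _ ≤ _ := h3
    _ ≤ (|B| + 1) * (2 * s) := by gcongr
    _ = _ := by ring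

/-- The sector condition on slightly larger discs. -/
lemma exists_shifted_sector_bound {k : ℕ} (hk1 : 1 ≤ k) (hk : k ≤ 6) :
    ∃ e : ℝ, 0 < e ∧ e ≤ 1 / 4 ∧ ∃ c : ℝ, 0 < c ∧ ∀ ρ : ℝ, 0 ≤ ρ → ∀ s : ℝ, 0 ≤ s → s ≤ e →
      s ≤ e * ρ → ∀ z : ℂ, ‖z‖ ≤ Real.exp s →
      c * (‖1 - z‖ + ρ) ≤ ‖Polynomial.aeval z (bdfPoly k) + (ρ : ℂ)‖ := by
  obtain ⟨c, hc, hc1, hcb⟩ := exists_sector_bound hk1 hk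
  obtain ⟨L, hL, hLb⟩ := exists_norm_aeval_sub_le (bdfPoly k)
  -- The entry c / (2L) together with s ≤ e ρ makes the change of δ_k at most cρ/2, and 1/4 makes
  -- the shift 2s of the point at most ρ/2. Both are absorbed by the term in ρ.
  refine ⟨min (1 / 4) (c / (2 * L)), by positivity, min_le_left _ _, c / 4, by positivity,
    fun ρ hρ s hs hse hsρ z hz => ?_⟩
  obtain ⟨h1, h2, h3⟩ := hLb s hs (hse.trans ((min_le_left _ _).trans (by norm_num))) z hz
  set w := ((Real.exp (-s) : ℝ) : ℂ) * z with hw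
  have h4 := hcb w h1 ρ hρ
  have h5 : L * s ≤ c / 2 * ρ := by
    have : s ≤ c / (2 * L) * ρ := hsρ.trans (by gcongr; exact min_le_right _ _)
    calc L * s ≤ L * (c / (2 * L) * ρ) := by gcongr
      _ = c / 2 * ρ := by field_simp
  have h6 : s ≤ 1 / 4 * ρ := hsρ.trans (by gcongr; exact min_le_left _ _)
  have h7 : ‖1 - z‖ ≤ ‖1 - w‖ + 2 * s := by
    have : 1 - z = (1 - w) - (z - w) := by ring
    rw [this]
    exact (norm_sub_le _ _).trans (by linarith)
  have h8 : ‖Polynomial.aeval w (bdfPoly k) + (ρ : ℂ)‖ ≤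
      ‖Polynomial.aeval z (bdfPoly k) + (ρ : ℂ)‖ + L * s := by
    have : Polynomial.aeval w (bdfPoly k) + (ρ : ℂ) = (Polynomial.aeval z (bdfPoly k) + (ρ : ℂ)) -
      (Polynomial.aeval z (bdfPoly k) - Polynomial.aeval w (bdfPoly k)) := by ring
    rw [this]
    exact (norm_sub_le _ _).trans (by linarith)
  have h9 := norm_nonneg (1 - w)
  nlinarith

/-- The resolvent kernel of implicit Euler is an explicit geometric sequence. It serves as the
comparison kernel for small ρ. -/
lemma coeff_inv_one_add_sub_X {ρ : ℝ} (hρ : 0 ≤ ρ) :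
    ((1 - Polynomial.X + Polynomial.C ρ : Polynomial ℝ) : PowerSeries ℝ) *
      PowerSeries.mk (fun n => ((1 + ρ) ^ (n + 1))⁻¹) = 1 := by
  have h : (1 + ρ) ≠ 0 := by positivity
  ext n
  have : ((1 - Polynomial.X + Polynomial.C ρ : Polynomial ℝ) : PowerSeries ℝ) =
      PowerSeries.C (1 + ρ) - PowerSeries.X := by
    simp; ring
  rw [this, sub_mul, map_sub, PowerSeries.coeff_C_mul, PowerSeries.coeff_mk]
  rcases n with _ | n
  · simp [h]
  · rw [PowerSeries.coeff_succ_X_mul, PowerSeries.coeff_mk, PowerSeries.coeff_one]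
    simp only [Nat.add_eq_zero_iff, one_ne_zero, and_false, if_false]
    rw [pow_succ (1 + ρ) (n + 1)]
    field_simp
    ring

/-- Decay of the resolvent kernel and of the inverse of the cofactor. -/
lemma exists_kernel_bounds {k : ℕ} (hk1 : 1 ≤ k) (hk : k ≤ 6) :
    ∃ e : ℝ, 0 < e ∧ e ≤ 1 / 4 ∧ ∃ C : ℝ, 0 < C ∧
      (∀ ρ : ℝ, 0 < ρ → ρ ≤ 1 → ∀ n : ℕ,
        |PowerSeries.coeff n (bdfResolvent k ρ)| ≤ C * Real.exp (-(e / 2 * ρ)) ^ n) ∧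
      (∀ ρ : ℝ, 1 ≤ ρ → ∀ n : ℕ,
        |PowerSeries.coeff n (bdfResolvent k ρ)| ≤ C / ρ * Real.exp (-e) ^ n) ∧
      ∃ f : PowerSeries ℝ, (bdfCofactor k : PowerSeries ℝ) * f = 1 ∧
        ∀ n : ℕ, |PowerSeries.coeff n f| ≤ C * Real.exp (-e) ^ n := by
  obtain ⟨e1, he1, he1', c1, hc1, hs1⟩ := exists_shifted_sector_bound hk1 hk
  obtain ⟨e2, he2, he2', c2, hc2, hs2⟩ := exists_shifted_sector_bound (k := 1) le_rfl (by norm_num)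
  obtain ⟨c3, hc3, hc31, hs3⟩ := exists_sector_bound hk1 hk
  obtain ⟨L, hL, hLb⟩ := exists_norm_aeval_sub_le (bdfCofactor k)
  obtain ⟨C0, hC0, hCb⟩ := exists_norm_aeval_bdfPoly_sub_le k hk1 3
  set e := min (min e1 e2) (c3 / (2 * L)) with he
  have hee1 : e ≤ e1 := (min_le_left _ _).trans (min_le_left _ _)
  have hee2 : e ≤ e2 := (min_le_left _ _).trans (min_le_right _ _)
  have hee3 : e ≤ c3 / (2 * L) := min_le_right _ _
  have hepos : 0 < e := by positivity
  set C := 1 + C0 / (c1 * c2) + 1 / c1 + 2 / c3 with hC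
  have hCpos : 0 < C := by positivity
  have hpowexp : ∀ (s : ℝ) (n : ℕ) (M : ℝ), M / Real.exp s ^ n = M * Real.exp (-s) ^ n := by
    intro s n M
    rw [Real.exp_neg, inv_pow, div_eq_mul_inv]
  refine ⟨e, hepos, hee1.trans he1', C, hCpos, ?_, ?_, ?_⟩
  · intro ρ hρpos hρ1 n
    have hρ := hρpos.le
    set s := e / 2 * ρ with hs
    have hs0 : 0 < s := by positivity
    have hse : s ≤ e := by rw [hs]; nlinarith
    have hseρ : s ≤ e * ρ := by rw [hs]; nlinarith
    have hs1' : s ≤ 1 / 2 := by linarith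
    have hexp : Real.exp s ≤ 1 + 2 * s := exp_le_one_add_two_mul hs0.le hs1'
    -- A direct Cauchy estimate would lose a factor 1/ρ. The difference to the implicit Euler kernel
    -- has the numerator 1 - ξ - δ_k = O(|1 - ξ|²), while the product of the two denominators is at
    -- least c (|1 - ξ| + ρ)². The quotient is bounded uniformly in ρ, and the Euler kernel is
    -- bounded by hand.
    set g : PowerSeries ℝ := PowerSeries.mk (fun n => ((1 + ρ) ^ (n + 1))⁻¹) with hg
    have hmul : (((bdfPoly k + Polynomial.C ρ) * (1 - Polynomial.X + Polynomial.C ρ) :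
        Polynomial ℝ) : PowerSeries ℝ) * (bdfResolvent k ρ - g) =
        ((1 - Polynomial.X - bdfPoly k : Polynomial ℝ) : PowerSeries ℝ) := by
      have h1 := bdfPoly_mul_bdfResolvent hk1 hρ
      have h2 := coeff_inv_one_add_sub_X hρ
      rw [← hg] at h2
      rw [Polynomial.coe_mul, Polynomial.coe_sub]
      have h3 : ((1 - Polynomial.X : Polynomial ℝ) : PowerSeries ℝ) =
        ((1 - Polynomial.X + Polynomial.C ρ : Polynomial ℝ) : PowerSeries ℝ) -
          ((Polynomial.C ρ : Polynomial ℝ) : PowerSeries ℝ) := by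
        rw [← Polynomial.coe_sub]; congr 1; ring
      have h4 : ((bdfPoly k : Polynomial ℝ) : PowerSeries ℝ) =
        ((bdfPoly k + Polynomial.C ρ : Polynomial ℝ) : PowerSeries ℝ) -
          ((Polynomial.C ρ : Polynomial ℝ) : PowerSeries ℝ) := by
        rw [← Polynomial.coe_sub]; congr 1; ring
      rw [h3, h4]
      linear_combination ((1 - Polynomial.X + Polynomial.C ρ : Polynomial ℝ) : PowerSeries ℝ) * h1 -
        ((bdfPoly k + Polynomial.C ρ : Polynomial ℝ) : PowerSeries ℝ) * h2
    have hlow : ∀ z : ℂ, ‖z‖ ≤ Real.exp s →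
        c1 * c2 * (‖1 - z‖ + ρ) ^ 2 ≤ ‖Polynomial.aeval z
          ((bdfPoly k + Polynomial.C ρ) * (1 - Polynomial.X + Polynomial.C ρ))‖ := by
      intro z hz
      have h1 := hs1 ρ hρ s hs0.le (hse.trans hee1) (hseρ.trans (by gcongr)) z hz
      have h2 := hs2 ρ hρ s hs0.le (hse.trans hee2) (hseρ.trans (by gcongr)) z hz
      have h3 : Polynomial.aeval z (bdfPoly 1) = 1 - z := by simp [aeval_bdfPoly]
      rw [h3] at h2
      rw [map_mul, norm_mul]
      simp only [map_add, map_sub, map_one, Polynomial.aeval_X, Polynomial.aeval_C]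
      have h4 : 0 ≤ c2 * (‖1 - z‖ + ρ) := by positivity
      calc _ = (c1 * (‖1 - z‖ + ρ)) * (c2 * (‖1 - z‖ + ρ)) := by ring
        _ ≤ _ := mul_le_mul h1 h2 h4 (norm_nonneg _)
    have hb := abs_coeff_le_of_mul_eq hmul (R := Real.exp s) (M := C0 / (c1 * c2))
      (Real.exp_pos _) ?_ ?_ n
    · rw [hpowexp] at hb
      have hgn : |PowerSeries.coeff n g| ≤ Real.exp (-s) ^ n := by
        rw [hg, PowerSeries.coeff_mk, abs_of_pos (by positivity), Real.exp_neg, inv_pow]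
        gcongr
        calc Real.exp s ^ n ≤ (1 + ρ) ^ n := by
              gcongr
              refine hexp.trans ?_
              rw [hs]; nlinarith
          _ ≤ (1 + ρ) ^ (n + 1) := pow_le_pow_right₀ (by linarith) (by omega)
      have htri : |PowerSeries.coeff n (bdfResolvent k ρ)| ≤
          |PowerSeries.coeff n (bdfResolvent k ρ - g)| + |PowerSeries.coeff n g| := by
        have : PowerSeries.coeff n (bdfResolvent k ρ) =
            PowerSeries.coeff n (bdfResolvent k ρ - g) + PowerSeries.coeff n g := by
          rw [map_sub]; ring
        rw [this]
        exact abs_add_le _ _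
      calc _ ≤ _ := htri
        _ ≤ C0 / (c1 * c2) * Real.exp (-s) ^ n + Real.exp (-s) ^ n := add_le_add hb hgn
        _ = (1 + C0 / (c1 * c2)) * Real.exp (-s) ^ n := by ring
        _ ≤ _ := by
          gcongr
          rw [hC]
          have : 0 < 1 / c1 := by positivity
          have : 0 < 2 / c3 := by positivity
          linarith
    · intro z hz h0
      have := hlow z hz
      rw [h0, norm_zero] at this
      have h2 : 0 < c1 * c2 * (‖1 - z‖ + ρ) ^ 2 := by positivity
      linarith
    · intro z hz
      have h1 := hlow z hz.le
      have h2 := hCb z (by rw [hz]; linarith)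
      have h3 : Polynomial.aeval z (1 - Polynomial.X - bdfPoly k) =
          -(Polynomial.aeval z (bdfPoly k) - (1 - z)) := by simp
      rw [h3, norm_neg, div_mul_eq_mul_div, le_div_iff₀ (by positivity)]
      calc _ ≤ C0 * ‖1 - z‖ ^ 2 * (c1 * c2) := by gcongr
        _ ≤ C0 * (c1 * c2 * (‖1 - z‖ + ρ) ^ 2) := by
          have : ‖1 - z‖ ^ 2 ≤ (‖1 - z‖ + ρ) ^ 2 := by gcongr; linarith
          calc _ = C0 * (c1 * c2 * ‖1 - z‖ ^ 2) := by ring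
            _ ≤ _ := by gcongr
        _ ≤ _ := by gcongr
  · intro ρ hρ n
    have hρ0 : 0 ≤ ρ := by linarith
    have hb := abs_coeff_le_of_mul_eq (P := 1) (Q := bdfPoly k + Polynomial.C ρ)
      (f := bdfResolvent k ρ) (by simpa using bdfPoly_mul_bdfResolvent hk1 hρ0)
      (R := Real.exp e) (M := 1 / c1 / ρ) (Real.exp_pos _) ?_ ?_ n
    · rw [hpowexp] at hb
      refine hb.trans ?_
      gcongr
      rw [hC]
      have : 0 < C0 / (c1 * c2) := by positivity
      have : 0 < 2 / c3 := by positivity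
      linarith
    · intro z hz h0
      have := hs1 ρ hρ0 e hepos.le hee1 (hee1.trans (by nlinarith)) z hz
      simp at h0
      rw [h0, norm_zero] at this
      have h2 : 0 < c1 * (‖1 - z‖ + ρ) := by positivity
      linarith
    · intro z hz
      have := hs1 ρ hρ0 e hepos.le hee1 (hee1.trans (by nlinarith)) z hz.le
      simp only [map_one, norm_one, map_add, Polynomial.aeval_C]
      rw [div_div, div_mul_eq_mul_div, le_div_iff₀ (by positivity)]
      have h2 := norm_nonneg (1 - z)
      have h3 : c1 * ρ ≤ c1 * (‖1 - z‖ + ρ) := by gcongr; linarith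
      simpa using h3.trans this
  -- Away from 1 the cofactor is δ_k / (1 - z), bounded below by the sector condition with ρ = 0; at
  -- 1 it equals 1. The choice of e carries half of this bound over to the disc of radius `Real.exp
  -- e`.
  · have hμ : ∀ z : ℂ, ‖z‖ ≤ 1 → c3 ≤ ‖Polynomial.aeval z (bdfCofactor k)‖ := by
      intro z hz
      by_cases hz1 : z = 1
      · rw [hz1]
        have : Polynomial.aeval (1 : ℂ) (bdfCofactor k) = 1 := by
          have h := Polynomial.aeval_algebraMap_apply ℂ (1 : ℝ) (bdfCofactor k)
          rw [map_one, Polynomial.coe_aeval_eq_eval, eval_one_bdfCofactor hk1, map_one] at h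
          exact h
        rw [this, norm_one]; exact hc31
      · have h := hs3 z hz 0 le_rfl
        rw [bdfPoly_eq_mul, map_mul] at h
        simp only [map_sub, map_one, Polynomial.aeval_X, Complex.ofReal_zero, add_zero,
          norm_mul] at h
        have hp : 0 < ‖1 - z‖ := norm_pos_iff.2 (sub_ne_zero.2 (Ne.symm hz1))
        rw [mul_comm c3] at h
        exact le_of_mul_le_mul_left h hp
    have hμ2 : ∀ z : ℂ, ‖z‖ ≤ Real.exp e → c3 / 2 ≤ ‖Polynomial.aeval z (bdfCofactor k)‖ := by
      intro z hz
      obtain ⟨h1, -, h3⟩ := hLb e hepos.le (by linarith) z hz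
      have h4 := hμ _ h1
      have h5 : L * e ≤ c3 / 2 := by
        calc L * e ≤ L * (c3 / (2 * L)) := by gcongr
          _ = c3 / 2 := by field_simp
      have h6 := norm_sub_norm_le (Polynomial.aeval (((Real.exp (-e) : ℝ) : ℂ) * z) (bdfCofactor k))
        (Polynomial.aeval z (bdfCofactor k))
      rw [norm_sub_rev] at h6
      linarith
    have hinv : (bdfCofactor k : PowerSeries ℝ) * (bdfCofactor k : PowerSeries ℝ)⁻¹ = 1 := by
      refine PowerSeries.mul_inv_cancel _ ?_
      rw [← PowerSeries.coeff_zero_eq_constantCoeff_apply, Polynomial.coeff_coe]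
      intro h0
      have h1 := hμ 0 (by simp)
      rw [← Polynomial.coeff_zero_eq_aeval_zero', h0] at h1
      simp at h1
      linarith
    refine ⟨_, hinv, fun n => ?_⟩
    have hb := abs_coeff_le_of_mul_eq (P := 1) (Q := bdfCofactor k)
      (by simpa using hinv) (R := Real.exp e) (M := 2 / c3) (Real.exp_pos _) ?_ ?_ n
    · rw [hpowexp] at hb
      refine hb.trans ?_
      gcongr
      rw [hC]
      have : 0 < C0 / (c1 * c2) := by positivity
      have : 0 < 1 / c1 := by positivity
      linarith
    · intro z hz h0
      have := hμ2 z hz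
      rw [h0, norm_zero] at this
      linarith
    · intro z hz
      have := hμ2 z hz.le
      simp only [map_one, norm_one]
      rw [div_mul_eq_mul_div, le_div_iff₀ hc3]
      linarith

/-! ### Formal expansions at `ξ = e^{-z}` -/

open PowerSeries in
/-- The formal power series `e^{a z}`. -/
def expSeries (a : ℝ) : PowerSeries ℝ := PowerSeries.mk fun n => a ^ n / (n.factorial : ℝ)

lemma expSeries_eq (a : ℝ) : expSeries a = PowerSeries.rescale a (PowerSeries.exp ℝ) := by
  ext n
  simp [expSeries, PowerSeries.coeff_rescale, PowerSeries.coeff_exp, div_eq_mul_inv]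

lemma expSeries_mul (a b : ℝ) : expSeries a * expSeries b = expSeries (a + b) := by
  simp only [expSeries_eq]
  exact PowerSeries.exp_mul_exp_eq_exp_add a b

lemma expSeries_zero : expSeries 0 = 1 := by
  ext n
  rcases n with _ | n <;> simp [expSeries, PowerSeries.coeff_one]

lemma expSeries_pow (a : ℝ) (n : ℕ) : expSeries a ^ n = expSeries (n * a) := by
  induction n with
  | zero => simp [expSeries_zero]
  | succ n ih => rw [pow_succ, ih, expSeries_mul]; congr 1; push_cast; ring

lemma derivative_expSeries_neg_one :
    PowerSeries.derivative ℝ (expSeries (-1)) = -expSeries (-1) := by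
  ext n
  rw [PowerSeries.coeff_derivative, map_neg, expSeries, PowerSeries.coeff_mk, PowerSeries.coeff_mk,
    Nat.factorial_succ]
  have : (n.factorial : ℝ) ≠ 0 := by positivity
  push_cast
  field_simp
  ring

/-- `1 - e^{-z}`. -/
def oneSubExp : PowerSeries ℝ := 1 - expSeries (-1)

/-- The zero of 1 - e^{-z} at z = 0 is simple, so z and 1 - ξ measure the same order of vanishing at
ξ = 1. -/
lemma exists_oneSubExp_eq : ∃ u : PowerSeries ℝ, oneSubExp = PowerSeries.X * u ∧
    PowerSeries.constantCoeff u = 1 := by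
  have h : PowerSeries.X ∣ oneSubExp := by
    rw [PowerSeries.X_dvd_iff, ← PowerSeries.coeff_zero_eq_constantCoeff_apply]
    simp [oneSubExp, expSeries]
  obtain ⟨u, hu⟩ := h
  refine ⟨u, hu, ?_⟩
  have := congrArg (PowerSeries.coeff 1) hu
  rw [PowerSeries.coeff_succ_X_mul] at this
  rw [← PowerSeries.coeff_zero_eq_constantCoeff_apply, ← this]
  simp [oneSubExp, expSeries, PowerSeries.coeff_one]

lemma oneSubExp_ne_zero : oneSubExp ≠ 0 := by
  obtain ⟨u, hu, hu1⟩ := exists_oneSubExp_eq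
  rw [hu]
  refine mul_ne_zero PowerSeries.X_ne_zero fun h => ?_
  rw [h] at hu1
  simp at hu1

/-- Substitution of `e^{-z}` into a polynomial. -/
def expEval : Polynomial ℝ →ₐ[ℝ] PowerSeries ℝ := Polynomial.aeval (expSeries (-1))

lemma expEval_X : expEval Polynomial.X = 1 - oneSubExp := by
  simp [expEval, oneSubExp]

lemma expEval_one_sub_X : expEval (1 - Polynomial.X) = oneSubExp := by
  rw [map_sub, map_one, expEval_X]; ring

lemma derivative_oneSubExp : PowerSeries.derivative ℝ oneSubExp = 1 - oneSubExp := by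
  rw [oneSubExp, map_sub, derivative_expSeries_neg_one]
  simp

lemma derivative_expEval (P : Polynomial ℝ) :
    PowerSeries.derivative ℝ (expEval P) =
      -(expEval Polynomial.X * expEval (Polynomial.derivative P)) := by
  induction P using Polynomial.induction_on' with
  | add p q hp hq => simp only [map_add, hp, hq]; ring
  | monomial n a =>
    rw [← Polynomial.C_mul_X_pow_eq_monomial]
    have hC : expEval (Polynomial.C a) = PowerSeries.C a := by
      simp [expEval]
    rcases n with _ | n
    · simp [hC]
    · rw [map_mul, Derivation.leibniz, hC, map_pow, Derivation.leibniz_pow]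
      simp [expEval, derivative_expSeries_neg_one]
      ring

/-- The order of the root `1` of a polynomial is seen by substituting `e^{-z}`. -/
lemma pow_dvd_of_X_pow_dvd_expEval {P : Polynomial ℝ} {a : ℕ}
    (h : PowerSeries.X ^ a ∣ expEval P) : (1 - Polynomial.X) ^ a ∣ P := by
  by_cases hP : P = 0
  · simp [hP]
  obtain ⟨q, hq, hnd⟩ := Polynomial.exists_eq_pow_rootMultiplicity_mul_and_not_dvd P hP 1
  set b := P.rootMultiplicity 1 with hb
  by_cases hab : a ≤ b
  · have h1 : (1 - Polynomial.X : Polynomial ℝ) ^ a ∣ (1 - Polynomial.X) ^ b := pow_dvd_pow _ hab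
    have h2 : (Polynomial.X - Polynomial.C 1 : Polynomial ℝ) ^ b ∣ P := ⟨q, hq⟩
    have h3 : (1 - Polynomial.X : Polynomial ℝ) ^ b ∣ (Polynomial.X - Polynomial.C 1) ^ b := by
      refine pow_dvd_pow_of_dvd ⟨-1, ?_⟩ b
      simp
    exact h1.trans (h3.trans h2)
  · exfalso
    push Not at hab
    obtain ⟨u, hu, hu1⟩ := exists_oneSubExp_eq
    have h1 : expEval P = PowerSeries.X ^ b * ((-u) ^ b * expEval q) := by
      rw [hq, map_mul, map_pow, map_sub, expEval_X]
      have : expEval (Polynomial.C 1) = 1 := by simp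
      rw [this, hu]
      have : (1 - PowerSeries.X * u - 1 : PowerSeries ℝ) = PowerSeries.X * (-u) := by ring
      rw [this, mul_pow]; ring
    have h2 : PowerSeries.X ^ (b + 1) ∣ PowerSeries.X ^ b * ((-u) ^ b * expEval q) := by
      rw [← h1]; exact (pow_dvd_pow _ hab).trans h
    rw [pow_succ] at h2
    have h3 := (mul_dvd_mul_iff_left (pow_ne_zero b PowerSeries.X_ne_zero)).1 h2
    rw [PowerSeries.X_dvd_iff, map_mul, map_pow, map_neg, hu1] at h3
    have h4 : PowerSeries.constantCoeff (expEval q) = q.eval 1 := by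
      have hE : PowerSeries.constantCoeff (expSeries (-1)) = 1 := by
        rw [← PowerSeries.coeff_zero_eq_constantCoeff_apply]; simp [expSeries]
      rw [expEval, Polynomial.aeval_def, Polynomial.hom_eval₂, hE]
      rw [Polynomial.eval, Polynomial.eval₂_eq_sum, Polynomial.eval₂_eq_sum]
      refine Finset.sum_congr rfl fun i _ => ?_
      congr 1
    rw [h4] at h3
    apply hnd
    rw [Polynomial.dvd_iff_isRoot]
    have h5 : ((-1 : ℝ)) ^ b ≠ 0 := by positivity
    simpa [h5] using h3

/-- Order of consistency of the BDF method. -/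
lemma exists_expEval_bdfPoly (k : ℕ) : ∃ a : PowerSeries ℝ,
    expEval (bdfPoly k) = PowerSeries.X * (1 + PowerSeries.X ^ k * a) := by
  have hδ : expEval (bdfPoly k) =
      ∑ j ∈ Finset.Icc 1 k, PowerSeries.C (1 / (j : ℝ)) * oneSubExp ^ j := by
    rw [bdfPoly, map_sum]
    refine Finset.sum_congr rfl fun j _ => ?_
    rw [map_mul, map_pow, expEval_one_sub_X]
    congr 1
    simp only [expEval, Polynomial.aeval_C]
    rfl
  -- With w = 1 - e^{-z} one has z = -log(1 - w), and δ_k is the truncated logarithm series. As w' =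
  -- 1 - w, the derivative of ∑ w^j/j is (1 - w) ∑_{i<k} w^i = 1 - w^k. So the difference has
  -- derivative -w^k = O(z^k) and no constant term.
  have hder : PowerSeries.derivative ℝ (expEval (bdfPoly k) - PowerSeries.X) =
      -oneSubExp ^ k := by
    rw [map_sub, hδ, map_sum]
    have h1 : ∀ j ∈ Finset.Icc 1 k,
        PowerSeries.derivative ℝ (PowerSeries.C (1 / (j : ℝ)) * oneSubExp ^ j) =
          oneSubExp ^ (j - 1) * (1 - oneSubExp) := by
      intro j hj
      have hj1 : (j : ℝ) ≠ 0 := by have := (Finset.mem_Icc.1 hj).1; positivity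
      rw [Derivation.leibniz, Derivation.leibniz_pow, derivative_oneSubExp]
      simp only [smul_eq_mul, PowerSeries.derivative_C, mul_zero, add_zero, nsmul_eq_mul]
      have : (PowerSeries.C (1 / (j : ℝ)) : PowerSeries ℝ) * (j : PowerSeries ℝ) = 1 := by
        rw [← map_natCast (PowerSeries.C (R := ℝ)), ← map_mul, one_div_mul_cancel hj1, map_one]
      linear_combination (oneSubExp ^ (j - 1) * (1 - oneSubExp)) * this
    rw [Finset.sum_congr rfl h1, ← Finset.sum_mul]
    have h2 : ∑ j ∈ Finset.Icc 1 k, oneSubExp ^ (j - 1) = ∑ i ∈ Finset.range k, oneSubExp ^ i := by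
      rw [Finset.range_eq_Ico, Finset.sum_Ico_eq_sum_range, ← Finset.Ico_add_one_right_eq_Icc,
        Finset.sum_Ico_eq_sum_range]
      simp
    rw [h2, PowerSeries.derivative_X]
    have := geom_sum_mul oneSubExp k
    linear_combination -this
  obtain ⟨u, hu, -⟩ := exists_oneSubExp_eq
  have hdvd : PowerSeries.X ^ (k + 1) ∣ expEval (bdfPoly k) - PowerSeries.X := by
    rw [PowerSeries.X_pow_dvd_iff]
    intro n hn
    rcases n with _ | n
    · rw [PowerSeries.coeff_zero_eq_constantCoeff_apply, hδ, map_sub, map_sum]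
      rw [Finset.sum_eq_zero]
      · simp
      · intro j hj
        have : j ≠ 0 := by have := (Finset.mem_Icc.1 hj).1; omega
        rw [hu]
        simp [this]
    · have h3 : PowerSeries.coeff n (PowerSeries.derivative ℝ
          (expEval (bdfPoly k) - PowerSeries.X)) = 0 := by
        rw [hder]
        have : PowerSeries.X ^ k ∣ -oneSubExp ^ k := by
          rw [hu, mul_pow]; exact Dvd.dvd.neg_right ⟨_, rfl⟩
        exact PowerSeries.X_pow_dvd_iff.1 this n (by omega)
      rw [PowerSeries.coeff_derivative] at h3
      have h4 : ((n : ℝ) + 1) ≠ 0 := by positivity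
      exact (mul_eq_zero.1 h3).resolve_right h4
  obtain ⟨a, ha⟩ := hdvd
  refine ⟨a, ?_⟩
  linear_combination ha

/-- Because e^{xz} P(e^{-z}) = ∑ p_j e^{(x-j)z}, its i-th coefficient is the difference operator
P(e^{-D}) applied to t^i/i! at x. Exactness on polynomials thus becomes an identity of formal
series. -/
lemma coeff_expSeries_mul_expEval (x : ℝ) (P : Polynomial ℝ) (i : ℕ) :
    PowerSeries.coeff i (expSeries x * expEval P) =
      ∑ j ∈ Finset.range (P.natDegree + 1), P.coeff j * ((x - j) ^ i / (i.factorial : ℝ)) := by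
  rw [expEval, Polynomial.aeval_eq_sum_range, Finset.mul_sum, map_sum]
  refine Finset.sum_congr rfl fun j _ => ?_
  rw [expSeries_pow, mul_smul_comm, expSeries_mul, map_smul, expSeries, PowerSeries.coeff_mk,
    smul_eq_mul]
  ring_nf

/-- `δ_k(e^{-D})^m` agrees with `D^m` on polynomials of degree less than `k + m`. -/
lemma sum_bdfPoly_pow_mul (k m i : ℕ) (hi : i < k + m) (x : ℝ) :
    ∑ j ∈ Finset.range ((bdfPoly k ^ m).natDegree + 1),
      (bdfPoly k ^ m).coeff j * ((x - j) ^ i / (i.factorial : ℝ)) =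
      if m ≤ i then x ^ (i - m) / ((i - m).factorial : ℝ) else 0 := by
  obtain ⟨a, ha⟩ := exists_expEval_bdfPoly k
  rw [← coeff_expSeries_mul_expEval, map_pow, ha]
  -- δ_k(e^{-z})^m = z^m + O(z^{k+m}), so below degree k + m only z^m e^{xz} contributes.
  obtain ⟨b, hb⟩ : PowerSeries.X ^ k * a ∣ (1 + PowerSeries.X ^ k * a) ^ m - 1 := by
    have := sub_dvd_pow_sub_pow (1 + PowerSeries.X ^ k * a) 1 m
    simpa using this
  have h1 : expSeries x * (PowerSeries.X * (1 + PowerSeries.X ^ k * a)) ^ m =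
      PowerSeries.X ^ m * expSeries x + PowerSeries.X ^ (k + m) * (expSeries x * a * b) := by
    rw [mul_pow, pow_add]
    linear_combination expSeries x * PowerSeries.X ^ m * hb
  rw [h1, map_add, PowerSeries.coeff_X_pow_mul', PowerSeries.coeff_X_pow_mul', if_neg (not_le.2 hi)]
  simp [expSeries]

/-! ### Generating functions of the monomials -/

/-- The generating power series `∑ n (n^j / j!) ξ^n`. -/
def monomialSeries (j : ℕ) : PowerSeries ℝ :=
  PowerSeries.mk fun n => (n : ℝ) ^ j / (j.factorial : ℝ)

/-- The numerator of the generating function of the monomials (an Eulerian polynomial). -/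
def monomialNumerator : ℕ → Polynomial ℝ
  | 0 => 1
  | j + 1 => Polynomial.C (1 / ((j : ℝ) + 1)) * (Polynomial.X *
      ((1 - Polynomial.X) * Polynomial.derivative (monomialNumerator j) +
        Polynomial.C ((j : ℝ) + 1) * monomialNumerator j))

/-- The Euler operator ξ d/dξ multiplies the n-th coefficient by n. This drives the induction on j
for the numerators. -/
lemma derivative_monomialSeries (j : ℕ) :
    PowerSeries.X * PowerSeries.derivative ℝ (monomialSeries j) =
      PowerSeries.C ((j : ℝ) + 1) * monomialSeries (j + 1) := by
  ext n
  rw [PowerSeries.coeff_C_mul]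
  have hj : (j.factorial : ℝ) ≠ 0 := by positivity
  rcases n with _ | n
  · simp [monomialSeries]
  · rw [PowerSeries.coeff_succ_X_mul, PowerSeries.coeff_derivative, monomialSeries, monomialSeries,
      PowerSeries.coeff_mk, PowerSeries.coeff_mk, Nat.factorial_succ]
    push_cast
    field_simp
    ring

lemma one_sub_X_pow_mul_monomialSeries (j : ℕ) :
    (1 - PowerSeries.X) ^ (j + 1) * monomialSeries j = (monomialNumerator j : PowerSeries ℝ) := by
  induction j with
  | zero =>
    have : monomialSeries 0 = PowerSeries.mk 1 := by
      ext n; simp [monomialSeries]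
    rw [this, mul_comm]
    simpa [monomialNumerator] using PowerSeries.mk_one_mul_one_sub_eq_one ℝ
  | succ j ih =>
    have hd := congrArg (PowerSeries.derivative ℝ) ih
    rw [Derivation.leibniz, Derivation.leibniz_pow, PowerSeries.derivative_coe] at hd
    simp only [map_sub, Derivation.map_one_eq_zero, PowerSeries.derivative_X, smul_eq_mul,
      nsmul_eq_mul, Nat.add_sub_cancel] at hd
    have hm := derivative_monomialSeries j
    have hj : ((j : ℝ) + 1) ≠ 0 := by positivity
    have hCC : (PowerSeries.C (1 / ((j : ℝ) + 1)) : PowerSeries ℝ) * PowerSeries.C ((j : ℝ) + 1) =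
        1 := by
      rw [← map_mul, one_div_mul_cancel hj, map_one]
    have hcast : (PowerSeries.C ((j : ℝ) + 1) : PowerSeries ℝ) = (((j + 1 : ℕ)) : PowerSeries ℝ) := by
      rw [← map_natCast (PowerSeries.C (R := ℝ))]; push_cast; rfl
    simp only [monomialNumerator, Polynomial.coe_mul, Polynomial.coe_add, Polynomial.coe_sub,
      Polynomial.coe_one, Polynomial.coe_X, Polynomial.coe_C]
    rw [hcast] at hm hCC ⊢
    linear_combination (-(1 - PowerSeries.X) ^ (j + 1 + 1) * monomialSeries (j + 1)) * hCC
      - PowerSeries.C (1 / ((j : ℝ) + 1)) * (1 - PowerSeries.X) ^ (j + 2) * hm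
      + PowerSeries.C (1 / ((j : ℝ) + 1)) * PowerSeries.X * (1 - PowerSeries.X) * hd
      + PowerSeries.C (1 / ((j : ℝ) + 1)) * PowerSeries.X * ((j + 1 : ℕ) : PowerSeries ℝ) * ih

/-- The regular part of the generating function of the monomials at `ξ = e^{-z}`. -/
def monomialRegular (j : ℕ) : PowerSeries ℝ := PowerSeries.mk fun n =>
  (-1) ^ j * ((bernoulli' (n + j + 1) : ℚ) : ℝ) /
    (((n : ℝ) + j + 1) * (j.factorial : ℝ) * (n.factorial : ℝ))

lemma derivative_monomialRegular (j : ℕ) :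
    PowerSeries.derivative ℝ (monomialRegular j) =
      -(((j + 1 : ℕ) : PowerSeries ℝ) * monomialRegular (j + 1)) := by
  ext n
  rw [map_neg, ← map_natCast (PowerSeries.C (R := ℝ)), PowerSeries.coeff_C_mul,
    PowerSeries.coeff_derivative, monomialRegular, monomialRegular, PowerSeries.coeff_mk,
    PowerSeries.coeff_mk, Nat.factorial_succ, Nat.factorial_succ]
  have e : n + 1 + j + 1 = n + (j + 1) + 1 := by ring
  rw [e]
  have h1 : (j.factorial : ℝ) ≠ 0 := by positivity
  have h2 : (n.factorial : ℝ) ≠ 0 := by positivity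
  have h3 : ((n : ℝ) + (j + 1) + 1) ≠ 0 := by positivity
  have h4 : ((n : ℝ) + 1 + j + 1) ≠ 0 := by positivity
  have h5 : ((n : ℝ) + 1 + j + 1) = ((n : ℝ) + (j + 1) + 1) := by ring
  push_cast
  rw [h5]
  field_simp
  ring

/-- The constant term is a multiple of the Bernoulli number with index j + 1, which is odd and
larger than 1. The additional order for even l + m comes from here. -/
lemma constantCoeff_monomialRegular {j : ℕ} (hj : Even j) (hj2 : 1 ≤ j) :
    PowerSeries.X ∣ monomialRegular j := by
  rw [PowerSeries.X_dvd_iff, ← PowerSeries.coeff_zero_eq_constantCoeff_apply, monomialRegular,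
    PowerSeries.coeff_mk, bernoulli'_eq_zero_of_odd (by simpa using hj.add_one) (by omega)]
  simp

/-- Freed of denominators, this is ∑ (n^j/j!) e^{-nz} = z^{-j-1} + regular part. For j = 0 it is the
generating function of the Bernoulli numbers; differentiation in z brings down a factor -n and
raises j. Clearing the pole keeps the argument inside formal power series. -/
lemma X_pow_mul_expEval_monomialNumerator (j : ℕ) :
    PowerSeries.X ^ (j + 1) * expEval (monomialNumerator j) =
      oneSubExp ^ (j + 1) * (1 + PowerSeries.X ^ (j + 1) * monomialRegular j) := by
  induction j with
  | zero =>
    have hB := bernoulli'PowerSeries_mul_exp_sub_one ℝ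
    have hB0 : bernoulli'PowerSeries ℝ = 1 + PowerSeries.X * monomialRegular 0 := by
      ext n
      rcases n with _ | n
      · simp [bernoulli'PowerSeries]
      · rw [map_add, PowerSeries.coeff_succ_X_mul, PowerSeries.coeff_one, monomialRegular,
          PowerSeries.coeff_mk, bernoulli'PowerSeries, PowerSeries.coeff_mk, Nat.factorial_succ]
        simp
    have hE : PowerSeries.exp ℝ * expSeries (-1) = 1 := by
      have : PowerSeries.exp ℝ = expSeries 1 := by rw [expSeries_eq]; simp
      rw [this, expSeries_mul]; simp [expSeries_zero]
    simp only [monomialNumerator, map_one, mul_one, zero_add, pow_one]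
    rw [← hB0, oneSubExp]
    linear_combination (-expSeries (-1)) * hB + (bernoulli'PowerSeries ℝ - PowerSeries.X) * hE
  | succ j ih =>
    have hd := congrArg (PowerSeries.derivative ℝ) ih
    rw [Derivation.leibniz, Derivation.leibniz_pow, Derivation.leibniz, Derivation.leibniz_pow,
      derivative_expEval, derivative_oneSubExp, map_add, Derivation.leibniz,
      Derivation.leibniz_pow, derivative_monomialRegular] at hd
    simp only [Derivation.map_one_eq_zero, PowerSeries.derivative_X, smul_eq_mul,
      nsmul_eq_mul, Nat.add_sub_cancel] at hd
    have hj : ((j : ℝ) + 1) ≠ 0 := by positivity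
    have hE : expEval (monomialNumerator (j + 1)) = PowerSeries.C (1 / ((j : ℝ) + 1)) *
        (expEval Polynomial.X * (oneSubExp * expEval (Polynomial.derivative (monomialNumerator j)) +
          ((j + 1 : ℕ) : PowerSeries ℝ) * expEval (monomialNumerator j))) := by
      have hC : ∀ c : ℝ, expEval (Polynomial.C c) = PowerSeries.C c := by
        intro c
        simp only [expEval, Polynomial.aeval_C]
        rfl
      have hcast : (PowerSeries.C ((j : ℝ) + 1) : PowerSeries ℝ) =
          (((j + 1 : ℕ)) : PowerSeries ℝ) := by
        rw [← map_natCast (PowerSeries.C (R := ℝ))]; push_cast; rfl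
      rw [monomialNumerator, map_mul, map_mul, map_add, map_mul, map_mul, hC, hC, hcast,
        expEval_one_sub_X]
    have hCC : (PowerSeries.C (1 / ((j : ℝ) + 1)) : PowerSeries ℝ) * ((j + 1 : ℕ) : PowerSeries ℝ) =
        1 := by
      rw [← map_natCast (PowerSeries.C (R := ℝ)), ← map_mul]
      push_cast
      rw [one_div_mul_cancel hj, map_one]
    rw [hE, expEval_X]
    rw [expEval_X] at hd
    linear_combination (-PowerSeries.C (1 / ((j : ℝ) + 1)) * PowerSeries.X * oneSubExp) * hd
      + (oneSubExp ^ (j + 2) * (1 + PowerSeries.X ^ (j + 2) * monomialRegular (j + 1)) ) * hCC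
      + PowerSeries.C (1 / ((j : ℝ) + 1)) * ((j + 1 : ℕ) : PowerSeries ℝ) *
        (oneSubExp + PowerSeries.X * (1 - oneSubExp)) * ih

/-- At ξ = e^{-z} the discretization δ_k^i applied to the samples of t^{l+i}/(l+i)! has the
generating function z^{-l-1} (1 + z^k a)^i (1 + z^{l+i+1} · regular). The leading term does not
depend on i, so two choices of i differ only at higher order. -/
lemma X_pow_mul_expEval_cofactor (k i l : ℕ) {a : PowerSeries ℝ}
    (ha : expEval (bdfPoly k) = PowerSeries.X * (1 + PowerSeries.X ^ k * a)) :
    PowerSeries.X ^ (l + 1) * expEval (bdfCofactor k ^ i * monomialNumerator (l + i)) =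
      oneSubExp ^ (l + 1) * ((1 + PowerSeries.X ^ k * a) ^ i *
        (1 + PowerSeries.X ^ (l + i + 1) * monomialRegular (l + i))) := by
  have h1 := X_pow_mul_expEval_monomialNumerator (l + i)
  have h2 : oneSubExp ^ i * expEval (bdfCofactor k) ^ i =
      PowerSeries.X ^ i * (1 + PowerSeries.X ^ k * a) ^ i := by
    rw [← mul_pow, ← mul_pow, ← ha, bdfPoly_eq_mul, map_mul, expEval_one_sub_X]
  have h0 : (PowerSeries.X ^ i * oneSubExp ^ i : PowerSeries ℝ) ≠ 0 :=
    mul_ne_zero (pow_ne_zero _ PowerSeries.X_ne_zero) (pow_ne_zero _ oneSubExp_ne_zero)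
  apply mul_left_cancel₀ h0
  rw [map_mul, map_pow]
  have e1 : (PowerSeries.X : PowerSeries ℝ) ^ (l + i + 1) = PowerSeries.X ^ i * PowerSeries.X ^ (l + 1) := by
    rw [← pow_add]; congr 1; ring
  have e2 : oneSubExp ^ (l + i + 1) = oneSubExp ^ i * oneSubExp ^ (l + 1) := by
    rw [← pow_add]; congr 1; ring
  rw [e1, e2] at h1
  rw [e1]
  linear_combination (PowerSeries.X ^ i * PowerSeries.X ^ (l + 1) *
    expEval (monomialNumerator (l + i))) * h2 +
    PowerSeries.X ^ i * (1 + PowerSeries.X ^ k * a) ^ i * h1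

/-- The quadrature errors of two discretizations of the same monomial cancel to high order at
`ξ = 1`. -/
lemma exists_quadrature_difference_eq {k m l o : ℕ} (hl : l < k) (hm : 1 ≤ m)
    (ho : o + l + 1 ≤ k) (hom : o ≤ if Odd (l + m) then m else m + 1) :
    ∃ U : Polynomial ℝ,
      ((bdfPoly k ^ m : Polynomial ℝ) : PowerSeries ℝ) * monomialSeries (l + m) -
        ((bdfPoly k ^ (k - l) : Polynomial ℝ) : PowerSeries ℝ) * monomialSeries k =
        (1 - PowerSeries.X) ^ o * (U : PowerSeries ℝ) := by
  obtain ⟨a, ha⟩ := exists_expEval_bdfPoly k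
  -- each of the two terms is `1 + O(z^{l+1+o})` after normalization
  have hterm : ∀ i : ℕ, (o + l + 1 ≤ l + i + 1 ∨ (o + l + 1 ≤ l + i + 2 ∧ Even (l + i) ∧ 1 ≤ l + i)) →
      ∃ b : PowerSeries ℝ, (1 + PowerSeries.X ^ k * a) ^ i *
        (1 + PowerSeries.X ^ (l + i + 1) * monomialRegular (l + i)) =
          1 + PowerSeries.X ^ (l + 1 + o) * b := by
    intro i hi
    have h1 : PowerSeries.X ^ (l + 1 + o) ∣ (1 + PowerSeries.X ^ k * a) ^ i - 1 := by
      have h2 := sub_dvd_pow_sub_pow (1 + PowerSeries.X ^ k * a) 1 i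
      rw [one_pow, add_sub_cancel_left] at h2
      exact (dvd_mul_of_dvd_left (pow_dvd_pow _ (by omega)) a).trans h2
    have h2 : PowerSeries.X ^ (l + 1 + o) ∣
        PowerSeries.X ^ (l + i + 1) * monomialRegular (l + i) := by
      rcases hi with hi | ⟨hi, he, h1⟩
      · exact dvd_mul_of_dvd_left (pow_dvd_pow _ (by omega)) _
      · have h3 := mul_dvd_mul (dvd_refl ((PowerSeries.X : PowerSeries ℝ) ^ (l + i + 1)))
          (constantCoeff_monomialRegular he h1)
        rw [← pow_succ] at h3
        exact (pow_dvd_pow _ (by omega)).trans h3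
    obtain ⟨b1, hb1⟩ := h1
    obtain ⟨b2, hb2⟩ := h2
    refine ⟨b1 + (1 + PowerSeries.X ^ k * a) ^ i * b2, ?_⟩
    linear_combination hb1 + (1 + PowerSeries.X ^ k * a) ^ i * hb2
  obtain ⟨b1, hb1⟩ := hterm m (by
    split_ifs at hom with hodd
    · left; omega
    · right; exact ⟨by omega, Nat.not_odd_iff_even.1 hodd, by omega⟩)
  -- The reference discretization is i = k - l, acting on t^k/k!. Its error z^{k+1} is beyond the
  -- order considered.
  obtain ⟨b2, hb2⟩ := hterm (k - l) (by left; omega)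
  have e1 := X_pow_mul_expEval_cofactor k m l ha
  have e2 := X_pow_mul_expEval_cofactor k (k - l) l ha
  rw [hb1] at e1
  rw [hb2] at e2
  have hlk : l + (k - l) = k := by omega
  rw [hlk] at e2
  -- W is the difference multiplied by (1 - ξ)^{l+1}. It vanishes to order l + 1 + o at ξ = 1: the
  -- first l + 1 orders cancel the common pole, and o remain.
  set W : Polynomial ℝ := bdfCofactor k ^ m * monomialNumerator (l + m) -
    bdfCofactor k ^ (k - l) * monomialNumerator k with hW
  obtain ⟨u, hu, -⟩ := exists_oneSubExp_eq
  have hWdvd : PowerSeries.X ^ (l + 1 + o) ∣ expEval W := by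
    refine ⟨u ^ (l + 1) * (b1 - b2), ?_⟩
    apply mul_left_cancel₀ (pow_ne_zero (l + 1) (PowerSeries.X_ne_zero (R := ℝ)))
    rw [hu, mul_pow] at e1 e2
    rw [hW, map_sub]
    linear_combination e1 - e2
  obtain ⟨U, hU⟩ := pow_dvd_of_X_pow_dvd_expEval hWdvd
  refine ⟨U, ?_⟩
  have h1X : (1 - PowerSeries.X : PowerSeries ℝ) ≠ 0 := by
    intro h
    have := congrArg PowerSeries.constantCoeff h
    simp at this
  apply mul_left_cancel₀ (pow_ne_zero (l + 1) h1X)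
  have hUc := congrArg (fun P : Polynomial ℝ => (P : PowerSeries ℝ)) hU
  simp only [hW, Polynomial.coe_sub, Polynomial.coe_mul, Polynomial.coe_pow, Polynomial.coe_one,
    Polynomial.coe_X] at hUc
  have n1 := one_sub_X_pow_mul_monomialSeries (l + m)
  have n2 := one_sub_X_pow_mul_monomialSeries k
  simp only [Polynomial.coe_pow]
  have hδ : ((bdfPoly k : Polynomial ℝ) : PowerSeries ℝ) =
      (1 - PowerSeries.X) * (bdfCofactor k : PowerSeries ℝ) := by
    rw [bdfPoly_eq_mul]; simp
  rw [hδ, mul_pow, mul_pow]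
  have p1 : (1 - PowerSeries.X : PowerSeries ℝ) ^ (l + m + 1) =
    (1 - PowerSeries.X) ^ (l + 1) * (1 - PowerSeries.X) ^ m := by rw [← pow_add]; congr 1; ring
  have p2 : (1 - PowerSeries.X : PowerSeries ℝ) ^ (k + 1) =
    (1 - PowerSeries.X) ^ (l + 1) * (1 - PowerSeries.X) ^ (k - l) := by
    rw [← pow_add]; congr 1; omega
  have p3 : (1 - PowerSeries.X : PowerSeries ℝ) ^ (l + 1 + o) =
    (1 - PowerSeries.X) ^ (l + 1) * (1 - PowerSeries.X) ^ o := by rw [← pow_add]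
  rw [p1] at n1
  rw [p2] at n2
  rw [p3] at hUc
  linear_combination (bdfCofactor k : PowerSeries ℝ) ^ m * n1 -
    (bdfCofactor k : PowerSeries ℝ) ^ (k - l) * n2 + hUc

/-! ### Iterated integrals of exponentials -/

/-- The `i`-fold integral `(J^i e^{-ρ ·})(t)`. -/
def expIntegral (ρ : ℝ) : ℕ → ℝ → ℝ
  | 0, t => Real.exp (-(ρ * t))
  | i + 1, t => (t ^ i / (i.factorial : ℝ) - expIntegral ρ i t) / ρ

lemma hasDerivAt_monomial_succ (i : ℕ) (t : ℝ) :
    HasDerivAt (fun t : ℝ => t ^ (i + 1) / ((i + 1).factorial : ℝ)) (t ^ i / (i.factorial : ℝ)) t := by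
  have h := (hasDerivAt_pow (i + 1) t).div_const ((i + 1).factorial : ℝ)
  refine h.congr_deriv ?_
  rw [Nat.factorial_succ]
  have h1 : (i.factorial : ℝ) ≠ 0 := by positivity
  push_cast
  field_simp

lemma hasDerivAt_expIntegral_zero (ρ t : ℝ) :
    HasDerivAt (expIntegral ρ 0) (-ρ * expIntegral ρ 0 t) t := by
  have h : HasDerivAt (fun t : ℝ => Real.exp (-(ρ * t))) _ t :=
    ((hasDerivAt_id t).const_mul ρ).neg.exp
  change HasDerivAt (fun t : ℝ => Real.exp (-(ρ * t))) (-ρ * Real.exp (-(ρ * t))) t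
  refine h.congr_deriv ?_
  simp only [Pi.neg_apply, id]
  ring

lemma hasDerivAt_expIntegral_succ {ρ : ℝ} (hρ : ρ ≠ 0) (i : ℕ) (t : ℝ) :
    HasDerivAt (expIntegral ρ (i + 1)) (expIntegral ρ i t) t := by
  induction i with
  | zero =>
    have h := ((hasDerivAt_const t (1 : ℝ)).sub (hasDerivAt_expIntegral_zero ρ t)).div_const ρ
    have h2 : expIntegral ρ (0 + 1) = fun x => ((fun _ : ℝ => (1 : ℝ)) - expIntegral ρ 0) x / ρ := by
      funext s; simp [expIntegral]
    rw [h2]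
    refine h.congr_deriv ?_
    field_simp
    ring
  | succ i ih =>
    have h := ((hasDerivAt_monomial_succ i t).sub ih).div_const ρ
    exact h

lemma continuous_expIntegral (ρ : ℝ) (i : ℕ) : Continuous (expIntegral ρ i) := by
  induction i with
  | zero =>
    change Continuous fun t => Real.exp (-(ρ * t))
    fun_prop
  | succ i ih =>
    change Continuous fun t => (t ^ i / (i.factorial : ℝ) - expIntegral ρ i t) / ρ
    fun_prop

lemma expIntegral_succ_zero (ρ : ℝ) (i : ℕ) : expIntegral ρ (i + 1) 0 = 0 := by
  induction i with
  | zero => simp [expIntegral]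
  | succ i ih =>
    change ((0 : ℝ) ^ (i + 1) / ((i + 1).factorial : ℝ) - expIntegral ρ (i + 1) 0) / ρ = 0
    rw [ih]; simp

/-- The difference of the two sides at level i + 1 vanishes at 0, and its derivative is the
difference at level i. Divided by ρ, the same inequality is the nonnegativity of the next integral.
-/
lemma expIntegral_le {ρ : ℝ} (hρ : 0 < ρ) (i : ℕ) {t : ℝ} (ht : 0 ≤ t) :
    expIntegral ρ i t ≤ t ^ i / (i.factorial : ℝ) := by
  induction i generalizing t with
  | zero => simpa [expIntegral] using mul_nonneg hρ.le ht
  | succ i ih =>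
    have hmono : MonotoneOn (fun t => t ^ (i + 1) / ((i + 1).factorial : ℝ) -
        expIntegral ρ (i + 1) t) (Ici 0) := by
      have hd : ∀ t, HasDerivAt (fun t => t ^ (i + 1) / ((i + 1).factorial : ℝ) -
          expIntegral ρ (i + 1) t) (t ^ i / (i.factorial : ℝ) - expIntegral ρ i t) t := fun t =>
        (hasDerivAt_monomial_succ i t).sub (hasDerivAt_expIntegral_succ hρ.ne' i t)
      refine monotoneOn_of_deriv_nonneg (convex_Ici 0)
        (fun t _ => (hd t).continuousAt.continuousWithinAt)
        (fun t _ => (hd t).differentiableAt.differentiableWithinAt) (fun t ht => ?_)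
      rw [(hd t).deriv]
      have := ih (t := t) (by simpa using (interior_subset ht))
      linarith
    have h := hmono (mem_Ici.2 le_rfl) (mem_Ici.2 ht) ht
    simp only [expIntegral_succ_zero] at h
    simp at h
    linarith

lemma expIntegral_nonneg {ρ : ℝ} (hρ : 0 < ρ) (i : ℕ) {t : ℝ} (ht : 0 ≤ t) :
    0 ≤ expIntegral ρ i t := by
  rcases i with _ | i
  · exact (Real.exp_pos _).le
  · exact div_nonneg (sub_nonneg.2 (expIntegral_le hρ i ht)) hρ.le

/-- With y = J^{i+1} e^{-ρ·} and y' = J^i e^{-ρ·} this reads y' + ρ y = t^i/i!. So these functions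
are the exact solutions for monomial sources. -/
lemma mul_expIntegral_succ {ρ : ℝ} (hρ : ρ ≠ 0) (i : ℕ) (t : ℝ) :
    ρ * expIntegral ρ (i + 1) t = t ^ i / (i.factorial : ℝ) - expIntegral ρ i t := by
  change ρ * ((t ^ i / (i.factorial : ℝ) - expIntegral ρ i t) / ρ) = _
  field_simp

lemma expIntegral_scale {r τ : ℝ} (hr : r ≠ 0) (hτ : τ ≠ 0) (i : ℕ) (x : ℝ) :
    expIntegral r i (τ * x) = τ ^ i * expIntegral (r * τ) i x := by
  induction i with
  | zero => simp [expIntegral, mul_assoc]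
  | succ i ih =>
    change ((τ * x) ^ i / (i.factorial : ℝ) - expIntegral r i (τ * x)) / r =
      τ ^ (i + 1) * ((x ^ i / (i.factorial : ℝ) - expIntegral (r * τ) i x) / (r * τ))
    rw [ih]
    field_simp
    ring

/-! ### Defects of the BDF method -/

/-- The difference operator multiplies e^{-ρt} by δ_k(e^ρ), which should approximate -ρ. The
residual vanishes at ρ = 0 and has derivative (1 - e^ρ)^k by a geometric sum, so the mean value
inequality gives the order. -/
lemma abs_bdfSymbol_exp_add_le (k : ℕ) {ρ : ℝ} (hρ : 0 ≤ ρ) (hρ1 : ρ ≤ 1) :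
    |bdfSymbol k (Real.exp ρ) + ρ| ≤ 2 ^ k * ρ ^ (k + 1) := by
  have hd : ∀ x : ℝ, HasDerivAt (fun x => bdfSymbol k (Real.exp x) + x)
      ((1 - Real.exp x) ^ k) x := by
    intro x
    have h1 : HasDerivAt (fun x => bdfSymbol k (Real.exp x))
        (∑ j ∈ Finset.Icc 1 k, (1 - Real.exp x) ^ (j - 1) * (-Real.exp x)) x := by
      unfold bdfSymbol
      refine HasDerivAt.fun_sum fun j hj => ?_
      have hj1 : (j : ℝ) ≠ 0 := by have := (Finset.mem_Icc.1 hj).1; positivity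
      have h := (((Real.hasDerivAt_exp x).const_sub 1).pow j).const_mul (1 / (j : ℝ))
      refine h.congr_deriv ?_
      field_simp
    have h2 := h1.add (hasDerivAt_id x)
    refine h2.congr_deriv ?_
    rw [← Finset.sum_mul]
    have h3 : ∑ j ∈ Finset.Icc 1 k, (1 - Real.exp x) ^ (j - 1) =
        ∑ i ∈ Finset.range k, (1 - Real.exp x) ^ i := by
      rw [← Finset.Ico_add_one_right_eq_Icc, Finset.sum_Ico_eq_sum_range]
      simp
    rw [h3]
    have := geom_sum_mul (1 - Real.exp x) k
    linear_combination this
  have hb : ∀ x ∈ Icc (0 : ℝ) ρ, ‖(1 - Real.exp x) ^ k‖ ≤ (2 * ρ) ^ k := by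
    intro x hx
    rw [norm_pow]
    have h1 : Real.exp x ≤ 1 + 2 * x := by
      rcases le_or_gt x (1 / 2) with h | h
      · exact exp_le_one_add_two_mul hx.1 h
      · have hq := Real.abs_exp_sub_one_sub_id_le (x := x) (by
          rw [abs_of_nonneg hx.1]; linarith [hx.2])
        have := le_abs_self (Real.exp x - 1 - x)
        nlinarith [hx.1, hx.2]
    have h2 : 1 ≤ Real.exp x := Real.one_le_exp hx.1
    rw [Real.norm_eq_abs, abs_of_nonpos (by linarith)]
    gcongr
    · linarith
    · linarith [hx.2]
  have h := (convex_Icc (0 : ℝ) ρ).norm_image_sub_le_of_norm_hasDerivWithin_le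
    (fun x _ => (hd x).hasDerivWithinAt) hb (left_mem_Icc.2 hρ) (right_mem_Icc.2 hρ)
  have h0 : bdfSymbol k (Real.exp 0) + 0 = 0 := by
    rw [← eval_bdfPoly, bdfPoly_eq_mul]
    simp
  rw [h0, sub_zero, Real.norm_eq_abs, Real.norm_eq_abs, sub_zero, abs_of_nonneg hρ] at h
  refine h.trans (le_of_eq ?_)
  rw [mul_pow]; ring

lemma exists_abs_bdfSymbol_exp_add_le (k : ℕ) (hk : 1 ≤ k) : ∃ C : ℝ, 0 < C ∧ ∀ ρ : ℝ, 0 ≤ ρ →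
    |bdfSymbol k (Real.exp ρ) + ρ| ≤ C * Real.exp (k * ρ) := by
  refine ⟨(∑ j ∈ Finset.Icc 1 k, (1 / (j : ℝ))) + 1, ?_, fun ρ hρ => ?_⟩
  · have : 0 ≤ ∑ j ∈ Finset.Icc 1 k, (1 / (j : ℝ)) := Finset.sum_nonneg fun j _ => by positivity
    linarith
  have h1 : |bdfSymbol k (Real.exp ρ)| ≤
      (∑ j ∈ Finset.Icc 1 k, (1 / (j : ℝ))) * Real.exp (k * ρ) := by
    rw [bdfSymbol, Finset.sum_mul]
    refine (Finset.abs_sum_le_sum_abs _ _).trans (Finset.sum_le_sum fun j hj => ?_)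
    rw [abs_mul, abs_of_nonneg (show (0 : ℝ) ≤ 1 / (j : ℝ) by positivity), abs_pow]
    gcongr
    have h2 : 1 ≤ Real.exp ρ := Real.one_le_exp hρ
    rw [abs_of_nonpos (by linarith), Real.exp_nat_mul]
    calc (-(1 - Real.exp ρ)) ^ j ≤ Real.exp ρ ^ j := by gcongr <;> linarith
      _ ≤ _ := pow_le_pow_right₀ h2 (Finset.mem_Icc.1 hj).2
  have h3 : ρ ≤ Real.exp (k * ρ) := by
    have : ρ ≤ k * ρ := le_mul_of_one_le_left hρ (by exact_mod_cast hk)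
    linarith [Real.add_one_le_exp (k * ρ)]
  calc _ ≤ |bdfSymbol k (Real.exp ρ)| + |ρ| := abs_add_le _ _
    _ ≤ _ := by rw [abs_of_nonneg hρ]; linarith

lemma sum_bdfPoly_mul (k i : ℕ) (hi : i ≤ k) (x : ℝ) :
    ∑ j ∈ Finset.range ((bdfPoly k).natDegree + 1),
      (bdfPoly k).coeff j * ((x - j) ^ i / (i.factorial : ℝ)) =
      if 1 ≤ i then x ^ (i - 1) / ((i - 1).factorial : ℝ) else 0 := by
  have := sum_bdfPoly_pow_mul k 1 i (by omega) x
  simpa only [pow_one] using this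

/-- The defect of the BDF method for iterated integrals of exponentials. -/
lemma sum_bdfPoly_mul_expIntegral (k : ℕ) {ρ : ℝ} (hρ : ρ ≠ 0) {i : ℕ} (hi : i ≤ k) (x : ℝ) :
    ∑ j ∈ Finset.range ((bdfPoly k).natDegree + 1),
      (bdfPoly k).coeff j * expIntegral ρ (i + 1) (x - j) - expIntegral ρ i x =
      (-1 / ρ) ^ (i + 1) * (Real.exp (-(ρ * x)) * (bdfSymbol k (Real.exp ρ) + ρ)) := by
  induction i with
  | zero =>
    have h := sum_bdfPoly_mul k 0 (Nat.zero_le _) x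
    simp at h
    have h1 : ∑ j ∈ Finset.range ((bdfPoly k).natDegree + 1),
        (bdfPoly k).coeff j * Real.exp (-(ρ * (x - j))) =
        Real.exp (-(ρ * x)) * bdfSymbol k (Real.exp ρ) := by
      rw [← eval_bdfPoly, Polynomial.eval_eq_sum_range, Finset.mul_sum]
      refine Finset.sum_congr rfl fun j _ => ?_
      rw [← Real.exp_nat_mul, mul_left_comm, ← Real.exp_add]
      congr 2
      ring
    have h2 : ∀ j : ℕ, (bdfPoly k).coeff j * expIntegral ρ (0 + 1) (x - j) =
        (bdfPoly k).coeff j / ρ - (bdfPoly k).coeff j * Real.exp (-(ρ * (x - j))) / ρ := by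
      intro j
      simp [expIntegral]; ring
    simp_rw [h2]
    rw [Finset.sum_sub_distrib, ← Finset.sum_div, ← Finset.sum_div, h, h1]
    simp only [expIntegral]
    rw [zero_add, pow_one]
    field_simp
    ring
  | succ i ih =>
    have h := sum_bdfPoly_mul k (i + 1) hi x
    simp only [Nat.le_add_left, if_true, Nat.add_sub_cancel] at h
    have h2 : ∀ j : ℕ, (bdfPoly k).coeff j * expIntegral ρ (i + 1 + 1) (x - j) =
        (bdfPoly k).coeff j * ((x - j) ^ (i + 1) / ((i + 1).factorial : ℝ)) / ρ -
          (bdfPoly k).coeff j * expIntegral ρ (i + 1) (x - j) / ρ := by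
      intro j
      rw [expIntegral]; ring
    simp_rw [h2]
    rw [Finset.sum_sub_distrib, ← Finset.sum_div, ← Finset.sum_div, h]
    have h3 := ih (by omega)
    have h4 : expIntegral ρ (i + 1) x = (x ^ i / (i.factorial : ℝ) - expIntegral ρ i x) / ρ := rfl
    rw [pow_succ (-1 / ρ) (i + 1)]
    rw [h4]
    linear_combination (-1 / ρ) * h3

/-! ### Geometric bounds for power series -/

/-- The coefficients of `f` are bounded by `A q^n`. -/
def GeomBound (A q : ℝ) (f : PowerSeries ℝ) : Prop :=
  ∀ n : ℕ, |PowerSeries.coeff n f| ≤ A * q ^ n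

/-- In the Cauchy product the faster factor is p^i ≤ r^i q^i. The slower rate q survives, and a
geometric series in r is all that is lost. -/
lemma GeomBound.mul {A B p q r : ℝ} {f g : PowerSeries ℝ} (hf : GeomBound A p f)
    (hg : GeomBound B q g) (hp : 0 ≤ p) (hq : 0 < q) (hr : p ≤ r * q) (hr1 : r < 1) (hA : 0 ≤ A)
    (hB : 0 ≤ B) : GeomBound (A * B / (1 - r)) q (f * g) := by
  intro n
  have hr0 : 0 ≤ r := by
    by_contra h
    push Not at h
    nlinarith
  rw [PowerSeries.coeff_mul, Finset.Nat.sum_antidiagonal_eq_sum_range_succ_mk]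
  have h1 : ∀ i ∈ Finset.range (n + 1),
      |PowerSeries.coeff i f * PowerSeries.coeff (n - i) g| ≤ A * B * q ^ n * r ^ i := by
    intro i hi
    have hin : i ≤ n := Nat.lt_succ_iff.1 (Finset.mem_range.1 hi)
    rw [abs_mul]
    calc _ ≤ (A * p ^ i) * (B * q ^ (n - i)) :=
          mul_le_mul (hf i) (hg _) (abs_nonneg _) (by positivity)
      _ ≤ (A * (r * q) ^ i) * (B * q ^ (n - i)) := by gcongr
      _ = A * B * (q ^ i * q ^ (n - i)) * r ^ i := by rw [mul_pow]; ring
      _ = A * B * q ^ n * r ^ i := by rw [← pow_add, Nat.add_sub_cancel' hin]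
  refine (Finset.abs_sum_le_sum_abs _ _).trans ((Finset.sum_le_sum h1).trans ?_)
  rw [← Finset.mul_sum]
  have h2 : ∑ i ∈ Finset.range (n + 1), r ^ i ≤ 1 / (1 - r) := by
    have h3 := geom_sum_mul_neg r (n + 1)
    have h4 : 0 ≤ r ^ (n + 1) := by positivity
    rw [le_div_iff₀ (by linarith)]
    linarith
  calc _ ≤ A * B * q ^ n * (1 / (1 - r)) := by gcongr
    _ = _ := by ring

lemma GeomBound.mono {A B p q : ℝ} {f : PowerSeries ℝ} (hf : GeomBound A p f) (hp : 0 ≤ p)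
    (hpq : p ≤ q) (hA : 0 ≤ A) (hAB : A ≤ B) : GeomBound B q f := fun n =>
  (hf n).trans (mul_le_mul hAB (pow_le_pow_left₀ hp hpq n) (by positivity) (hA.trans hAB))

/-- A power series with finitely many nonzero coefficients is geometrically bounded. -/
lemma exists_geomBound_of_finite {f : PowerSeries ℝ} {K : ℕ}
    (hf : ∀ n, K ≤ n → PowerSeries.coeff n f = 0) {q : ℝ} (hq : 0 < q) :
    ∃ A : ℝ, 0 < A ∧ GeomBound A q f := by
  have h0 : 0 ≤ ∑ i ∈ Finset.range K, |PowerSeries.coeff i f| / q ^ i :=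
    Finset.sum_nonneg fun i _ => by positivity
  refine ⟨∑ i ∈ Finset.range K, |PowerSeries.coeff i f| / q ^ i + 1, by linarith, fun n => ?_⟩
  by_cases hn : K ≤ n
  · rw [hf n hn, abs_zero]; positivity
  · push Not at hn
    have h1 : |PowerSeries.coeff n f| / q ^ n ≤
        ∑ i ∈ Finset.range K, |PowerSeries.coeff i f| / q ^ i :=
      Finset.single_le_sum (f := fun i => |PowerSeries.coeff i f| / q ^ i)
        (fun i _ => by positivity) (Finset.mem_range.2 hn)
    calc |PowerSeries.coeff n f| = |PowerSeries.coeff n f| / q ^ n * q ^ n := by field_simp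
      _ ≤ _ := by gcongr; linarith

lemma exists_geomBound_polynomial (P : Polynomial ℝ) {q : ℝ} (hq : 0 < q) :
    ∃ A : ℝ, 0 < A ∧ GeomBound A q (P : PowerSeries ℝ) :=
  exists_geomBound_of_finite (K := P.natDegree + 1) (fun n hn => by
    rw [Polynomial.coeff_coe]
    exact Polynomial.coeff_eq_zero_of_natDegree_lt hn) hq

lemma exists_geomBound_pow {f : PowerSeries ℝ} {A p : ℝ} (hf : GeomBound A p f) (hA : 0 ≤ A)
    (hp : 0 < p) (o : ℕ) {q : ℝ} (hpq : p < q) : ∃ B : ℝ, 0 < B ∧ GeomBound B q (f ^ o) := by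
  induction o with
  | zero =>
    obtain ⟨B, hB, h⟩ := exists_geomBound_polynomial 1 (hp.trans hpq)
    exact ⟨B, hB, by simpa using h⟩
  | succ o ih =>
    obtain ⟨B, hB, h⟩ := ih
    have hq := hp.trans hpq
    have hr : p / q < 1 := (div_lt_one hq).2 hpq
    have := hf.mul h hp.le hq (r := p / q) (by rw [div_mul_cancel₀ _ hq.ne']) hr hA hB.le
    refine ⟨A * B / (1 - p / q) + 1, ?_, ?_⟩
    · have : 0 ≤ A * B / (1 - p / q) := div_nonneg (by positivity) (by linarith)
      linarith
    · rw [pow_succ']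
      exact this.mono hq.le le_rfl (div_nonneg (by positivity) (by linarith)) (by linarith)

/-- Product of a shifted geometrically bounded series with a geometrically bounded one. -/
lemma abs_coeff_mul_le_of_shift {A B p q r : ℝ} {f g : PowerSeries ℝ} {n0 : ℕ}
    (hf0 : ∀ n < n0, PowerSeries.coeff n f = 0)
    (hf : ∀ n, |PowerSeries.coeff (n + n0) f| ≤ A * p ^ n)
    (hg : GeomBound B q g) (hp : 0 ≤ p) (hq : 0 < q) (hr : p ≤ r * q) (hr1 : r < 1) (hA : 0 ≤ A)
    (hB : 0 ≤ B) {n : ℕ} (hn : n0 ≤ n) :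
    |PowerSeries.coeff n (f * g)| ≤ A * B / (1 - r) * q ^ (n - n0) := by
  have hX : f = PowerSeries.X ^ n0 * PowerSeries.mk fun n => PowerSeries.coeff (n + n0) f := by
    ext i
    rw [PowerSeries.coeff_X_pow_mul']
    split_ifs with h
    · rw [PowerSeries.coeff_mk, Nat.sub_add_cancel h]
    · exact hf0 i (not_le.1 h)
  have hf' : GeomBound A p (PowerSeries.mk fun n => PowerSeries.coeff (n + n0) f) := fun i => by
    rw [PowerSeries.coeff_mk]; exact hf i
  rw [hX, mul_assoc, PowerSeries.coeff_X_pow_mul', if_pos hn]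
  exact hf'.mul hg hp hq hr hr1 hA hB (n - n0)

/-! ### Sampled functions -/

/-- Generating series of the samples of `f · 1_{[0,∞)}` at `n - s`. -/
def sampleSeries (f : ℝ → ℝ) (s : ℝ) : PowerSeries ℝ :=
  PowerSeries.mk fun n => if s ≤ n then f (n - s) else 0

/-- The monomial `x^i / i!`. -/
def monomialFun (i : ℕ) (x : ℝ) : ℝ := x ^ i / (i.factorial : ℝ)

lemma sampleSeries_monomialFun_zero (i : ℕ) : sampleSeries (monomialFun i) 0 = monomialSeries i := by
  ext n
  simp [sampleSeries, monomialSeries, monomialFun]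

/-- For s ≥ 0 the indices j > n have negative arguments and contribute nothing, so the Cauchy
product may be summed over the fixed stencil of P. -/
lemma coeff_polynomial_mul_sampleSeries (P : Polynomial ℝ) (f : ℝ → ℝ) {s : ℝ} (hs : 0 ≤ s)
    (n : ℕ) : PowerSeries.coeff n ((P : PowerSeries ℝ) * sampleSeries f s) =
      ∑ j ∈ Finset.range (P.natDegree + 1),
        P.coeff j * if 0 ≤ (n : ℝ) - s - j then f (n - s - j) else 0 := by
  have hterm : ∀ j ∈ Finset.range (n + 1), PowerSeries.coeff j (P : PowerSeries ℝ) *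
      PowerSeries.coeff (n - j) (sampleSeries f s) =
      P.coeff j * if 0 ≤ (n : ℝ) - s - j then f (n - s - j) else 0 := by
    intro j hj
    have hjn : j ≤ n := Nat.lt_succ_iff.1 (Finset.mem_range.1 hj)
    rw [Polynomial.coeff_coe, sampleSeries, PowerSeries.coeff_mk, Nat.cast_sub hjn]
    have e : (n : ℝ) - j - s = n - s - j := by ring
    rw [e]
    congr 1
    refine if_congr ⟨fun h => by linarith, fun h => by linarith⟩ rfl rfl
  rw [PowerSeries.coeff_mul, Finset.Nat.sum_antidiagonal_eq_sum_range_succ_mk]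
  simp only
  rw [Finset.sum_congr rfl hterm]
  set N := max (n + 1) (P.natDegree + 1) with hN
  have h1 : ∀ j ∈ Finset.range N, j ∉ Finset.range (n + 1) →
      (P.coeff j * if 0 ≤ (n : ℝ) - s - j then f (n - s - j) else 0) = 0 := by
    intro j _ hj
    have : n + 1 ≤ j := by simpa using hj
    have h2 : (n : ℝ) + 1 ≤ j := by exact_mod_cast this
    rw [if_neg (by linarith), mul_zero]
  have h2 : ∀ j ∈ Finset.range N, j ∉ Finset.range (P.natDegree + 1) →
      (P.coeff j * if 0 ≤ (n : ℝ) - s - j then f (n - s - j) else 0) = 0 := by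
    intro j _ hj
    have : P.natDegree + 1 ≤ j := by simpa using hj
    rw [Polynomial.coeff_eq_zero_of_natDegree_lt this, zero_mul]
  rw [Finset.sum_subset (Finset.range_mono (le_max_left _ _)) h1,
    Finset.sum_subset (Finset.range_mono (le_max_right _ _)) h2]

lemma abs_coeff_polynomial_mul_sampleSeries_le (P : Polynomial ℝ) {f : ℝ → ℝ} {s : ℝ} (hs : 0 ≤ s)
    (n : ℕ) {B : ℝ} (hB : 0 ≤ B) (hf : ∀ x, 0 ≤ x → x ≤ n - s → |f x| ≤ B) :
    |PowerSeries.coeff n ((P : PowerSeries ℝ) * sampleSeries f s)| ≤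
      (∑ j ∈ Finset.range (P.natDegree + 1), |P.coeff j|) * B := by
  rw [coeff_polynomial_mul_sampleSeries P f hs, Finset.sum_mul]
  refine (Finset.abs_sum_le_sum_abs _ _).trans (Finset.sum_le_sum fun j _ => ?_)
  rw [abs_mul]
  gcongr
  split_ifs with h
  · exact hf _ h (by linarith [(Nat.cast_nonneg j : (0 : ℝ) ≤ j)])
  · simpa using hB

lemma coeff_polynomial_mul_sampleSeries_of_lt (P : Polynomial ℝ) (f : ℝ → ℝ) {s : ℝ} (hs : 0 ≤ s)
    {n : ℕ} (hn : (n : ℝ) < s) :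
    PowerSeries.coeff n ((P : PowerSeries ℝ) * sampleSeries f s) = 0 := by
  rw [coeff_polynomial_mul_sampleSeries P f hs]
  refine Finset.sum_eq_zero fun j _ => ?_
  rw [if_neg (by linarith [(Nat.cast_nonneg j : (0 : ℝ) ≤ j)]), mul_zero]

lemma coeff_polynomial_mul_sampleSeries_of_le (P : Polynomial ℝ) (f : ℝ → ℝ) {s : ℝ} (hs : 0 ≤ s)
    {n : ℕ} (hn : (P.natDegree : ℝ) ≤ n - s) :
    PowerSeries.coeff n ((P : PowerSeries ℝ) * sampleSeries f s) =
      ∑ j ∈ Finset.range (P.natDegree + 1), P.coeff j * f (n - s - j) := by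
  rw [coeff_polynomial_mul_sampleSeries P f hs]
  refine Finset.sum_congr rfl fun j hj => ?_
  have : (j : ℝ) ≤ P.natDegree := by exact_mod_cast Nat.lt_succ_iff.1 (Finset.mem_range.1 hj)
  rw [if_pos (by linarith)]

/-- The defect `δ_k y - y'` of the monomials. -/
def monomialDefect (k m l : ℕ) (s : ℝ) : PowerSeries ℝ :=
  ((bdfPoly k ^ m : Polynomial ℝ) : PowerSeries ℝ) * sampleSeries (monomialFun (l + m)) s -
    sampleSeries (monomialFun l) s

/-- The defect `δ_k y - y'` of `y = J^{l+1} e^{-ρ ·}`. -/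
def expDefect (k l : ℕ) (ρ s : ℝ) : PowerSeries ℝ :=
  (bdfPoly k : PowerSeries ℝ) * sampleSeries (expIntegral ρ (l + 1)) s -
    sampleSeries (expIntegral ρ l) s

lemma coeff_sampleSeries (f : ℝ → ℝ) (s : ℝ) (n : ℕ) :
    PowerSeries.coeff n (sampleSeries f s) = if s ≤ n then f (n - s) else 0 := by
  rw [sampleSeries, PowerSeries.coeff_mk]

lemma natDegree_bdfPoly_pow_le (k m : ℕ) : (bdfPoly k ^ m).natDegree ≤ k * m := by
  refine Polynomial.natDegree_pow_le.trans ?_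
  rw [mul_comm]
  refine Nat.mul_le_mul_right m ?_
  unfold bdfPoly
  refine Polynomial.natDegree_sum_le_of_forall_le _ _ fun j hj => ?_
  refine (Polynomial.natDegree_C_mul_le _ _).trans (Polynomial.natDegree_pow_le.trans ?_)
  have h1 : (1 - Polynomial.X : Polynomial ℝ).natDegree ≤ 1 := by
    refine (Polynomial.natDegree_sub_le _ _).trans ?_
    simp
  calc j * (1 - Polynomial.X : Polynomial ℝ).natDegree ≤ j * 1 := Nat.mul_le_mul_left j h1
    _ ≤ k := by simpa using (Finset.mem_Icc.1 hj).2

/-- From km steps after s on, the whole stencil lies where the truncated power is a polynomial, of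
degree l + m < k + m, and there δ_k^m is exact. -/
lemma coeff_monomialDefect_of_le {k m l : ℕ} (hl : l < k) {s : ℝ} (hs : 0 ≤ s) {n : ℕ}
    (hn : ((k * m : ℕ) : ℝ) ≤ n - s) : PowerSeries.coeff n (monomialDefect k m l s) = 0 := by
  have h0 : (0 : ℝ) ≤ ((k * m : ℕ) : ℝ) := Nat.cast_nonneg _
  have hd : ((bdfPoly k ^ m).natDegree : ℝ) ≤ n - s :=
    le_trans (by exact_mod_cast natDegree_bdfPoly_pow_le k m) hn
  rw [monomialDefect, map_sub, coeff_polynomial_mul_sampleSeries_of_le _ _ hs hd,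
    coeff_sampleSeries, if_pos (by linarith)]
  unfold monomialFun
  rw [sum_bdfPoly_pow_mul k m (l + m) (by omega), if_pos (by omega), Nat.add_sub_cancel, sub_self]

lemma coeff_expDefect_of_le {k l : ℕ} (hl : l ≤ k) {ρ s : ℝ} (hρ : ρ ≠ 0) (hs : 0 ≤ s) {n : ℕ}
    (hn : (k : ℝ) ≤ n - s) : PowerSeries.coeff n (expDefect k l ρ s) =
      (-1 / ρ) ^ (l + 1) * (Real.exp (-(ρ * (n - s))) * (bdfSymbol k (Real.exp ρ) + ρ)) := by
  have h0 : (0 : ℝ) ≤ k := Nat.cast_nonneg _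
  have hd : ((bdfPoly k).natDegree : ℝ) ≤ n - s := by
    have := natDegree_bdfPoly_pow_le k 1
    rw [pow_one, mul_one] at this
    exact le_trans (by exact_mod_cast this) hn
  rw [expDefect, map_sub, coeff_polynomial_mul_sampleSeries_of_le _ _ hs hd,
    coeff_sampleSeries, if_pos (by linarith), sum_bdfPoly_mul_expIntegral k hρ hl]

lemma coeff_monomialDefect_of_lt {k m l : ℕ} {s : ℝ} (hs : 0 ≤ s) {n : ℕ} (hn : (n : ℝ) < s) :
    PowerSeries.coeff n (monomialDefect k m l s) = 0 := by
  rw [monomialDefect, map_sub, coeff_polynomial_mul_sampleSeries_of_lt _ _ hs hn,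
    coeff_sampleSeries, if_neg (not_le.2 hn), sub_self]

lemma coeff_expDefect_of_lt {k l : ℕ} {ρ s : ℝ} (hs : 0 ≤ s) {n : ℕ} (hn : (n : ℝ) < s) :
    PowerSeries.coeff n (expDefect k l ρ s) = 0 := by
  rw [expDefect, map_sub, coeff_polynomial_mul_sampleSeries_of_lt _ _ hs hn,
    coeff_sampleSeries, if_neg (not_le.2 hn), sub_self]

lemma abs_monomialFun_le {i : ℕ} {x K : ℝ} (hx : 0 ≤ x) (hxK : x ≤ K) : |monomialFun i x| ≤ K ^ i := by
  have hK : 0 ≤ K := hx.trans hxK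
  unfold monomialFun
  rw [abs_of_nonneg (by positivity)]
  calc x ^ i / (i.factorial : ℝ) ≤ x ^ i / 1 := by
        gcongr
        exact_mod_cast i.factorial_pos
    _ ≤ K ^ i := by rw [div_one]; gcongr

lemma abs_expIntegral_le {ρ : ℝ} (hρ : 0 < ρ) {i : ℕ} {x K : ℝ} (hx : 0 ≤ x) (hxK : x ≤ K) :
    |expIntegral ρ i x| ≤ K ^ i := by
  rw [abs_of_nonneg (expIntegral_nonneg hρ i hx)]
  exact (expIntegral_le hρ i hx).trans ((le_abs_self _).trans (abs_monomialFun_le hx hxK))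

/-- The defect lives in a window of length km, so any exponential rate e can be claimed at the price
of the factor e^{|e|km}. -/
lemma exists_monomialDefect_le (k m l : ℕ) (hl : l < k) (e : ℝ) :
    ∃ C : ℝ, 0 < C ∧ ∀ s : ℝ, 0 ≤ s → ∀ n : ℕ, s ≤ n →
      |PowerSeries.coeff n (monomialDefect k m l s)| ≤ C * Real.exp (-(e * (n - s))) := by
  set K : ℝ := ((k * m : ℕ) : ℝ) with hK
  have hK0 : 0 ≤ K := Nat.cast_nonneg _
  set S := ∑ j ∈ Finset.range ((bdfPoly k ^ m).natDegree + 1), |(bdfPoly k ^ m).coeff j| with hS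
  have hS0 : 0 ≤ S := Finset.sum_nonneg fun j _ => abs_nonneg _
  refine ⟨(S * K ^ (l + m) + K ^ l + 1) * Real.exp (|e| * K), by positivity, fun s hs n hn => ?_⟩
  rcases le_or_gt K (n - s) with h | h
  · rw [coeff_monomialDefect_of_le hl hs h, abs_zero]; positivity
  · have h1 : |PowerSeries.coeff n (monomialDefect k m l s)| ≤ S * K ^ (l + m) + K ^ l + 1 := by
      rw [monomialDefect, map_sub]
      have h2 := abs_coeff_polynomial_mul_sampleSeries_le (bdfPoly k ^ m)
        (f := monomialFun (l + m)) hs n (B := K ^ (l + m)) (by positivity)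
        (fun x hx hxn => abs_monomialFun_le hx (by linarith))
      have h3 : |PowerSeries.coeff n (sampleSeries (monomialFun l) s)| ≤ K ^ l := by
        rw [coeff_sampleSeries, if_pos hn]
        exact abs_monomialFun_le (by linarith) h.le
      have := abs_sub _ _ |>.trans (add_le_add h2 h3)
      linarith
    refine h1.trans ?_
    rw [mul_assoc, ← Real.exp_add]
    refine le_mul_of_one_le_right (by positivity) (Real.one_le_exp ?_)
    have h4 : e * (n - s) ≤ |e| * (n - s) :=
      mul_le_mul_of_nonneg_right (le_abs_self e) (by linarith)
    have h5 : |e| * (n - s) ≤ |e| * K := by gcongr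
    linarith

/-- Within k steps of s the defect is merely bounded, which is the fast term. Beyond the window it
is ρ^{-l-1} e^{-ρ(n-s)} (δ_k(e^ρ) + ρ) up to sign: for ρ ≤ 1 consistency leaves ρ^{k-l}, and for ρ ≥
1 the growth e^{kρ} is dominated because n - s ≥ k. -/
lemma exists_expDefect_le (k l : ℕ) (hk : 1 ≤ k) (hl : l ≤ k) :
    ∃ C : ℝ, 0 < C ∧ ∀ s : ℝ, 0 ≤ s → ∀ n : ℕ, s ≤ n →
      (∀ ρ : ℝ, 1 ≤ ρ → |PowerSeries.coeff n (expDefect k l ρ s)| ≤ C * Real.exp (-(n - s))) ∧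
      (∀ ρ : ℝ, 0 < ρ → ρ ≤ 1 → |PowerSeries.coeff n (expDefect k l ρ s)| ≤
        C * (Real.exp (-(n - s)) + ρ ^ (k - l) * Real.exp (-(ρ * (n - s))))) := by
  have hk0 : (0 : ℝ) ≤ k := Nat.cast_nonneg _
  set S := ∑ j ∈ Finset.range ((bdfPoly k).natDegree + 1), |(bdfPoly k).coeff j| with hS
  have hS0 : 0 ≤ S := Finset.sum_nonneg fun j _ => abs_nonneg _
  obtain ⟨C0, hC0, hC0b⟩ := exists_abs_bdfSymbol_exp_add_le k hk
  set B := S * (k : ℝ) ^ (l + 1) + (k : ℝ) ^ l with hB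
  have hB0 : 0 ≤ B := by positivity
  refine ⟨(B + C0 + 2 ^ k) * Real.exp k, by positivity, fun s hs n hn => ?_⟩
  have hwin : (n : ℝ) - s < k → ∀ ρ : ℝ, 0 < ρ → |PowerSeries.coeff n (expDefect k l ρ s)| ≤
      B * Real.exp k * Real.exp (-(n - s)) := by
    intro h ρ hρ
    have h1 : |PowerSeries.coeff n (expDefect k l ρ s)| ≤ B := by
      rw [expDefect, map_sub]
      have h2 := abs_coeff_polynomial_mul_sampleSeries_le (bdfPoly k)
        (f := expIntegral ρ (l + 1)) hs n (B := (k : ℝ) ^ (l + 1)) (by positivity)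
        (fun x hx hxn => abs_expIntegral_le hρ hx (by linarith))
      have h3 : |PowerSeries.coeff n (sampleSeries (expIntegral ρ l) s)| ≤ (k : ℝ) ^ l := by
        rw [coeff_sampleSeries, if_pos hn]
        exact abs_expIntegral_le hρ (by linarith) h.le
      exact abs_sub _ _ |>.trans (add_le_add h2 h3)
    refine h1.trans ?_
    rw [mul_assoc, ← Real.exp_add]
    exact le_mul_of_one_le_right hB0 (Real.one_le_exp (by linarith))
  have htail : (k : ℝ) ≤ n - s → ∀ ρ : ℝ, 0 < ρ → |PowerSeries.coeff n (expDefect k l ρ s)| =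
      (1 / ρ) ^ (l + 1) * (Real.exp (-(ρ * (n - s))) * |bdfSymbol k (Real.exp ρ) + ρ|) := by
    intro h ρ hρ
    rw [coeff_expDefect_of_le hl hρ.ne' hs h, abs_mul, abs_mul, abs_pow, abs_div, abs_neg, abs_one,
      abs_of_pos hρ, abs_of_pos (Real.exp_pos _)]
  have hexpk : (1 : ℝ) ≤ Real.exp k := Real.one_le_exp hk0
  constructor
  · intro ρ hρ
    rcases lt_or_ge ((n : ℝ) - s) k with h | h
    · refine (hwin h ρ (by linarith)).trans ?_
      gcongr
      have : (0 : ℝ) < 2 ^ k := by positivity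
      linarith
    · rw [htail h ρ (by linarith)]
      have h1 : (1 / ρ) ^ (l + 1) ≤ 1 :=
        pow_le_one₀ (by positivity) ((div_le_one (by linarith)).2 hρ)
      have h2 := hC0b ρ (by linarith)
      calc _ ≤ 1 * (Real.exp (-(ρ * (n - s))) * (C0 * Real.exp (k * ρ))) := by gcongr
        _ = C0 * Real.exp (k * ρ + -(ρ * (n - s))) := by rw [Real.exp_add]; ring
        _ ≤ C0 * Real.exp (k + -(n - s)) := by
          gcongr C0 * Real.exp ?_
          nlinarith
        _ = C0 * Real.exp k * Real.exp (-(n - s)) := by rw [Real.exp_add]; ring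
        _ ≤ _ := by
          gcongr
          have : (0 : ℝ) < 2 ^ k := by positivity
          linarith
  · intro ρ hρ hρ1
    have hnn : 0 ≤ ρ ^ (k - l) * Real.exp (-(ρ * (n - s))) := by positivity
    rcases lt_or_ge ((n : ℝ) - s) k with h | h
    · refine (hwin h ρ hρ).trans ?_
      have : (0 : ℝ) < 2 ^ k := by positivity
      have h2 : B ≤ B + C0 + 2 ^ k := by linarith
      have h3 := Real.exp_pos (-((n : ℝ) - s))
      calc _ ≤ (B + C0 + 2 ^ k) * Real.exp k * Real.exp (-(n - s)) := by gcongr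
        _ ≤ _ := by gcongr; linarith
    · rw [htail h ρ hρ]
      have h2 := abs_bdfSymbol_exp_add_le k hρ.le hρ1
      have h4 : (1 / ρ) ^ (l + 1) * ρ ^ (k + 1) = ρ ^ (k - l) := by
        have : k + 1 = (k - l) + (l + 1) := by omega
        rw [this, pow_add ρ (k - l), mul_left_comm, ← mul_pow, one_div_mul_cancel hρ.ne', one_pow, mul_one]
      calc _ ≤ (1 / ρ) ^ (l + 1) * (Real.exp (-(ρ * (n - s))) * (2 ^ k * ρ ^ (k + 1))) := by gcongr
        _ = 2 ^ k * (((1 / ρ) ^ (l + 1) * ρ ^ (k + 1)) * Real.exp (-(ρ * (n - s)))) := by ring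
        _ = 2 ^ k * (ρ ^ (k - l) * Real.exp (-(ρ * (n - s)))) := by rw [h4]
        _ ≤ ((B + C0 + 2 ^ k) * Real.exp k) *
            (ρ ^ (k - l) * Real.exp (-(ρ * (n - s)))) := by
          gcongr
          have : (0 : ℝ) < 2 ^ k := by positivity
          nlinarith
        _ ≤ _ := by
          gcongr
          linarith [Real.exp_pos (-((n : ℝ) - s))]

/-! ### Errors of the BDF method for `y' + ρ y = t^l / l!` -/

/-- Error at the grid points of the BDF method applied to `y' + ρ y = (t - s)_+^l / l!`, where the
source is replaced by `δ_k^m` applied to its `m`-fold integral. -/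
def odeError (k m l : ℕ) (ρ s : ℝ) : PowerSeries ℝ :=
  ((bdfPoly k ^ m : Polynomial ℝ) : PowerSeries ℝ) * sampleSeries (monomialFun (l + m)) s *
    bdfResolvent k ρ - sampleSeries (expIntegral ρ (l + 1)) s

lemma C_mul_sampleSeries_expIntegral {ρ : ℝ} (hρ : ρ ≠ 0) (l : ℕ) (s : ℝ) :
    PowerSeries.C ρ * sampleSeries (expIntegral ρ (l + 1)) s =
      sampleSeries (monomialFun l) s - sampleSeries (expIntegral ρ l) s := by
  ext n
  rw [PowerSeries.coeff_C_mul, map_sub, coeff_sampleSeries, coeff_sampleSeries, coeff_sampleSeries]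
  split_ifs
  · rw [mul_expIntegral_succ hρ]; rfl
  · simp

/-- Multiply the error by δ_k + ρ: the discrete solution leaves δ_k^m of the data, the exact
solution leaves δ_k y + ρ y, and ρ y = source - y'. -/
lemma odeError_eq {k : ℕ} (hk : 1 ≤ k) (m l : ℕ) {ρ : ℝ} (hρ : 0 < ρ) (s : ℝ) :
    odeError k m l ρ s = (monomialDefect k m l s - expDefect k l ρ s) * bdfResolvent k ρ := by
  have h1 := bdfPoly_mul_bdfResolvent hk hρ.le
  have h2 := C_mul_sampleSeries_expIntegral hρ.ne' l s
  rw [Polynomial.coe_add, Polynomial.coe_C] at h1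
  rw [odeError, monomialDefect, expDefect]
  linear_combination (sampleSeries (expIntegral ρ (l + 1)) s) * h1 - bdfResolvent k ρ * h2

lemma ceil_bounds {s : ℝ} (hs : 0 ≤ s) {n : ℕ} (hn : s ≤ n) :
    ⌈s⌉₊ ≤ n ∧ s ≤ ⌈s⌉₊ ∧ (⌈s⌉₊ : ℝ) ≤ s + 1 :=
  ⟨Nat.ceil_le.2 hn, Nat.le_ceil s, (Nat.ceil_lt_add_one hs).le⟩

/-- Convolution of an exponentially decaying defect starting at `s` with an exponentially decaying
kernel. -/
lemma abs_coeff_mul_le_exp {A B a b s : ℝ} {f g : PowerSeries ℝ} (hs : 0 ≤ s)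
    (hf0 : ∀ n : ℕ, (n : ℝ) < s → PowerSeries.coeff n f = 0)
    (hf : ∀ n : ℕ, s ≤ n → |PowerSeries.coeff n f| ≤ A * Real.exp (-(a * (n - s))))
    (hg : GeomBound B (Real.exp (-b)) g) (hb : 0 ≤ b) (hab : b < a) (hA : 0 ≤ A) (hB : 0 ≤ B)
    {n : ℕ} (hn : s ≤ n) :
    |PowerSeries.coeff n (f * g)| ≤
      A * B / (1 - Real.exp (-(a - b))) * (Real.exp b * Real.exp (-(b * (n - s)))) := by
  obtain ⟨h1, h2, h3⟩ := ceil_bounds hs hn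
  have hr : Real.exp (-(a - b)) < 1 := Real.exp_lt_one_iff.2 (by linarith)
  have h := abs_coeff_mul_le_of_shift (A := A) (B := B) (p := Real.exp (-a)) (q := Real.exp (-b))
    (r := Real.exp (-(a - b))) (n0 := ⌈s⌉₊) (f := f) (g := g)
    (fun i hi => hf0 i (Nat.lt_ceil.1 hi)) (fun i => ?_) hg (Real.exp_pos _).le (Real.exp_pos _)
    (by rw [← Real.exp_add]; gcongr; linarith) hr hA hB h1
  · refine h.trans ?_
    have h4 : 0 < 1 - Real.exp (-(a - b)) := by linarith
    gcongr
    rw [← Real.exp_nat_mul, ← Real.exp_add, Nat.cast_sub h1]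
    gcongr
    nlinarith
  · refine (hf _ (by push_cast; linarith [(Nat.cast_nonneg i : (0 : ℝ) ≤ i)])).trans ?_
    rw [← Real.exp_nat_mul]
    push_cast
    gcongr
    nlinarith

lemma exp_neg_half_le {ρ : ℝ} (hρ : 0 ≤ ρ) (hρ1 : ρ ≤ 1) : Real.exp (-(ρ / 2)) ≤ 1 - ρ / 4 := by
  have h7 := Real.add_one_le_exp (ρ / 2)
  rw [Real.exp_neg, inv_le_comm₀ (Real.exp_pos _) (by linarith)]
  refine le_trans ?_ h7
  rw [inv_le_iff_one_le_mul₀ (by linarith)]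
  nlinarith

/-- The error for large `ρ`. -/
lemma exists_odeError_le_of_one_le {k : ℕ} (hk1 : 1 ≤ k) (hk : k ≤ 6) (m : ℕ) {l : ℕ} (hl : l < k) :
    ∃ c : ℝ, 0 < c ∧ ∃ C : ℝ, 0 < C ∧ ∀ ρ : ℝ, 1 ≤ ρ → ∀ s : ℝ, 0 ≤ s → ∀ n : ℕ, s ≤ n →
      |PowerSeries.coeff n (odeError k m l ρ s)| ≤ C / ρ * Real.exp (-(c * (n - s))) := by
  obtain ⟨e, he, he4, C0, hC0, -, hker, -⟩ := exists_kernel_bounds hk1 hk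
  obtain ⟨C1, hC1, hd1⟩ := exists_monomialDefect_le k m l hl 1
  obtain ⟨C2, hC2, hd2⟩ := exists_expDefect_le k l hk1 hl.le
  have hr : Real.exp (-(1 - e)) < 1 := Real.exp_lt_one_iff.2 (by linarith)
  have hr' : 0 < 1 - Real.exp (-(1 - e)) := by linarith
  refine ⟨e, he, (C1 + C2) * C0 / (1 - Real.exp (-(1 - e))) * Real.exp e, by positivity,
    fun ρ hρ s hs n hn => ?_⟩
  rw [odeError_eq hk1 m l (by linarith)]
  refine (abs_coeff_mul_le_exp (A := C1 + C2) (B := C0 / ρ) (a := 1) (b := e) hs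
    (fun i hi => ?_) (fun i hi => ?_) (hker ρ hρ) he.le (by linarith) (by positivity)
    (by positivity) hn).trans (le_of_eq ?_)
  · rw [map_sub, coeff_monomialDefect_of_lt hs hi, coeff_expDefect_of_lt hs hi, sub_zero]
  · rw [map_sub]
    have h1 := hd1 s hs i hi
    have h2 := (hd2 s hs i hi).1 ρ hρ
    rw [one_mul] at h1 ⊢
    refine (abs_sub _ _).trans ?_
    linarith
  · ring

/-- The error for small `ρ` and a source starting at an arbitrary point. -/
lemma exists_odeError_top_le_of_le_one {k : ℕ} (hk1 : 1 ≤ k) (hk : k ≤ 6) (m : ℕ) :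
    ∃ c : ℝ, 0 < c ∧ ∃ C : ℝ, 0 < C ∧ ∀ ρ : ℝ, 0 < ρ → ρ ≤ 1 → ∀ s : ℝ, 0 ≤ s → ∀ n : ℕ, s ≤ n →
      |PowerSeries.coeff n (odeError k m (k - 1) ρ s)| ≤ C * Real.exp (-(c * ρ * (n - s))) := by
  obtain ⟨e, he, he4, C0, hC0, hker, -⟩ := exists_kernel_bounds hk1 hk
  obtain ⟨C1, hC1, hd1⟩ := exists_monomialDefect_le k m (k - 1) (by omega) 1
  obtain ⟨C2, hC2, hd2⟩ := exists_expDefect_le k (k - 1) hk1 (by omega)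
  have hkk : k - (k - 1) = 1 := by omega
  rw [hkk] at hd2
  set r := 1 - Real.exp (-(1 / 2)) with hr
  have hr0 : 0 < r := by
    have : Real.exp (-(1 / 2)) < 1 := Real.exp_lt_one_iff.2 (by norm_num)
    linarith
  refine ⟨e / 2, by positivity, ((C1 + C2) * C0 / r + C2 * C0 * 4) * Real.exp 1, by positivity,
    fun ρ hρ hρ1 s hs n hn => ?_⟩
  rw [odeError_eq hk1 m _ hρ]
  -- split the defect into a rapidly and a slowly decaying part
  set f := monomialDefect k m (k - 1) s - expDefect k (k - 1) ρ s with hf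
  have hf0 : ∀ i : ℕ, (i : ℝ) < s → PowerSeries.coeff i f = 0 := fun i hi => by
    rw [hf, map_sub, coeff_monomialDefect_of_lt hs hi, coeff_expDefect_of_lt hs hi, sub_zero]
  have hfb : ∀ i : ℕ, s ≤ i → |PowerSeries.coeff i f| ≤
      (C1 + C2) * Real.exp (-(i - s)) + C2 * ρ * Real.exp (-(ρ * (i - s))) := by
    intro i hi
    rw [hf, map_sub]
    have h1 := hd1 s hs i hi
    have h2 := (hd2 s hs i hi).2 ρ hρ hρ1
    rw [one_mul] at h1
    rw [pow_one] at h2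
    refine (abs_sub _ _).trans ?_
    linarith
  -- Cutting f off at the fast envelope (C1 + C2) e^{-(i-s)} leaves a remainder below the slow
  -- envelope alone.
  set f1 : PowerSeries ℝ := PowerSeries.mk fun i => if s ≤ i then
    max (-((C1 + C2) * Real.exp (-(i - s)))) (min (PowerSeries.coeff i f)
      ((C1 + C2) * Real.exp (-(i - s)))) else 0 with hf1
  have hf1b : ∀ i : ℕ, s ≤ i → |PowerSeries.coeff i f1| ≤ (C1 + C2) * Real.exp (-(1 * (i - s))) := by
    intro i hi
    rw [hf1, PowerSeries.coeff_mk, if_pos hi, one_mul]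
    have : 0 < (C1 + C2) * Real.exp (-(i - s)) := by positivity
    exact abs_le.2 ⟨le_max_left _ _, max_le (by linarith) (min_le_right _ _)⟩
  have hf10 : ∀ i : ℕ, (i : ℝ) < s → PowerSeries.coeff i f1 = 0 := fun i hi => by
    rw [hf1, PowerSeries.coeff_mk, if_neg (not_le.2 hi)]
  have hf2b : ∀ i : ℕ, s ≤ i → |PowerSeries.coeff i (f - f1)| ≤
      C2 * ρ * Real.exp (-(ρ * (i - s))) := by
    intro i hi
    rw [map_sub, hf1, PowerSeries.coeff_mk, if_pos hi]
    have h1 := hfb i hi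
    have h2 : 0 < (C1 + C2) * Real.exp (-(i - s)) := by positivity
    have h3 : 0 < C2 * ρ * Real.exp (-(ρ * (i - s))) := by positivity
    rw [abs_le] at h1 ⊢
    rcases le_total (PowerSeries.coeff i f) ((C1 + C2) * Real.exp (-(i - s))) with h | h
    · rw [min_eq_left h]
      rcases le_total (-((C1 + C2) * Real.exp (-(i - s)))) (PowerSeries.coeff i f) with h' | h'
      · rw [max_eq_right h']; constructor <;> linarith
      · rw [max_eq_left h']; constructor <;> linarith
    · rw [min_eq_right h, max_eq_right (by linarith)]; constructor <;> linarith
  have hf20 : ∀ i : ℕ, (i : ℝ) < s → PowerSeries.coeff i (f - f1) = 0 := fun i hi => by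
    rw [map_sub, hf0 i hi, hf10 i hi, sub_zero]
  have hb0 : 0 ≤ e / 2 * ρ := by positivity
  have hb1 : e / 2 * ρ ≤ 1 / 2 := by nlinarith
  have hb2 : e / 2 * ρ ≤ 1 / 2 * ρ := by nlinarith
  have hg : GeomBound C0 (Real.exp (-(e / 2 * ρ))) (bdfResolvent k ρ) := hker ρ hρ hρ1
  have h1 := abs_coeff_mul_le_exp hs hf10 hf1b hg hb0 (by linarith) (by positivity) hC0.le hn
  have h2 := abs_coeff_mul_le_exp hs hf20 hf2b hg hb0 (by nlinarith) (by positivity) hC0.le hn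
  have h3 : PowerSeries.coeff n (f * bdfResolvent k ρ) =
      PowerSeries.coeff n (f1 * bdfResolvent k ρ) +
        PowerSeries.coeff n ((f - f1) * bdfResolvent k ρ) := by
    rw [← map_add]; congr 1; ring
  rw [h3]
  set E := Real.exp (-(e / 2 * ρ * (n - s))) with hE
  have hE0 : 0 < E := Real.exp_pos _
  have hexp : Real.exp (e / 2 * ρ) ≤ Real.exp 1 := Real.exp_le_exp.2 (by linarith)
  have hden1 : r ≤ 1 - Real.exp (-(1 - e / 2 * ρ)) := by
    rw [hr]
    have : Real.exp (-(1 - e / 2 * ρ)) ≤ Real.exp (-(1 / 2)) := Real.exp_le_exp.2 (by linarith)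
    linarith
  -- Convolving the slow part with the kernel costs a factor 4/ρ. For l = k - 1 the slow envelope
  -- carries ρ^{k-l} = ρ, which cancels it.
  have hden2 : ρ / 4 ≤ 1 - Real.exp (-(ρ - e / 2 * ρ)) := by
    have h5 : Real.exp (-(ρ - e / 2 * ρ)) ≤ Real.exp (-(ρ / 2)) :=
      Real.exp_le_exp.2 (by linarith)
    have h6 := exp_neg_half_le hρ.le hρ1
    linarith
  refine (abs_add_le _ _).trans ((add_le_add h1 h2).trans ?_)
  have t1 : (C1 + C2) * C0 / (1 - Real.exp (-(1 - e / 2 * ρ))) * (Real.exp (e / 2 * ρ) * E) ≤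
      (C1 + C2) * C0 / r * (Real.exp 1 * E) := by gcongr
  have t2 : C2 * ρ * C0 / (1 - Real.exp (-(ρ - e / 2 * ρ))) * (Real.exp (e / 2 * ρ) * E) ≤
      C2 * C0 * 4 * (Real.exp 1 * E) := by
    have : C2 * ρ * C0 / (1 - Real.exp (-(ρ - e / 2 * ρ))) ≤ C2 * C0 * 4 := by
      calc _ ≤ C2 * ρ * C0 / (ρ / 4) := by gcongr
        _ = C2 * C0 * 4 := by field_simp
    gcongr
  linarith

/-- Substituting J^{l+1} e^{-ρ·} = t^{l+1}/(l+1)! - ρ J^{l+2} e^{-ρ·} trades one power of ρ for one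
more integration. The leftover is a polynomial defect with finite support past s. -/
lemma expDefect_eq_sub {k l : ℕ} {ρ : ℝ} (hρ : ρ ≠ 0) (s : ℝ) :
    expDefect k l ρ s = monomialDefect k 1 l s - PowerSeries.C ρ * expDefect k (l + 1) ρ s := by
  have h1 := C_mul_sampleSeries_expIntegral hρ l s
  have h2 := C_mul_sampleSeries_expIntegral hρ (l + 1) s
  rw [expDefect, expDefect, monomialDefect, pow_one]
  linear_combination (bdfPoly k : PowerSeries ℝ) * h2 - h1

/-- `∑_{a < P} δ^a (-ρ)^{P - 1 - a}`, the quotient of `δ^P - (-ρ)^P` by `δ + ρ`. -/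
def bdfQuotient (k P : ℕ) (ρ : ℝ) : PowerSeries ℝ :=
  ∑ a ∈ Finset.range P, (bdfPoly k : PowerSeries ℝ) ^ a * (-PowerSeries.C ρ) ^ (P - 1 - a)

/-- Division of δ^P by δ + ρ with remainder (-ρ)^P. Powers of δ_k in the data become powers of ρ in
front of the resolvent, up to a quotient without resolvent. -/
lemma bdfPoly_pow_mul_bdfResolvent {k : ℕ} (hk : 1 ≤ k) (P : ℕ) {ρ : ℝ} (hρ : 0 ≤ ρ) :
    (bdfPoly k : PowerSeries ℝ) ^ P * bdfResolvent k ρ =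
      bdfQuotient k P ρ + (-PowerSeries.C ρ) ^ P * bdfResolvent k ρ := by
  have h1 := bdfPoly_mul_bdfResolvent hk hρ
  rw [Polynomial.coe_add, Polynomial.coe_C] at h1
  have h2 := (Commute.all (bdfPoly k : PowerSeries ℝ) (-PowerSeries.C ρ)).geom_sum₂_mul P
  rw [bdfQuotient]
  linear_combination (-bdfResolvent k ρ) * h2 +
    (∑ a ∈ Finset.range P, (bdfPoly k : PowerSeries ℝ) ^ a * (-PowerSeries.C ρ) ^ (P - 1 - a)) * h1

lemma GeomBound.sum {ι : Type*} (s : Finset ι) {A : ι → ℝ} {q : ℝ} {f : ι → PowerSeries ℝ}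
    (h : ∀ i ∈ s, GeomBound (A i) q (f i)) : GeomBound (∑ i ∈ s, A i) q (∑ i ∈ s, f i) := fun n => by
  rw [map_sum, Finset.sum_mul]
  exact (Finset.abs_sum_le_sum_abs _ _).trans (Finset.sum_le_sum fun i hi => h i hi n)

lemma exists_geomBound_bdfQuotient_mul (k P : ℕ) {H : PowerSeries ℝ} {B p q : ℝ}
    (hH : GeomBound B p H) (hB : 0 ≤ B) (hp : 0 < p) (hpq : p < q) :
    ∃ A : ℝ, 0 < A ∧ ∀ ρ : ℝ, 0 ≤ ρ → ρ ≤ 1 → GeomBound A q (bdfQuotient k P ρ * H) := by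
  have hq := hp.trans hpq
  have h1 : ∀ a : ℕ, ∃ A : ℝ, 0 < A ∧ GeomBound A q ((bdfPoly k : PowerSeries ℝ) ^ a * H) := by
    intro a
    obtain ⟨A, hA, hAb⟩ := exists_geomBound_polynomial (bdfPoly k ^ a) hp
    have hHq : GeomBound B q H := hH.mono hp.le hpq.le hB le_rfl
    have hr : p / q < 1 := (div_lt_one hq).2 hpq
    have h := hAb.mul hHq hp.le hq (r := p / q) (by rw [div_mul_cancel₀ _ hq.ne']) hr hA.le hB
    rw [Polynomial.coe_pow] at h
    have h0 : 0 ≤ A * B / (1 - p / q) := div_nonneg (by positivity) (by linarith)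
    exact ⟨A * B / (1 - p / q) + 1, by linarith, h.mono hq.le le_rfl h0 (by linarith)⟩
  choose A hA hAb using h1
  have hS : 0 ≤ ∑ a ∈ Finset.range P, A a := Finset.sum_nonneg fun a _ => (hA a).le
  refine ⟨∑ a ∈ Finset.range P, A a + 1, by linarith, fun ρ hρ hρ1 => ?_⟩
  have h2 : GeomBound (∑ a ∈ Finset.range P, A a) q (bdfQuotient k P ρ * H) := by
    rw [bdfQuotient, Finset.sum_mul]
    refine GeomBound.sum _ fun a _ n => ?_
    have e : (bdfPoly k : PowerSeries ℝ) ^ a * (-PowerSeries.C ρ) ^ (P - 1 - a) * H =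
        PowerSeries.C ((-ρ) ^ (P - 1 - a)) * ((bdfPoly k : PowerSeries ℝ) ^ a * H) := by
      rw [map_pow, map_neg]; ring
    rw [e, PowerSeries.coeff_C_mul, abs_mul]
    have h3 : |(-ρ) ^ (P - 1 - a)| ≤ 1 := by
      rw [abs_pow, abs_neg, abs_of_nonneg hρ]
      exact pow_le_one₀ hρ hρ1
    calc _ ≤ 1 * (A a * q ^ n) := mul_le_mul h3 (hAb a n) (abs_nonneg _) zero_le_one
      _ = _ := one_mul _
  exact h2.mono hq.le le_rfl hS (by linarith)

/-- Each use of `expDefect_eq_sub` produces (-ρ)^P times the resolvent times a finitely supported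
defect. Writing (-ρ)^P · resolvent as δ^P · resolvent minus the quotient, the first part raises the
source from δ^P on t^{l+P} to δ^{P+1} on t^{l+P+1}, and the second goes into R. At P = k - l the
source has become the reference discretization of `exists_quadrature_difference_eq`. -/
lemma exists_telescoped_expDefect {k : ℕ} (hk : 1 ≤ k) (l P : ℕ) (hP : l + P ≤ k) {q : ℝ}
    (hq : 0 < q) : ∃ A : ℝ, 0 < A ∧ ∀ ρ : ℝ, 0 < ρ → ρ ≤ 1 → ∃ R : PowerSeries ℝ,
      GeomBound A q R ∧ bdfResolvent k ρ * (monomialSeries l + expDefect k l ρ 0) =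
        bdfResolvent k ρ * ((bdfPoly k : PowerSeries ℝ) ^ P * monomialSeries (l + P)) + R +
          (-PowerSeries.C ρ) ^ P * (bdfResolvent k ρ * expDefect k (l + P) ρ 0) := by
  induction P with
  | zero =>
    refine ⟨1, one_pos, fun ρ hρ hρ1 => ⟨0, fun n => ?_, ?_⟩⟩
    · rw [map_zero, abs_zero]; positivity
    · simp; ring
  | succ P ih =>
    obtain ⟨A, hA, hAb⟩ := ih (by omega)
    have hfin : ∀ n, k ≤ n → PowerSeries.coeff n (monomialDefect k 1 (l + P) 0) = 0 := by
      intro n hn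
      refine coeff_monomialDefect_of_le (by omega) le_rfl ?_
      rw [mul_one, sub_zero]; exact_mod_cast hn
    obtain ⟨B, hB, hBb⟩ := exists_geomBound_of_finite hfin (q := q / 2) (by positivity)
    obtain ⟨A', hA', hAb'⟩ := exists_geomBound_bdfQuotient_mul k P hBb hB.le
      (by positivity) (show q / 2 < q by linarith)
    refine ⟨A + A', by positivity, fun ρ hρ hρ1 => ?_⟩
    obtain ⟨R, hR, hReq⟩ := hAb ρ hρ hρ1
    refine ⟨R - bdfQuotient k P ρ * monomialDefect k 1 (l + P) 0, fun n => ?_, ?_⟩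
    · rw [map_sub, add_mul]
      exact (abs_sub _ _).trans (add_le_add (hR n) (hAb' ρ hρ.le hρ1 n))
    · rw [hReq, expDefect_eq_sub (l := l + P) hρ.ne']
      have h1 := bdfPoly_pow_mul_bdfResolvent hk P hρ.le
      have h2 : monomialDefect k 1 (l + P) 0 = (bdfPoly k : PowerSeries ℝ) *
          monomialSeries (l + (P + 1)) - monomialSeries (l + P) := by
        rw [monomialDefect, sampleSeries_monomialFun_zero, sampleSeries_monomialFun_zero, pow_one]
        rfl
      have e : l + P + 1 = l + (P + 1) := by ring
      rw [e, h2]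
      linear_combination (-((bdfPoly k : PowerSeries ℝ) *
          monomialSeries (l + (P + 1)) - monomialSeries (l + P))) * h1

/-- The error for small `ρ` and a source starting at `0`. -/
lemma exists_odeError_zero_le_of_le_one {k : ℕ} (hk1 : 1 ≤ k) (hk : k ≤ 6) {m l : ℕ} (hm : 1 ≤ m)
    (hl : l < k) : ∃ c : ℝ, 0 < c ∧ ∃ C : ℝ, 0 < C ∧ ∀ ρ : ℝ, 0 < ρ → ρ ≤ 1 → ∀ n : ℕ,
      |PowerSeries.coeff n (odeError k m l ρ 0)| ≤ C * (Real.exp (-(c * n)) +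
        (ρ ^ (if Odd (l + m) then m else m + 1) + ρ ^ (k - l - 1)) * Real.exp (-(c * ρ * n))) := by
  obtain ⟨e, he, he4, C0, hC0, hker, -, f, hf, hfb⟩ := exists_kernel_bounds hk1 hk
  set m' := if Odd (l + m) then m else m + 1 with hm'
  -- The number of powers of 1 - ξ gained. Capping it at k - l - 1 is harmless, because ρ^{k-l-1} is
  -- part of the bound anyway.
  set o := min m' (k - l - 1) with ho
  obtain ⟨U, hU⟩ := exists_quadrature_difference_eq (k := k) (m := m) (l := l) (o := o) hl hm
    (by have := min_le_right m' (k - l - 1); omega) (min_le_left _ _)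
  obtain ⟨A1, hA1, hR⟩ := exists_telescoped_expDefect hk1 l (k - l) (by omega)
    (q := Real.exp (-(e / 2))) (Real.exp_pos _)
  have hlk : l + (k - l) = k := by omega
  rw [hlk] at hR
  obtain ⟨A2, hA2, hfo⟩ := exists_geomBound_pow (q := Real.exp (-(3 * e / 4))) hfb hC0.le
    (Real.exp_pos _) o (Real.exp_lt_exp.2 (by linarith))
  obtain ⟨A3, hA3, hUb⟩ := exists_geomBound_polynomial U (q := Real.exp (-e)) (Real.exp_pos _)
  set r := Real.exp (-(e / 4)) with hr
  have hr1 : r < 1 := Real.exp_lt_one_iff.2 (by linarith)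
  have hr1' : 0 < 1 - r := by linarith
  have hH := hUb.mul hfo (Real.exp_pos _).le (Real.exp_pos _) (r := r)
    (by rw [hr, ← Real.exp_add]; gcongr; linarith) hr1 hA3.le hA2.le
  set H := (U : PowerSeries ℝ) * f ^ o with hHdef
  set A4 := A3 * A2 / (1 - r) with hA4
  have hA40 : 0 ≤ A4 := by positivity
  obtain ⟨A5, hA5, hqH⟩ := exists_geomBound_bdfQuotient_mul k o hH hA40 (Real.exp_pos _)
    (q := Real.exp (-(e / 2))) (Real.exp_lt_exp.2 (by linarith))
  obtain ⟨C2, hC2, hd2⟩ := exists_expDefect_le k k hk1 le_rfl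
  set A6 := A4 * C0 / (1 - r) with hA6
  have hA60 : 0 ≤ A6 := by positivity
  refine ⟨e / 2, by positivity, A1 + A5 + A6 + 2 * C2 * C0 * 4, by positivity,
    fun ρ hρ hρ1 n => ?_⟩
  obtain ⟨R, hRb, hReq⟩ := hR ρ hρ hρ1
  have hg : GeomBound C0 (Real.exp (-(e / 2 * ρ))) (bdfResolvent k ρ) := hker ρ hρ hρ1
  -- decomposition of the error
  have hmain : odeError k m l ρ 0 = bdfQuotient k o ρ * H +
      (-PowerSeries.C ρ) ^ o * (H * bdfResolvent k ρ) - R -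
        (-PowerSeries.C ρ) ^ (k - l) * (expDefect k k ρ 0 * bdfResolvent k ρ) := by
    rw [odeError_eq hk1 m l hρ, monomialDefect, sampleSeries_monomialFun_zero,
      sampleSeries_monomialFun_zero]
    have h1 := bdfPoly_pow_mul_bdfResolvent hk1 o hρ.le
    -- The inverse cofactor turns powers of 1 - ξ into powers of δ_k, which division by δ_k + ρ
    -- converts into ρ^o.
    have h2 : (1 - PowerSeries.X : PowerSeries ℝ) ^ o = (bdfPoly k : PowerSeries ℝ) ^ o * f ^ o := by
      have h3 : ((bdfPoly k : Polynomial ℝ) : PowerSeries ℝ) =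
        (1 - PowerSeries.X) * (bdfCofactor k : PowerSeries ℝ) := by rw [bdfPoly_eq_mul]; simp
      rw [h3, ← mul_pow, mul_assoc, hf, mul_one]
    rw [h2, Polynomial.coe_pow, Polynomial.coe_pow] at hU
    rw [Polynomial.coe_pow, hHdef]
    linear_combination bdfResolvent k ρ * hU - hReq + f ^ o * (U : PowerSeries ℝ) * h1
  have hE : Real.exp (-(e / 2)) ^ n = Real.exp (-(e / 2 * n)) := by
    rw [← Real.exp_nat_mul]; congr 1; ring
  have hEρ : Real.exp (-(e / 2 * ρ)) ^ n = Real.exp (-(e / 2 * ρ * n)) := by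
    rw [← Real.exp_nat_mul]; congr 1; ring
  have b1 := hqH ρ hρ.le hρ1 n
  have b2 := (hH.mul hg (Real.exp_pos _).le (Real.exp_pos _) (r := r)
    (by rw [hr, ← Real.exp_add]; gcongr; nlinarith) hr1 hA40 hC0.le) n
  have b3 := hRb n
  -- At index k this defect is no longer small. The prefactor ρ^{k-l} pays the 1/ρ lost in the
  -- convolution with the kernel, and ρ^{k-l-1} remains.
  have hT : GeomBound (2 * C2) (Real.exp (-ρ)) (expDefect k k ρ 0) := by
    intro i
    have := (hd2 0 le_rfl i (Nat.cast_nonneg i)).2 ρ hρ hρ1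
    rw [Nat.sub_self, pow_zero, one_mul, sub_zero] at this
    refine this.trans ?_
    have h5 : Real.exp (-(i : ℝ)) ≤ Real.exp (-(ρ * i)) :=
      Real.exp_le_exp.2 (by nlinarith [(Nat.cast_nonneg i : (0 : ℝ) ≤ i)])
    have h6 : Real.exp (-ρ) ^ i = Real.exp (-(ρ * i)) := by
      rw [← Real.exp_nat_mul]; congr 1; ring
    rw [h6]
    nlinarith
  have hr2 := exp_neg_half_le hρ.le hρ1
  have b4 := (hT.mul hg (Real.exp_pos _).le (Real.exp_pos _) (r := Real.exp (-(ρ / 2)))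
    (by rw [← Real.exp_add]; gcongr; nlinarith) (by linarith) (by positivity) hC0.le) n
  rw [hE] at b1 b3
  rw [hEρ] at b2 b4
  set E := Real.exp (-(e / 2 * n)) with hEdef
  set Eρ := Real.exp (-(e / 2 * ρ * n)) with hEρdef
  have hE0 : 0 < E := Real.exp_pos _
  have hEρ0 : 0 < Eρ := Real.exp_pos _
  have hsign : ∀ (j : ℕ) (g : PowerSeries ℝ), |PowerSeries.coeff n ((-PowerSeries.C ρ) ^ j * g)| =
      ρ ^ j * |PowerSeries.coeff n g| := by
    intro j g
    rw [← map_neg, ← map_pow, PowerSeries.coeff_C_mul, abs_mul, abs_pow, abs_neg, abs_of_pos hρ]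
  have b4' : ρ ^ (k - l) * |PowerSeries.coeff n (expDefect k k ρ 0 * bdfResolvent k ρ)| ≤
      2 * C2 * C0 * 4 * (ρ ^ (k - l - 1) * Eρ) := by
    have h7 : k - l = (k - l - 1) + 1 := by omega
    calc _ ≤ ρ ^ (k - l) * (2 * C2 * C0 / (1 - Real.exp (-(ρ / 2))) * Eρ) := by gcongr
      _ ≤ ρ ^ (k - l) * (2 * C2 * C0 / (ρ / 4) * Eρ) := by
        gcongr
        linarith
      _ = _ := by
        rw [h7, pow_succ]
        simp only [Nat.add_sub_cancel]
        field_simp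
  have hρo : ρ ^ o ≤ ρ ^ m' + ρ ^ (k - l - 1) := by
    rcases min_choice m' (k - l - 1) with h | h
    · rw [ho, h]; linarith [pow_pos hρ (k - l - 1)]
    · rw [ho, h]; linarith [pow_pos hρ m']
  have b2' : ρ ^ o * |PowerSeries.coeff n (H * bdfResolvent k ρ)| ≤
      A6 * ((ρ ^ m' + ρ ^ (k - l - 1)) * Eρ) := by
    calc _ ≤ (ρ ^ m' + ρ ^ (k - l - 1)) * (A6 * Eρ) := by gcongr
      _ = _ := by ring
  rw [hmain, map_sub, map_sub, map_add]
  refine (abs_sub _ _).trans ((add_le_add_left ((abs_sub _ _).trans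
    (add_le_add_left (abs_add_le _ _) _)) _).trans ?_)
  rw [hsign, hsign]
  have h8 : ρ ^ (k - l - 1) * Eρ ≤ (ρ ^ m' + ρ ^ (k - l - 1)) * Eρ := by
    gcongr
    linarith [pow_pos hρ m']
  have hS0 : 0 ≤ (ρ ^ m' + ρ ^ (k - l - 1)) * Eρ := by positivity
  have h9 : 2 * C2 * C0 * 4 * (ρ ^ (k - l - 1) * Eρ) ≤
      2 * C2 * C0 * 4 * ((ρ ^ m' + ρ ^ (k - l - 1)) * Eρ) := by gcongr
  have h10 : 0 ≤ (A6 + 2 * C2 * C0 * 4) * E := by positivity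
  have h11 : 0 ≤ (A1 + A5) * ((ρ ^ m' + ρ ^ (k - l - 1)) * Eρ) := by positivity
  linarith

/-! ### The Stieltjes representation of `1 / (λ + s^α)` -/

lemma cos_le_cos_mul {α b : ℝ} (hα0 : 0 < α) (hα1 : α < 1) (hb : |b| ≤ Real.pi) :
    Real.cos (Real.pi * α) ≤ Real.cos (α * b) := by
  rw [← Real.cos_abs (α * b), abs_mul, abs_of_pos hα0]
  refine Real.cos_le_cos_of_nonneg_of_le_pi (by positivity) (by nlinarith [Real.pi_pos]) ?_
  rw [mul_comm Real.pi]
  gcongr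

/-- Lower bound of `λ + e^{α w}` in the strip `|Im w| ≤ π`. -/
lemma le_norm_add_cexp {α l : ℝ} (hα0 : 0 < α) (hα1 : α < 1) (hl : 0 ≤ l) {w : ℂ}
    (hw : |w.im| ≤ Real.pi) :
    Real.sin (Real.pi * α) * Real.exp (α * w.re) ≤ ‖(l : ℂ) + Complex.exp (α * w)‖ := by
  have hs : 0 ≤ Real.sin (Real.pi * α) := Real.sin_nonneg_of_nonneg_of_le_pi
    (by positivity) (by nlinarith [Real.pi_pos])
  refine abs_le_of_sq_le_sq' ?_ (norm_nonneg _) |>.2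
  have hre : ((l : ℂ) + Complex.exp (α * w)).re =
      l + Real.exp (α * w.re) * Real.cos (α * w.im) := by
    simp [Complex.exp_re]
  have him : ((l : ℂ) + Complex.exp (α * w)).im = Real.exp (α * w.re) * Real.sin (α * w.im) := by
    simp [Complex.exp_im]
  rw [Complex.sq_norm, Complex.normSq_apply, hre, him]
  set U := Real.exp (α * w.re) with hU
  have hU0 : 0 < U := Real.exp_pos _
  have hcos := cos_le_cos_mul hα0 hα1 hw
  have h1 := Real.sin_sq_add_cos_sq (α * w.im)
  have h2 := Real.sin_sq_add_cos_sq (Real.pi * α)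
  have h3 : l * U * Real.cos (Real.pi * α) ≤ l * U * Real.cos (α * w.im) := by gcongr
  have h4 : (l + U * Real.cos (α * w.im)) * (l + U * Real.cos (α * w.im)) +
      U * Real.sin (α * w.im) * (U * Real.sin (α * w.im)) =
      l ^ 2 + 2 * (l * U * Real.cos (α * w.im)) + U ^ 2 := by
    linear_combination U ^ 2 * h1
  rw [h4]
  have h5 : l ^ 2 + 2 * (l * U * Real.cos (Real.pi * α)) + U ^ 2 =
      (l + U * Real.cos (Real.pi * α)) ^ 2 + (Real.sin (Real.pi * α) * U) ^ 2 := by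
    linear_combination -U ^ 2 * h2
  nlinarith [sq_nonneg (l + U * Real.cos (Real.pi * α))]

/-- The density in the Stieltjes representation of `1 / (λ + s^α)`. -/
def stieltjesDensity (α l r : ℝ) : ℝ :=
  Real.sin (Real.pi * α) / Real.pi *
    (r ^ α / (l ^ 2 + 2 * l * r ^ α * Real.cos (Real.pi * α) + (r ^ α) ^ 2))

lemma sin_pi_mul_pos {α : ℝ} (hα0 : 0 < α) (hα1 : α < 1) : 0 < Real.sin (Real.pi * α) :=
  Real.sin_pos_of_pos_of_lt_pi (by positivity) (by nlinarith [Real.pi_pos])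

lemma stieltjes_den_ge {α l u : ℝ} :
    (Real.sin (Real.pi * α) * u) ^ 2 ≤
      l ^ 2 + 2 * l * u * Real.cos (Real.pi * α) + u ^ 2 := by
  have h2 := Real.sin_sq_add_cos_sq (Real.pi * α)
  have h5 : l ^ 2 + 2 * (l * u * Real.cos (Real.pi * α)) + u ^ 2 =
      (l + u * Real.cos (Real.pi * α)) ^ 2 + (Real.sin (Real.pi * α) * u) ^ 2 := by
    linear_combination -u ^ 2 * h2
  nlinarith [sq_nonneg (l + u * Real.cos (Real.pi * α))]

lemma stieltjesDensity_nonneg {α l r : ℝ} (hα0 : 0 < α) (hα1 : α < 1) (hr : 0 ≤ r) :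
    0 ≤ stieltjesDensity α l r := by
  have h := sin_pi_mul_pos hα0 hα1
  have h2 : 0 ≤ l ^ 2 + 2 * l * r ^ α * Real.cos (Real.pi * α) + (r ^ α) ^ 2 :=
    (sq_nonneg _).trans stieltjes_den_ge
  unfold stieltjesDensity
  positivity

lemma cexp_ne_of_abs_im_lt {s : ℝ} (hs : 0 < s) {w : ℂ} (hw : |w.im| < 2 * Real.pi)
    (h : Complex.exp w = s) : w = ((Real.log s : ℝ) : ℂ) := by
  have h1 : Complex.exp w = Complex.exp ((Real.log s : ℝ) : ℂ) := by
    rw [h, ← Complex.ofReal_exp, Real.exp_log hs]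
  obtain ⟨n, hn⟩ := Complex.exp_eq_exp_iff_exists_int.1 h1
  have him := congrArg Complex.im hn
  simp at him
  rw [him, abs_mul, abs_of_pos (by positivity : 0 < 2 * Real.pi)] at hw
  have h2 : |(n : ℝ)| < 1 := by
    by_contra hc
    push Not at hc
    nlinarith [Real.pi_pos]
  have h3 : n = 0 := by
    have : |n| < 1 := by exact_mod_cast h2
    exact Int.abs_lt_one_iff.1 this
  rw [hn, h3]; simp

/-- The Cauchy integrand for the keyhole contour, in logarithmic coordinates. -/
lemma exists_rect_function {α l s : ℝ} (hα0 : 0 < α) (hα1 : α < 1) (hl : 0 ≤ l) (hs : 0 < s) :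
    ∃ h : ℂ → ℂ, (∀ M : ℝ, DifferentiableOn ℂ h (uIcc (-M) M ×ℂ uIcc (-Real.pi) Real.pi)) ∧
      ∀ w : ℂ, |w.im| ≤ Real.pi → Complex.exp w ≠ s →
        h w = (1 / ((l : ℂ) + Complex.exp (α * w)) - 1 / ((l : ℂ) + ((s ^ α : ℝ) : ℂ))) *
          (Complex.exp w / (Complex.exp w - s)) := by
  set w0 : ℂ := ((Real.log s : ℝ) : ℂ) with hw0
  set f : ℂ → ℂ := fun w => 1 / ((l : ℂ) + Complex.exp (α * w)) with hf
  have hne : ∀ w : ℂ, |w.im| ≤ Real.pi → (l : ℂ) + Complex.exp (α * w) ≠ 0 := by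
    intro w hw h0
    have := le_norm_add_cexp hα0 hα1 hl hw
    rw [h0, norm_zero] at this
    have h2 : 0 < Real.sin (Real.pi * α) * Real.exp (α * w.re) :=
      mul_pos (sin_pi_mul_pos hα0 hα1) (Real.exp_pos _)
    linarith
  have hfd : ∀ w : ℂ, |w.im| ≤ Real.pi → DifferentiableAt ℂ f w := by
    intro w hw
    have := hne w hw
    refine DifferentiableAt.div (differentiableAt_const _) (by fun_prop) this
  have hexp0 : Complex.exp w0 = s := by
    rw [hw0, ← Complex.ofReal_exp, Real.exp_log hs]
  have hfw0 : f w0 = 1 / ((l : ℂ) + ((s ^ α : ℝ) : ℂ)) := by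
    rw [hf, hw0]
    simp only
    rw [← Complex.ofReal_mul, ← Complex.ofReal_exp, Real.rpow_def_of_pos hs, mul_comm α]
  set S : Set ℂ := {w | |w.im| < Real.pi} with hS
  have hSo : IsOpen S := isOpen_lt (by fun_prop) continuous_const
  have hS0 : w0 ∈ S := by
    rw [hS, hw0, mem_ofPred_eq, Complex.ofReal_im, abs_zero]; exact Real.pi_pos
  have hds : ∀ g : ℂ → ℂ, (∀ w : ℂ, |w.im| ≤ Real.pi → DifferentiableAt ℂ g w) →
      ∀ w : ℂ, |w.im| ≤ Real.pi → DifferentiableAt ℂ (dslope g w0) w := by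
    intro g hg w hw
    by_cases hww : w = w0
    · rw [hww]
      have h1 : DifferentiableOn ℂ (dslope g w0) S :=
        (Complex.differentiableOn_dslope (hSo.mem_nhds hS0)).2
          fun z hz => (hg z (le_of_lt hz)).differentiableWithinAt
      exact h1.differentiableAt (hSo.mem_nhds hS0)
    · exact (differentiableAt_dslope_of_ne hww).2 (hg w hw)
  have hdexp : ∀ w : ℂ, |w.im| ≤ Real.pi → dslope Complex.exp w0 w ≠ 0 := by
    intro w hw
    by_cases hww : w = w0
    · rw [hww, dslope_same, Complex.deriv_exp]; exact Complex.exp_ne_zero _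
    · rw [dslope_of_ne _ hww, slope_def_field]
      refine div_ne_zero ?_ (sub_ne_zero.2 hww)
      intro h0
      apply hww
      refine cexp_ne_of_abs_im_lt hs (lt_of_le_of_lt hw (by linarith [Real.pi_pos])) ?_
      rw [hexp0] at h0
      linear_combination h0
  -- Subtracting the value at w0 = log s makes the pole removable, and a quotient of two slopes
  -- displays the extension. The denominator has no zero because log s is the only logarithm of s in
  -- the strip.
  refine ⟨fun w => Complex.exp w * (dslope f w0 w / dslope Complex.exp w0 w), fun M w hw => ?_,
    fun w hw hws => ?_⟩
  · have hwim : |w.im| ≤ Real.pi := by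
      have h1 : w.im ∈ uIcc (-Real.pi) Real.pi := hw.2
      rw [uIcc_of_le (by linarith [Real.pi_pos])] at h1
      exact abs_le.2 h1
    exact (Complex.differentiable_exp.differentiableAt.mul ((hds f hfd w hwim).div
      (hds _ (fun z _ => Complex.differentiable_exp.differentiableAt) w hwim)
      (hdexp w hwim))).differentiableWithinAt
  · have hww : w ≠ w0 := fun h => hws (by rw [h, hexp0])
    simp only
    rw [dslope_of_ne _ hww, dslope_of_ne _ hww, slope_def_field, slope_def_field, hexp0, ← hfw0]
    have h1 : w - w0 ≠ 0 := sub_ne_zero.2 hww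
    have h2 : Complex.exp w - s ≠ 0 := sub_ne_zero.2 hws
    rw [show 1 / ((l : ℂ) + Complex.exp (α * w)) = f w from rfl]
    clear_value f
    field_simp

/-- The lines Im w = ±π are the two banks of the cut: e^w equals -e^x on both, while e^{αw} takes
conjugate values. The constant c drops out, and the difference of conjugates is 2i times an
imaginary part. -/
lemma stieltjes_jump {α l s : ℝ} (hα0 : 0 < α) (hα1 : α < 1) (hl : 0 ≤ l) (hs : 0 < s) (c : ℂ)
    (x : ℝ) :
    (1 / ((l : ℂ) + Complex.exp (α * ((x : ℂ) + ((-Real.pi : ℝ) : ℂ) * Complex.I))) - c) *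
        (Complex.exp ((x : ℂ) + ((-Real.pi : ℝ) : ℂ) * Complex.I) /
          (Complex.exp ((x : ℂ) + ((-Real.pi : ℝ) : ℂ) * Complex.I) - s)) -
      (1 / ((l : ℂ) + Complex.exp (α * ((x : ℂ) + (Real.pi : ℂ) * Complex.I))) - c) *
        (Complex.exp ((x : ℂ) + (Real.pi : ℂ) * Complex.I) /
          (Complex.exp ((x : ℂ) + (Real.pi : ℂ) * Complex.I) - s)) =
      2 * Real.pi * Complex.I *
        ((Real.exp x * (stieltjesDensity α l (Real.exp x) / (s + Real.exp x)) : ℝ) : ℂ) := by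
  have hn1 := le_norm_add_cexp (w := (x : ℂ) + ((-Real.pi : ℝ) : ℂ) * Complex.I) hα0 hα1 hl
    (by simp [abs_of_pos Real.pi_pos])
  have hn2 := le_norm_add_cexp (w := (x : ℂ) + (Real.pi : ℂ) * Complex.I) hα0 hα1 hl
    (by simp [abs_of_pos Real.pi_pos])
  have e1 : Complex.exp ((x : ℂ) + ((-Real.pi : ℝ) : ℂ) * Complex.I) = -((Real.exp x : ℝ) : ℂ) := by
    rw [Complex.exp_add]; push_cast; rw [neg_mul, Complex.exp_neg, Complex.exp_pi_mul_I]; simp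
  have e2 : Complex.exp ((x : ℂ) + (Real.pi : ℂ) * Complex.I) = -((Real.exp x : ℝ) : ℂ) := by
    rw [Complex.exp_add, Complex.exp_pi_mul_I]; push_cast; ring
  have hu : Real.exp x ^ α = Real.exp (α * x) := by
    rw [← Real.exp_mul, mul_comm]
  set u := Real.exp (α * x) with hu'
  set C := Real.cos (Real.pi * α) with hC
  set Sn := Real.sin (Real.pi * α) with hSn
  have hSn0 : 0 < Sn := sin_pi_mul_pos hα0 hα1
  have hu0 : 0 < u := Real.exp_pos _
  have e3 : Complex.exp (α * ((x : ℂ) + ((-Real.pi : ℝ) : ℂ) * Complex.I)) =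
      (u : ℂ) * ((C : ℂ) - (Sn : ℂ) * Complex.I) := by
    have : (α : ℂ) * ((x : ℂ) + ((-Real.pi : ℝ) : ℂ) * Complex.I) =
      ((α * x : ℝ) : ℂ) + ((-(Real.pi * α) : ℝ) : ℂ) * Complex.I := by push_cast; ring
    rw [this, Complex.exp_add, Complex.exp_mul_I, ← Complex.ofReal_exp, ← Complex.ofReal_cos,
      ← Complex.ofReal_sin, Real.cos_neg, Real.sin_neg, Complex.ofReal_neg, neg_mul,
      ← sub_eq_add_neg]
  have e4 : Complex.exp (α * ((x : ℂ) + (Real.pi : ℂ) * Complex.I)) =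
      (u : ℂ) * ((C : ℂ) + (Sn : ℂ) * Complex.I) := by
    have : (α : ℂ) * ((x : ℂ) + (Real.pi : ℂ) * Complex.I) =
      ((α * x : ℝ) : ℂ) + ((Real.pi * α : ℝ) : ℂ) * Complex.I := by push_cast; ring
    rw [this, Complex.exp_add, Complex.exp_mul_I, ← Complex.ofReal_exp, ← Complex.ofReal_cos,
      ← Complex.ofReal_sin]
  have hre : ((x : ℂ) + ((-Real.pi : ℝ) : ℂ) * Complex.I).re = x := by simp
  have hre2 : ((x : ℂ) + (Real.pi : ℂ) * Complex.I).re = x := by simp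
  have hpos : 0 < Sn * u := by positivity
  have d1 : (l : ℂ) + (u : ℂ) * ((C : ℂ) - (Sn : ℂ) * Complex.I) ≠ 0 := by
    intro h0
    rw [e3, h0, norm_zero, hre] at hn1
    linarith
  have d2 : (l : ℂ) + (u : ℂ) * ((C : ℂ) + (Sn : ℂ) * Complex.I) ≠ 0 := by
    intro h0
    rw [e4, h0, norm_zero, hre2] at hn2
    linarith
  have hden : 0 < l ^ 2 + 2 * l * u * C + u ^ 2 :=
    lt_of_lt_of_le (by positivity) (stieltjes_den_ge (α := α) (l := l) (u := u))
  have hcs := Real.sin_sq_add_cos_sq (Real.pi * α)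
  rw [← hSn, ← hC] at hcs
  have hprod : ((l : ℂ) + (u : ℂ) * ((C : ℂ) - (Sn : ℂ) * Complex.I)) *
      ((l : ℂ) + (u : ℂ) * ((C : ℂ) + (Sn : ℂ) * Complex.I)) =
      ((l ^ 2 + 2 * l * u * C + u ^ 2 : ℝ) : ℂ) := by
    have hcs' : (Sn : ℂ) ^ 2 + (C : ℂ) ^ 2 = 1 := by exact_mod_cast hcs
    push_cast
    linear_combination (u : ℂ) ^ 2 * hcs' - (u : ℂ) ^ 2 * (Sn : ℂ) ^ 2 * Complex.I_sq
  have hsx : (s : ℂ) + ((Real.exp x : ℝ) : ℂ) ≠ 0 := by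
    have : 0 < s + Real.exp x := by positivity
    exact_mod_cast this.ne'
  have hden' : ((l ^ 2 + 2 * l * u * C + u ^ 2 : ℝ) : ℂ) ≠ 0 := by exact_mod_cast hden.ne'
  rw [e1, e2, e3, e4]
  have hfrac : -((Real.exp x : ℝ) : ℂ) / (-((Real.exp x : ℝ) : ℂ) - s) =
      ((Real.exp x : ℝ) : ℂ) / ((s : ℂ) + ((Real.exp x : ℝ) : ℂ)) := by
    rw [← neg_div_neg_eq, neg_neg, neg_sub, sub_neg_eq_add]
  rw [hfrac, ← sub_mul, sub_sub_sub_cancel_right]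
  have hdiff : 1 / ((l : ℂ) + (u : ℂ) * ((C : ℂ) - (Sn : ℂ) * Complex.I)) -
      1 / ((l : ℂ) + (u : ℂ) * ((C : ℂ) + (Sn : ℂ) * Complex.I)) =
      2 * Complex.I * ((u * Sn / (l ^ 2 + 2 * l * u * C + u ^ 2) : ℝ) : ℂ) := by
    rw [div_sub_div _ _ d1 d2, hprod]
    push_cast
    push_cast at hden'
    field_simp
    ring
  rw [hdiff]
  unfold stieltjesDensity
  rw [hu, ← hC, ← hSn]
  have hpi : (Real.pi : ℂ) ≠ 0 := by exact_mod_cast Real.pi_ne_zero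
  push_cast
  push_cast at hden' hsx
  field_simp

/-- Cauchy's theorem on the rectangle [-M, M] × [-π, π]. The horizontal sides give 2πi times the
truncated integral. On the right side h tends to minus the subtracted constant, which yields the
value; on the left side h is O(e^{-(1-α)M}). -/
lemma tendsto_integral_stieltjesDensity_exp {α l s : ℝ} (hα0 : 0 < α) (hα1 : α < 1) (hl : 0 ≤ l)
    (hs : 0 < s) :
    Tendsto (fun M : ℝ => ∫ x in (-M)..M,
      Real.exp x * (stieltjesDensity α l (Real.exp x) / (s + Real.exp x))) atTop
      (𝓝 (1 / (l + s ^ α))) := by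
  obtain ⟨h, hd, hh⟩ := exists_rect_function hα0 hα1 hl hs
  set f0 : ℂ := 1 / ((l : ℂ) + ((s ^ α : ℝ) : ℂ)) with hf0
  set P : ℝ → ℝ := fun M => ∫ x in (-M)..M,
      Real.exp x * (stieltjesDensity α l (Real.exp x) / (s + Real.exp x)) with hP
  set Sn := Real.sin (Real.pi * α) with hSn
  have hSn0 : 0 < Sn := sin_pi_mul_pos hα0 hα1
  have hpi := Real.pi_pos
  have hrect : ∀ M : ℝ, 2 * Real.pi * Complex.I * (P M : ℂ) +
      Complex.I * (∫ y in (-Real.pi)..Real.pi, h ((M : ℂ) + y * Complex.I)) -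
      Complex.I * (∫ y in (-Real.pi)..Real.pi, h (((-M : ℝ) : ℂ) + y * Complex.I)) = 0 := by
    intro M
    have h1 := Complex.integral_boundary_rect_eq_zero_of_differentiableOn h
      ⟨-M, -Real.pi⟩ ⟨M, Real.pi⟩ (hd M)
    simp only [smul_eq_mul] at h1
    have hcont : ∀ c : ℝ, c ∈ uIcc (-Real.pi) Real.pi →
        IntervalIntegrable (fun x : ℝ => h ((x : ℂ) + (c : ℂ) * Complex.I)) volume (-M) M := by
      intro c hc
      apply ContinuousOn.intervalIntegrable
      refine (hd M).continuousOn.comp (by fun_prop) ?_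
      intro x hx
      rw [Complex.mem_reProdIm]
      simpa using ⟨hx, hc⟩
    have hne : ∀ (x : ℝ) (w : ℂ), Complex.exp w = -((Real.exp x : ℝ) : ℂ) →
        Complex.exp w ≠ s := by
      intro x w hw h0
      rw [hw] at h0
      have h2 : -Real.exp x = s := by exact_mod_cast h0
      linarith [Real.exp_pos x]
    rw [← intervalIntegral.integral_sub (hcont _ left_mem_uIcc) (hcont _ right_mem_uIcc)] at h1
    have h2 : ∀ x : ℝ, h ((x : ℂ) + ((-Real.pi : ℝ) : ℂ) * Complex.I) -
        h ((x : ℂ) + (Real.pi : ℂ) * Complex.I) = 2 * Real.pi * Complex.I *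
        ((Real.exp x * (stieltjesDensity α l (Real.exp x) / (s + Real.exp x)) : ℝ) : ℂ) := by
      intro x
      rw [← stieltjes_jump hα0 hα1 hl hs f0 x, hh, hh]
      · simp [abs_of_pos hpi]
      · refine hne x _ ?_
        rw [Complex.exp_add, Complex.exp_pi_mul_I]; push_cast; ring
      · simp [abs_of_pos hpi]
      · refine hne x _ ?_
        rw [Complex.exp_add]; push_cast; rw [neg_mul, Complex.exp_neg, Complex.exp_pi_mul_I]; simp
    simp_rw [h2] at h1
    rw [intervalIntegral.integral_const_mul, intervalIntegral.integral_ofReal] at h1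
    exact h1
  have hnf : ∀ w : ℂ, |w.im| ≤ Real.pi →
      ‖1 / ((l : ℂ) + Complex.exp (α * w))‖ ≤ Real.exp (-(α * w.re)) / Sn := by
    intro w hw
    have h1 := le_norm_add_cexp hα0 hα1 hl hw
    have h2 : 0 < Sn * Real.exp (α * w.re) := mul_pos hSn0 (Real.exp_pos _)
    rw [norm_div, norm_one, Real.exp_neg]
    calc _ ≤ 1 / (Sn * Real.exp (α * w.re)) := one_div_le_one_div_of_le h2 h1
      _ = _ := by field_simp
  have hyim : ∀ y : ℝ, y ∈ uIoc (-Real.pi) Real.pi → |y| ≤ Real.pi := by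
    intro y hy
    rw [uIoc_of_le (by linarith)] at hy
    exact abs_le.2 ⟨hy.1.le, hy.2⟩
  have hright : Tendsto (fun M : ℝ => ∫ y in (-Real.pi)..Real.pi, (h ((M : ℂ) + y * Complex.I) + f0))
      atTop (𝓝 0) := by
    have hb : Tendsto (fun M : ℝ => (2 * (Real.exp (-(α * M)) / Sn) +
        2 * ‖f0‖ * s * Real.exp (-M)) * |Real.pi - -Real.pi|) atTop (𝓝 0) := by
      have e1 : Tendsto (fun M : ℝ => Real.exp (-(α * M))) atTop (𝓝 0) :=
        Real.tendsto_exp_neg_atTop_nhds_zero.comp (tendsto_id.const_mul_atTop hα0)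
      have e2 := Real.tendsto_exp_neg_atTop_nhds_zero
      have := (((e1.div_const Sn).const_mul 2).add (e2.const_mul (2 * ‖f0‖ * s))).mul_const
        |Real.pi - -Real.pi|
      simpa using this
    refine squeeze_zero_norm' ?_ hb
    filter_upwards [Real.tendsto_exp_atTop.eventually_ge_atTop (2 * s)] with M hM
    refine intervalIntegral.norm_integral_le_of_norm_le_const fun y hy => ?_
    set w : ℂ := (M : ℂ) + y * Complex.I with hw
    have hwre : w.re = M := by simp [hw]
    have hwim : |w.im| ≤ Real.pi := by simpa [hw] using hyim y hy
    have hnw : ‖Complex.exp w‖ = Real.exp M := by rw [Complex.norm_exp, hwre]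
    have hws : Real.exp M / 2 ≤ ‖Complex.exp w - s‖ := by
      have := norm_sub_norm_le (Complex.exp w) s
      rw [hnw, Complex.norm_real, Real.norm_of_nonneg hs.le] at this
      linarith
    have hws0 : 0 < ‖Complex.exp w - s‖ := lt_of_lt_of_le (by positivity) hws
    have hne : Complex.exp w - s ≠ 0 := norm_pos_iff.1 hws0
    rw [hh w hwim (sub_ne_zero.1 hne)]
    have e : (1 / ((l : ℂ) + Complex.exp (α * w)) - f0) * (Complex.exp w / (Complex.exp w - s)) + f0
        = 1 / ((l : ℂ) + Complex.exp (α * w)) * (Complex.exp w / (Complex.exp w - s)) -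
          f0 * s / (Complex.exp w - s) := by
      generalize 1 / ((l : ℂ) + Complex.exp (α * w)) = F
      clear_value f0
      field_simp
      ring
    rw [e]
    refine (norm_sub_le _ _).trans (add_le_add ?_ ?_)
    · rw [norm_mul, norm_div _ (Complex.exp w - s), hnw, mul_comm]
      have h3 := hnf w hwim
      rw [hwre] at h3
      refine mul_le_mul ?_ h3 (norm_nonneg _) (by norm_num)
      rw [div_le_iff₀ hws0]; linarith
    · rw [norm_div, norm_mul, Complex.norm_real, Real.norm_of_nonneg hs.le, div_le_iff₀ hws0,
        Real.exp_neg]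
      calc ‖f0‖ * s = 2 * ‖f0‖ * s * (Real.exp M)⁻¹ * (Real.exp M / 2) := by
            field_simp
        _ ≤ _ := by gcongr
  have hleft : Tendsto (fun M : ℝ => ∫ y in (-Real.pi)..Real.pi,
      h (((-M : ℝ) : ℂ) + y * Complex.I)) atTop (𝓝 0) := by
    have hb : Tendsto (fun M : ℝ => (2 / s * (Real.exp (-((1 - α) * M)) / Sn +
        ‖f0‖ * Real.exp (-M))) * |Real.pi - -Real.pi|) atTop (𝓝 0) := by
      have e1 : Tendsto (fun M : ℝ => Real.exp (-((1 - α) * M))) atTop (𝓝 0) :=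
        Real.tendsto_exp_neg_atTop_nhds_zero.comp (tendsto_id.const_mul_atTop (by linarith))
      have e2 := Real.tendsto_exp_neg_atTop_nhds_zero
      have := (((e1.div_const Sn).add (e2.const_mul ‖f0‖)).const_mul (2 / s)).mul_const
        |Real.pi - -Real.pi|
      simpa using this
    refine squeeze_zero_norm' ?_ hb
    filter_upwards [Real.tendsto_exp_neg_atTop_nhds_zero.eventually_le_const
      (show 0 < s / 2 by positivity)] with M hM
    refine intervalIntegral.norm_integral_le_of_norm_le_const fun y hy => ?_
    set w : ℂ := ((-M : ℝ) : ℂ) + y * Complex.I with hw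
    have hwre : w.re = -M := by simp [hw]
    have hwim : |w.im| ≤ Real.pi := by simpa [hw] using hyim y hy
    have hnw : ‖Complex.exp w‖ = Real.exp (-M) := by rw [Complex.norm_exp, hwre]
    have hws : s / 2 ≤ ‖Complex.exp w - s‖ := by
      have := norm_sub_norm_le (s : ℂ) (Complex.exp w)
      rw [hnw, Complex.norm_real, Real.norm_of_nonneg hs.le, norm_sub_rev] at this
      linarith
    have hws0 : 0 < ‖Complex.exp w - s‖ := lt_of_lt_of_le (by positivity) hws
    have hne : Complex.exp w - s ≠ 0 := norm_pos_iff.1 hws0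
    rw [hh w hwim (sub_ne_zero.1 hne), norm_mul, norm_div _ (Complex.exp w - s), hnw]
    have h3 := hnf w hwim
    rw [hwre] at h3
    calc _ ≤ (Real.exp (-(α * -M)) / Sn + ‖f0‖) * (Real.exp (-M) / (s / 2)) := by
          refine mul_le_mul ((norm_sub_le _ _).trans (by gcongr)) ?_ (by positivity) (by positivity)
          gcongr
      _ = 2 / s * (Real.exp (-(α * -M)) * Real.exp (-M) / Sn + ‖f0‖ * Real.exp (-M)) := by
          field_simp
      _ = _ := by
          rw [← Real.exp_add]; ring_nf
  have hPc : Tendsto (fun M => (P M : ℂ)) atTop (𝓝 f0) := by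
    have hint : ∀ M : ℝ, IntervalIntegrable (fun y : ℝ => h ((M : ℂ) + y * Complex.I)) volume
        (-Real.pi) Real.pi := by
      intro M
      apply ContinuousOn.intervalIntegrable
      refine (hd M).continuousOn.comp (by fun_prop) ?_
      intro x hx
      rw [Complex.mem_reProdIm]
      simpa using hx
    have e : ∀ M, (P M : ℂ) = f0 - (2 * Real.pi : ℂ)⁻¹ *
        ((∫ y in (-Real.pi)..Real.pi, (h ((M : ℂ) + y * Complex.I) + f0)) -
          ∫ y in (-Real.pi)..Real.pi, h (((-M : ℝ) : ℂ) + y * Complex.I)) := by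
      intro M
      rw [intervalIntegral.integral_add (hint M) intervalIntegrable_const,
        intervalIntegral.integral_const]
      have hpi' : (Real.pi : ℂ) ≠ 0 := by exact_mod_cast hpi.ne'
      have hr := hrect M
      have hr2 : 2 * Real.pi * (P M : ℂ) +
          (∫ y in (-Real.pi)..Real.pi, h ((M : ℂ) + y * Complex.I)) -
          (∫ y in (-Real.pi)..Real.pi, h (((-M : ℝ) : ℂ) + y * Complex.I)) = 0 := by
        refine (mul_eq_zero.1 (Eq.trans ?_ hr)).resolve_left Complex.I_ne_zero
        ring
      rw [Complex.real_smul]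
      generalize (∫ y in (-Real.pi)..Real.pi, h (((-M : ℝ) : ℂ) + y * Complex.I)) = B at hr2 ⊢
      push_cast
      field_simp
      linear_combination hr2
    have := ((hright.sub hleft).const_mul (2 * Real.pi : ℂ)⁻¹).const_sub f0
    simp only [sub_zero, mul_zero] at this
    exact this.congr fun M => (e M).symm
  have h5 := (Complex.continuous_re.tendsto f0).comp hPc
  have h6 : f0.re = 1 / (l + s ^ α) := by
    rw [hf0, ← Complex.ofReal_add, ← Complex.ofReal_one, ← Complex.ofReal_div, Complex.ofReal_re]
  rw [h6] at h5
  exact h5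

lemma continuousOn_stieltjesDensity {α l : ℝ} (hα0 : 0 < α) (hα1 : α < 1) :
    ContinuousOn (stieltjesDensity α l) (Ioi 0) := by
  intro r hr
  have hr : 0 < r := hr
  apply ContinuousAt.continuousWithinAt
  unfold stieltjesDensity
  have h0 : 0 < l ^ 2 + 2 * l * r ^ α * Real.cos (Real.pi * α) + (r ^ α) ^ 2 :=
    lt_of_lt_of_le (pow_pos (mul_pos (sin_pi_mul_pos hα0 hα1) (Real.rpow_pos_of_pos hr α)) 2)
      stieltjes_den_ge
  have h1 : ContinuousAt (fun r : ℝ => r ^ α) r := Real.continuousAt_rpow_const _ _ (Or.inl hr.ne')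
  exact continuousAt_const.mul (h1.div (by fun_prop) h0.ne')

/-- `∫₀^∞ stieltjesDensity α l r / (s + r) dr = 1 / (l + s^α)`. -/
lemma integral_stieltjesDensity {α l s : ℝ} (hα0 : 0 < α) (hα1 : α < 1) (hl : 0 ≤ l)
    (hs : 0 < s) :
    IntegrableOn (fun r => stieltjesDensity α l r / (s + r)) (Ioi 0) ∧
      ∫ r in Ioi 0, stieltjesDensity α l r / (s + r) = 1 / (l + s ^ α) := by
  have ht := tendsto_integral_stieltjesDensity_exp hα0 hα1 hl hs
  set F : ℝ → ℝ := fun r => stieltjesDensity α l r / (s + r) with hF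
  have hcont : Continuous fun x => Real.exp x * F (Real.exp x) := by
    refine Real.continuous_exp.mul ?_
    have h1 : ContinuousOn F (Ioi 0) := by
      refine (continuousOn_stieltjesDensity hα0 hα1).div (by fun_prop) fun r hr => ?_
      have hr : 0 < r := hr
      positivity
    exact h1.comp_continuous Real.continuous_exp fun x => Real.exp_pos x
  have hnn : ∀ x, 0 ≤ Real.exp x * F (Real.exp x) := by
    intro x
    have := stieltjesDensity_nonneg (l := l) hα0 hα1 (Real.exp_pos x).le
    simp only [hF]
    positivity
  have hcov : AECover volume atTop fun M : ℝ => Ioc (-M) M :=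
    aecover_Ioc tendsto_neg_atTop_atBot tendsto_id
  have ht' : Tendsto (fun M : ℝ => ∫ x in Ioc (-M) M, Real.exp x * F (Real.exp x)) atTop
      (𝓝 (1 / (l + s ^ α))) := by
    refine ht.congr' ?_
    filter_upwards [eventually_ge_atTop 0] with M hM
    rw [intervalIntegral.integral_of_le (by linarith)]
  have hint : Integrable (fun x => Real.exp x * F (Real.exp x)) := by
    refine hcov.integrable_of_integral_tendsto_of_nonneg_ae _ (fun M => ?_)
      (Eventually.of_forall hnn) ht'
    exact (hcont.continuousOn.integrableOn_Icc).mono_set Ioc_subset_Icc_self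
  have heq := hcov.integral_eq_of_tendsto _ hint ht'
  have himg : Real.exp '' univ = Ioi 0 := by rw [image_univ, Real.range_exp]
  have hder : ∀ x ∈ (univ : Set ℝ), HasDerivWithinAt Real.exp (Real.exp x) univ x :=
    fun x _ => (Real.hasDerivAt_exp x).hasDerivWithinAt
  constructor
  · rw [← himg, integrableOn_image_iff_integrableOn_abs_deriv_smul MeasurableSet.univ hder
      Real.exp_injective.injOn]
    simpa [abs_of_pos (Real.exp_pos _)] using hint
  · rw [← himg, integral_image_eq_integral_abs_deriv_smul MeasurableSet.univ hder
      Real.exp_injective.injOn]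
    simpa [abs_of_pos (Real.exp_pos _)] using heq

/-! ### The spectral density -/

/-- The density of `x / ((1 - x) + x s^α)` as a Stieltjes function of `s`. -/
def spectralDensity (α r x : ℝ) : ℝ :=
  Real.sin (Real.pi * α) / Real.pi * (r ^ α * x ^ 2 /
    ((1 - x) ^ 2 + 2 * (1 - x) * (r ^ α * x) * Real.cos (Real.pi * α) + (r ^ α * x) ^ 2))

lemma spectralDensity_zero (α r : ℝ) : spectralDensity α r 0 = 0 := by
  simp [spectralDensity]

/-- The eigenvalue of -Δ belonging to x is (1 - x)/x; scaling the fraction by x² gives the form that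
remains meaningful at x = 0. -/
lemma spectralDensity_eq {α r x : ℝ} (hx : x ≠ 0) :
    spectralDensity α r x = stieltjesDensity α ((1 - x) / x) r := by
  unfold spectralDensity stieltjesDensity
  congr 1
  rw [← mul_div_mul_right (r ^ α) _ (pow_ne_zero 2 hx)]
  congr 1
  field_simp

lemma spectralDensity_nonneg {α r x : ℝ} (hα0 : 0 < α) (hα1 : α < 1) (hr : 0 ≤ r) :
    0 ≤ spectralDensity α r x := by
  rcases eq_or_ne x 0 with rfl | hx
  · rw [spectralDensity_zero]
  · rw [spectralDensity_eq hx]; exact stieltjesDensity_nonneg hα0 hα1 hr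

lemma continuousOn_spectralDensity {α : ℝ} (hα0 : 0 < α) (hα1 : α < 1) :
    ContinuousOn (fun p : ℝ × ℝ => spectralDensity α p.1 p.2) (Ioi 0 ×ˢ Icc 0 1) := by
  rintro ⟨r, x⟩ ⟨hr, hx⟩
  have hr : 0 < r := hr
  apply ContinuousAt.continuousWithinAt
  have hra : 0 < r ^ α := Real.rpow_pos_of_pos hr α
  have h0 : (1 - x) ^ 2 + 2 * (1 - x) * (r ^ α * x) * Real.cos (Real.pi * α) + (r ^ α * x) ^ 2
      ≠ 0 := by
    rcases eq_or_ne x 0 with rfl | hx0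
    · norm_num
    · have h1 : 0 < x := lt_of_le_of_ne hx.1 (Ne.symm hx0)
      exact (lt_of_lt_of_le (pow_pos (mul_pos (sin_pi_mul_pos hα0 hα1) (mul_pos hra h1)) 2)
        stieltjes_den_ge).ne'
  unfold spectralDensity
  have h1 : ContinuousAt (fun p : ℝ × ℝ => p.1 ^ α) (r, x) :=
    continuousAt_fst.rpow_const (Or.inl hr.ne')
  exact continuousAt_const.mul (ContinuousAt.div (by fun_prop) (by fun_prop) h0)

lemma spectralDensity_le {α r x : ℝ} (hα0 : 0 < α) (hα1 : α < 1) (hr : 0 < r) :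
    spectralDensity α r x ≤ 1 / (Real.pi * Real.sin (Real.pi * α)) * r ^ (-α) := by
  have hs := sin_pi_mul_pos hα0 hα1
  have hpi := Real.pi_pos
  have hra : 0 < r ^ α := Real.rpow_pos_of_pos hr α
  rcases eq_or_ne x 0 with rfl | hx
  · rw [spectralDensity_zero]; positivity
  · have hx2 : 0 < x ^ 2 := by positivity
    have h1 : 0 < (Real.sin (Real.pi * α) * (r ^ α * x)) ^ 2 := by positivity
    unfold spectralDensity
    calc _ ≤ Real.sin (Real.pi * α) / Real.pi * (r ^ α * x ^ 2 /
          (Real.sin (Real.pi * α) * (r ^ α * x)) ^ 2) := by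
          gcongr
          exact stieltjes_den_ge
      _ = _ := by
          rw [Real.rpow_neg hr.le]
          field_simp

/-- `(1 - x) σ ≤ c x` uniformly in `r`. -/
lemma one_sub_mul_spectralDensity_le {α r x : ℝ} (hα0 : 0 < α) (hα1 : α < 1) (hr : 0 < r)
    (hx : x ∈ Icc (0 : ℝ) 1) :
    (1 - x) * spectralDensity α r x ≤
      Real.sin (Real.pi * α) / Real.pi / (2 * (1 + Real.cos (Real.pi * α))) * x := by
  have hs := sin_pi_mul_pos hα0 hα1
  have hpi := Real.pi_pos
  have hra : 0 < r ^ α := Real.rpow_pos_of_pos hr α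
  have hcos : 0 < 1 + Real.cos (Real.pi * α) := by
    have : Real.cos Real.pi < Real.cos (Real.pi * α) :=
      Real.cos_lt_cos_of_nonneg_of_le_pi (by positivity) le_rfl (by nlinarith)
    rw [Real.cos_pi] at this
    linarith
  rcases eq_or_lt_of_le hx.1 with h0 | hx0
  · rw [← h0, spectralDensity_zero]; simp
  rcases eq_or_lt_of_le hx.2 with h0 | hx1
  · rw [h0]; simp; positivity
  have hx1' : 0 < 1 - x := by linarith
  -- The arithmetic-geometric mean inequality for 1 - x and r^α x. After it the power r^α cancels,
  -- so the bound is uniform in r.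
  have hden : 2 * (1 + Real.cos (Real.pi * α)) * ((1 - x) * (r ^ α * x)) ≤
      (1 - x) ^ 2 + 2 * (1 - x) * (r ^ α * x) * Real.cos (Real.pi * α) + (r ^ α * x) ^ 2 := by
    nlinarith [sq_nonneg ((1 - x) - r ^ α * x)]
  unfold spectralDensity
  calc _ ≤ (1 - x) * (Real.sin (Real.pi * α) / Real.pi * (r ^ α * x ^ 2 /
        (2 * (1 + Real.cos (Real.pi * α)) * ((1 - x) * (r ^ α * x))))) := by
        gcongr
    _ = _ := by field_simp

/-- The Stieltjes representation of `x / ((1 - x) + x s^α)`. -/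
lemma integral_spectralDensity {α s x : ℝ} (hα0 : 0 < α) (hα1 : α < 1) (hs : 0 < s)
    (hx : x ∈ Icc (0 : ℝ) 1) :
    IntegrableOn (fun r => spectralDensity α r x / (s + r)) (Ioi 0) ∧
      ∫ r in Ioi 0, spectralDensity α r x / (s + r) = x / ((1 - x) + x * s ^ α) := by
  rcases eq_or_lt_of_le hx.1 with h0 | hx0
  · rw [← h0]; simp [spectralDensity_zero]
  · have h := integral_stieltjesDensity (l := (1 - x) / x) hα0 hα1
      (div_nonneg (by linarith [hx.2]) hx0.le) hs
    simp_rw [spectralDensity_eq hx0.ne']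
    refine ⟨h.1, h.2.trans ?_⟩
    have : 0 < s ^ α := Real.rpow_pos_of_pos hs α
    have : 0 < 1 - x + x * s ^ α := by
      have := hx.2
      have : 0 < x * s ^ α := by positivity
      linarith
    field_simp

/-! ### Superposition of the scalar error bounds -/

lemma exp_neg_le_rpow (p : ℝ) (hp : 0 ≤ p) {c : ℝ} (hc : 0 < c) :
    ∃ C : ℝ, 0 < C ∧ ∀ y : ℝ, 0 < y → Real.exp (-(c * y)) ≤ C * y ^ (-p) := by
  obtain ⟨N, hN⟩ := exists_nat_ge p
  refine ⟨1 + N.factorial / c ^ N, by positivity, fun y hy => ?_⟩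
  have h1 : y ^ p ≤ 1 + y ^ N := by
    rcases le_total y 1 with h | h
    · exact (Real.rpow_le_one hy.le h hp).trans (by linarith [pow_pos hy N])
    · have := Real.rpow_le_rpow_of_exponent_le h hN
      rw [Real.rpow_natCast] at this
      linarith
  have h2 := Real.pow_div_factorial_le_exp (c * y) (by positivity) N
  have h3 : 1 ≤ Real.exp (c * y) := Real.one_le_exp (by positivity)
  have h4 : y ^ N ≤ N.factorial / c ^ N * Real.exp (c * y) := by
    calc y ^ N = N.factorial / c ^ N * ((c * y) ^ N / N.factorial) := by
          have := Nat.factorial_ne_zero N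
          rw [mul_pow]; field_simp
      _ ≤ _ := by gcongr
  rw [Real.exp_neg, Real.rpow_neg hy.le, ← div_eq_mul_inv,
    inv_le_comm₀ (Real.exp_pos _) (by positivity), inv_div, div_le_iff₀ (by positivity)]
  linarith

/-- The regimes ρ ≥ 1 and ρ ≤ 1 merge into one bound. The factor 1/(1 + ρ) on the fast term is the
one whose integral against the spectral density is known in closed form. -/
lemma odeError_le_aux {c1 c2 C1 C2 ρ y e P : ℝ} (hρ : 0 < ρ) (hy : 0 ≤ y) (hP : 0 ≤ P)
    (hC1 : 0 < C1) (hC2 : 0 < C2)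
    (h1 : 1 ≤ ρ → e ≤ C1 / ρ * Real.exp (-(c1 * y)))
    (h2 : ρ ≤ 1 → e ≤ C2 * (Real.exp (-(c2 * y)) + P * Real.exp (-(c2 * ρ * y)))) :
    e ≤ 2 * (C1 + C2) * (Real.exp (-(min c1 c2 * y)) / (1 + ρ) +
      P * Real.exp (-(min c1 c2 * ρ * y))) := by
  have e1 : Real.exp (-(c1 * y)) ≤ Real.exp (-(min c1 c2 * y)) := by
    gcongr; exact min_le_left _ _
  have e2 : Real.exp (-(c2 * y)) ≤ Real.exp (-(min c1 c2 * y)) := by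
    gcongr; exact min_le_right _ _
  have e3 : Real.exp (-(c2 * ρ * y)) ≤ Real.exp (-(min c1 c2 * ρ * y)) := by
    gcongr; exact min_le_right _ _
  have hE := Real.exp_pos (-(min c1 c2 * y))
  have hE2 := Real.exp_pos (-(min c1 c2 * ρ * y))
  set E := Real.exp (-(min c1 c2 * y))
  set E2 := Real.exp (-(min c1 c2 * ρ * y))
  have hPE : 0 ≤ P * E2 := by positivity
  rcases le_total 1 ρ with h | h
  · refine (h1 h).trans ?_
    calc C1 / ρ * Real.exp (-(c1 * y)) ≤ C1 / ρ * E := by gcongr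
      _ ≤ 2 * C1 * (E / (1 + ρ)) := by
          rw [div_mul_eq_mul_div, mul_div_assoc', div_le_div_iff₀ hρ (by positivity)]
          have : 0 < C1 * E := by positivity
          nlinarith
      _ ≤ 2 * (C1 + C2) * (E / (1 + ρ) + P * E2) := by
          gcongr <;> linarith
  · refine (h2 h).trans ?_
    calc _ ≤ C2 * (E + P * E2) := by gcongr
      _ ≤ C2 * (2 * (E / (1 + ρ)) + 2 * (P * E2)) := by
          refine mul_le_mul_of_nonneg_left (add_le_add ?_ (by linarith)) hC2.le
          rw [mul_div_assoc', le_div_iff₀ (by positivity)]; nlinarith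
      _ ≤ _ := by
          have : 0 < E / (1 + ρ) := by positivity
          nlinarith

lemma exists_odeError_zero_le {k m l : ℕ} (hk1 : 1 ≤ k) (hk : k ≤ 6) (hm : 1 ≤ m) (hl : l < k) :
    ∃ c : ℝ, 0 < c ∧ ∃ C : ℝ, 0 < C ∧ ∀ ρ : ℝ, 0 < ρ → ∀ n : ℕ,
      |PowerSeries.coeff n (odeError k m l ρ 0)| ≤ C * (Real.exp (-(c * n)) / (1 + ρ) +
        (ρ ^ (if Odd (l + m) then m else m + 1) + ρ ^ (k - l - 1)) * Real.exp (-(c * ρ * n))) := by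
  obtain ⟨c1, hc1, C1, hC1, h1⟩ := exists_odeError_le_of_one_le hk1 hk m hl
  obtain ⟨c2, hc2, C2, hC2, h2⟩ := exists_odeError_zero_le_of_le_one hk1 hk hm hl
  refine ⟨min c1 c2, lt_min hc1 hc2, 2 * (C1 + C2), by positivity, fun ρ hρ n => ?_⟩
  refine odeError_le_aux hρ (Nat.cast_nonneg n) (by positivity) hC1 hC2 (fun h => ?_) fun h => ?_
  · simpa using h1 ρ h 0 le_rfl n (Nat.cast_nonneg n)
  · exact h2 ρ hρ h n

lemma exists_odeError_top_le {k : ℕ} (hk1 : 1 ≤ k) (hk : k ≤ 6) (m : ℕ) :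
    ∃ c : ℝ, 0 < c ∧ ∃ C : ℝ, 0 < C ∧ ∀ ρ : ℝ, 0 < ρ → ∀ s : ℝ, 0 ≤ s → ∀ n : ℕ, s ≤ n →
      |PowerSeries.coeff n (odeError k m (k - 1) ρ s)| ≤
        C * (Real.exp (-(c * (n - s))) / (1 + ρ) +
          (ρ ^ 0 + ρ ^ 0) * Real.exp (-(c * ρ * (n - s)))) := by
  obtain ⟨c1, hc1, C1, hC1, h1⟩ := exists_odeError_le_of_one_le (l := k - 1) hk1 hk m (by omega)
  obtain ⟨c2, hc2, C2, hC2, h2⟩ := exists_odeError_top_le_of_le_one hk1 hk m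
  refine ⟨min c1 c2, lt_min hc1 hc2, 2 * (C1 + C2), by positivity, fun ρ hρ s hs n hn => ?_⟩
  refine odeError_le_aux hρ (sub_nonneg.2 hn) (by positivity) hC1 hC2 (fun h => h1 ρ h s hs n hn)
    fun h => (h2 ρ hρ h s hs n hn).trans ?_
  gcongr
  have := Real.exp_pos (-(c2 * (n - s)))
  have := Real.exp_pos (-(c2 * ρ * (n - s)))
  simp only [pow_zero]
  linarith

lemma integral_rpow_mul_exp {q b : ℝ} (hq : -1 < q) (hb : 0 < b) :
    IntegrableOn (fun r : ℝ => r ^ q * Real.exp (-(b * r))) (Ioi 0) ∧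
      ∫ r in Ioi (0 : ℝ), r ^ q * Real.exp (-(b * r)) = Real.Gamma (q + 1) * b ^ (-(q + 1)) := by
  have h := Real.integral_rpow_mul_exp_neg_mul_Ioi (a := q + 1) (r := b) (by linarith) hb
  have h2 := integrableOn_rpow_mul_exp_neg_mul_rpow (s := q) (p := 1) hq zero_lt_one hb
  simp only [add_sub_cancel_right] at h
  constructor
  · refine h2.congr_fun (fun r _ => ?_) measurableSet_Ioi
    simp
  · rw [h, one_div, Real.inv_rpow hb.le, Real.rpow_neg hb.le, mul_comm]

/-- Integration of a scalar error bound against a weight in the spectral parameter. -/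
lemma abs_integral_weight_mul_le {W e : ℝ → ℝ} {a w0 I0 τ y c C E : ℝ} (p1 p2 : ℕ)
    (ha : a < 1) (hτ : 0 < τ) (hy : 0 < y) (hc : 0 < c) (hC : 0 < C) (hE : 0 ≤ E) (hw0 : 0 ≤ w0)
    (hW0 : ∀ r, 0 < r → 0 ≤ W r) (hW : ∀ r, 0 < r → W r ≤ w0 * r ^ (-a))
    (hI : IntegrableOn (fun r => W r * (τ / (1 + r * τ))) (Ioi 0))
    (hI0 : ∫ r in Ioi 0, W r * (τ / (1 + r * τ)) ≤ I0)
    (he : ∀ r, 0 < r → |e r| ≤ C * (E / (1 + r * τ) +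
      ((r * τ) ^ p1 + (r * τ) ^ p2) * Real.exp (-(c * (r * τ) * y)))) :
    |∫ r in Ioi 0, W r * (τ * e r)| ≤ C * (E * I0 +
      w0 * (Real.Gamma (p1 - a + 1) * c ^ (-(p1 - a + 1)) * (τ ^ (p1 + 1) * (τ * y) ^ (a - p1 - 1)) +
        Real.Gamma (p2 - a + 1) * c ^ (-(p2 - a + 1)) *
          (τ ^ (p2 + 1) * (τ * y) ^ (a - p2 - 1)))) := by
  have hq : ∀ p : ℕ, -1 < (p : ℝ) - a := fun p => by
    have : (0 : ℝ) ≤ p := Nat.cast_nonneg p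
    linarith
  have hb : 0 < c * (τ * y) := by positivity
  have hg := fun p : ℕ => integral_rpow_mul_exp (hq p) hb
  set f : ℕ → ℝ → ℝ := fun p r => r ^ ((p : ℝ) - a) * Real.exp (-(c * (τ * y) * r)) with hf
  have hmaj : ∀ r ∈ Ioi (0 : ℝ), ‖W r * (τ * e r)‖ ≤ C * E * (W r * (τ / (1 + r * τ))) +
      (C * w0 * τ ^ (p1 + 1) * f p1 r + C * w0 * τ ^ (p2 + 1) * f p2 r) := by
    intro r hr
    have hr : 0 < r := hr
    have hfp : ∀ p : ℕ, f p r = r ^ (-a) * (r ^ p * Real.exp (-(c * (r * τ) * y))) := by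
      intro p
      simp only [hf]
      rw [show (p : ℝ) - a = -a + p by ring, Real.rpow_add hr, Real.rpow_natCast, mul_assoc,
        show c * (τ * y) * r = c * (r * τ) * y by ring]
    rw [norm_mul, norm_mul, Real.norm_of_nonneg (hW0 r hr), Real.norm_of_nonneg hτ.le,
      Real.norm_eq_abs]
    calc W r * (τ * |e r|) ≤ W r * (τ * (C * (E / (1 + r * τ) +
          ((r * τ) ^ p1 + (r * τ) ^ p2) * Real.exp (-(c * (r * τ) * y))))) := by
          have := hW0 r hr
          have := he r hr
          gcongr
      _ = C * E * (W r * (τ / (1 + r * τ))) + W r * (C * τ * (((r * τ) ^ p1 + (r * τ) ^ p2) *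
          Real.exp (-(c * (r * τ) * y)))) := by ring
      _ ≤ C * E * (W r * (τ / (1 + r * τ))) + w0 * r ^ (-a) *
          (C * τ * (((r * τ) ^ p1 + (r * τ) ^ p2) * Real.exp (-(c * (r * τ) * y)))) := by
          have := hW r hr
          gcongr
      _ = _ := by
          rw [hfp, hfp]; ring
  have hi1 := hI.const_mul (C * E)
  have hi2 := (hg p1).1.const_mul (C * w0 * τ ^ (p1 + 1))
  have hi3 := (hg p2).1.const_mul (C * w0 * τ ^ (p2 + 1))
  have hmain := norm_integral_le_of_norm_le (hi1.add (hi2.add hi3))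
    ((ae_restrict_iff' measurableSet_Ioi).2 (Eventually.of_forall hmaj))
  rw [Real.norm_eq_abs] at hmain
  refine hmain.trans ?_
  rw [integral_add' hi1 (hi2.add hi3), integral_add' hi2 hi3, integral_const_mul,
    integral_const_mul, integral_const_mul, (hg p1).2, (hg p2).2]
  have hsplit : ∀ p : ℕ, (c * (τ * y)) ^ (-((p : ℝ) - a + 1)) =
      c ^ (-((p : ℝ) - a + 1)) * (τ * y) ^ (a - p - 1) := by
    intro p
    rw [Real.mul_rpow hc.le (by positivity), show a - p - 1 = -((p : ℝ) - a + 1) by ring]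
  rw [hsplit, hsplit]
  have : C * E * ∫ r in Ioi 0, W r * (τ / (1 + r * τ)) ≤ C * E * I0 := by gcongr
  linarith

/-- The Stieltjes representation at s = 1/τ. It controls the initial layer e^{-cn} in the superposed
error. -/
lemma integral_spectralDensity_step {α τ x : ℝ} (hα0 : 0 < α) (hα1 : α < 1) (hτ : 0 < τ)
    (hx : x ∈ Icc (0 : ℝ) 1) :
    IntegrableOn (fun r => spectralDensity α r x * (τ / (1 + r * τ))) (Ioi 0) ∧
      ∫ r in Ioi 0, spectralDensity α r x * (τ / (1 + r * τ)) =
        x / ((1 - x) + x * τ ^ (-α)) := by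
  have h := integral_spectralDensity hα0 hα1 (inv_pos.2 hτ) hx
  have e : ∀ r ∈ Ioi (0 : ℝ), spectralDensity α r x / (τ⁻¹ + r) =
      spectralDensity α r x * (τ / (1 + r * τ)) := by
    intro r hr
    have hr : 0 < r := hr
    rw [div_eq_mul_inv]
    congr 1
    field_simp
  refine ⟨h.1.congr_fun e measurableSet_Ioi, ?_⟩
  rw [← setIntegral_congr_fun measurableSet_Ioi e, h.2, Real.inv_rpow hτ.le, Real.rpow_neg hτ.le]

lemma integral_spectralDensity_step_le {α τ x : ℝ} (hα0 : 0 < α) (hα1 : α < 1) (hτ : 0 < τ)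
    (hx : x ∈ Icc (0 : ℝ) 1) :
    ∫ r in Ioi 0, spectralDensity α r x * (τ / (1 + r * τ)) ≤ τ ^ α := by
  rw [(integral_spectralDensity_step hα0 hα1 hτ hx).2, Real.rpow_neg hτ.le]
  have hτa : 0 < τ ^ α := Real.rpow_pos_of_pos hτ α
  rcases eq_or_lt_of_le hx.1 with h0 | hx0
  · rw [← h0]; simp; positivity
  · have : 0 < 1 - x + x * (τ ^ α)⁻¹ := by
      have := hx.2
      have : 0 < x * (τ ^ α)⁻¹ := by positivity
      linarith
    rw [div_le_iff₀ this, mul_add, mul_left_comm, mul_inv_cancel₀ hτa.ne']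
    nlinarith [hx.2]

lemma one_sub_mul_integral_spectralDensity_step_le {α τ x : ℝ} (hα0 : 0 < α) (hα1 : α < 1)
    (hτ : 0 < τ) (hx : x ∈ Icc (0 : ℝ) 1) :
    ∫ r in Ioi 0, (1 - x) * spectralDensity α r x * (τ / (1 + r * τ)) ≤ x := by
  simp_rw [mul_assoc]
  rw [integral_const_mul, (integral_spectralDensity_step hα0 hα1 hτ hx).2, Real.rpow_neg hτ.le]
  have hτa : 0 < τ ^ α := Real.rpow_pos_of_pos hτ α
  rcases eq_or_lt_of_le hx.1 with h0 | hx0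
  · rw [← h0]; simp
  · have : 0 < 1 - x + x * (τ ^ α)⁻¹ := by
      have := hx.2
      have : 0 < x * (τ ^ α)⁻¹ := by positivity
      linarith
    rw [mul_div_assoc', div_le_iff₀ this]
    have : 0 < x * (τ ^ α)⁻¹ := by positivity
    nlinarith

/-- The kernel error for the source term `t^l / l!`. -/
theorem exists_source_kernel_error_le {α : ℝ} (hα0 : 0 < α) (hα1 : α < 1) {k m l : ℕ}
    (hk1 : 1 ≤ k) (hk : k ≤ 6) (hm : 1 ≤ m) (hl : l < k) :
    ∃ c : ℝ, 0 < c ∧ ∀ x ∈ Icc (0 : ℝ) 1, ∀ τ : ℝ, 0 < τ → ∀ n : ℕ, 1 ≤ n →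
      |∫ r in Ioi 0, spectralDensity α r x *
        (τ ^ (l + 1) * PowerSeries.coeff n (odeError k m l (r * τ) 0))| ≤
        c * sourceFactor α k m l τ (n * τ) := by
  obtain ⟨c, hc, C, hC, h⟩ := exists_odeError_zero_le hk1 hk hm hl
  -- With n = t/τ, the bound e^{-cn} ≤ D n^{-(k-l-α)} turns the initial layer τ^l τ^α e^{-cn} into a
  -- multiple of τ^k t^{α+l-k}.
  obtain ⟨D, hD, hexp⟩ := exp_neg_le_rpow (k - l - α)
    (by have : (l : ℝ) + 1 ≤ k := by exact_mod_cast hl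
        linarith) hc
  -- Integration against r^{-α} sends ρ^p e^{-cρn} to τ^{p+1} t^{α-p-1} up to a factor τ^l; p1
  -- yields the parity dependent term, p2 the term with τ^k.
  set p1 : ℕ := if Odd (l + m) then m else m + 1 with hp1
  set p2 : ℕ := k - l - 1 with hp2
  set w0 : ℝ := 1 / (Real.pi * Real.sin (Real.pi * α)) with hw0
  have hw0' : 0 < w0 := by
    have := sin_pi_mul_pos hα0 hα1
    have := Real.pi_pos
    positivity
  have hG : ∀ p : ℕ, 0 < Real.Gamma (p - α + 1) * c ^ (-((p : ℝ) - α + 1)) := by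
    intro p
    have : (0 : ℝ) ≤ p := Nat.cast_nonneg p
    exact mul_pos (Real.Gamma_pos_of_pos (by linarith)) (Real.rpow_pos_of_pos hc _)
  set G1 := Real.Gamma (p1 - α + 1) * c ^ (-((p1 : ℝ) - α + 1))
  set G2 := Real.Gamma (p2 - α + 1) * c ^ (-((p2 : ℝ) - α + 1))
  have hG1 : 0 < G1 := hG p1
  have hG2 : 0 < G2 := hG p2
  refine ⟨C * (D + w0 * (G1 + G2)), by positivity, fun x hx τ hτ n hn => ?_⟩
  have hn0 : (0 : ℝ) < n := by exact_mod_cast hn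
  have hmain := abs_integral_weight_mul_le (W := fun r => spectralDensity α r x)
    (e := fun r => PowerSeries.coeff n (odeError k m l (r * τ) 0)) p1 p2 hα1 hτ hn0 hc hC
    (Real.exp_pos (-(c * n))).le hw0'.le (fun r hr => spectralDensity_nonneg hα0 hα1 hr.le)
    (fun r hr => spectralDensity_le hα0 hα1 hr)
    (integral_spectralDensity_step hα0 hα1 hτ hx).1
    (integral_spectralDensity_step_le hα0 hα1 hτ hx) (fun r hr => h _ (by positivity) n)
  have e1 : ∫ r in Ioi 0, spectralDensity α r x *
        (τ ^ (l + 1) * PowerSeries.coeff n (odeError k m l (r * τ) 0)) =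
      τ ^ l * ∫ r in Ioi 0, spectralDensity α r x *
        (τ * PowerSeries.coeff n (odeError k m l (r * τ) 0)) := by
    rw [← integral_const_mul]
    congr 1; funext r; ring
  rw [e1, abs_mul, abs_of_pos (pow_pos hτ l)]
  set t : ℝ := n * τ with ht
  have ht0 : 0 < t := by positivity
  set S1 : ℝ := τ ^ (l + p1 + 1) * t ^ (α - p1 - 1) with hS1
  set S2 : ℝ := τ ^ k * t ^ (α + l - k) with hS2
  have hS1' : 0 < S1 := by positivity
  have hS2' : 0 < S2 := by positivity
  have hSF : sourceFactor α k m l τ t = S1 + S2 := by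
    unfold sourceFactor
    rw [← hS2, hS1, hp1]
    split_ifs with h
    · rfl
    · push_cast
      rw [show l + m + 2 = l + (m + 1) + 1 by ring, show α - m - 2 = α - (m + 1) - 1 by ring]
  have e2 : τ ^ l * (τ ^ (p1 + 1) * (τ * n) ^ (α - p1 - 1)) = S1 := by
    rw [hS1, ht, mul_comm τ (n : ℝ)]; ring
  have e3 : τ ^ l * (τ ^ (p2 + 1) * (τ * n) ^ (α - p2 - 1)) = S2 := by
    have h1 : (p2 : ℝ) = k - l - 1 := by
      rw [hp2, Nat.sub_sub, Nat.cast_sub (by omega)]; push_cast; ring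
    rw [hS2, ht, mul_comm τ (n : ℝ), ← mul_assoc, ← pow_add, h1]
    congr 2
    · omega
    · ring
  have e4 : τ ^ l * (Real.exp (-(c * n)) * τ ^ α) ≤ D * S2 := by
    calc τ ^ l * (Real.exp (-(c * n)) * τ ^ α) ≤
        τ ^ l * ((D * (n : ℝ) ^ (-((k : ℝ) - l - α))) * τ ^ α) := by
          gcongr; exact hexp n hn0
      _ = D * S2 := by
          rw [hS2, ht, Real.mul_rpow hn0.le hτ.le, show -((k : ℝ) - l - α) = α + l - k by ring,
            show α + l - k = α + (l + (-k : ℝ)) by ring, Real.rpow_add hτ, Real.rpow_add hτ,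
            Real.rpow_natCast, Real.rpow_neg hτ.le, Real.rpow_natCast]
          field_simp
  rw [hSF]
  calc _ ≤ τ ^ l * _ := mul_le_mul_of_nonneg_left hmain (by positivity)
    _ = C * (τ ^ l * (Real.exp (-(c * n)) * τ ^ α) + w0 * (G1 *
        (τ ^ l * (τ ^ (p1 + 1) * (τ * n) ^ (α - p1 - 1))) +
        G2 * (τ ^ l * (τ ^ (p2 + 1) * (τ * n) ^ (α - p2 - 1))))) := by ring
    _ ≤ C * (D * S2 + w0 * (G1 * S1 + G2 * S2)) := by
        rw [e2, e3]; gcongr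
    _ ≤ _ := by
        have : 0 ≤ C * (D * S1 + w0 * (G1 * S2 + G2 * S1)) := by positivity
        linarith

/-- The kernel error for the initial value. -/
theorem exists_initial_kernel_error_le {α : ℝ} (hα0 : 0 < α) (hα1 : α < 1) {k m : ℕ}
    (hk1 : 1 ≤ k) (hk : k ≤ 6) (hm : 1 ≤ m) :
    ∃ c : ℝ, 0 < c ∧ ∀ x ∈ Icc (0 : ℝ) 1, ∀ τ : ℝ, 0 < τ → ∀ n : ℕ, 1 ≤ n →
      (1 - x) * |∫ r in Ioi 0, spectralDensity α r x *
        (τ * PowerSeries.coeff n (odeError k m 0 (r * τ) 0))| ≤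
        c * initialFactor k m τ (n * τ) * x := by
  obtain ⟨c, hc, C, hC, h⟩ := exists_odeError_zero_le hk1 hk hm (l := 0) (by omega)
  obtain ⟨D, hD, hexp⟩ := exp_neg_le_rpow k (Nat.cast_nonneg k) hc
  set p1 : ℕ := if Odd (0 + m) then m else m + 1 with hp1
  set p2 : ℕ := k - 0 - 1 with hp2
  have hsin := sin_pi_mul_pos hα0 hα1
  have hpi := Real.pi_pos
  have hcos : 0 < 1 + Real.cos (Real.pi * α) := by
    have : Real.cos Real.pi < Real.cos (Real.pi * α) :=
      Real.cos_lt_cos_of_nonneg_of_le_pi (by positivity) le_rfl (by nlinarith)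
    rw [Real.cos_pi] at this
    linarith
  set w0 : ℝ := Real.sin (Real.pi * α) / Real.pi / (2 * (1 + Real.cos (Real.pi * α))) with hw0
  have hw0' : 0 < w0 := by positivity
  have hG : ∀ p : ℕ, 0 < Real.Gamma (p - 0 + 1) * c ^ (-((p : ℝ) - 0 + 1)) := by
    intro p
    have : (0 : ℝ) ≤ p := Nat.cast_nonneg p
    exact mul_pos (Real.Gamma_pos_of_pos (by linarith)) (Real.rpow_pos_of_pos hc _)
  set G1 := Real.Gamma (p1 - 0 + 1) * c ^ (-((p1 : ℝ) - 0 + 1))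
  set G2 := Real.Gamma (p2 - 0 + 1) * c ^ (-((p2 : ℝ) - 0 + 1))
  have hG1 : 0 < G1 := hG p1
  have hG2 : 0 < G2 := hG p2
  refine ⟨C * (D + w0 * (G1 + G2)), by positivity, fun x hx τ hτ n hn => ?_⟩
  have hn0 : (0 : ℝ) < n := by exact_mod_cast hn
  have hx1 : 0 ≤ 1 - x := by linarith [hx.2]
  have hx0 : 0 ≤ x := hx.1
  -- The weight (1 - x) σ_r(x) is bounded by w0 x without decay in r, hence a = 0 and powers
  -- t^{-p-1}. The factor x is kept, to be divided out later by
  -- `IsSymmContraction.norm_le_of_apply_eq`.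
  have hmain := abs_integral_weight_mul_le (W := fun r => (1 - x) * spectralDensity α r x)
    (e := fun r => PowerSeries.coeff n (odeError k m 0 (r * τ) 0)) (a := 0) (w0 := w0 * x)
    p1 p2 zero_lt_one hτ hn0 hc hC
    (Real.exp_pos (-(c * n))).le (by positivity)
    (fun r hr => mul_nonneg hx1 (spectralDensity_nonneg hα0 hα1 hr.le))
    (fun r hr => by simpa using one_sub_mul_spectralDensity_le hα0 hα1 hr hx)
    (by simp_rw [mul_assoc]; exact (integral_spectralDensity_step hα0 hα1 hτ hx).1.const_mul _)
    (one_sub_mul_integral_spectralDensity_step_le hα0 hα1 hτ hx)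
    (fun r hr => h _ (by positivity) n)
  have e1 : (1 - x) * |∫ r in Ioi 0, spectralDensity α r x *
        (τ * PowerSeries.coeff n (odeError k m 0 (r * τ) 0))| =
      |∫ r in Ioi 0, (1 - x) * spectralDensity α r x *
        (τ * PowerSeries.coeff n (odeError k m 0 (r * τ) 0))| := by
    simp_rw [mul_assoc]
    rw [integral_const_mul, abs_mul, abs_of_nonneg hx1]
  rw [e1]
  refine hmain.trans ?_
  set t : ℝ := n * τ with ht
  have ht0 : 0 < t := by positivity
  set S1 : ℝ := τ ^ (p1 + 1) / t ^ (p1 + 1) with hS1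
  set S2 : ℝ := τ ^ k / t ^ k with hS2
  have hS1' : 0 < S1 := by positivity
  have hS2' : 0 < S2 := by positivity
  have hSF : initialFactor k m τ t = S1 + S2 := by
    unfold initialFactor
    rw [← hS2, hS1, hp1, zero_add]
    split_ifs with h <;> rfl
  have hpow : ∀ p : ℕ, τ ^ (p + 1) * (τ * n) ^ ((0 : ℝ) - p - 1) = τ ^ (p + 1) / t ^ (p + 1) := by
    intro p
    rw [div_eq_mul_inv, show (0 : ℝ) - p - 1 = -((p + 1 : ℕ) : ℝ) by push_cast; ring,
      Real.rpow_neg (by positivity), Real.rpow_natCast, ht, mul_comm τ (n : ℝ)]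
  have e3 : τ ^ (p2 + 1) * (τ * n) ^ ((0 : ℝ) - p2 - 1) = S2 := by
    rw [hpow, hS2, show p2 + 1 = k by omega]
  have e4 : Real.exp (-(c * n)) ≤ D * S2 := by
    refine (hexp n hn0).trans_eq ?_
    rw [hS2, ht, Real.rpow_neg hn0.le, Real.rpow_natCast, mul_pow]
    field_simp
  rw [hSF, hpow p1, e3, ← hS1]
  calc _ ≤ C * (D * S2 * x + w0 * x * (G1 * S1 + G2 * S2)) := by gcongr
    _ ≤ _ := by
        have : 0 ≤ C * (D * S1 + w0 * (G1 * S2 + G2 * S1)) * x := by positivity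
        linarith

/-- The kernel error for the remainder of the source term. -/
theorem exists_remainder_kernel_error_le {α : ℝ} (hα0 : 0 < α) (hα1 : α < 1) {k : ℕ}
    (hk1 : 1 ≤ k) (hk : k ≤ 6) (m : ℕ) :
    ∃ c : ℝ, 0 < c ∧ ∀ x ∈ Icc (0 : ℝ) 1, ∀ τ : ℝ, 0 < τ → ∀ n : ℕ, ∀ s : ℝ, 0 ≤ s →
      s < n * τ →
      |∫ r in Ioi 0, spectralDensity α r x *
        (τ ^ k * PowerSeries.coeff n (odeError k m (k - 1) (r * τ) (s / τ)))| ≤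
        c * τ ^ k * (n * τ - s) ^ (α - 1) := by
  obtain ⟨c, hc, C, hC, h⟩ := exists_odeError_top_le hk1 hk m
  obtain ⟨D, hD, hexp⟩ := exp_neg_le_rpow (1 - α) (by linarith) hc
  set w0 : ℝ := 1 / (Real.pi * Real.sin (Real.pi * α)) with hw0
  have hw0' : 0 < w0 := by
    have := sin_pi_mul_pos hα0 hα1
    have := Real.pi_pos
    positivity
  set G := Real.Gamma ((0 : ℕ) - α + 1) * c ^ (-(((0 : ℕ) : ℝ) - α + 1)) with hG
  have hG1 : 0 < G := by
    exact mul_pos (Real.Gamma_pos_of_pos (by push_cast; linarith)) (Real.rpow_pos_of_pos hc _)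
  refine ⟨C * (D + w0 * (G + G)), by positivity, fun x hx τ hτ n s hs hsn => ?_⟩
  have hst : s / τ < n := by rw [div_lt_iff₀ hτ]; exact hsn
  set y : ℝ := n - s / τ with hy
  have hy0 : 0 < y := sub_pos.2 hst
  have hτy : τ * y = n * τ - s := by rw [hy]; field_simp
  -- With p = 0 in both slots the integral is of size τ (nτ - s)^{α-1}, the weakly singular kernel
  -- of the remainder.
  have hmain := abs_integral_weight_mul_le (W := fun r => spectralDensity α r x)
    (e := fun r => PowerSeries.coeff n (odeError k m (k - 1) (r * τ) (s / τ)))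
    0 0 hα1 hτ hy0 hc hC
    (Real.exp_pos (-(c * y))).le hw0'.le (fun r hr => spectralDensity_nonneg hα0 hα1 hr.le)
    (fun r hr => spectralDensity_le hα0 hα1 hr)
    (integral_spectralDensity_step hα0 hα1 hτ hx).1
    (integral_spectralDensity_step_le hα0 hα1 hτ hx)
    (fun r hr => h _ (by positivity) (s / τ) (by positivity) n hst.le)
  have e1 : ∫ r in Ioi 0, spectralDensity α r x *
        (τ ^ k * PowerSeries.coeff n (odeError k m (k - 1) (r * τ) (s / τ))) =
      τ ^ (k - 1) * ∫ r in Ioi 0, spectralDensity α r x *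
        (τ * PowerSeries.coeff n (odeError k m (k - 1) (r * τ) (s / τ))) := by
    rw [← integral_const_mul]
    congr 1; funext r
    rw [show τ ^ k = τ ^ (k - 1) * τ by rw [← pow_succ]; congr 1; omega]; ring
  have hk' : τ ^ k = τ ^ (k - 1) * τ := by rw [← pow_succ]; congr 1; omega
  rw [e1, abs_mul, abs_of_pos (pow_pos hτ (k - 1))]
  rw [← hG] at hmain
  have e2 : τ ^ (0 + 1) * (τ * y) ^ (α - (0 : ℕ) - 1) = τ * (τ * y) ^ (α - 1) := by
    simp
  rw [e2] at hmain
  have e4 : Real.exp (-(c * y)) * τ ^ α ≤ D * (τ * (τ * y) ^ (α - 1)) := by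
    calc _ ≤ D * y ^ (-(1 - α)) * τ ^ α := by gcongr; exact hexp y hy0
      _ = _ := by
        rw [Real.mul_rpow hτ.le hy0.le, Real.rpow_sub_one hτ.ne', neg_sub]
        field_simp
  rw [← hτy, hk']
  calc _ ≤ τ ^ (k - 1) * _ := mul_le_mul_of_nonneg_left hmain (by positivity)
    _ ≤ τ ^ (k - 1) * (C * (D * (τ * (τ * y) ^ (α - 1)) +
        w0 * (G * (τ * (τ * y) ^ (α - 1)) + G * (τ * (τ * y) ^ (α - 1))))) := by gcongr
    _ = _ := by ring

/-! ### Convolutions on an interval -/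

section VConv

variable {E₁ E₂ E₃ E₄ E₅ E₆ : Type*}
  [NormedAddCommGroup E₁] [NormedSpace ℝ E₁] [NormedAddCommGroup E₂] [NormedSpace ℝ E₂]
  [NormedAddCommGroup E₃] [NormedSpace ℝ E₃] [NormedAddCommGroup E₄] [NormedSpace ℝ E₄]
  [NormedAddCommGroup E₅] [NormedSpace ℝ E₅] [NormedAddCommGroup E₆] [NormedSpace ℝ E₆]

/-- The convolution `∫₀ᵗ L (f (t - s)) (g s) ds`. -/
def vconv (L : E₁ →L[ℝ] E₂ →L[ℝ] E₃) (f : ℝ → E₁) (g : ℝ → E₂) (t : ℝ) : E₃ :=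
  ∫ s in (0 : ℝ)..t, L (f (t - s)) (g s)

lemma vconv_eq_swap (L : E₁ →L[ℝ] E₂ →L[ℝ] E₃) (f : ℝ → E₁) (g : ℝ → E₂) (t : ℝ) :
    vconv L f g t = ∫ s in (0 : ℝ)..t, L (f s) (g (t - s)) := by
  have := intervalIntegral.integral_comp_sub_left (a := 0) (b := t)
    (fun s => L (f (t - s)) (g s)) t
  simp only [sub_self, sub_zero, sub_sub_cancel] at this
  exact this.symm

lemma vconv_flip (L : E₁ →L[ℝ] E₂ →L[ℝ] E₃) (f : ℝ → E₁) (g : ℝ → E₂) (t : ℝ) :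
    vconv L.flip g f t = vconv L f g t := by
  rw [vconv_eq_swap L, vconv]
  rfl

lemma vconv_congr (L : E₁ →L[ℝ] E₂ →L[ℝ] E₃) {f f' : ℝ → E₁} {g g' : ℝ → E₂} {t : ℝ}
    (ht : 0 ≤ t) (hf : ∀ s, 0 < s → s ≤ t → f s = f' s) (hg : ∀ s, 0 < s → s ≤ t → g s = g' s) :
    vconv L f g t = vconv L f' g' t := by
  unfold vconv
  rw [intervalIntegral.integral_of_le ht, intervalIntegral.integral_of_le ht,
    integral_Ioc_eq_integral_Ioo, integral_Ioc_eq_integral_Ioo]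
  refine setIntegral_congr_fun measurableSet_Ioo fun s hs => ?_
  rw [hf (t - s) (by linarith [hs.2]) (by linarith [hs.1]), hg s hs.1 hs.2.le]

lemma indicator_Ioc_eq_zero {E : Type*} [NormedAddCommGroup E] (T : ℝ) (u : ℝ → E) (s : ℝ)
    (hs : s ≤ 0) : indicator (Ioc 0 T) u s = 0 :=
  indicator_of_notMem (fun h => by linarith [h.1]) _

lemma indicator_Ioi_eq_zero {E : Type*} [NormedAddCommGroup E] (u : ℝ → E) (s : ℝ)
    (hs : s ≤ 0) : indicator (Ioi 0) u s = 0 :=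
  indicator_of_notMem (fun h => absurd h (not_lt.2 hs)) _

lemma indicator_Ioi_eq_indicator_Ioc {E : Type*} [NormedAddCommGroup E] {T : ℝ} (u : ℝ → E)
    (s : ℝ) (hs : s ≤ T) : indicator (Ioi 0) u s = indicator (Ioc 0 T) u s := by
  simp only [indicator, mem_Ioi, mem_Ioc, hs, and_true]

lemma indicator_Ioc_eq_indicator_Ioi {E : Type*} [NormedAddCommGroup E] (T : ℝ) (u : ℝ → E) :
    indicator (Ioc 0 T) u = indicator (Ioi 0) (indicator (Iic T) u) := by
  rw [indicator_indicator]; rfl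

lemma vconv_eq_convolution (L : E₁ →L[ℝ] E₂ →L[ℝ] E₃) (f : ℝ → E₁) (g : ℝ → E₂) {T t : ℝ}
    (htT : t ≤ T) :
    convolution (indicator (Ioc 0 T) f) (indicator (Ioc 0 T) g) L volume t =
      indicator (Ioi 0) (vconv L f g) t := by
  rw [indicator_Ioc_eq_indicator_Ioi, indicator_Ioc_eq_indicator_Ioi, ← posConvolution_eq_convolution_indicator _ _ L volume, posConvolution]
  by_cases h0 : t ∈ Ioi (0 : ℝ)
  · rw [indicator_of_mem h0, indicator_of_mem h0, ← vconv_eq_swap L]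
    refine vconv_congr L (le_of_lt h0) (fun s _ hs => ?_) fun s _ hs => ?_ <;>
    exact indicator_of_mem (show _ ∈ Iic T from hs.trans htT) _
  · rw [indicator_of_notMem h0, indicator_of_notMem h0]

/-- Causality: for factors supported on the positive axis, the convolution at t ≤ T sees only their
values up to T. -/
lemma convolution_indicator_eq_of_le (L : E₁ →L[ℝ] E₂ →L[ℝ] E₃) {f f' : ℝ → E₁} {g g' : ℝ → E₂}
    {T t : ℝ} (hf : ∀ s, s ≤ T → f s = f' s) (hg : ∀ s, s ≤ T → g s = g' s)
    (hf0 : ∀ s, s ≤ 0 → f s = 0) (hf0' : ∀ s, s ≤ 0 → f' s = 0)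
    (hg0' : ∀ s, s ≤ 0 → g' s = 0) (ht : t ≤ T) :
    convolution f g L volume t = convolution f' g' L volume t := by
  rw [convolution, convolution]
  congr 1
  funext s
  rcases le_or_gt s 0 with h | h
  · rw [hf0 s h, hf0' s h]; simp
  · rw [hg (t - s) (by linarith)]
    rcases le_or_gt s T with h2 | h2
    · rw [hf s h2]
    · rw [hg0' (t - s) (by linarith)]; simp

/-- Extend all factors by zero and use associativity of the convolution on the line. Continuity of f
makes it bounded, so the triple convolution exists at every t and not only almost everywhere. -/
theorem vconv_assoc [CompleteSpace E₃] [CompleteSpace E₅]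
    (L : E₁ →L[ℝ] E₂ →L[ℝ] E₃) (L₂ : E₃ →L[ℝ] E₄ →L[ℝ] E₆)
    (L₃ : E₁ →L[ℝ] E₅ →L[ℝ] E₆) (L₄ : E₂ →L[ℝ] E₄ →L[ℝ] E₅) [CompleteSpace E₆]
    (hL : ∀ x y z, L₂ (L x y) z = L₃ x (L₄ y z))
    {f : ℝ → E₁} {g : ℝ → E₂} {k : ℝ → E₄} {T t : ℝ}
    (hf : ContinuousOn f (Icc 0 T)) (hg : IntegrableOn g (Ioc 0 T)) (hk : IntegrableOn k (Ioc 0 T))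
    (ht0 : 0 ≤ t) (htT : t ≤ T) :
    vconv L₂ (vconv L f g) k t = vconv L₃ f (vconv L₄ g k) t := by
  rcases eq_or_lt_of_le ht0 with rfl | ht
  · simp [vconv]
  have hfi : IntegrableOn f (Ioc 0 T) := (hf.integrableOn_Icc).mono_set Ioc_subset_Icc_self
  set F := indicator (Ioc 0 T) f with hF
  set G := indicator (Ioc 0 T) g with hG
  set K := indicator (Ioc 0 T) k with hK
  have hFi : Integrable F := (integrable_indicator_iff measurableSet_Ioc).2 hfi
  have hGi : Integrable G := (integrable_indicator_iff measurableSet_Ioc).2 hg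
  have hKi : Integrable K := (integrable_indicator_iff measurableSet_Ioc).2 hk
  obtain ⟨B, hB⟩ := isCompact_Icc.exists_bound_of_continuousOn hf
  have hFb : ∀ s, ‖‖F s‖‖ ≤ max B 0 := by
    intro s
    rw [norm_norm]
    by_cases h : s ∈ Ioc 0 T
    · rw [hF, indicator_of_mem h]; exact (hB s (Ioc_subset_Icc_self h)).trans (le_max_left _ _)
    · rw [hF, indicator_of_notMem h, norm_zero]; exact le_max_right _ _
  have hgk := hGi.norm.integrable_convolution (ContinuousLinearMap.mul ℝ ℝ) hKi.norm
  have hassoc := convolution_assoc (μ := volume) (ν := volume) L L₂ L₃ L₄ hL (x₀ := t)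
    (f := F) (g := G) (k := K)
    hFi.aestronglyMeasurable hGi.aestronglyMeasurable hKi.aestronglyMeasurable
    (hFi.ae_convolution_exists L hGi)
    (hGi.norm.ae_convolution_exists (ContinuousLinearMap.mul ℝ ℝ) hKi.norm)
    (by
      have h1 : Integrable (fun s => (fun y => convolution (fun x => ‖G x‖) (fun x => ‖K x‖)
        (ContinuousLinearMap.mul ℝ ℝ) volume y) (t - s)) := hgk.comp_sub_left t
      exact h1.bdd_mul hFi.norm.aestronglyMeasurable (Eventually.of_forall hFb))
  have e1 : convolution (convolution F G L volume) K L₂ volume t =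
      convolution (indicator (Ioc 0 T) (vconv L f g)) K L₂ volume t := by
    refine convolution_indicator_eq_of_le (T := T) L₂ (fun s hs => ?_) (fun _ _ => rfl)
      (fun s hs => ?_) (indicator_Ioc_eq_zero T _) (indicator_Ioc_eq_zero T k) htT
    · rw [vconv_eq_convolution L f g hs, indicator_Ioi_eq_indicator_Ioc _ _ hs]
    · rw [vconv_eq_convolution L f g (by linarith : s ≤ T), indicator_Ioi_eq_zero _ _ hs]
  have e2 : convolution F (convolution G K L₄ volume) L₃ volume t =
      convolution F (indicator (Ioc 0 T) (vconv L₄ g k)) L₃ volume t := by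
    refine convolution_indicator_eq_of_le (T := T) L₃ (fun _ _ => rfl) (fun s hs => ?_)
      (indicator_Ioc_eq_zero T f) (indicator_Ioc_eq_zero T f)
      (indicator_Ioc_eq_zero T _) htT
    · rw [vconv_eq_convolution L₄ g k hs, indicator_Ioi_eq_indicator_Ioc _ _ hs]
  rw [e1, e2, vconv_eq_convolution L₂ _ _ htT, vconv_eq_convolution L₃ _ _ htT,
    indicator_of_mem (show t ∈ Ioi (0 : ℝ) from ht),
    indicator_of_mem (show t ∈ Ioi (0 : ℝ) from ht)] at hassoc
  exact hassoc

/-- The convolution of an integrable and a continuous function vanishing at `0` is continuous. -/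
theorem continuousOn_vconv (L : E₁ →L[ℝ] E₂ →L[ℝ] E₃) {f : ℝ → E₁} {g : ℝ → E₂} {T : ℝ}
    (hf : ContinuousOn f (Icc 0 T)) (hf0 : f 0 = 0) (hg : IntegrableOn g (Ioc 0 T)) :
    ContinuousOn (vconv L f g) (Icc 0 T) := by
  rcases lt_or_ge T 0 with hT | hT
  · rw [Icc_eq_empty (by linarith)]; exact continuousOn_empty _
  set F : ℝ → E₁ := IccExtend hT (fun x => f x) with hF
  have hFc : Continuous F := (continuousOn_iff_continuous_domRestrict.1 hf).Icc_extend'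
  have hF1 : ∀ s, 0 ≤ s → s ≤ T → F s = f s := fun s h0 h1 => by
    rw [hF, IccExtend_of_mem hT (fun x : Icc (0 : ℝ) T => f x) ⟨h0, h1⟩]
  have hF0 : ∀ s, s ≤ 0 → F s = 0 := fun s h0 => by
    rw [hF, IccExtend_of_le_left hT _ h0, hf0]
  set G := indicator (Ioc 0 T) g with hG
  have hGi : Integrable G := (integrable_indicator_iff measurableSet_Ioc).2 hg
  obtain ⟨B, hB⟩ := isCompact_Icc.exists_bound_of_continuousOn hf
  have hbd : BddAbove (range fun x => ‖F x‖) := by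
    refine ⟨B, ?_⟩
    rintro _ ⟨x, rfl⟩
    exact hB _ (projIcc 0 T hT x).2
  have hc := hbd.continuous_convolution_left_of_integrable L hFc hGi
  refine hc.continuousOn.congr fun t ht => ?_
  have hext : (fun s => L (F s) (G (t - s))) = fun s => indicator (Ioc 0 T) F s |> fun a =>
      L a (G (t - s)) := by
    funext s
    rcases le_or_gt s 0 with h | h
    · simp only; rw [hF0 s h, indicator_of_notMem (fun h' => by linarith [h'.1])]
    · rcases le_or_gt s T with h2 | h2
      · rw [indicator_of_mem (show s ∈ Ioc 0 T from ⟨h, h2⟩)]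
      · have : G (t - s) = 0 := indicator_of_notMem (fun h' => by linarith [h'.1, ht.2]) _
        simp only; rw [this]; simp
  have h1 : convolution F G L volume t = convolution (indicator (Ioc 0 T) F) G L volume t := by
    rw [convolution, convolution, hext]
  change vconv L f g t = convolution F G L volume t
  rw [h1, vconv_eq_convolution L F g ht.2]
  rcases eq_or_lt_of_le ht.1 with h | h
  · rw [← h, indicator_of_notMem (by simp)]; simp [vconv]
  · rw [indicator_of_mem (show t ∈ Ioi (0 : ℝ) from h)]
    exact vconv_congr L ht.1 (fun s h0 h1 => (hF1 s h0.le (h1.trans ht.2)).symm) fun _ _ _ => rfl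

end VConv

/-! ### Uniqueness for the Laplace transform -/

/-- A function whose Laplace transform vanishes at `1, 2, 3, …` vanishes. -/
theorem eqOn_zero_of_laplace_eq_zero {D : ℝ → ℝ} (hD : ContinuousOn D (Ioi 0))
    (hi : IntegrableOn (fun t => Real.exp (-t) * D t) (Ioi 0))
    (h : ∀ n : ℕ, ∫ t in Ioi 0, Real.exp (-((n + 1 : ℝ) * t)) * D t = 0) :
    ∀ t, 0 < t → D t = 0 := by
  set H : ℝ → ℝ := fun t => Real.exp (-t) * D t with hH
  have hmem : ∀ t ∈ Ioi (0 : ℝ), Real.exp (-t) ∈ Icc (0 : ℝ) 1 := fun t ht =>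
    ⟨(Real.exp_pos _).le, Real.exp_le_one_iff.2 (by simpa using le_of_lt ht)⟩
  have hpm : ∀ n : ℕ, IntegrableOn (fun t => Real.exp (-t) ^ n * H t) (Ioi 0) := by
    intro n
    refine Integrable.bdd_mul (c := 1) hi (by fun_prop) ?_
    refine (ae_restrict_iff' measurableSet_Ioi).2 (Eventually.of_forall fun t ht => ?_)
    rw [Real.norm_of_nonneg (by positivity)]
    exact pow_le_one₀ (hmem t ht).1 (hmem t ht).2
  -- In the variable u = e^{-t} the hypotheses say that all moments vanish; Weierstrass
  -- approximation then extends this from polynomials to continuous functions of u.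
  have hpoly : ∀ p : Polynomial ℝ, IntegrableOn (fun t => p.eval (Real.exp (-t)) * H t) (Ioi 0) ∧
      ∫ t in Ioi 0, p.eval (Real.exp (-t)) * H t = 0 := by
    intro p
    have e : (fun t => p.eval (Real.exp (-t)) * H t) = fun t =>
        ∑ i ∈ Finset.range (p.natDegree + 1), p.coeff i * (Real.exp (-t) ^ i * H t) := by
      funext t
      rw [Polynomial.eval_eq_sum_range, Finset.sum_mul]
      simp only [mul_assoc]
    rw [e]
    constructor
    · exact integrable_finsetSum _ fun i _ => (hpm i).const_mul _
    · rw [integral_finsetSum _ fun i _ => (hpm i).const_mul _]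
      refine Finset.sum_eq_zero fun i _ => ?_
      rw [integral_const_mul, mul_eq_zero]
      right
      refine Eq.trans ?_ (h i)
      congr 1
      funext t
      rw [hH, ← mul_assoc, ← Real.exp_nat_mul, ← Real.exp_add]
      congr 2; ring
  have hcont : ∀ q : ℝ → ℝ, ContinuousOn q (Icc 0 1) →
      ∫ t in Ioi 0, q (Real.exp (-t)) * H t = 0 := by
    intro q hq
    have hqm : AEStronglyMeasurable (fun t => q (Real.exp (-t))) (volume.restrict (Ioi 0)) := by
      have : ContinuousOn (fun t => q (Real.exp (-t))) (Ioi 0) := hq.comp (by fun_prop) hmem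
      exact this.aestronglyMeasurable measurableSet_Ioi
    obtain ⟨B, hB⟩ := isCompact_Icc.exists_bound_of_continuousOn hq
    have hqi : IntegrableOn (fun t => q (Real.exp (-t)) * H t) (Ioi 0) :=
      Integrable.bdd_mul (c := B) hi hqm ((ae_restrict_iff' measurableSet_Ioi).2
        (Eventually.of_forall fun t ht => hB _ (hmem t ht)))
    set M := ∫ t in Ioi 0, ‖H t‖ with hM
    have hM0 : 0 ≤ M := integral_nonneg fun t => norm_nonneg _
    by_contra hne
    obtain ⟨p, hp⟩ := exists_polynomial_near_of_continuousOn 0 1 q hq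
      (‖∫ t in Ioi 0, q (Real.exp (-t)) * H t‖ / (M + 1))
      (div_pos (norm_pos_iff.2 hne) (by positivity))
    set δ := ‖∫ t in Ioi 0, q (Real.exp (-t)) * H t‖ / (M + 1) with hδ
    have hδ0 : 0 < δ := div_pos (norm_pos_iff.2 hne) (by positivity)
    have h1 : ∫ t in Ioi 0, q (Real.exp (-t)) * H t =
        ∫ t in Ioi 0, (q (Real.exp (-t)) * H t - p.eval (Real.exp (-t)) * H t) := by
      rw [integral_sub hqi (hpoly p).1, (hpoly p).2, sub_zero]
    have h2 : ‖∫ t in Ioi 0, q (Real.exp (-t)) * H t‖ ≤ δ * M := by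
      rw [h1, hM, ← integral_const_mul]
      refine norm_integral_le_of_norm_le (hi.norm.const_mul δ)
        ((ae_restrict_iff' measurableSet_Ioi).2 (Eventually.of_forall fun t ht => ?_))
      rw [← sub_mul, norm_mul, norm_sub_rev]
      exact mul_le_mul_of_nonneg_right (hp _ (hmem t ht)).le (norm_nonneg _)
    have h3 : ‖∫ t in Ioi 0, q (Real.exp (-t)) * H t‖ = δ * (M + 1) := by
      rw [hδ]; field_simp
    linarith
  have hae : ∀ᵐ t : ℝ, t ∈ Ioi (0 : ℝ) → H t = 0 := by
    refine isOpen_Ioi.ae_eq_zero_of_integral_contDiff_smul_eq_zero hi.locallyIntegrableOn ?_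
    intro φ hφ hφc hφs
    have hz : ∀ t, t ≤ 0 → φ t = 0 := fun t ht =>
      image_eq_zero_of_notMem_tsupport fun h' => absurd (hφs h') (not_lt.2 ht)
    obtain ⟨R, hR⟩ := hφc.isBounded.exists_norm_le
    have hzR : ∀ t, R < t → φ t = 0 := fun t ht =>
      image_eq_zero_of_notMem_tsupport fun h' => by
        have := hR t h'
        rw [Real.norm_eq_abs] at this
        linarith [le_abs_self t]
    -- Near u = 0 the value -log |u| leaves the compact support of φ. At u = 0 itself the convention
    -- `Real.log 0 = 0` is harmless, since φ also vanishes at 0.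
    have hq : ContinuousOn (fun u => φ (-Real.log u)) (Icc 0 1) := by
      intro u hu
      apply ContinuousAt.continuousWithinAt
      rcases eq_or_lt_of_le hu.1 with h0 | h0
      · rw [← h0]
        have hev : (fun u => φ (-Real.log u)) =ᶠ[𝓝 0] fun _ => 0 := by
          have h1 : ∀ᶠ u in 𝓝 (0 : ℝ), |u| < Real.exp (-(|R| + 1)) := by
            have := (continuous_abs.tendsto (0 : ℝ)).eventually_lt_const
              (u := Real.exp (-(|R| + 1))) (by rw [abs_zero]; exact Real.exp_pos _)
            exact this
          filter_upwards [h1] with u hu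
          rcases eq_or_ne u 0 with rfl | hne
          · simp [hz]
          · apply hzR
            rw [← Real.log_abs]
            have := (Real.log_lt_iff_lt_exp (abs_pos.2 hne)).2 hu
            linarith [le_abs_self R]
        exact (continuousAt_const.congr hev.symm)
      · exact hφ.continuous.continuousAt.comp (Real.continuousAt_log h0.ne').neg
    have h1 := hcont _ hq
    have h2 : ∫ t, φ t • H t = ∫ t in Ioi 0, φ t * H t := by
      rw [← integral_indicator measurableSet_Ioi]
      congr 1
      funext t
      by_cases ht : t ∈ Ioi (0 : ℝ)
      · rw [indicator_of_mem ht, smul_eq_mul]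
      · rw [indicator_of_notMem ht, hz t (not_lt.1 ht), zero_smul]
    rw [h2]
    simpa using h1
  have hEq : EqOn D (fun _ => 0) (Ioi 0) := by
    refine Measure.eqOn_open_of_ae_eq (μ := volume) ?_ isOpen_Ioi hD continuousOn_const
    refine (ae_restrict_iff' measurableSet_Ioi).2 (hae.mono fun t ht h0 => ?_)
    exact (mul_eq_zero.1 (ht h0)).resolve_left (Real.exp_ne_zero _)
  exact fun t ht => hEq ht

/-! ### The scalar solution kernels -/

lemma continuousOn_expIntegral_prod (i : ℕ) :
    ContinuousOn (fun p : ℝ × ℝ => expIntegral p.2 i p.1) (univ ×ˢ Ioi 0) := by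
  induction i with
  | zero =>
    simp only [expIntegral]
    fun_prop
  | succ i ih =>
    change ContinuousOn (fun p : ℝ × ℝ =>
      (p.1 ^ i / (i.factorial : ℝ) - expIntegral p.2 i p.1) / p.2) _
    refine ContinuousOn.div (ContinuousOn.sub (by fun_prop) ih) (by fun_prop) ?_
    rintro ⟨t, r⟩ ⟨_, hr⟩
    exact (ne_of_gt hr)

/-- Add the bounds y ≤ t^{l+1} and r y ≤ t^l. The decay 1/(1 + r) is what makes the integral against
r^{-α} converge. -/
lemma expIntegral_succ_le {r : ℝ} (hr : 0 < r) (l : ℕ) {t : ℝ} (ht : 0 ≤ t) :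
    expIntegral r (l + 1) t ≤ (t ^ (l + 1) + t ^ l) * (1 / (1 + r)) := by
  rw [mul_one_div, le_div_iff₀ (by positivity), mul_add, mul_one]
  have hf : ∀ j : ℕ, t ^ j / (j.factorial : ℝ) ≤ t ^ j := fun j =>
    div_le_self (by positivity) (by exact_mod_cast Nat.one_le_iff_ne_zero.2 (Nat.factorial_ne_zero j))
  have h1 := (expIntegral_le hr (l + 1) ht).trans (hf (l + 1))
  have h2 := mul_expIntegral_succ hr.ne' l t
  have h3 := expIntegral_nonneg hr l ht
  have h4 := hf l
  linarith

/-- Up to a constant, this is the integrand of the Stieltjes representation at x = 1, s = 1. -/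
lemma integrableOn_rpow_div {α : ℝ} (hα0 : 0 < α) (hα1 : α < 1) :
    IntegrableOn (fun r : ℝ => r ^ (-α) * (1 / (1 + r))) (Ioi 0) := by
  have hs := sin_pi_mul_pos hα0 hα1
  have hpi := Real.pi_pos
  have h := (integral_spectralDensity (x := 1) hα0 hα1 zero_lt_one (by simp)).1
  refine IntegrableOn.congr_fun (h.const_mul (Real.pi / Real.sin (Real.pi * α))) (fun r hr => ?_)
    measurableSet_Ioi
  have hr : 0 < r := hr
  have hra : 0 < r ^ α := Real.rpow_pos_of_pos hr α
  simp only [spectralDensity]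
  rw [Real.rpow_neg hr.le]
  field_simp
  ring

/-- The solution kernel `∫₀^∞ σ_r(x) (J^{l+1} e^{-r·})(t) dr`. -/
def kernelFun (α : ℝ) (l : ℕ) (t x : ℝ) : ℝ :=
  -- The clamp `max t 0` extends the kernel by zero to t ≤ 0, so it is jointly continuous on all of
  -- ℝ × [0,1] and can be curried.
  ∫ r in Ioi 0, spectralDensity α r x * expIntegral r (l + 1) (max t 0)

lemma kernelFun_integrand_le {α : ℝ} (hα0 : 0 < α) (hα1 : α < 1) (l : ℕ) {t B r x : ℝ}
    (ht : t ≤ B) (hr : 0 < r) :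
    ‖spectralDensity α r x * expIntegral r (l + 1) (max t 0)‖ ≤
      1 / (Real.pi * Real.sin (Real.pi * α)) * (max B 0 ^ (l + 1) + max B 0 ^ l) *
        (r ^ (-α) * (1 / (1 + r))) := by
  have hs := sin_pi_mul_pos hα0 hα1
  have hpi := Real.pi_pos
  have h0 : 0 ≤ max t 0 := le_max_right _ _
  have h1 := spectralDensity_le (x := x) hα0 hα1 hr
  have h2 := spectralDensity_nonneg (x := x) hα0 hα1 hr.le
  have h3 := expIntegral_nonneg hr (l + 1) h0
  have h4 := expIntegral_succ_le hr l h0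
  have h5 : max t 0 ≤ max B 0 := max_le_max_right 0 ht
  rw [Real.norm_of_nonneg (mul_nonneg h2 h3)]
  calc _ ≤ (1 / (Real.pi * Real.sin (Real.pi * α)) * r ^ (-α)) *
        ((max t 0 ^ (l + 1) + max t 0 ^ l) * (1 / (1 + r))) := by gcongr
    _ ≤ (1 / (Real.pi * Real.sin (Real.pi * α)) * r ^ (-α)) *
        ((max B 0 ^ (l + 1) + max B 0 ^ l) * (1 / (1 + r))) := by gcongr
    _ = _ := by ring

lemma continuousOn_kernelFun_integrand {α : ℝ} (hα0 : 0 < α) (hα1 : α < 1) (l : ℕ) {x : ℝ}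
    (hx : x ∈ Icc (0 : ℝ) 1) :
    ContinuousOn (fun p : ℝ × ℝ => spectralDensity α p.2 x * expIntegral p.2 (l + 1) (max p.1 0))
      (univ ×ˢ Ioi 0) := by
  refine ContinuousOn.mul ?_ ?_
  · refine (continuousOn_spectralDensity hα0 hα1).comp
      (f := fun p : ℝ × ℝ => (p.2, x)) (by fun_prop) ?_
    rintro ⟨t, r⟩ ⟨_, hr⟩
    exact ⟨hr, hx⟩
  · refine (continuousOn_expIntegral_prod (l + 1)).comp
      (f := fun p : ℝ × ℝ => (max p.1 0, p.2)) (by fun_prop) ?_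
    rintro ⟨t, r⟩ ⟨_, hr⟩
    exact ⟨mem_univ _, hr⟩

lemma integrableOn_kernelFun_integrand {α : ℝ} (hα0 : 0 < α) (hα1 : α < 1) (l : ℕ) (t : ℝ) {x : ℝ}
    (hx : x ∈ Icc (0 : ℝ) 1) :
    IntegrableOn (fun r => spectralDensity α r x * expIntegral r (l + 1) (max t 0)) (Ioi 0) := by
  refine Integrable.mono' ((integrableOn_rpow_div hα0 hα1).const_mul _) ?_
    ((ae_restrict_iff' measurableSet_Ioi).2
      (Eventually.of_forall fun r hr => kernelFun_integrand_le hα0 hα1 l le_rfl hr))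
  refine ContinuousOn.aestronglyMeasurable ?_ measurableSet_Ioi
  exact (continuousOn_kernelFun_integrand hα0 hα1 l hx).comp (f := fun r : ℝ => (t, r))
    (by fun_prop) fun r hr => ⟨mem_univ _, hr⟩

lemma continuous_kernelFun {α : ℝ} (hα0 : 0 < α) (hα1 : α < 1) (l : ℕ) :
    Continuous fun p : ℝ × Icc (0 : ℝ) 1 => kernelFun α l p.1 p.2 := by
  rw [continuous_iff_continuousAt]
  rintro ⟨t, x⟩
  refine continuousAt_of_dominated (bound := fun r =>
    1 / (Real.pi * Real.sin (Real.pi * α)) * (max (t + 1) 0 ^ (l + 1) + max (t + 1) 0 ^ l) *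
        (r ^ (-α) * (1 / (1 + r)))) ?_ ?_ ((integrableOn_rpow_div hα0 hα1).const_mul _) ?_
  · exact Eventually.of_forall fun p =>
      (integrableOn_kernelFun_integrand hα0 hα1 l p.1 p.2.2).aestronglyMeasurable
  · have : ∀ᶠ p : ℝ × Icc (0 : ℝ) 1 in 𝓝 (t, x), p.1 < t + 1 :=
      continuousAt_fst.eventually_lt_const (by simp)
    filter_upwards [this] with p hp
    exact (ae_restrict_iff' measurableSet_Ioi).2
      (Eventually.of_forall fun r hr => kernelFun_integrand_le hα0 hα1 l hp.le hr)
  · refine (ae_restrict_iff' measurableSet_Ioi).2 (Eventually.of_forall fun r hr => ?_)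
    have h1 : Continuous fun p : ℝ × Icc (0 : ℝ) 1 => spectralDensity α r p.2 := by
      refine (continuousOn_spectralDensity hα0 hα1).comp_continuous
        (f := fun p : ℝ × Icc (0 : ℝ) 1 => (r, (p.2 : ℝ))) (by fun_prop) fun p => ⟨hr, p.2.2⟩
    have h2 : Continuous fun p : ℝ × Icc (0 : ℝ) 1 => expIntegral r (l + 1) (max p.1 0) :=
      (continuous_expIntegral r (l + 1)).comp (by fun_prop)
    exact (h1.mul h2).continuousAt

lemma kernelFun_zero (α : ℝ) (l : ℕ) (x : ℝ) : kernelFun α l 0 x = 0 := by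
  simp [kernelFun, expIntegral_succ_zero]

lemma kernelFun_succ {α : ℝ} (hα0 : 0 < α) (hα1 : α < 1) (l : ℕ) {t x : ℝ} (ht : 0 ≤ t)
    (hx : x ∈ Icc (0 : ℝ) 1) :
    kernelFun α (l + 1) t x = ∫ s in (0 : ℝ)..t, kernelFun α l s x := by
  have hint : Integrable (Function.uncurry fun s r : ℝ =>
      spectralDensity α r x * expIntegral r (l + 1) (max s 0))
      ((volume.restrict (Ioc 0 t)).prod (volume.restrict (Ioi 0))) := by
    refine Integrable.mono' ((((integrableOn_rpow_div hα0 hα1).const_mul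
      (1 / (Real.pi * Real.sin (Real.pi * α)) * (max t 0 ^ (l + 1) + max t 0 ^ l)))).comp_snd
      (volume.restrict (Ioc 0 t))) ?_ ?_
    · rw [Measure.prod_restrict]
      refine ContinuousOn.aestronglyMeasurable ?_ (measurableSet_Ioc.prod measurableSet_Ioi)
      exact (continuousOn_kernelFun_integrand hα0 hα1 l hx).mono (prod_mono_left (subset_univ _))
    · rw [Measure.prod_restrict]
      refine (ae_restrict_iff' (measurableSet_Ioc.prod measurableSet_Ioi)).2
        (Eventually.of_forall ?_)
      rintro ⟨s, r⟩ ⟨hs, hr⟩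
      exact kernelFun_integrand_le hα0 hα1 l hs.2 hr
  rw [intervalIntegral.integral_of_le ht]
  unfold kernelFun
  rw [integral_integral_swap hint]
  refine setIntegral_congr_fun measurableSet_Ioi fun r hr => ?_
  have hr : 0 < r := hr
  rw [integral_const_mul, ← intervalIntegral.integral_of_le ht, max_eq_left ht]
  congr 1
  have h1 : ∫ s in (0 : ℝ)..t, expIntegral r (l + 1) (max s 0) =
      ∫ s in (0 : ℝ)..t, expIntegral r (l + 1) s := by
    refine intervalIntegral.integral_congr fun s hs => ?_
    rw [uIcc_of_le ht] at hs
    simp only [max_eq_left hs.1]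
  rw [h1, intervalIntegral.integral_eq_sub_of_hasDerivAt
    (fun s _ => hasDerivAt_expIntegral_succ hr.ne' (l + 1) s)
    ((continuous_expIntegral r (l + 1)).intervalIntegrable _ _), expIntegral_succ_zero, sub_zero]

lemma integral_exp_neg_mul {b : ℝ} (hb : 0 < b) :
    IntegrableOn (fun t : ℝ => Real.exp (-(b * t))) (Ioi 0) ∧
      ∫ t in Ioi (0 : ℝ), Real.exp (-(b * t)) = 1 / b := by
  have h := integral_rpow_mul_exp (q := 0) (by norm_num) hb
  simpa [Real.rpow_neg_one] using h

lemma integral_mul_exp_neg_mul {b : ℝ} (hb : 0 < b) :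
    IntegrableOn (fun t : ℝ => t * Real.exp (-(b * t))) (Ioi 0) ∧
      ∫ t in Ioi (0 : ℝ), t * Real.exp (-(b * t)) = 1 / b ^ 2 := by
  have h := integral_rpow_mul_exp (q := 1) (by norm_num) hb
  have e : (-(1 + 1) : ℝ) = -((2 : ℕ) : ℝ) := by norm_num
  rw [e, Real.rpow_neg hb.le, Real.rpow_natCast] at h
  have e2 : Real.Gamma (1 + 1) = 1 := by
    rw [Real.Gamma_add_one one_ne_zero, Real.Gamma_one, one_mul]
  simpa [e2] using h

/-- The Laplace transform of the first solution kernel. -/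
lemma laplace_kernelFun {α : ℝ} (hα0 : 0 < α) (hα1 : α < 1) {s x : ℝ} (hs : 0 < s)
    (hx : x ∈ Icc (0 : ℝ) 1) :
    IntegrableOn (fun t => Real.exp (-(s * t)) * kernelFun α 0 t x) (Ioi 0) ∧
      ∫ t in Ioi 0, Real.exp (-(s * t)) * kernelFun α 0 t x =
        1 / s * (x / ((1 - x) + x * s ^ α)) := by
  have hbound : IntegrableOn (fun t : ℝ => Real.exp (-(s * t)) * (t + 1)) (Ioi 0) := by
    refine IntegrableOn.congr_fun
      ((integral_mul_exp_neg_mul hs).1.add (integral_exp_neg_mul hs).1) (fun t _ => ?_)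
      measurableSet_Ioi
    simp only [Pi.add_apply]; ring
  have hint : Integrable (Function.uncurry fun t r : ℝ =>
      Real.exp (-(s * t)) * (spectralDensity α r x * expIntegral r (0 + 1) (max t 0)))
      ((volume.restrict (Ioi 0)).prod (volume.restrict (Ioi 0))) := by
    refine Integrable.mono' (hbound.mul_prod ((integrableOn_rpow_div hα0 hα1).const_mul
      (1 / (Real.pi * Real.sin (Real.pi * α))))) ?_ ?_
    · rw [Measure.prod_restrict]
      refine ContinuousOn.aestronglyMeasurable ?_ (measurableSet_Ioi.prod measurableSet_Ioi)
      refine ContinuousOn.mul (by fun_prop) ?_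
      exact (continuousOn_kernelFun_integrand hα0 hα1 0 hx).mono (prod_mono_left (subset_univ _))
    · rw [Measure.prod_restrict]
      refine (ae_restrict_iff' (measurableSet_Ioi.prod measurableSet_Ioi)).2
        (Eventually.of_forall ?_)
      rintro ⟨t, r⟩ ⟨ht, hr⟩
      have ht : 0 < t := ht
      have h1 := kernelFun_integrand_le (x := x) hα0 hα1 0 (le_refl t) hr
      simp only [Function.uncurry]
      rw [norm_mul, Real.norm_of_nonneg (Real.exp_pos _).le]
      refine (mul_le_mul_of_nonneg_left h1 (Real.exp_pos _).le).trans_eq ?_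
      rw [max_eq_left ht.le, zero_add, pow_one, pow_zero]
      ring
  have hsplit : ∀ t : ℝ, Real.exp (-(s * t)) * kernelFun α 0 t x = ∫ r in Ioi 0,
      Real.exp (-(s * t)) * (spectralDensity α r x * expIntegral r (0 + 1) (max t 0)) :=
    fun t => (integral_const_mul _ _).symm
  simp_rw [hsplit]
  refine ⟨hint.integral_prod_left, ?_⟩
  rw [integral_integral_swap hint, ← (integral_spectralDensity hα0 hα1 hs hx).2,
    ← integral_const_mul]
  refine setIntegral_congr_fun measurableSet_Ioi fun r hr => ?_
  have hr : 0 < r := hr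
  have hsr : 0 < s + r := by positivity
  have e1 : ∀ t ∈ Ioi (0 : ℝ), Real.exp (-(s * t)) * (spectralDensity α r x *
      expIntegral r (0 + 1) (max t 0)) = spectralDensity α r x / r *
      (Real.exp (-(s * t)) - Real.exp (-((s + r) * t))) := by
    intro t ht
    rw [max_eq_left (le_of_lt ht)]
    simp only [expIntegral]
    rw [show -((s + r) * t) = -(s * t) + -(r * t) by ring, Real.exp_add]
    simp
    ring
  rw [setIntegral_congr_fun measurableSet_Ioi e1, integral_const_mul,
    integral_sub (integral_exp_neg_mul hs).1 (integral_exp_neg_mul hsr).1,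
    (integral_exp_neg_mul hs).2, (integral_exp_neg_mul hsr).2]
  field_simp
  ring

/-- The symbol of the fractional differential operator, in the time domain. -/
def fracKernel (α x t : ℝ) : ℝ := (1 - x) + x * ((Real.Gamma (1 - α))⁻¹ * t ^ (-α))

lemma laplace_fracKernel {α : ℝ} (hα1 : α < 1) {s : ℝ} (x : ℝ) (hs : 0 < s) :
    IntegrableOn (fun t => Real.exp (-(s * t)) * fracKernel α x t) (Ioi 0) ∧
      ∫ t in Ioi 0, Real.exp (-(s * t)) * fracKernel α x t = ((1 - x) + x * s ^ α) / s := by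
  have h1 := integral_exp_neg_mul hs
  have h2 := integral_rpow_mul_exp (q := -α) (by linarith) hs
  have hG : Real.Gamma (1 - α) ≠ 0 := (Real.Gamma_pos_of_pos (by linarith)).ne'
  have e : (fun t => Real.exp (-(s * t)) * fracKernel α x t) = fun t =>
      (1 - x) * Real.exp (-(s * t)) +
        x * (Real.Gamma (1 - α))⁻¹ * (t ^ (-α) * Real.exp (-(s * t))) := by
    funext t; unfold fracKernel; ring
  rw [e]
  refine ⟨(h1.1.const_mul _).add (h2.1.const_mul _), ?_⟩
  rw [integral_add (h1.1.const_mul _) (h2.1.const_mul _), integral_const_mul, integral_const_mul,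
    h1.2, h2.2, show -(-α + 1) = α - 1 by ring, show -α + 1 = 1 - α by ring,
    Real.rpow_sub_one hs.ne']
  field_simp

lemma integrableOn_fracKernel {α : ℝ} (hα1 : α < 1) (x T : ℝ) :
    IntegrableOn (fracKernel α x) (Ioc 0 T) := by
  rcases le_or_gt T 0 with hT | hT
  · rw [Ioc_eq_empty (not_lt.2 hT)]; exact integrableOn_empty
  rw [← intervalIntegrable_iff_integrableOn_Ioc_of_le hT.le]
  unfold fracKernel
  exact intervalIntegrable_const.add
    (((intervalIntegral.intervalIntegrable_rpow' (by linarith)).const_mul _).const_mul _)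

/-- The scalar kernel solves the integrated fractional equation. -/
theorem vconv_kernelFun_fracKernel {α : ℝ} (hα0 : 0 < α) (hα1 : α < 1) {x : ℝ}
    (hx : x ∈ Icc (0 : ℝ) 1) {t : ℝ} (ht : 0 ≤ t) :
    vconv (ContinuousLinearMap.mul ℝ ℝ) (fun t => kernelFun α 0 t x) (fracKernel α x) t = x * t := by
  set K : ℝ → ℝ := fun t => kernelFun α 0 t x with hK
  have hKc : Continuous K := (continuous_kernelFun hα0 hα1 0).comp
    (f := fun t : ℝ => (t, (⟨x, hx⟩ : Icc (0 : ℝ) 1))) (by fun_prop)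
  -- With q = (1 - x) + x s^α, the transforms multiply to (1/s)(x/q) · (q/s) = x/s², the transform
  -- of x t. So the transform of D vanishes and D = 0 by uniqueness.
  set D : ℝ → ℝ := fun t => vconv (ContinuousLinearMap.mul ℝ ℝ) K (fracKernel α x) t - x * t
    with hD
  have hcont : ContinuousOn D (Ioi 0) := by
    intro t ht
    have h1 : ContinuousOn (vconv (ContinuousLinearMap.mul ℝ ℝ) K (fracKernel α x)) (Icc 0 (t + 1)) :=
      continuousOn_vconv _ hKc.continuousOn (kernelFun_zero α 0 x) (integrableOn_fracKernel hα1 x _)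
    have h2 : Icc 0 (t + 1) ∈ 𝓝 t := Icc_mem_nhds ht (by linarith)
    have h3 := (h1 t (mem_of_mem_nhds h2)).continuousAt h2
    exact (h3.sub (by fun_prop)).continuousWithinAt
  have hden : ∀ s : ℝ, 0 < s → 0 < (1 - x) + x * s ^ α := by
    intro s hs
    have h3 := Real.rpow_pos_of_pos hs α
    rcases eq_or_lt_of_le hx.1 with h | h
    · rw [← h]; simp
    · have : 0 < x * s ^ α := by positivity
      linarith [hx.2]
  have hlap : ∀ s : ℝ, 0 < s → IntegrableOn (fun t => Real.exp (-(s * t)) * D t) (Ioi 0) ∧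
      ∫ t in Ioi 0, Real.exp (-(s * t)) * D t = 0 := by
    intro s hs
    have hb := laplace_fracKernel hα1 x hs
    have hk := laplace_kernelFun hα0 hα1 hs hx
    have hconv := integral_posConvolution hb.1 hk.1 (ContinuousLinearMap.mul ℝ ℝ)
    have hconvi := integrable_posConvolution hb.1 hk.1 (ContinuousLinearMap.mul ℝ ℝ)
    have he : ∀ t : ℝ, ∫ u in (0 : ℝ)..t, (ContinuousLinearMap.mul ℝ ℝ)
        (Real.exp (-(s * u)) * fracKernel α x u) (Real.exp (-(s * (t - u))) * kernelFun α 0 (t - u) x)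
        = Real.exp (-(s * t)) * vconv (ContinuousLinearMap.mul ℝ ℝ) K (fracKernel α x) t := by
      intro t
      unfold vconv
      rw [← intervalIntegral.integral_const_mul]
      congr 1
      funext u
      simp only [ContinuousLinearMap.mul_apply', hK]
      rw [show -(s * t) = -(s * u) + -(s * (t - u)) by ring, Real.exp_add]
      ring
    simp_rw [he] at hconv
    have hi1 : IntegrableOn (fun t => Real.exp (-(s * t)) *
        vconv (ContinuousLinearMap.mul ℝ ℝ) K (fracKernel α x) t) (Ioi 0) := by
      refine IntegrableOn.congr_fun hconvi.integrableOn (fun t ht => ?_) measurableSet_Ioi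
      rw [posConvolution, indicator_of_mem ht, he]
    have hi2 := integral_mul_exp_neg_mul hs
    have e : (fun t => Real.exp (-(s * t)) * D t) = fun t => Real.exp (-(s * t)) *
        vconv (ContinuousLinearMap.mul ℝ ℝ) K (fracKernel α x) t -
        x * (t * Real.exp (-(s * t))) := by
      funext t; simp only [hD]; ring
    rw [e]
    refine ⟨hi1.sub (hi2.1.const_mul x), ?_⟩
    rw [integral_sub hi1 (hi2.1.const_mul x), integral_const_mul, hi2.2, hconv, hb.2, hk.2,
      ContinuousLinearMap.mul_apply']
    have := hden s hs
    field_simp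
    ring
  rcases eq_or_lt_of_le ht with rfl | ht
  · simp [vconv]
  have h0 := eqOn_zero_of_laplace_eq_zero hcont (by simpa using (hlap 1 one_pos).1)
    (fun n => (hlap (n + 1) (by positivity)).2) t ht
  simp only [hD] at h0
  linarith

/-- The operator-valued solution kernels, as functions of the spectral parameter. -/
def solutionKernel {α : ℝ} (hα0 : 0 < α) (hα1 : α < 1) (l : ℕ) (t : ℝ) : C(Icc (0 : ℝ) 1, ℝ) :=
  ContinuousMap.curry ⟨_, continuous_kernelFun hα0 hα1 l⟩ t

lemma solutionKernel_apply {α : ℝ} (hα0 : 0 < α) (hα1 : α < 1) (l : ℕ) (t : ℝ)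
    (x : Icc (0 : ℝ) 1) : solutionKernel hα0 hα1 l t x = kernelFun α l t x := rfl

lemma continuous_solutionKernel {α : ℝ} (hα0 : 0 < α) (hα1 : α < 1) (l : ℕ) :
    Continuous (solutionKernel hα0 hα1 l) :=
  (ContinuousMap.curry ⟨_, continuous_kernelFun hα0 hα1 l⟩).continuous

lemma solutionKernel_zero {α : ℝ} (hα0 : 0 < α) (hα1 : α < 1) (l : ℕ) :
    solutionKernel hα0 hα1 l 0 = 0 := by
  ext x; exact kernelFun_zero α l x

lemma integral_continuousMap_apply {f : ℝ → C(Icc (0 : ℝ) 1, ℝ)} {a b : ℝ}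
    (hf : IntervalIntegrable f volume a b) (x : Icc (0 : ℝ) 1) :
    (∫ s in a..b, f s) x = ∫ s in a..b, f s x :=
  ((ContinuousMap.evalCLM ℝ x).intervalIntegral_comp_comm hf).symm

lemma solutionKernel_succ {α : ℝ} (hα0 : 0 < α) (hα1 : α < 1) (l : ℕ) {t : ℝ} (ht : 0 ≤ t) :
    solutionKernel hα0 hα1 (l + 1) t = ∫ s in (0 : ℝ)..t, solutionKernel hα0 hα1 l s := by
  ext x
  rw [integral_continuousMap_apply ((continuous_solutionKernel hα0 hα1 l).intervalIntegrable _ _)]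
  exact kernelFun_succ hα0 hα1 l ht x.2

/-- The coordinate function on `[0,1]`. -/
def coordFun : C(Icc (0 : ℝ) 1, ℝ) := ⟨fun x => x, continuous_subtype_val⟩

lemma coordFun_apply (x : Icc (0 : ℝ) 1) : coordFun x = x := rfl

/-- `fracKernel` as a function of the spectral parameter. -/
def fracKernelMap (α t : ℝ) : C(Icc (0 : ℝ) 1, ℝ) :=
  (1 - coordFun) + ((Real.Gamma (1 - α))⁻¹ * t ^ (-α)) • coordFun

lemma integrableOn_fracKernelMap {α : ℝ} (hα1 : α < 1) (T : ℝ) :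
    IntegrableOn (fracKernelMap α) (Ioc 0 T) := by
  rcases le_or_gt T 0 with hT | hT
  · rw [Ioc_eq_empty (not_lt.2 hT)]; exact integrableOn_empty
  have h1 : IntervalIntegrable (fun t : ℝ => (Real.Gamma (1 - α))⁻¹ * t ^ (-α)) volume 0 T :=
    (intervalIntegral.intervalIntegrable_rpow' (by linarith)).const_mul _
  have h2 : IntervalIntegrable (fun t : ℝ => ((Real.Gamma (1 - α))⁻¹ * t ^ (-α)) • coordFun)
      volume 0 T := ⟨h1.1.smul_const _, h1.2.smul_const _⟩
  exact (intervalIntegrable_iff_integrableOn_Ioc_of_le hT.le).1 (intervalIntegrable_const.add h2)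

lemma vconv_solutionKernel_fracKernelMap {α : ℝ} (hα0 : 0 < α) (hα1 : α < 1) {t : ℝ}
    (ht : 0 ≤ t) :
    vconv (ContinuousLinearMap.mul ℝ C(Icc (0 : ℝ) 1, ℝ)) (solutionKernel hα0 hα1 0)
      (fracKernelMap α) t = t • coordFun := by
  ext x
  unfold vconv
  rw [integral_continuousMap_apply]
  · have h := vconv_kernelFun_fracKernel hα0 hα1 x.2 ht
    unfold vconv at h
    rw [ContinuousMap.smul_apply, coordFun_apply, smul_eq_mul, mul_comm, ← h]
    congr 1
    funext s
    simp only [ContinuousLinearMap.mul_apply', ContinuousMap.mul_apply, solutionKernel_apply,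
      fracKernelMap, fracKernel, ContinuousMap.add_apply, ContinuousMap.sub_apply,
      ContinuousMap.one_apply, ContinuousMap.smul_apply, coordFun_apply, smul_eq_mul]
    ring
  · have h1 : IntervalIntegrable (fracKernelMap α) volume 0 t :=
      (intervalIntegrable_iff_integrableOn_Ioc_of_le ht).2 (integrableOn_fracKernelMap hα1 t)
    have h2 : Continuous fun s => solutionKernel hα0 hα1 0 (t - s) :=
      (continuous_solutionKernel hα0 hα1 0).comp (by fun_prop)
    exact h1.continuousOn_mul h2.continuousOn

/-! ### Superposition of resolvent kernels -/

/-- A spectral weight decaying like `1 / (1 + r)`. -/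
structure IsSpectralWeight (W : ℝ → ℝ) : Prop where
  continuousOn : ContinuousOn W (Ioi 0)
  bound : ∃ M, ∀ r, 0 < r → |W r| ≤ M * (1 / (1 + r))

lemma IsSpectralWeight.add {W W' : ℝ → ℝ} (h : IsSpectralWeight W) (h' : IsSpectralWeight W') :
    IsSpectralWeight fun r => W r + W' r := by
  obtain ⟨M, hM⟩ := h.bound
  obtain ⟨M', hM'⟩ := h'.bound
  refine ⟨h.1.add h'.1, M + M', fun r hr => (abs_add_le _ _).trans ?_⟩
  rw [add_mul]
  exact add_le_add (hM r hr) (hM' r hr)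

lemma IsSpectralWeight.const_mul {W : ℝ → ℝ} (h : IsSpectralWeight W) (c : ℝ) :
    IsSpectralWeight fun r => c * W r := by
  obtain ⟨M, hM⟩ := h.bound
  refine ⟨continuousOn_const.mul h.1, |c| * M, fun r hr => ?_⟩
  rw [abs_mul, mul_assoc]
  exact mul_le_mul_of_nonneg_left (hM r hr) (abs_nonneg c)

lemma isSpectralWeight_zero : IsSpectralWeight fun _ => 0 :=
  ⟨continuousOn_const, 0, fun r _ => by simp⟩

lemma isSpectralWeight_sum {ι : Type*} (s : Finset ι) {W : ι → ℝ → ℝ}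
    (h : ∀ i ∈ s, IsSpectralWeight (W i)) : IsSpectralWeight fun r => ∑ i ∈ s, W i r := by
  classical
  induction s using Finset.induction_on with
  | empty => simpa using isSpectralWeight_zero
  | insert a s ha ih =>
    simp only [Finset.sum_insert ha]
    exact (h a (Finset.mem_insert_self a s)).add
      (ih fun i hi => h i (Finset.mem_insert_of_mem hi))

lemma IsSpectralWeight.scale {W : ℝ → ℝ} (h : IsSpectralWeight W) {τ : ℝ} (hτ : 0 < τ) :
    IsSpectralWeight fun r => W (r * τ) := by
  obtain ⟨M, hM⟩ := h.bound
  refine ⟨h.1.comp (by fun_prop) fun r hr => mul_pos hr hτ, |M| * (1 + 1 / τ), fun r hr => ?_⟩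
  have h1 : 1 / (1 + r * τ) ≤ (1 + 1 / τ) * (1 / (1 + r)) := by
    rw [mul_one_div, div_le_div_iff₀ (by positivity) (by positivity)]
    have : (1 + 1 / τ) * (1 + r * τ) = 1 + r + r * τ + 1 / τ := by field_simp; ring
    rw [this]
    have : 0 < r * τ := by positivity
    have : 0 < 1 / τ := by positivity
    linarith
  calc |W (r * τ)| ≤ M * (1 / (1 + r * τ)) := hM _ (by positivity)
    _ ≤ |M| * (1 / (1 + r * τ)) := by gcongr; exact le_abs_self M
    _ ≤ |M| * ((1 + 1 / τ) * (1 / (1 + r))) := by gcongr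
    _ = _ := by ring

lemma isSpectralWeight_expIntegral (l : ℕ) {t : ℝ} (ht : 0 ≤ t) :
    IsSpectralWeight fun r => expIntegral r (l + 1) t := by
  refine ⟨?_, t ^ (l + 1) + t ^ l, fun r hr => ?_⟩
  · exact (continuousOn_expIntegral_prod (l + 1)).comp (f := fun r : ℝ => (t, r)) (by fun_prop)
      fun r hr => ⟨mem_univ _, hr⟩
  · rw [abs_of_nonneg (expIntegral_nonneg hr _ ht)]
    exact expIntegral_succ_le hr l ht

lemma spectralDensity_mul_weight_le {α : ℝ} (hα0 : 0 < α) (hα1 : α < 1) {W : ℝ → ℝ} {M : ℝ}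
    (hM : ∀ r, 0 < r → |W r| ≤ M * (1 / (1 + r))) {r : ℝ} (hr : 0 < r) (x : ℝ) :
    ‖spectralDensity α r x * W r‖ ≤ 1 / (Real.pi * Real.sin (Real.pi * α)) * M *
      (r ^ (-α) * (1 / (1 + r))) := by
  have h1 := spectralDensity_le (x := x) hα0 hα1 hr
  have h2 := spectralDensity_nonneg (x := x) hα0 hα1 hr.le
  have h3 := hM r hr
  rw [norm_mul, Real.norm_of_nonneg h2, Real.norm_eq_abs]
  calc _ ≤ (1 / (Real.pi * Real.sin (Real.pi * α)) * r ^ (-α)) * (M * (1 / (1 + r))) := by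
        gcongr
        exact h2.trans h1
    _ = _ := by ring

lemma IsSpectralWeight.integrableOn {α : ℝ} (hα0 : 0 < α) (hα1 : α < 1) {W : ℝ → ℝ}
    (h : IsSpectralWeight W) {x : ℝ} (hx : x ∈ Icc (0 : ℝ) 1) :
    IntegrableOn (fun r => spectralDensity α r x * W r) (Ioi 0) := by
  obtain ⟨M, hM⟩ := h.bound
  refine Integrable.mono' ((integrableOn_rpow_div hα0 hα1).const_mul _) ?_
    ((ae_restrict_iff' measurableSet_Ioi).2
      (Eventually.of_forall fun r hr => spectralDensity_mul_weight_le hα0 hα1 hM hr x))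
  refine ContinuousOn.aestronglyMeasurable (ContinuousOn.mul ?_ h.1) measurableSet_Ioi
  exact (continuousOn_spectralDensity hα0 hα1).comp (f := fun r : ℝ => (r, x))
    (by fun_prop) fun r hr => ⟨hr, hx⟩

lemma IsSpectralWeight.continuous_integral {α : ℝ} (hα0 : 0 < α) (hα1 : α < 1) {W : ℝ → ℝ}
    (h : IsSpectralWeight W) :
    Continuous fun x : Icc (0 : ℝ) 1 => ∫ r in Ioi 0, spectralDensity α r x * W r := by
  obtain ⟨M, hM⟩ := h.bound
  refine continuous_of_dominated (bound := fun r => 1 / (Real.pi * Real.sin (Real.pi * α)) * M *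
      (r ^ (-α) * (1 / (1 + r)))) (fun x => (h.integrableOn hα0 hα1 x.2).aestronglyMeasurable)
    (fun x => (ae_restrict_iff' measurableSet_Ioi).2 (Eventually.of_forall fun r hr =>
      spectralDensity_mul_weight_le hα0 hα1 hM hr x))
    ((integrableOn_rpow_div hα0 hα1).const_mul _)
    ((ae_restrict_iff' measurableSet_Ioi).2 (Eventually.of_forall fun r hr => ?_))
  refine Continuous.mul ?_ continuous_const
  exact (continuousOn_spectralDensity hα0 hα1).comp_continuous
    (f := fun x : Icc (0 : ℝ) 1 => (r, (x : ℝ))) (by fun_prop) fun x => ⟨hr, x.2⟩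

open Classical in
/-- The superposition `x ↦ ∫₀^∞ σ_r(x) W(r) dr`. -/
def superpose (α : ℝ) (W : ℝ → ℝ) : C(Icc (0 : ℝ) 1, ℝ) :=
  if h : Continuous fun x : Icc (0 : ℝ) 1 => ∫ r in Ioi 0, spectralDensity α r x * W r then ⟨_, h⟩
  else 0

lemma superpose_apply {α : ℝ} (hα0 : 0 < α) (hα1 : α < 1) {W : ℝ → ℝ}
    (h : IsSpectralWeight W) (x : Icc (0 : ℝ) 1) :
    superpose α W x = ∫ r in Ioi 0, spectralDensity α r x * W r := by
  rw [superpose, dif_pos (h.continuous_integral hα0 hα1)]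
  rfl

lemma superpose_congr {α : ℝ} (hα0 : 0 < α) (hα1 : α < 1) {W W' : ℝ → ℝ}
    (h : IsSpectralWeight W) (h' : IsSpectralWeight W') (he : ∀ r, 0 < r → W r = W' r) :
    superpose α W = superpose α W' := by
  ext x
  rw [superpose_apply hα0 hα1 h, superpose_apply hα0 hα1 h']
  refine setIntegral_congr_fun measurableSet_Ioi fun r hr => ?_
  simp only [he r hr]

lemma superpose_add {α : ℝ} (hα0 : 0 < α) (hα1 : α < 1) {W W' : ℝ → ℝ}
    (h : IsSpectralWeight W) (h' : IsSpectralWeight W') :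
    superpose α (fun r => W r + W' r) = superpose α W + superpose α W' := by
  ext x
  rw [ContinuousMap.add_apply, superpose_apply hα0 hα1 h, superpose_apply hα0 hα1 h',
    superpose_apply hα0 hα1 (h.add h')]
  simp only [mul_add]
  exact integral_add (h.integrableOn hα0 hα1 x.2) (h'.integrableOn hα0 hα1 x.2)

lemma superpose_const_mul {α : ℝ} (hα0 : 0 < α) (hα1 : α < 1) {W : ℝ → ℝ}
    (h : IsSpectralWeight W) (c : ℝ) :
    superpose α (fun r => c * W r) = c • superpose α W := by
  ext x
  rw [ContinuousMap.smul_apply, superpose_apply hα0 hα1 h, superpose_apply hα0 hα1 (h.const_mul c),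
    smul_eq_mul, ← integral_const_mul]
  congr 1
  funext r
  ring

lemma superpose_sum {α : ℝ} (hα0 : 0 < α) (hα1 : α < 1) {ι : Type*} (s : Finset ι)
    {W : ι → ℝ → ℝ} (h : ∀ i ∈ s, IsSpectralWeight (W i)) :
    superpose α (fun r => ∑ i ∈ s, W i r) = ∑ i ∈ s, superpose α (W i) := by
  classical
  induction s using Finset.induction_on with
  | empty =>
    ext x
    simp only [Finset.sum_empty]
    rw [superpose_apply hα0 hα1 isSpectralWeight_zero]
    simp
  | insert a s ha ih =>
    simp only [Finset.sum_insert ha]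
    rw [superpose_add hα0 hα1 (h a (Finset.mem_insert_self a s))
      (isSpectralWeight_sum s fun i hi => h i (Finset.mem_insert_of_mem hi)),
      ih fun i hi => h i (Finset.mem_insert_of_mem hi)]

lemma solutionKernel_eq_superpose {α : ℝ} (hα0 : 0 < α) (hα1 : α < 1) (l : ℕ) {t : ℝ}
    (ht : 0 ≤ t) :
    solutionKernel hα0 hα1 l t = superpose α fun r => expIntegral r (l + 1) t := by
  ext x
  rw [superpose_apply hα0 hα1 (isSpectralWeight_expIntegral l ht), solutionKernel_apply, kernelFun,
    max_eq_left ht]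

/-! ### The discrete kernel -/

/-- The identity (δ_k + ρ) · resolvent = 1 is a recursion that expresses the n-th coefficient by
earlier ones, divided by δ_k(0) + ρ > 0. -/
lemma continuousOn_coeff_bdfResolvent {k : ℕ} (hk : 1 ≤ k) (n : ℕ) :
    ContinuousOn (fun ρ => PowerSeries.coeff n (bdfResolvent k ρ)) (Ioi 0) := by
  induction n using Nat.strong_induction_on with
  | _ n ih =>
    have h0 : 0 < bdfSymbol k 0 := bdfSymbol_zero_pos hk (by norm_num)
    have key : ∀ ρ ∈ Ioi (0 : ℝ), PowerSeries.coeff n (bdfResolvent k ρ) =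
        ((if n = 0 then 1 else 0) - ∑ i ∈ Finset.range n, (bdfPoly k).coeff (i + 1) *
          PowerSeries.coeff (n - (i + 1)) (bdfResolvent k ρ)) / (bdfSymbol k 0 + ρ) := by
      intro ρ hρ
      have hρ : 0 < ρ := hρ
      have h := congrArg (PowerSeries.coeff n) (bdfPoly_mul_bdfResolvent hk hρ.le)
      rw [Polynomial.coe_add, Polynomial.coe_C, add_mul, map_add, PowerSeries.coeff_mul, PowerSeries.coeff_one,
        Finset.Nat.sum_antidiagonal_eq_sum_range_succ
          (fun i j => PowerSeries.coeff i (bdfPoly k : PowerSeries ℝ) *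
            PowerSeries.coeff j (bdfResolvent k ρ)), Finset.sum_range_succ',
        PowerSeries.coeff_C_mul] at h
      simp only [Polynomial.coeff_coe, coeff_zero_bdfPoly, Nat.sub_zero] at h
      rw [eq_div_iff (by positivity)]
      linear_combination h
    refine ContinuousOn.congr ?_ key
    refine ContinuousOn.div (ContinuousOn.sub continuousOn_const (continuousOn_finsetSum _
      fun i hi => continuousOn_const.mul (ih _ ?_))) (by fun_prop) fun ρ hρ => ?_
    · have := Finset.mem_range.1 hi
      omega
    · have hρ : 0 < ρ := hρ
      positivity

lemma exists_abs_coeff_bdfResolvent_le {k : ℕ} (hk1 : 1 ≤ k) (hk : k ≤ 6) :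
    ∃ C : ℝ, 0 < C ∧ ∀ ρ : ℝ, 0 < ρ → ∀ n : ℕ,
      |PowerSeries.coeff n (bdfResolvent k ρ)| ≤ C * (1 / (1 + ρ)) := by
  obtain ⟨e, he, -, C, hC, h1, h2, -⟩ := exists_kernel_bounds hk1 hk
  refine ⟨2 * C, by positivity, fun ρ hρ n => ?_⟩
  rw [mul_one_div, le_div_iff₀ (by positivity)]
  rcases le_total ρ 1 with h | h
  · have h3 : Real.exp (-(e / 2 * ρ)) ^ n ≤ 1 :=
      pow_le_one₀ (Real.exp_pos _).le (Real.exp_le_one_iff.2 (by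
        have : 0 < e / 2 * ρ := by positivity
        linarith))
    have h4 := h1 ρ hρ h n
    calc _ ≤ C * 1 * (1 + 1) := by
          gcongr
          exact h4.trans (by gcongr)
      _ = _ := by ring
  · have h3 : Real.exp (-e) ^ n ≤ 1 :=
      pow_le_one₀ (Real.exp_pos _).le (Real.exp_le_one_iff.2 (by linarith))
    have h4 := h2 ρ h n
    calc _ ≤ C / ρ * 1 * (ρ + ρ) := by
          gcongr
          exact h4.trans (by gcongr)
      _ = _ := by field_simp; ring

lemma isSpectralWeight_coeff_bdfResolvent {k : ℕ} (hk1 : 1 ≤ k) (hk : k ≤ 6) (n : ℕ) :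
    IsSpectralWeight fun ρ => PowerSeries.coeff n (bdfResolvent k ρ) := by
  obtain ⟨C, -, h⟩ := exists_abs_coeff_bdfResolvent_le hk1 hk
  exact ⟨continuousOn_coeff_bdfResolvent hk1 n, C, fun ρ hρ => h ρ hρ n⟩

/-- The kernel of the discrete solution operator. -/
def discreteKernel (α : ℝ) (k : ℕ) (τ : ℝ) (n : ℕ) : C(Icc (0 : ℝ) 1, ℝ) :=
  superpose α fun r => τ * PowerSeries.coeff n (bdfResolvent k (r * τ))

lemma isSpectralWeight_discreteKernel {k : ℕ} (hk1 : 1 ≤ k) (hk : k ≤ 6) {τ : ℝ} (hτ : 0 < τ)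
    (n : ℕ) : IsSpectralWeight fun r => τ * PowerSeries.coeff n (bdfResolvent k (r * τ)) :=
  ((isSpectralWeight_coeff_bdfResolvent hk1 hk n).scale hτ).const_mul τ

/-! ### The generating function of the discrete kernel -/

lemma taylorCoeff_of_hasSum {f : ℝ → ℝ} {c : ℕ → ℝ}
    (h : ∀ᶠ z in 𝓝 (0 : ℝ), HasSum (fun n => z ^ n * c n) (f z)) :
    AnalyticAt ℝ f 0 ∧ ∀ n, taylorCoeff f n = c n := by
  have h1 : HasFPowerSeriesAt f (FormalMultilinearSeries.ofScalars ℝ c) 0 := by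
    rw [hasFPowerSeriesAt_iff]
    simpa [FormalMultilinearSeries.coeff_ofScalars] using h
  refine ⟨h1.analyticAt, fun n => ?_⟩
  have h2 := congrArg (fun p => p.coeff n)
    (h1.analyticAt.hasFPowerSeriesAt.eq_formalMultilinearSeries h1)
  simpa [FormalMultilinearSeries.coeff_ofScalars, taylorCoeff] using h2

/-- The coefficients are bounded in n, so the series converges for |ξ| < 1. The Cauchy product with
δ_k + ρ is 1, which also shows that the denominator does not vanish. -/
lemma hasSum_bdfResolvent {k : ℕ} (hk1 : 1 ≤ k) (hk : k ≤ 6) {ρ ξ : ℝ} (hρ : 0 < ρ)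
    (hξ : |ξ| < 1) :
    HasSum (fun n => ξ ^ n * PowerSeries.coeff n (bdfResolvent k ρ)) (1 / (bdfSymbol k ξ + ρ)) := by
  obtain ⟨C, hC, hb⟩ := exists_abs_coeff_bdfResolvent_le hk1 hk
  have hs : Summable fun n => ‖ξ ^ n * PowerSeries.coeff n (bdfResolvent k ρ)‖ := by
    refine Summable.of_nonneg_of_le (fun n => norm_nonneg _) (fun n => ?_)
      ((summable_geometric_of_lt_one (abs_nonneg ξ) hξ).mul_right (C * (1 / (1 + ρ))))
    rw [norm_mul, norm_pow, Real.norm_eq_abs, Real.norm_eq_abs]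
    exact mul_le_mul_of_nonneg_left (hb ρ hρ n) (by positivity)
  set P : Polynomial ℝ := bdfPoly k + Polynomial.C ρ with hP
  have hz : ∀ n ∉ Finset.range (P.natDegree + 1), ξ ^ n * P.coeff n = 0 := by
    intro n hn
    rw [Polynomial.coeff_eq_zero_of_natDegree_lt (by simpa using hn), mul_zero]
  have hsP : Summable fun n => ‖ξ ^ n * P.coeff n‖ := by
    refine summable_of_ne_finset_zero (s := Finset.range (P.natDegree + 1)) fun n hn => ?_
    rw [hz n hn, norm_zero]
  have hPsum : ∑' n, ξ ^ n * P.coeff n = bdfSymbol k ξ + ρ := by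
    rw [tsum_eq_sum hz, show bdfSymbol k ξ + ρ = P.eval ξ by rw [hP]; simp [eval_bdfPoly],
      Polynomial.eval_eq_sum_range]
    exact Finset.sum_congr rfl fun i _ => mul_comm _ _
  have hprod := tsum_mul_tsum_eq_tsum_sum_antidiagonal_of_summable_norm hsP hs
  have hone : ∀ n, ∑ p ∈ Finset.HasAntidiagonal.antidiagonal n, ξ ^ p.1 * P.coeff p.1 *
      (ξ ^ p.2 * PowerSeries.coeff p.2 (bdfResolvent k ρ)) = if n = 0 then 1 else 0 := by
    intro n
    have h := congrArg (PowerSeries.coeff n) (bdfPoly_mul_bdfResolvent hk1 hρ.le)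
    rw [PowerSeries.coeff_mul, PowerSeries.coeff_one] at h
    have : ∑ p ∈ Finset.HasAntidiagonal.antidiagonal n, ξ ^ p.1 * P.coeff p.1 *
        (ξ ^ p.2 * PowerSeries.coeff p.2 (bdfResolvent k ρ)) = ξ ^ n *
        ∑ p ∈ Finset.HasAntidiagonal.antidiagonal n, PowerSeries.coeff p.1 (P : PowerSeries ℝ) *
          PowerSeries.coeff p.2 (bdfResolvent k ρ) := by
      rw [Finset.mul_sum]
      refine Finset.sum_congr rfl fun p hp => ?_
      rw [← Finset.HasAntidiagonal.mem_antidiagonal.1 hp, pow_add, Polynomial.coeff_coe]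
      ring
    rw [this, h]
    split_ifs with h0
    · rw [h0]; simp
    · simp
  simp_rw [hone, hPsum] at hprod
  rw [tsum_ite_eq] at hprod
  have hne : bdfSymbol k ξ + ρ ≠ 0 := by
    intro h
    rw [h, zero_mul] at hprod
    exact zero_ne_one hprod
  have hval : ∑' n, ξ ^ n * PowerSeries.coeff n (bdfResolvent k ρ) = 1 / (bdfSymbol k ξ + ρ) := by
    rw [eq_div_iff hne, mul_comm]; exact hprod
  rw [← hval]
  exact hs.of_norm.hasSum

/-- Summing under the integral gives ∫ σ_r(x) / (δ_k(ξ)/τ + r) dr, the Stieltjes representation at s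
= δ_k(ξ)/τ. Real ξ suffice, and for them δ_k(ξ) > 0. -/
lemma hasSum_discreteKernel {α : ℝ} (hα0 : 0 < α) (hα1 : α < 1) {k : ℕ} (hk1 : 1 ≤ k) (hk : k ≤ 6)
    {τ ξ : ℝ} (hτ : 0 < τ) (hξ : |ξ| < 1) (x : Icc (0 : ℝ) 1) :
    HasSum (fun n => ξ ^ n * discreteKernel α k τ n x)
      (x / ((1 - x) + x * (bdfSymbol k ξ / τ) ^ α)) := by
  obtain ⟨C, hC, hb⟩ := exists_abs_coeff_bdfResolvent_le hk1 hk
  have hδ : 0 < bdfSymbol k ξ := bdfSymbol_zero_pos hk1 (abs_lt.1 hξ).2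
  set F : ℕ → ℝ → ℝ := fun n r => ξ ^ n * (spectralDensity α r x *
    (τ * PowerSeries.coeff n (bdfResolvent k (r * τ)))) with hF
  have hFi : ∀ n, Integrable (F n) (volume.restrict (Ioi 0)) := fun n =>
    ((isSpectralWeight_discreteKernel hk1 hk hτ n).integrableOn hα0 hα1 x.2).const_mul _
  have hstep := integral_spectralDensity_step hα0 hα1 hτ x.2
  have hsum : Summable fun n => ∫ r in Ioi 0, ‖F n r‖ := by
    refine Summable.of_nonneg_of_le (fun n => integral_nonneg fun r => norm_nonneg _) (fun n => ?_)
      ((summable_geometric_of_lt_one (abs_nonneg ξ) hξ).mul_right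
        (C * ∫ r in Ioi 0, spectralDensity α r x * (τ / (1 + r * τ))))
    rw [← integral_const_mul, ← integral_const_mul]
    refine setIntegral_mono_on (hFi n).norm ((hstep.1.const_mul C).const_mul _) measurableSet_Ioi
      fun r hr => ?_
    have hr : 0 < r := hr
    have h1 := hb (r * τ) (by positivity) n
    have h2 := spectralDensity_nonneg (x := x) hα0 hα1 hr.le
    rw [hF, norm_mul, norm_pow, Real.norm_eq_abs, norm_mul, Real.norm_of_nonneg h2, norm_mul,
      Real.norm_of_nonneg hτ.le, Real.norm_eq_abs]
    calc _ ≤ |ξ| ^ n * (spectralDensity α r x * (τ * (C * (1 / (1 + r * τ))))) := by gcongr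
      _ = _ := by ring
  have h := hasSum_integral_of_summable_integral_norm hFi hsum
  have e1 : ∀ n, ∫ r in Ioi 0, F n r = ξ ^ n * discreteKernel α k τ n x := by
    intro n
    rw [discreteKernel, superpose_apply hα0 hα1 (isSpectralWeight_discreteKernel hk1 hk hτ n),
      ← integral_const_mul]
  have e2 : ∫ r in Ioi 0, ∑' n, F n r = x / ((1 - x) + x * (bdfSymbol k ξ / τ) ^ α) := by
    rw [← (integral_spectralDensity hα0 hα1 (div_pos hδ hτ) x.2).2]
    refine setIntegral_congr_fun measurableSet_Ioi fun r hr => ?_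
    have hr : 0 < r := hr
    have h1 := (hasSum_bdfResolvent hk1 hk (show 0 < r * τ by positivity) hξ).mul_left
      (spectralDensity α r x * τ)
    have h2 : HasSum (fun n => F n r) (spectralDensity α r x * τ * (1 / (bdfSymbol k ξ + r * τ))) := by
      rw [show (fun n => F n r) = fun n => spectralDensity α r x * τ *
        (ξ ^ n * PowerSeries.coeff n (bdfResolvent k (r * τ))) by funext n; simp only [hF]; ring]
      exact h1
    rw [h2.tsum_eq]
    field_simp
  simp_rw [e1] at h
  rw [e2] at h
  exact h

lemma contDiffAt_bdfSymbol_rpow {k : ℕ} (hk : 1 ≤ k) (β : ℝ) :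
    ContDiffAt ℝ ∞ (fun ξ => bdfSymbol k ξ ^ β) 0 := by
  refine ContDiffAt.rpow_const_of_ne ?_ (bdfSymbol_zero_pos hk (by norm_num)).ne'
  unfold bdfSymbol
  fun_prop

lemma taylorCoeff_const_add_mul {f : ℝ → ℝ} (hf : ContDiffAt ℝ ∞ f 0) (a b : ℝ) (n : ℕ) :
    taylorCoeff (fun ξ => a + b * f ξ) n = (if n = 0 then a else 0) + b * taylorCoeff f n := by
  have hf' : ContDiffAt ℝ n f 0 := hf.of_le (by exact_mod_cast le_top)
  unfold taylorCoeff
  rw [iteratedDeriv_fun_add contDiffAt_const (contDiffAt_const.mul hf'), iteratedDeriv_const,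
    iteratedDeriv_const_mul_field]
  split_ifs with h
  · rw [h]; simp
  · ring

lemma bdfWeight_natCast (m k j : ℕ) : bdfWeight m k j = (bdfPoly k ^ m).coeff j := by
  have h := taylorCoeff_aeval (𝕜 := ℝ) (bdfPoly k ^ m) j
  rw [RCLike.ofReal_real_eq_id, id] at h
  rw [← h, bdfWeight, taylorCoeff]
  congr 2
  funext ξ
  rw [Real.rpow_natCast, Polynomial.coe_aeval_eq_eval, Polynomial.eval_pow, eval_bdfPoly]

/-- The weights of the discrete fractional operator, as functions of the spectral parameter. -/
def fracWeight (α : ℝ) (k : ℕ) (τ : ℝ) (j : ℕ) : C(Icc (0 : ℝ) 1, ℝ) :=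
  (if j = 0 then 1 - coordFun else 0) + (τ ^ (-α) * bdfWeight α k j) • coordFun

/-- The generating functions x/((1 - x) + x (δ_k/τ)^α) and (1 - x) + x (δ_k/τ)^α have the constant
product x. Comparing Taylor coefficients, the discrete kernel inverts the discrete operator up to
the factor x. -/
theorem sum_discreteKernel_mul_fracWeight {α : ℝ} (hα0 : 0 < α) (hα1 : α < 1) {k : ℕ}
    (hk1 : 1 ≤ k) (hk : k ≤ 6) {τ : ℝ} (hτ : 0 < τ) (n : ℕ) :
    ∑ i ∈ Finset.range (n + 1), discreteKernel α k τ i * fracWeight α k τ (n - i) =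
      if n = 0 then coordFun else 0 := by
  ext x
  set F : ℝ → ℝ := fun ξ => x / ((1 - x) + x * (bdfSymbol k ξ / τ) ^ α) with hF
  set G : ℝ → ℝ := fun ξ => (1 - x) + x * τ ^ (-α) * bdfSymbol k ξ ^ α with hG
  have hev : ∀ᶠ ξ in 𝓝 (0 : ℝ), |ξ| < 1 :=
    (continuous_abs.tendsto (0 : ℝ)).eventually_lt_const (by simp)
  obtain ⟨hFa, hFt⟩ := taylorCoeff_of_hasSum (f := F)
    (hev.mono fun ξ hξ => hasSum_discreteKernel hα0 hα1 hk1 hk hτ hξ x)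
  have hGc : ContDiffAt ℝ ∞ G 0 :=
    contDiffAt_const.add (contDiffAt_const.mul (contDiffAt_bdfSymbol_rpow hk1 α))
  -- The constant is written in this form so that `taylorCoeff_const_add_mul` evaluates its Taylor
  -- coefficients.
  have hFG : F * G =ᶠ[𝓝 0] fun ξ => (x : ℝ) + 0 * (fun _ => (0 : ℝ)) ξ := by
    filter_upwards [hev] with ξ hξ
    have hδ : 0 < bdfSymbol k ξ := bdfSymbol_zero_pos hk1 (abs_lt.1 hξ).2
    have e : G ξ = (1 - x) + x * (bdfSymbol k ξ / τ) ^ α := by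
      rw [hG, Real.div_rpow hδ.le hτ.le, Real.rpow_neg hτ.le]
      ring
    have hpos : 0 < (1 - x) + x * (bdfSymbol k ξ / τ) ^ α := by
      have h3 := Real.rpow_pos_of_pos (div_pos hδ hτ) α
      have hx := x.2
      rcases eq_or_lt_of_le hx.1 with h | h
      · rw [← h]; simp
      · have : 0 < x * (bdfSymbol k ξ / τ) ^ α := by positivity
        linarith [hx.2]
    rw [Pi.mul_apply, e, hF, div_mul_cancel₀ _ hpos.ne']
    ring
  have h := taylorCoeff_mul (hFa.contDiffAt) hGc n
  rw [taylorCoeff_congr hFG, taylorCoeff_const_add_mul contDiffAt_const] at h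
  have hGt : ∀ j, taylorCoeff G j = fracWeight α k τ j x := by
    intro j
    rw [hG, taylorCoeff_const_add_mul (contDiffAt_bdfSymbol_rpow hk1 α)]
    have : taylorCoeff (fun ξ => bdfSymbol k ξ ^ α) j = bdfWeight α k j := rfl
    rw [this, fracWeight]
    split_ifs <;> simp [coordFun_apply] <;> ring
  rw [ContinuousMap.sum_apply]
  simp only [ContinuousMap.mul_apply]
  simp_rw [hFt, hGt] at h
  rw [← h]
  split_ifs <;> simp [coordFun_apply]

/-! ### A functional calculus for symmetric contractions -/

section FunctionalCalculus

variable {H : Type*} [NormedAddCommGroup H] [InnerProductSpace ℝ H]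

local notation "⟪" x ", " y "⟫" => inner ℝ x y

lemma norm_aeval_apply_le_of_finiteDimensional {W : Type*} [NormedAddCommGroup W]
    [InnerProductSpace ℝ W] [FiniteDimensional ℝ W] {T : W →ₗ[ℝ] W} (hT : T.IsSymmetric)
    (h0 : ∀ u, 0 ≤ ⟪T u, u⟫) (h1 : ∀ u, ⟪T u, u⟫ ≤ ⟪u, u⟫) (p : Polynomial ℝ) {M : ℝ}
    (hM : ∀ x ∈ Icc (0 : ℝ) 1, |p.eval x| ≤ M) (u : W) :
    ‖Polynomial.aeval T p u‖ ≤ M * ‖u‖ := by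
  have hM0 : 0 ≤ M := (abs_nonneg _).trans (hM 0 (by simp))
  set b := hT.eigenvectorBasis rfl with hb
  set lam := hT.eigenvalues rfl with hlam
  have hrange : ∀ i, lam i ∈ Icc (0 : ℝ) 1 := by
    intro i
    have h2 : ⟪T (b i), b i⟫ = lam i := by
      rw [hb, hT.apply_eigenvectorBasis, inner_smul_left, ← hb, real_inner_self_eq_norm_sq,
        b.orthonormal.1 i]
      simp [hlam]
    have h3 : ⟪b i, b i⟫ = 1 := by
      rw [real_inner_self_eq_norm_sq, b.orthonormal.1 i]; norm_num
    exact ⟨h2 ▸ h0 (b i), h2 ▸ h3 ▸ h1 (b i)⟩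
  have hpow : ∀ (j : ℕ) (i), b.repr ((T ^ j) u) i = lam i ^ j * b.repr u i := by
    intro j i
    induction j with
    | zero => simp
    | succ j ih =>
      rw [pow_succ', Module.End.mul_apply, hb, hT.eigenvectorBasis_apply_self_apply, ← hb, ih]
      simp only [RCLike.ofReal_real_eq_id, id, ← hlam]
      ring
  have hrepr : ∀ i, b.repr (Polynomial.aeval T p u) i = p.eval (lam i) * b.repr u i := by
    intro i
    rw [Polynomial.aeval_eq_sum_range, LinearMap.sum_apply, map_sum, Polynomial.eval_eq_sum_range,
      Finset.sum_mul]
    simp only [WithLp.ofLp_sum, Finset.sum_apply]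
    refine Finset.sum_congr rfl fun j _ => ?_
    rw [LinearMap.smul_apply, map_smul, PiLp.smul_apply, hpow, smul_eq_mul, mul_assoc]
  rw [← b.repr.norm_map, ← b.repr.norm_map u]
  refine abs_le_of_sq_le_sq' ?_ (by positivity) |>.2
  rw [mul_pow, EuclideanSpace.norm_sq_eq, EuclideanSpace.norm_sq_eq, Finset.mul_sum]
  refine Finset.sum_le_sum fun i _ => ?_
  rw [hrepr, norm_mul, mul_pow]
  have := hM _ (hrange i)
  rw [Real.norm_eq_abs]
  gcongr

/-- A symmetric operator `R` with `0 ≤ R ≤ 1`. -/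
structure IsSymmContraction (R : H →L[ℝ] H) : Prop where
  symm : ∀ u v, ⟪R u, v⟫ = ⟪u, R v⟫
  nonneg : ∀ u, 0 ≤ ⟪R u, u⟫
  le_one : ∀ u, ⟪R u, u⟫ ≤ ⟪u, u⟫

/-- Compress R to the Krylov space spanned by u, Ru, …, R^N u with N the degree of p. The
compression is again symmetric between 0 and 1 and agrees with R on all powers up to N, so the
finite-dimensional spectral theorem applies. -/
lemma IsSymmContraction.norm_aeval_apply_le {R : H →L[ℝ] H} (hR : IsSymmContraction R)
    (p : Polynomial ℝ) {M : ℝ} (hM : ∀ x ∈ Icc (0 : ℝ) 1, |p.eval x| ≤ M) (u : H) :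
    ‖Polynomial.aeval R p u‖ ≤ M * ‖u‖ := by
  set N := p.natDegree with hN
  set W : Submodule ℝ H := Submodule.span ℝ ((fun j : ℕ => (R ^ j) u) '' Finset.range (N + 1)) with hW
  have hfin : FiniteDimensional ℝ W :=
    FiniteDimensional.span_of_finite ℝ ((Finset.finite_toSet _).image _)
  have hmem : ∀ j, j ≤ N → (R ^ j) u ∈ W := fun j hj =>
    Submodule.subset_span ⟨j, by simpa using Nat.lt_succ_of_le hj, rfl⟩
  set T : W →ₗ[ℝ] W := (W.orthogonalProjectionOnto ∘L R ∘L W.subtypeL).toLinearMap with hT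
  have hTin : ∀ v w : W, ⟪T v, w⟫ = ⟪R v, (w : H)⟫ := fun v w =>
    W.inner_orthogonalProjectionOnto_eq_of_mem_right w (R v)
  have hTs : T.IsSymmetric := by
    intro v w
    rw [hTin, ← real_inner_comm v, hTin, hR.symm, real_inner_comm]
  set u' : W := ⟨u, by simpa using hmem 0 (Nat.zero_le _)⟩ with hu'
  have hpow : ∀ j, j ≤ N → (((T ^ j) u' : W) : H) = (R ^ j) u := by
    intro j hj
    induction j with
    | zero => simp [hu']
    | succ j ih =>
      rw [pow_succ', Module.End.mul_apply]
      have h1 : R ((T ^ j) u' : W) = (R ^ (j + 1)) u := by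
        rw [ih (by omega), pow_succ']; rfl
      have h2 : T ((T ^ j) u') = W.orthogonalProjectionOnto (R ((T ^ j) u' : W)) := rfl
      rw [h2, h1]
      exact congrArg Subtype.val
        (W.orthogonalProjectionOnto_mem_subspace_eq_self ⟨_, hmem (j + 1) hj⟩)
  have hp : ((Polynomial.aeval T p u' : W) : H) = Polynomial.aeval R p u := by
    rw [Polynomial.aeval_eq_sum_range, Polynomial.aeval_eq_sum_range, LinearMap.sum_apply,
      _root_.sum_apply, Submodule.coe_sum]
    refine Finset.sum_congr rfl fun j hj => ?_
    rw [LinearMap.smul_apply, _root_.smul_apply, Submodule.coe_smul,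
      hpow j (Nat.lt_succ_iff.1 (Finset.mem_range.1 hj))]
  have h := norm_aeval_apply_le_of_finiteDimensional hTs (fun w => by rw [hTin]; exact hR.nonneg _)
    (fun w => by rw [hTin]; exact hR.le_one _) p hM u'
  rw [← hp]
  exact h

/-- The polynomials as continuous functions on `[0,1]`. -/
abbrev polyMap : Polynomial ℝ →ₐ[ℝ] C(Icc (0 : ℝ) 1, ℝ) := Polynomial.toContinuousMapOnAlgHom _

lemma denseRange_polyMap : DenseRange polyMap := by
  intro f
  rw [Metric.mem_closure_range_iff]
  intro ε hε
  obtain ⟨p, hp⟩ := exists_polynomial_near_continuousMap 0 1 f ε hε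
  exact ⟨p, by rw [dist_eq_norm, norm_sub_rev]; exact hp⟩

lemma IsSymmContraction.norm_aeval_le {R : H →L[ℝ] H} (hR : IsSymmContraction R)
    (p : Polynomial ℝ) : ‖Polynomial.aeval R p‖ ≤ 1 * ‖polyMap p‖ := by
  rw [one_mul]
  refine ContinuousLinearMap.opNorm_le_bound _ (norm_nonneg _) fun u =>
    hR.norm_aeval_apply_le p (fun x hx => ?_) u
  exact (polyMap p).norm_coe_le_norm ⟨x, hx⟩

lemma exists_polyMap_extension {F : Type*} [NormedAddCommGroup F] [NormedSpace ℝ F]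
    [CompleteSpace F] (f : Polynomial ℝ →ₗ[ℝ] F) (hf : ∀ p, ‖f p‖ ≤ 1 * ‖polyMap p‖) :
    ∃ Φ : C(Icc (0 : ℝ) 1, ℝ) →L[ℝ] F, (∀ p, Φ (polyMap p) = f p) ∧ ∀ g, ‖Φ g‖ ≤ ‖g‖ :=
  ⟨f.extendOfNorm polyMap.toLinearMap, fun p => LinearMap.extendOfNorm_eq (f := f)
    (e := polyMap.toLinearMap) denseRange_polyMap ⟨1, hf⟩ p, fun g =>
    (LinearMap.norm_extendOfNorm_apply_le (f := f) (e := polyMap.toLinearMap)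
      denseRange_polyMap 1 hf g).trans_eq (one_mul _)⟩

variable [CompleteSpace H]

lemma IsSymmContraction.exists_funCalc {R : H →L[ℝ] H} (hR : IsSymmContraction R) :
    ∃ Φ : C(Icc (0 : ℝ) 1, ℝ) →L[ℝ] (H →L[ℝ] H),
      (∀ p, Φ (polyMap p) = Polynomial.aeval R p) ∧ ∀ g, ‖Φ g‖ ≤ ‖g‖ :=
  exists_polyMap_extension (Polynomial.aeval R).toLinearMap hR.norm_aeval_le

open Classical in
/-- The continuous functional calculus `f ↦ f(R)`. -/
def funCalc (R : H →L[ℝ] H) : C(Icc (0 : ℝ) 1, ℝ) →L[ℝ] (H →L[ℝ] H) :=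
  if h : IsSymmContraction R then h.exists_funCalc.choose else 0

variable {R : H →L[ℝ] H}

lemma IsSymmContraction.funCalc_poly (hR : IsSymmContraction R) (p : Polynomial ℝ) :
    funCalc R (polyMap p) = Polynomial.aeval R p := by
  rw [funCalc, dif_pos hR]; exact hR.exists_funCalc.choose_spec.1 p

lemma IsSymmContraction.norm_funCalc_le (hR : IsSymmContraction R) (f : C(Icc (0 : ℝ) 1, ℝ)) :
    ‖funCalc R f‖ ≤ ‖f‖ := by
  rw [funCalc, dif_pos hR]; exact hR.exists_funCalc.choose_spec.2 f

lemma IsSymmContraction.funCalc_mul (hR : IsSymmContraction R) (f g : C(Icc (0 : ℝ) 1, ℝ)) :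
    funCalc R (f * g) = funCalc R f * funCalc R g := by
  refine denseRange_polyMap.induction_on₂ (p := fun f g => funCalc R (f * g) =
    funCalc R f * funCalc R g) ?_ (fun p q => ?_) f g
  · exact isClosed_eq (by fun_prop) (by fun_prop)
  · rw [← map_mul, hR.funCalc_poly, hR.funCalc_poly, hR.funCalc_poly, map_mul]

lemma IsSymmContraction.funCalc_one (hR : IsSymmContraction R) : funCalc R 1 = 1 := by
  have h := hR.funCalc_poly 1
  rw [map_one (Polynomial.aeval R)] at h
  rw [← h, map_one polyMap]

lemma IsSymmContraction.funCalc_coordFun (hR : IsSymmContraction R) : funCalc R coordFun = R := by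
  have h := hR.funCalc_poly Polynomial.X
  rw [Polynomial.aeval_X] at h
  rw [show coordFun = polyMap Polynomial.X by ext x; simp [coordFun_apply], h]

lemma IsSymmContraction.funCalc_mul_apply (hR : IsSymmContraction R)
    (f g : C(Icc (0 : ℝ) 1, ℝ)) (u : H) :
    funCalc R (f * g) u = funCalc R f (funCalc R g u) := by
  rw [hR.funCalc_mul]; rfl

/-- If `R e = f(R) v` with `|f(x)| ≤ M x`, then `‖e‖ ≤ M ‖v‖`. -/
theorem IsSymmContraction.norm_le_of_apply_eq (hR : IsSymmContraction R)
    (hinj : ∀ u, R u = 0 → u = 0) {f : C(Icc (0 : ℝ) 1, ℝ)} {M : ℝ} (hM : 0 ≤ M)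
    (hf : ∀ x, |f x| ≤ M * x) {e v : H} (he : R e = funCalc R f v) : ‖e‖ ≤ M * ‖v‖ := by
  have key : ∀ y, ⟪e, R y⟫ ≤ M * ‖v‖ * ‖R y‖ := by
    intro y
    -- Formally e = (f/x)(R) v, but f/x need not be continuous at 0. The regularization f/(x + ε) is
    -- still bounded by M, and the error term disappears as ε → 0.
    have hε : ∀ ε : ℝ, 0 < ε → ⟪e, R y⟫ ≤ M * ‖v‖ * ‖R y‖ + ε * (M * ‖v‖ * ‖y‖) := by
      intro ε hε
      have hpos : ∀ x : Icc (0 : ℝ) 1, (0 : ℝ) < x + ε := fun x => by linarith [x.2.1]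
      let h : C(Icc (0 : ℝ) 1, ℝ) := ⟨fun x => f x / (x + ε),
        f.continuous.div (by fun_prop) fun x => (hpos x).ne'⟩
      have hh : ‖h‖ ≤ M := by
        refine (ContinuousMap.norm_le _ hM).2 fun x => ?_
        change ‖f x / (x + ε)‖ ≤ M
        rw [Real.norm_eq_abs, abs_div, abs_of_pos (hpos x), div_le_iff₀ (hpos x)]
        nlinarith [hf x]
      have hfe : f = coordFun * h + ε • h := by
        ext x
        change f x = x * (f x / (x + ε)) + ε * (f x / (x + ε))
        have := (hpos x).ne'
        field_simp
      have hhv : ‖funCalc R h v‖ ≤ M * ‖v‖ :=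
        ((funCalc R h).le_opNorm v).trans (by gcongr; exact (hR.norm_funCalc_le h).trans hh)
      have e1 : ⟪e, R y⟫ = ⟪funCalc R h v, R y⟫ + ε * ⟪funCalc R h v, y⟫ := by
        rw [← hR.symm, he, hfe, map_add, map_smul, _root_.add_apply,
          hR.funCalc_mul_apply, hR.funCalc_coordFun, inner_add_left, hR.symm,
          _root_.smul_apply, real_inner_smul_left]
      rw [e1]
      refine add_le_add ?_ (mul_le_mul_of_nonneg_left ?_ hε.le)
      · exact (real_inner_le_norm _ _).trans (by gcongr)
      · exact (real_inner_le_norm _ _).trans (by gcongr)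
    have ht : Tendsto (fun ε : ℝ => M * ‖v‖ * ‖R y‖ + ε * (M * ‖v‖ * ‖y‖)) (𝓝[>] 0)
        (𝓝 (M * ‖v‖ * ‖R y‖ + 0 * (M * ‖v‖ * ‖y‖))) :=
      (Continuous.tendsto (by fun_prop) _).mono_left nhdsWithin_le_nhds
    rw [zero_mul, add_zero] at ht
    exact ge_of_tendsto ht (eventually_nhdsWithin_of_forall fun ε h => hε ε h)
  -- An injective symmetric operator has dense range, so testing e against vectors R y is enough.
  have hdense : Dense (LinearMap.range R.toLinearMap : Set H) := by
    rw [Submodule.dense_iff_topologicalClosure_eq_top, Submodule.topologicalClosure_eq_top_iff,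
      Submodule.eq_bot_iff]
    intro u hu
    apply hinj
    rw [← inner_self_eq_zero (𝕜 := ℝ), hR.symm]
    exact Submodule.inner_left_of_mem_orthogonal (LinearMap.mem_range_self R.toLinearMap (R u)) hu
  have hall : ∀ z, ⟪e, z⟫ ≤ M * ‖v‖ * ‖z‖ := by
    intro z
    refine hdense.induction (P := fun z => ⟪e, z⟫ ≤ M * ‖v‖ * ‖z‖) ?_ ?_ z
    · rintro _ ⟨y, rfl⟩
      exact key y
    · exact isClosed_le (by fun_prop) (by fun_prop)
  have h := hall e
  rw [real_inner_self_eq_norm_sq] at h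
  rcases (norm_nonneg e).eq_or_lt with h0 | h0
  · rw [← h0]; positivity
  · nlinarith

end FunctionalCalculus

/-! ### The resolvent of the Dirichlet Laplacian -/

section Contraction

variable {H W : Type*} [NormedAddCommGroup H] [InnerProductSpace ℝ H] [CompleteSpace H]
  [NormedAddCommGroup W] [InnerProductSpace ℝ W] [CompleteSpace W]

/-- The quadratic form of ι ι* is ‖ι* u‖², and the adjoint of a contraction is a contraction. -/
lemma isSymmContraction_comp_adjoint {ι : W →L[ℝ] H} (hι : ∀ y, ‖ι y‖ ≤ ‖y‖) :
    IsSymmContraction (ι ∘L ι.adjoint) where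
  symm u v := by
    simp only [ContinuousLinearMap.comp_apply]
    rw [← ContinuousLinearMap.adjoint_inner_right ι, ContinuousLinearMap.adjoint_inner_left ι]
  nonneg u := by
    simp only [ContinuousLinearMap.comp_apply]
    rw [← ContinuousLinearMap.adjoint_inner_right, real_inner_self_eq_norm_sq]
    positivity
  le_one u := by
    simp only [ContinuousLinearMap.comp_apply]
    rw [← ContinuousLinearMap.adjoint_inner_right, real_inner_self_eq_norm_sq,
      real_inner_self_eq_norm_sq]
    have h : ‖ι.adjoint u‖ ^ 2 ≤ ‖ι.adjoint u‖ * ‖u‖ := by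
      rw [← real_inner_self_eq_norm_sq, ContinuousLinearMap.adjoint_inner_right]
      exact (real_inner_le_norm _ _).trans (by gcongr; exact hι _)
    have h0 := norm_nonneg (ι.adjoint u)
    have h1 := norm_nonneg u
    nlinarith [sq_nonneg (‖ι.adjoint u‖ - ‖u‖)]

lemma adjoint_eq_zero_of_comp_adjoint_eq_zero {ι : W →L[ℝ] H} {u : H}
    (h : (ι ∘L ι.adjoint) u = 0) : ι.adjoint u = 0 := by
  rw [← inner_self_eq_zero (𝕜 := ℝ), ContinuousLinearMap.adjoint_inner_right]
  rw [ContinuousLinearMap.comp_apply] at h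
  rw [h, inner_zero_left]

end Contraction

/-! ### Test functions and weak derivatives in L²(Ω). -/

section Laplacian

open TopologicalSpace

variable {𝕜 : Type*} [RCLike 𝕜] {d : ℕ} {Ω : Opens (EuclideanSpace ℝ (Fin d))}

/-- The partial derivative of a test function. -/
def testPartial {F : Type*} [NormedAddCommGroup F] [NormedSpace ℝ F] (i : Fin d) (φ : 𝓓(Ω, F)) :
    𝓓(Ω, F) where
  toFun x := fderiv ℝ φ x (EuclideanSpace.single i 1)
  contDiff' := by
    have h : ContDiff ℝ ∞ φ := φ.contDiff
    exact (h.fderiv_right (m := ∞) (by simp)).clm_apply contDiff_const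
  hasCompactSupport' := φ.hasCompactSupport.fderiv_apply (𝕜 := ℝ) _
  tsupport_subset' := (tsupport_fderiv_apply_subset ℝ _).trans φ.tsupport_subset

/-- Composition of a test function with a continuous linear map. -/
def testComp {F F' : Type*} [NormedAddCommGroup F] [NormedSpace ℝ F] [NormedAddCommGroup F']
    [NormedSpace ℝ F'] (L : F →L[ℝ] F') (φ : 𝓓(Ω, F)) : 𝓓(Ω, F') where
  toFun x := L (φ x)
  contDiff' := L.contDiff.comp φ.contDiff
  hasCompactSupport' := φ.hasCompactSupport.comp_left (map_zero L)
  tsupport_subset' := (tsupport_comp_subset (map_zero L) φ).trans φ.tsupport_subset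

lemma testPartial_testComp {F F' : Type*} [NormedAddCommGroup F] [NormedSpace ℝ F]
    [NormedAddCommGroup F'] [NormedSpace ℝ F'] (L : F →L[ℝ] F') (φ : 𝓓(Ω, F)) (i : Fin d) (x) :
    testPartial i (testComp L φ) x = L (testPartial i φ x) := by
  have h : HasFDerivAt φ (fderiv ℝ φ x) x :=
    ((φ.contDiff.differentiable (by simp)) x).hasFDerivAt
  have h2 := (L.hasFDerivAt (x := φ x)).comp x h
  change fderiv ℝ (fun x => L (φ x)) x _ = _
  have h3 : fderiv ℝ (fun x => L (φ x)) x = L ∘L fderiv ℝ φ x := h2.fderiv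
  rw [h3]
  rfl

lemma setIntegral_eq_of_tsupport {F : Type*} [NormedAddCommGroup F] [NormedSpace ℝ F]
    {f : EuclideanSpace ℝ (Fin d) → F} (h : ∀ x ∉ Ω, f x = 0) :
    ∫ x in (Ω : Set (EuclideanSpace ℝ (Fin d))), f x = ∫ x, f x :=
  setIntegral_eq_integral_of_forall_compl_eq_zero h

lemma test_eq_zero {F : Type*} [NormedAddCommGroup F] [NormedSpace ℝ F] (φ : 𝓓(Ω, F)) {x}
    (hx : x ∉ Ω) : φ x = 0 :=
  image_eq_zero_of_notMem_tsupport fun h => hx (φ.tsupport_subset h)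

lemma integral_test_smul_partial (φ : 𝓓(Ω, ℝ)) (ψ : 𝓓(Ω, 𝕜)) (i : Fin d) :
    ∫ x in (Ω : Set (EuclideanSpace ℝ (Fin d))), testPartial i φ x • ψ x =
      - ∫ x in (Ω : Set (EuclideanSpace ℝ (Fin d))), φ x • testPartial i ψ x := by
  rw [setIntegral_eq_of_tsupport fun x hx => by rw [test_eq_zero ψ hx, smul_zero],
    setIntegral_eq_of_tsupport fun x hx => by rw [test_eq_zero φ hx, zero_smul], eq_neg_iff_add_eq_zero,
    add_comm, ← eq_neg_iff_add_eq_zero]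
  have hint : ∀ (a : 𝓓(Ω, ℝ)) (b : 𝓓(Ω, 𝕜)), Integrable fun x => a x • b x := fun a b =>
    (Continuous.integrable_of_hasCompactSupport (by fun_prop) (a.hasCompactSupport.smul_right))
  exact integral_smul_fderiv_eq_neg_fderiv_smul_of_integrable (hint (testPartial i φ) ψ)
    (hint φ (testPartial i ψ)) (hint φ ψ)
    (fun x _ => (φ.contDiff.differentiable (by simp)) x)
    (fun x _ => (ψ.contDiff.differentiable (by simp)) x)

lemma memLp_test {F : Type*} [NormedAddCommGroup F] [NormedSpace ℝ F] (φ : 𝓓(Ω, F)) :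
    MemLp φ 2 (volume.restrict (Ω : Set (EuclideanSpace ℝ (Fin d)))) :=
  (φ.continuous.memLp_of_hasCompactSupport φ.hasCompactSupport).restrict _

/-- A test function as an element of `L²`. -/
def testL2 (φ : 𝓓(Ω, 𝕜)) : L2 𝕜 Ω := (memLp_test φ).toLp

lemma coeFn_testL2 (φ : 𝓓(Ω, 𝕜)) :
    testL2 φ =ᵐ[volume.restrict (Ω : Set (EuclideanSpace ℝ (Fin d)))] φ :=
  (memLp_test φ).coeFn_toLp

lemma integrable_test_smul (φ : 𝓓(Ω, ℝ)) (u : L2 𝕜 Ω) :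
    IntegrableOn (fun x => φ x • u x) (Ω : Set (EuclideanSpace ℝ (Fin d))) := by
  exact memLp_one_iff_integrable.1 ((Lp.memLp u).smul (memLp_test φ))

lemma integral_test_smul (φ : 𝓓(Ω, ℝ)) (u : L2 𝕜 Ω) :
    ∫ x in (Ω : Set (EuclideanSpace ℝ (Fin d))), φ x • u x =
      inner 𝕜 (testL2 (testComp (RCLike.ofRealCLM (K := 𝕜)) φ)) u := by
  rw [L2.inner_def]
  refine integral_congr_ae ?_
  filter_upwards [coeFn_testL2 (testComp (RCLike.ofRealCLM (K := 𝕜)) φ)] with x hx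
  rw [hx]
  change φ x • u x = inner 𝕜 ((φ x : ℝ) : 𝕜) (u x)
  rw [RCLike.inner_apply, RCLike.conj_ofReal, RCLike.real_smul_eq_coe_mul, mul_comm]

lemma continuous_integral_test_smul (φ : 𝓓(Ω, ℝ)) :
    Continuous fun u : L2 𝕜 Ω => ∫ x in (Ω : Set (EuclideanSpace ℝ (Fin d))), φ x • u x := by
  simp_rw [integral_test_smul]
  exact continuous_const.inner continuous_id

/-- Pairs `(u, w)` in the `H¹₀` closure have `w` as weak gradient. -/
lemma hasWeakPartial_of_mem_closure {u : L2 𝕜 Ω} {w : Fin d → L2 𝕜 Ω}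
    (h : (u, w) ∈ closure {p : L2 𝕜 Ω × (Fin d → L2 𝕜 Ω) | ∃ φ : 𝓓(Ω, 𝕜),
      (p.1 =ᵐ[volume.restrict (Ω : Set (EuclideanSpace ℝ (Fin d)))] φ) ∧
      ∀ i, p.2 i =ᵐ[volume.restrict (Ω : Set (EuclideanSpace ℝ (Fin d)))]
        fun x => fderiv ℝ φ x (EuclideanSpace.single i 1)}) (i : Fin d) :
    HasWeakPartial i u (w i) := by
  intro φ
  set S : Set (L2 𝕜 Ω × (Fin d → L2 𝕜 Ω)) := {p |
    ∫ x in (Ω : Set (EuclideanSpace ℝ (Fin d))), testPartial i φ x • p.1 x =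
      - ∫ x in (Ω : Set (EuclideanSpace ℝ (Fin d))), φ x • p.2 i x} with hS
  have hclosed : IsClosed S := by
    refine isClosed_eq ((continuous_integral_test_smul (𝕜 := 𝕜) (testPartial i φ)).comp
      continuous_fst) ?_
    exact ((continuous_integral_test_smul (𝕜 := 𝕜) φ).comp
      ((continuous_apply i).comp continuous_snd)).neg
  refine (closure_minimal ?_ hclosed h : (u, w) ∈ S)
  rintro ⟨p, q⟩ ⟨ψ, hp, hq⟩
  simp only at hp hq
  have e1 : ∫ x in (Ω : Set (EuclideanSpace ℝ (Fin d))), testPartial i φ x • p x =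
      ∫ x in (Ω : Set (EuclideanSpace ℝ (Fin d))), testPartial i φ x • ψ x :=
    integral_congr_ae (hp.mono fun x hx => by simp only [hx])
  have e2 : ∫ x in (Ω : Set (EuclideanSpace ℝ (Fin d))), φ x • q i x =
      ∫ x in (Ω : Set (EuclideanSpace ℝ (Fin d))), φ x • testPartial i ψ x :=
    integral_congr_ae ((hq i).mono fun x hx => by simp only [hx]; rfl)
  rw [hS, mem_ofPred_eq, e1, e2]
  exact integral_test_smul_partial φ ψ i

/-- The real inner product with a test function. -/
lemma real_inner_eq_of_ae_eq {w b : L2 𝕜 Ω} {ψ : 𝓓(Ω, 𝕜)}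
    (hb : b =ᵐ[volume.restrict (Ω : Set (EuclideanSpace ℝ (Fin d)))] ψ) :
    inner ℝ w b = RCLike.re (∫ x in (Ω : Set (EuclideanSpace ℝ (Fin d))),
        testComp (RCLike.reCLM (K := 𝕜)) ψ x • w x) +
      RCLike.im (∫ x in (Ω : Set (EuclideanSpace ℝ (Fin d))),
        testComp (RCLike.imCLM (K := 𝕜)) ψ x • w x) := by
  have h1 := integrable_test_smul (testComp (RCLike.reCLM (K := 𝕜)) ψ) w
  have h2 := integrable_test_smul (testComp (RCLike.imCLM (K := 𝕜)) ψ) w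
  have e1 := (RCLike.reCLM (K := 𝕜)).integral_comp_comm h1
  have e2 := (RCLike.imCLM (K := 𝕜)).integral_comp_comm h2
  simp only [RCLike.reCLM_apply, RCLike.imCLM_apply] at e1 e2
  rw [← e1, ← e2, ← integral_add h1.re h2.im, L2.inner_def]
  refine integral_congr_ae (hb.mono fun x hx => ?_)
  simp only [hx]
  change inner ℝ (w x) (ψ x) = RCLike.re (RCLike.re (ψ x) • w x) + RCLike.im (RCLike.im (ψ x) • w x)
  rw [RCLike.smul_re, RCLike.smul_im, real_inner_eq_re_inner 𝕜, RCLike.inner_apply, RCLike.mul_re,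
    RCLike.conj_re, RCLike.conj_im]
  ring

/-- The gradient w' from the H¹₀ closure and the gradient w from H² need not be the same object a
priori. Tested against ∂ᵢφ both produce ∫ u ∂ᵢ∂ᵢφ up to sign, so w' may be replaced by w and then
integrated by parts once more. -/
lemma sum_integral_weak_gradient {u f : L2 𝕜 Ω} {w w' : Fin d → L2 𝕜 Ω}
    {h : Fin d → Fin d → L2 𝕜 Ω} (hw : ∀ i, HasWeakPartial i u (w i))
    (hw' : ∀ i, HasWeakPartial i u (w' i)) (hh : ∀ i j, HasWeakPartial j (w i) (h i j))
    (hf : f = ∑ i, h i i) (φ : 𝓓(Ω, ℝ)) :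
    ∑ i, ∫ x in (Ω : Set (EuclideanSpace ℝ (Fin d))), testPartial i φ x • w' i x =
      - ∫ x in (Ω : Set (EuclideanSpace ℝ (Fin d))), φ x • f x := by
  have e1 : ∀ i, ∫ x in (Ω : Set (EuclideanSpace ℝ (Fin d))), testPartial i φ x • w' i x =
      - ∫ x in (Ω : Set (EuclideanSpace ℝ (Fin d))), φ x • h i i x := by
    intro i
    have h1 := hw i (testPartial i φ)
    have h2 := hw' i (testPartial i φ)
    rw [h1, neg_inj] at h2
    rw [← h2]
    exact hh i i φ
  simp_rw [e1]
  rw [hf, Finset.sum_neg_distrib, neg_inj, integral_test_smul]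
  simp_rw [integral_test_smul]
  rw [inner_sum]

end Laplacian

/-! ### H¹₀(Ω) as a closed space of pairs (u, ∇u), and the resolvent of the Dirichlet Laplacian. -/

section Resolvent

open TopologicalSpace

variable {𝕜 : Type*} [RCLike 𝕜] {d : ℕ} {Ω : Opens (EuclideanSpace ℝ (Fin d))}

/-- The space `L²(Ω)^{1+d}` of a function and its gradient, as a real Hilbert space. -/
abbrev GradSpace (𝕜 : Type*) [RCLike 𝕜] {d : ℕ} (Ω : Opens (EuclideanSpace ℝ (Fin d))) : Type _ :=
  PiLp 2 fun _ : Option (Fin d) => L2 𝕜 Ω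

/-- The pairs `(φ, ∇φ)` with a test function `φ`. -/
def testPairs (𝕜 : Type*) [RCLike 𝕜] {d : ℕ} (Ω : Opens (EuclideanSpace ℝ (Fin d))) :
    Set (GradSpace 𝕜 Ω) :=
  {y | ∃ φ : 𝓓(Ω, 𝕜),
    (y none =ᵐ[volume.restrict (Ω : Set (EuclideanSpace ℝ (Fin d)))] φ) ∧
    ∀ i, y (some i) =ᵐ[volume.restrict (Ω : Set (EuclideanSpace ℝ (Fin d)))] testPartial i φ}

/-- The Sobolev space `H¹₀(Ω)`, as a subspace of `L²(Ω)^{1+d}`. -/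
def sobolevSpace (𝕜 : Type*) [RCLike 𝕜] {d : ℕ} (Ω : Opens (EuclideanSpace ℝ (Fin d))) :
    Submodule ℝ (GradSpace 𝕜 Ω) :=
  (Submodule.span ℝ (testPairs 𝕜 Ω)).topologicalClosure

instance : CompleteSpace (sobolevSpace 𝕜 Ω) :=
  (Submodule.isClosed_topologicalClosure _).completeSpace_coe

/-- The embedding of `H¹₀(Ω)` into `L²(Ω)`. -/
def sobolevEmbedding (𝕜 : Type*) [RCLike 𝕜] {d : ℕ} (Ω : Opens (EuclideanSpace ℝ (Fin d))) :
    sobolevSpace 𝕜 Ω →L[ℝ] L2 𝕜 Ω :=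
  (PiLp.proj 2 (fun _ : Option (Fin d) => L2 𝕜 Ω) none).comp (sobolevSpace 𝕜 Ω).subtypeL

lemma sobolevEmbedding_apply (y : sobolevSpace 𝕜 Ω) :
    sobolevEmbedding 𝕜 Ω y = (y : GradSpace 𝕜 Ω) none := rfl

lemma norm_sobolevEmbedding_le (y : sobolevSpace 𝕜 Ω) : ‖sobolevEmbedding 𝕜 Ω y‖ ≤ ‖y‖ :=
  PiLp.norm_apply_le (y : GradSpace 𝕜 Ω) none

/-- The weak form of Δu = f. Weak derivatives are tested with real functions only, so the scalar
test function is split into real and imaginary parts. -/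
lemma inner_testPairs {u f : L2 𝕜 Ω} {w w' : Fin d → L2 𝕜 Ω}
    {h : Fin d → Fin d → L2 𝕜 Ω} (hw : ∀ i, HasWeakPartial i u (w i))
    (hw' : ∀ i, HasWeakPartial i u (w' i)) (hh : ∀ i j, HasWeakPartial j (w i) (h i j))
    (hf : f = ∑ i, h i i) {y : GradSpace 𝕜 Ω} (hy : y ∈ testPairs 𝕜 Ω) :
    ∑ i, inner ℝ (w' i) (y (some i)) = - inner ℝ f (y none) := by
  obtain ⟨φ, h0, hi⟩ := hy
  have hc : ∀ (L : 𝕜 →L[ℝ] ℝ) i,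
      ∫ x in (Ω : Set (EuclideanSpace ℝ (Fin d))), testComp L (testPartial i φ) x • w' i x =
      ∫ x in (Ω : Set (EuclideanSpace ℝ (Fin d))), testPartial i (testComp L φ) x • w' i x := by
    intro L i
    simp_rw [testPartial_testComp]
    rfl
  have h1 := fun i => real_inner_eq_of_ae_eq (w := w' i) (hi i)
  simp_rw [h1, hc]
  rw [real_inner_eq_of_ae_eq h0, Finset.sum_add_distrib, ← map_sum, ← map_sum,
    sum_integral_weak_gradient hw hw' hh hf, sum_integral_weak_gradient hw hw' hh hf, map_neg,
    map_neg]
  ring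

lemma testPairs_subset : testPairs 𝕜 Ω ⊆ sobolevSpace 𝕜 Ω := fun _ hy =>
  Submodule.le_topologicalClosure _ (Submodule.subset_span hy)

/-- The adjoint of the embedding is the Riesz representative in H¹₀. By density of the span, it is
determined by its inner products with test pairs. -/
lemma adjoint_sobolevEmbedding_eq {f : L2 𝕜 Ω} {y : sobolevSpace 𝕜 Ω}
    (h : ∀ z ∈ testPairs 𝕜 Ω, inner ℝ (y : GradSpace 𝕜 Ω) z = inner ℝ f (z none)) :
    (sobolevEmbedding 𝕜 Ω).adjoint f = y := by
  refine ext_inner_right ℝ fun z => ?_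
  rw [ContinuousLinearMap.adjoint_inner_left]
  set ℓ : GradSpace 𝕜 Ω →L[ℝ] ℝ := innerSL ℝ (y : GradSpace 𝕜 Ω) -
    (innerSL ℝ f).comp (PiLp.proj 2 (fun _ : Option (Fin d) => L2 𝕜 Ω) none) with hℓ
  have hle : sobolevSpace 𝕜 Ω ≤ ℓ.ker := by
    refine Submodule.topologicalClosure_minimal _ (Submodule.span_le.2 fun z hz => ?_)
      ℓ.isClosed_ker
    change inner ℝ (y : GradSpace 𝕜 Ω) z - inner ℝ f (z none) = 0
    rw [h z hz, sub_self]
  have hz : inner ℝ (y : GradSpace 𝕜 Ω) (z : GradSpace 𝕜 Ω) -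
    inner ℝ f ((z : GradSpace 𝕜 Ω) none) = 0 := hle z.2
  exact (sub_eq_zero.1 hz).symm

/-- The Dirichlet resolvent `(1 - Δ)⁻¹` (on all of `L²(Ω)`, in the weak sense). -/
def dirichletResolvent (𝕜 : Type*) [RCLike 𝕜] {d : ℕ} (Ω : Opens (EuclideanSpace ℝ (Fin d))) :
    L2 𝕜 Ω →L[ℝ] L2 𝕜 Ω :=
  sobolevEmbedding 𝕜 Ω ∘L (sobolevEmbedding 𝕜 Ω).adjoint

lemma isSymmContraction_dirichletResolvent : IsSymmContraction (dirichletResolvent 𝕜 Ω) :=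
  isSymmContraction_comp_adjoint norm_sobolevEmbedding_le

/-- Green's formula says that the H¹ inner product of (u, ∇u) with (φ, ∇φ) is ⟨u - f, φ⟩, so (u, ∇u)
is the adjoint embedding applied to u - f. This is the only information about the Laplacian that the
error estimate uses, besides injectivity of the resolvent. -/
lemma IsDirichletLaplacian.eq_dirichletResolvent {u f : L2 𝕜 Ω} (h : IsDirichletLaplacian u f) :
    u = dirichletResolvent 𝕜 Ω (u - f) := by
  obtain ⟨⟨w', hmem⟩, w, h, hw, hh, hf⟩ := h
  set y : GradSpace 𝕜 Ω := WithLp.toLp 2 fun o => o.elim u w' with hy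
  have hyW : y ∈ sobolevSpace 𝕜 Ω := by
    have hcont : Continuous fun p : L2 𝕜 Ω × (Fin d → L2 𝕜 Ω) =>
        (WithLp.toLp 2 fun o : Option (Fin d) => o.elim p.1 p.2 : GradSpace 𝕜 Ω) := by
      refine (PiLp.continuous_toLp 2 _).comp (continuous_pi fun o => ?_)
      cases o with
      | none => exact continuous_fst
      | some i => exact (continuous_apply i).comp continuous_snd
    have h2 : y ∈ closure (testPairs 𝕜 Ω) := by
      refine map_mem_closure (f := fun p : L2 𝕜 Ω × (Fin d → L2 𝕜 Ω) =>
        (WithLp.toLp 2 fun o : Option (Fin d) => o.elim p.1 p.2 : GradSpace 𝕜 Ω)) hcont hmem ?_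
      rintro p ⟨φ, h0, hi⟩
      exact ⟨φ, h0, hi⟩
    exact closure_minimal testPairs_subset (Submodule.isClosed_topologicalClosure _) h2
  have hw' := hasWeakPartial_of_mem_closure hmem
  have key : (sobolevEmbedding 𝕜 Ω).adjoint (u - f) = ⟨y, hyW⟩ := by
    refine adjoint_sobolevEmbedding_eq fun z hz => ?_
    rw [PiLp.inner_apply, Fintype.sum_option, inner_sub_left]
    have := inner_testPairs hw hw' hh hf hz
    change inner ℝ u (z none) + ∑ i, inner ℝ (w' i) (z (some i)) = _
    rw [this]
    ring
  rw [dirichletResolvent, ContinuousLinearMap.comp_apply, key, sobolevEmbedding_apply]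
  rfl

/-- For a real test function ψ put z = ∫ ψ u and test with ψ z. The real inner product becomes |z|²,
so all integrals against real test functions vanish. -/
lemma eq_zero_of_inner_test {u : L2 𝕜 Ω} (h : ∀ φ : 𝓓(Ω, 𝕜), inner ℝ u (testL2 φ) = 0) :
    u = 0 := by
  have h1 : ∀ ψ : 𝓓(Ω, ℝ), ∫ x in (Ω : Set (EuclideanSpace ℝ (Fin d))), ψ x • u x = 0 := by
    intro ψ
    set z := ∫ x in (Ω : Set (EuclideanSpace ℝ (Fin d))), ψ x • u x with hz
    have h2 := h (testComp (ContinuousLinearMap.toSpanSingleton ℝ z) ψ)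
    rw [real_inner_eq_of_ae_eq (coeFn_testL2 _)] at h2
    have hc : ∀ L : 𝕜 →L[ℝ] ℝ, ∫ x in (Ω : Set (EuclideanSpace ℝ (Fin d))),
        testComp L (testComp (ContinuousLinearMap.toSpanSingleton ℝ z) ψ) x • u x =
        L z • z := by
      intro L
      rw [hz, ← integral_smul]
      refine integral_congr_ae (Eventually.of_forall fun x => ?_)
      change L (ψ x • z) • u x = L z • ψ x • u x
      rw [map_smul, smul_smul, smul_eq_mul, mul_comm]
    rw [hc, hc, RCLike.smul_re, RCLike.smul_im] at h2
    simp only [RCLike.reCLM_apply, RCLike.imCLM_apply] at h2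
    exact RCLike.normSq_eq_zero.1 h2
  have h2 : ∀ᵐ x ∂volume, x ∈ (Ω : Set (EuclideanSpace ℝ (Fin d))) → u x = 0 := by
    refine IsOpen.ae_eq_zero_of_integral_contDiff_smul_eq_zero Ω.isOpen ?_ ?_
    · exact locallyIntegrableOn_of_locallyIntegrable_restrict
        ((Lp.memLp u).locallyIntegrable (by norm_num))
    · intro g hg hc hs
      have h3 := h1 ⟨g, hg, hc, hs⟩
      rw [setIntegral_eq_of_tsupport] at h3
      · exact h3
      · intro x hx
        rw [test_eq_zero _ hx, zero_smul]
  rw [Lp.eq_zero_iff_ae_eq_zero]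
  exact (ae_restrict_iff' Ω.isOpen.measurableSet).2 h2

lemma eq_zero_of_dirichletResolvent_eq_zero {u : L2 𝕜 Ω} (h : dirichletResolvent 𝕜 Ω u = 0) :
    u = 0 := by
  have h0 : (sobolevEmbedding 𝕜 Ω).adjoint u = 0 := adjoint_eq_zero_of_comp_adjoint_eq_zero h
  refine eq_zero_of_inner_test fun φ => ?_
  set y : GradSpace 𝕜 Ω := WithLp.toLp 2 fun o => o.elim (testL2 φ) fun i => testL2 (testPartial i φ)
  have hy : y ∈ sobolevSpace 𝕜 Ω :=
    testPairs_subset ⟨φ, coeFn_testL2 φ, fun i => coeFn_testL2 (testPartial i φ)⟩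
  have h1 := ContinuousLinearMap.adjoint_inner_left (sobolevEmbedding 𝕜 Ω) ⟨y, hy⟩ u
  rw [h0, inner_zero_left] at h1
  exact h1.symm

end Resolvent

/-! ### Iterated integrals and Taylor expansion -/

section IterInt

variable {E : Type*} [NormedAddCommGroup E] [NormedSpace ℝ E]

/-- The iterated integral `∫₀ᵗ (t - s)ʲ / j! f(s) ds`. -/
def iterInt (j : ℕ) (f : ℝ → E) : ℝ → E :=
  vconv (ContinuousLinearMap.lsmul ℝ ℝ) (monomialFun j) f

lemma continuous_monomialFun (j : ℕ) : Continuous (monomialFun j) := by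
  unfold monomialFun; fun_prop

lemma iterInt_apply (j : ℕ) (f : ℝ → E) (t : ℝ) :
    iterInt j f t = ∫ s in (0 : ℝ)..t, monomialFun j (t - s) • f s := rfl

lemma iterInt_zero (f : ℝ → E) (t : ℝ) : iterInt 0 f t = ∫ s in (0 : ℝ)..t, f s := by
  simp [iterInt_apply, monomialFun]

lemma iterInt_congr {f f' : ℝ → E} {t : ℝ} (ht : 0 ≤ t) (j : ℕ)
    (h : ∀ s, 0 < s → s ≤ t → f s = f' s) : iterInt j f t = iterInt j f' t :=
  vconv_congr _ ht (fun _ _ _ => rfl) h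

lemma integral_monomialFun (j : ℕ) (t : ℝ) :
    ∫ s in (0 : ℝ)..t, monomialFun j s = monomialFun (j + 1) t := by
  simp only [monomialFun]
  rw [intervalIntegral.integral_div, integral_pow, Nat.factorial_succ]
  push_cast
  field_simp
  simp

lemma integrableOn_of_continuousOn {f : ℝ → E} {T : ℝ} (hf : ContinuousOn f (Icc 0 T)) :
    IntegrableOn f (Ioc 0 T) :=
  (hf.integrableOn_compact isCompact_Icc).mono_set Ioc_subset_Icc_self

lemma continuousOn_integral {f : ℝ → E} {T : ℝ} (hf : IntegrableOn f (Ioc 0 T)) :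
    ContinuousOn (fun t => ∫ s in (0 : ℝ)..t, f s) (Icc 0 T) := by
  rcases lt_or_ge T 0 with hT | hT
  · rw [Icc_eq_empty (by linarith)]; exact continuousOn_empty _
  have h : IntegrableOn f (uIcc 0 T) := by
    rwa [uIcc_of_le hT, integrableOn_Icc_iff_integrableOn_Ioc]
  have := intervalIntegral.continuousOn_primitive_interval h
  rwa [uIcc_of_le hT] at this

variable [CompleteSpace E]

/-- Associativity of convolution with the constant kernel 1 = `monomialFun 0`. -/
lemma iterInt_succ {f : ℝ → E} {T t : ℝ} (hf : IntegrableOn f (Ioc 0 T)) (ht0 : 0 ≤ t)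
    (htT : t ≤ T) (j : ℕ) : iterInt (j + 1) f t = ∫ s in (0 : ℝ)..t, iterInt j f s := by
  rw [← iterInt_zero, iterInt, iterInt, iterInt]
  rw [← vconv_assoc (ContinuousLinearMap.lsmul ℝ ℝ) (ContinuousLinearMap.lsmul ℝ ℝ)
    (ContinuousLinearMap.lsmul ℝ ℝ) (ContinuousLinearMap.lsmul ℝ ℝ)
    (fun x y z => mul_smul x y z)
    (continuous_monomialFun 0).continuousOn
    (integrableOn_of_continuousOn (continuous_monomialFun j).continuousOn) hf ht0 htT]
  refine vconv_congr _ ht0 (fun s _ _ => ?_) fun _ _ _ => rfl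
  rw [← iterInt, iterInt_zero, integral_monomialFun]

lemma continuousOn_iterInt {f : ℝ → E} {T : ℝ} (hf : IntegrableOn f (Ioc 0 T)) (j : ℕ) :
    ContinuousOn (iterInt j f) (Icc 0 T) := by
  induction j with
  | zero => exact (continuousOn_integral hf).congr fun t _ => iterInt_zero f t
  | succ j ih =>
    exact (continuousOn_integral (integrableOn_of_continuousOn ih)).congr fun t ht =>
      iterInt_succ hf ht.1 ht.2 j

lemma iterInt_monomialFun (i j : ℕ) {t : ℝ} (ht : 0 ≤ t) :
    iterInt i (monomialFun j) t = monomialFun (i + j + 1) t := by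
  induction i generalizing t with
  | zero => rw [iterInt_zero, integral_monomialFun, zero_add]
  | succ i ih =>
    rw [iterInt_succ (integrableOn_of_continuousOn (continuous_monomialFun j).continuousOn) ht
      le_rfl, show i + 1 + j + 1 = i + j + 1 + 1 by ring, ← integral_monomialFun]
    exact intervalIntegral.integral_congr fun s hs => ih (by rw [uIcc_of_le ht] at hs; exact hs.1)

lemma iterInt_iterInt {f : ℝ → E} {T t : ℝ} (hf : IntegrableOn f (Ioc 0 T)) (ht0 : 0 ≤ t)
    (htT : t ≤ T) (i j : ℕ) : iterInt i (iterInt j f) t = iterInt (i + j + 1) f t := by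
  simp only [iterInt]
  rw [← vconv_assoc (ContinuousLinearMap.lsmul ℝ ℝ) (ContinuousLinearMap.lsmul ℝ ℝ)
    (ContinuousLinearMap.lsmul ℝ ℝ) (ContinuousLinearMap.lsmul ℝ ℝ)
    (fun x y z => mul_smul x y z)
    (continuous_monomialFun i).continuousOn
    (integrableOn_of_continuousOn (continuous_monomialFun j).continuousOn) hf ht0 htT]
  exact vconv_congr _ ht0 (fun s hs _ => iterInt_monomialFun i j hs.le) fun _ _ _ => rfl

lemma iterInt_monomialFun_smul (i j : ℕ) (h : E) {t : ℝ} (ht : 0 ≤ t) :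
    iterInt i (fun s => monomialFun j s • h) t = monomialFun (i + j + 1) t • h := by
  rw [← iterInt_monomialFun i j ht, iterInt_apply, iterInt_apply, ← intervalIntegral.integral_smul_const]
  simp_rw [smul_assoc]

lemma intervalIntegrable_iterInt {f : ℝ → E} {T t : ℝ} (hf : IntegrableOn f (Ioc 0 T))
    (ht0 : 0 ≤ t) (htT : t ≤ T) (i : ℕ) :
    IntervalIntegrable (fun s => monomialFun i (t - s) • f s) volume 0 t := by
  rw [intervalIntegrable_iff_integrableOn_Ioc_of_le ht0]
  have h1 : IntegrableOn f (Icc 0 t) :=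
    (integrableOn_Icc_iff_integrableOn_Ioc (by simp)).2 (hf.mono_set (Ioc_subset_Ioc_right htT))
  have h2 := h1.continuousOn_smul (f := fun s => monomialFun i (t - s))
    (((continuous_monomialFun i).comp (continuous_const.sub continuous_id)).continuousOn)
    isCompact_Icc
  exact h2.mono_set Ioc_subset_Icc_self

lemma iterInt_add {f f' : ℝ → E} {T t : ℝ} (hf : IntegrableOn f (Ioc 0 T))
    (hf' : IntegrableOn f' (Ioc 0 T)) (ht0 : 0 ≤ t) (htT : t ≤ T) (i : ℕ) :
    iterInt i (fun s => f s + f' s) t = iterInt i f t + iterInt i f' t := by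
  simp only [iterInt_apply, smul_add]
  exact intervalIntegral.integral_add (intervalIntegrable_iterInt hf ht0 htT i)
    (intervalIntegrable_iterInt hf' ht0 htT i)

lemma iterInt_sub {f f' : ℝ → E} {T t : ℝ} (hf : IntegrableOn f (Ioc 0 T))
    (hf' : IntegrableOn f' (Ioc 0 T)) (ht0 : 0 ≤ t) (htT : t ≤ T) (i : ℕ) :
    iterInt i (fun s => f s - f' s) t = iterInt i f t - iterInt i f' t := by
  simp only [iterInt_apply, smul_sub]
  exact intervalIntegral.integral_sub (intervalIntegrable_iterInt hf ht0 htT i)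
    (intervalIntegrable_iterInt hf' ht0 htT i)

lemma iterInt_finsetSum {ι : Type*} (s : Finset ι) {f : ι → ℝ → E} {T t : ℝ}
    (hf : ∀ i ∈ s, IntegrableOn (f i) (Ioc 0 T)) (ht0 : 0 ≤ t) (htT : t ≤ T) (j : ℕ) :
    iterInt j (fun r => ∑ i ∈ s, f i r) t = ∑ i ∈ s, iterInt j (f i) t := by
  simp only [iterInt_apply, Finset.smul_sum]
  exact intervalIntegral.integral_finsetSum fun i hi =>
    intervalIntegrable_iterInt (hf i hi) ht0 htT j

/-- The iterated integral of a function given by a Taylor expansion with integral remainder. -/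
lemma iterInt_taylor {g gk : ℝ → E} {a : ℕ → E} {n : ℕ} {T t : ℝ}
    (hgk : IntegrableOn gk (Ioc 0 T))
    (h : ∀ t ∈ Icc (0 : ℝ) T, g t =
      ∑ l ∈ Finset.range (n + 1), monomialFun l t • a l + iterInt n gk t)
    (ht : t ∈ Icc (0 : ℝ) T) (i : ℕ) :
    iterInt i g t = ∑ l ∈ Finset.range (n + 1), monomialFun (i + l + 1) t • a l +
      iterInt (i + n + 1) gk t := by
  have hc : ∀ l, IntegrableOn (fun s => monomialFun l s • a l) (Ioc 0 T) := fun l =>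
    integrableOn_of_continuousOn ((continuous_monomialFun l).smul continuous_const).continuousOn
  rw [iterInt_congr ht.1 i fun s h0 h1 => h s ⟨h0.le, h1.trans ht.2⟩,
    iterInt_add (integrable_finsetSum _ fun l _ => hc l)
      (integrableOn_of_continuousOn (continuousOn_iterInt hgk n)) ht.1 ht.2,
    iterInt_finsetSum _ (fun l _ => hc l) ht.1 ht.2, iterInt_iterInt hgk ht.1 ht.2]
  simp_rw [iterInt_monomialFun_smul i _ _ ht.1]

/-- Taylor's formula with a merely integrable top derivative: apply the formula to g' and integrate
it term by term. -/
lemma taylor_integral {n : ℕ} {g gk : ℝ → E} {T : ℝ} (hT : 0 < T)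
    (hg : ContDiffOn ℝ n g (Icc 0 T)) (hgk : IntegrableOn gk (Ioc 0 T))
    (h : ∀ t ∈ Icc (0 : ℝ) T, iteratedDerivWithin n g (Icc 0 T) t =
      iteratedDerivWithin n g (Icc 0 T) 0 + ∫ s in (0 : ℝ)..t, gk s) {t : ℝ}
    (ht : t ∈ Icc (0 : ℝ) T) :
    g t = ∑ l ∈ Finset.range (n + 1), monomialFun l t • iteratedDerivWithin l g (Icc 0 T) 0 +
      iterInt n gk t := by
  induction n generalizing g t with
  | zero =>
    have := h t ht
    simp only [iteratedDerivWithin_zero] at this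
    simp [iterInt_zero, this, monomialFun]
  | succ n ih =>
    have hu := uniqueDiffOn_Icc hT
    have hg' : ContDiffOn ℝ n (derivWithin g (Icc 0 T)) (Icc 0 T) :=
      hg.derivWithin hu (by norm_cast)
    have h1 := fun (t : ℝ) (ht : t ∈ Icc (0 : ℝ) T) => ih hg'
      (by simpa only [iteratedDerivWithin_succ'] using h) ht
    have hd : ∀ s ∈ Icc (0 : ℝ) T, HasDerivWithinAt g (derivWithin g (Icc 0 T) s) (Icc 0 T) s :=
      fun s hs => ((hg.differentiableOn (by simp)) s hs).hasDerivWithinAt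
    have h2 : ∫ s in (0 : ℝ)..t, derivWithin g (Icc 0 T) s = g t - g 0 := by
      refine intervalIntegral.integral_eq_sub_of_hasDerivAt_of_le ht.1
        (hg.continuousOn.mono (Icc_subset_Icc_right ht.2)) (fun s hs => ?_) ?_
      · have hs' : s ∈ Ioo 0 T := ⟨hs.1, hs.2.trans_le ht.2⟩
        exact (hd s ⟨hs'.1.le, hs'.2.le⟩).hasDerivAt (Icc_mem_nhds hs'.1 hs'.2)
      · rw [intervalIntegrable_iff_integrableOn_Ioc_of_le ht.1]
        exact integrableOn_of_continuousOn (hg'.continuousOn.mono (Icc_subset_Icc_right ht.2))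
    rw [← iterInt_zero, iterInt_taylor hgk h1 ht 0] at h2
    rw [eq_sub_iff_add_eq] at h2
    rw [Finset.sum_range_succ', ← h2]
    simp only [iteratedDerivWithin_succ', zero_add]
    have h0 : monomialFun 0 t = 1 := by simp [monomialFun]
    rw [h0, one_smul, iteratedDerivWithin_zero]
    abel

end IterInt

section RiemannLiouville

variable {E : Type*} [NormedAddCommGroup E] [NormedSpace ℝ E]

lemma rlIntegral_natCast {m : ℕ} (hm : 1 ≤ m) (f : ℝ → E) (t : ℝ) :
    rlIntegral m f t = iterInt (m - 1) f t := by
  obtain ⟨m, rfl⟩ := Nat.exists_eq_add_of_le' hm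
  rw [rlIntegral, iterInt_apply, ← intervalIntegral.integral_smul]
  simp only [Nat.add_sub_cancel]
  push_cast
  rw [Real.Gamma_nat_eq_factorial]
  simp only [add_sub_cancel_right, Real.rpow_natCast, monomialFun, smul_smul, div_eq_inv_mul]

end RiemannLiouville

/-! ### Representation of the solution -/

section SolutionKernel

variable {α : ℝ} {hα0 : 0 < α} {hα1 : α < 1}

lemma integrableOn_solutionKernel (l : ℕ) (T : ℝ) :
    IntegrableOn (solutionKernel hα0 hα1 l) (Ioc 0 T) :=
  integrableOn_of_continuousOn (continuous_solutionKernel hα0 hα1 l).continuousOn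

lemma iterInt_solutionKernel (j l : ℕ) {t : ℝ} (ht : 0 ≤ t) :
    iterInt j (solutionKernel hα0 hα1 l) t = solutionKernel hα0 hα1 (j + l + 1) t := by
  induction j generalizing t with
  | zero => rw [iterInt_zero, zero_add, solutionKernel_succ hα0 hα1 l ht]
  | succ j ih =>
    rw [iterInt_succ (integrableOn_solutionKernel l t) ht le_rfl,
      show j + 1 + l + 1 = j + l + 1 + 1 by ring, solutionKernel_succ hα0 hα1 _ ht]
    exact intervalIntegral.integral_congr fun s hs => ih (by rw [uIcc_of_le ht] at hs; exact hs.1)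

variable {H : Type*} [NormedAddCommGroup H] [InnerProductSpace ℝ H] [CompleteSpace H]
  {R : H →L[ℝ] H}

/-- Integrations of the data move into the index of the kernel, because convolution is associative
and the kernels are successive integrals of each other. -/
lemma vconv_solutionKernel_iterInt {f : ℝ → H} {T t : ℝ} (hf : IntegrableOn f (Ioc 0 T))
    (ht0 : 0 ≤ t) (htT : t ≤ T) (l j : ℕ) :
    vconv (funCalc R) (solutionKernel hα0 hα1 l) (iterInt j f) t =
      vconv (funCalc R) (solutionKernel hα0 hα1 (j + l + 1)) f t := by
  have h := vconv_assoc (ContinuousLinearMap.lsmul ℝ ℝ : ℝ →L[ℝ] C(Icc (0 : ℝ) 1, ℝ) →L[ℝ] _).flip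
    (funCalc R) (funCalc R) (ContinuousLinearMap.lsmul ℝ ℝ)
    (fun x y z => by
      change funCalc R (y • x) z = funCalc R x (y • z)
      rw [map_smul, map_smul]; rfl)
    (continuous_solutionKernel hα0 hα1 l).continuousOn
    (integrableOn_of_continuousOn (continuous_monomialFun j).continuousOn) hf ht0 htT
  rw [iterInt, ← h]
  refine vconv_congr _ ht0 (fun s hs _ => ?_) fun _ _ _ => rfl
  rw [vconv_flip, ← iterInt, iterInt_solutionKernel _ _ hs.le]

lemma iterInt_vconv_solutionKernel {f : ℝ → H} {T t : ℝ} (hf : IntegrableOn f (Ioc 0 T))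
    (ht0 : 0 ≤ t) (htT : t ≤ T) (l j : ℕ) :
    iterInt j (vconv (funCalc R) (solutionKernel hα0 hα1 l) f) t =
      vconv (funCalc R) (solutionKernel hα0 hα1 (j + l + 1)) f t := by
  have h := vconv_assoc (ContinuousLinearMap.lsmul ℝ ℝ : ℝ →L[ℝ] C(Icc (0 : ℝ) 1, ℝ) →L[ℝ] _)
    (funCalc R) (ContinuousLinearMap.lsmul ℝ ℝ) (funCalc R)
    (fun x y z => by
      change funCalc R (x • y) z = x • funCalc R y z
      rw [map_smul]; rfl)
    (continuous_monomialFun j).continuousOn (integrableOn_solutionKernel (hα0 := hα0) (hα1 := hα1) l T) hf ht0 htT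
  rw [iterInt, ← h]
  refine vconv_congr _ ht0 (fun s hs _ => ?_) fun _ _ _ => rfl
  rw [← iterInt, iterInt_solutionKernel _ _ hs.le]

lemma intervalIntegrable_funCalc_apply {f : ℝ → H} {t : ℝ} (hf : ContinuousOn f (Icc 0 t))
    (ht : 0 ≤ t) (l : ℕ) :
    IntervalIntegrable (fun s => funCalc R (solutionKernel hα0 hα1 l (t - s)) (f s)) volume 0 t := by
  rw [intervalIntegrable_iff_integrableOn_Ioc_of_le ht]
  exact integrableOn_of_continuousOn ((((funCalc R).continuous.comp
    (continuous_solutionKernel hα0 hα1 l)).comp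
      (continuous_const.sub continuous_id)).continuousOn.clm_apply hf)

lemma integral_funCalc_apply {f : ℝ → C(Icc (0 : ℝ) 1, ℝ)} {a b : ℝ}
    (hf : IntervalIntegrable f volume a b) (u : H) :
    ∫ s in a..b, funCalc R (f s) u = funCalc R (∫ s in a..b, f s) u :=
  (((ContinuousLinearMap.apply ℝ H u).comp (funCalc R)).intervalIntegral_comp_comm hf)

lemma iterInt_funCalc_apply (u : H) (l j : ℕ) {t : ℝ} (ht : 0 ≤ t) :
    iterInt j (fun s => funCalc R (solutionKernel hα0 hα1 l s) u) t =
      funCalc R (solutionKernel hα0 hα1 (j + l + 1) t) u := by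
  rw [← iterInt_solutionKernel j l ht, iterInt_apply, iterInt_apply, ← integral_funCalc_apply]
  · refine intervalIntegral.integral_congr fun s _ => ?_
    simp only [map_smul]
    rfl
  · exact (((continuous_monomialFun j).comp (continuous_const.sub continuous_id)).smul
      (continuous_solutionKernel hα0 hα1 l)).intervalIntegrable _ _

lemma vconv_solutionKernel_monomialFun_smul (u : H) (l j : ℕ) {t : ℝ} (ht : 0 ≤ t) :
    vconv (funCalc R) (solutionKernel hα0 hα1 l) (fun s => monomialFun j s • u) t =
      funCalc R (solutionKernel hα0 hα1 (j + l + 1) t) u := by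
  rw [vconv_eq_swap, ← iterInt_funCalc_apply u l j ht, iterInt_apply]
  exact intervalIntegral.integral_congr fun s _ => by simp only [map_smul]

end SolutionKernel

/-! ### Functions with vanishing iterated integrals. -/

section Uniqueness

variable {E : Type*} [NormedAddCommGroup E] [NormedSpace ℝ E] [CompleteSpace E]

lemma eqOn_zero_of_integral_eq_zero {f : ℝ → E} {T : ℝ} (hT : 0 < T)
    (hf : ContinuousOn f (Icc 0 T)) (h : ∀ t ∈ Icc (0 : ℝ) T, ∫ s in (0 : ℝ)..t, f s = 0) :
    EqOn f 0 (Icc 0 T) := by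
  have h1 : EqOn f 0 (Ioo 0 T) := by
    intro t ht
    have hm : Ioo (0 : ℝ) T ∈ 𝓝 t := Ioo_mem_nhds ht.1 ht.2
    have hd : HasDerivAt (fun t => ∫ s in (0 : ℝ)..t, f s) (f t) t := by
      refine intervalIntegral.integral_hasDerivAt_right ?_ ?_ ?_
      · rw [intervalIntegrable_iff_integrableOn_Ioc_of_le ht.1.le]
        exact integrableOn_of_continuousOn (hf.mono (Icc_subset_Icc_right ht.2.le))
      · exact (hf.mono Ioo_subset_Icc_self).stronglyMeasurableAtFilter isOpen_Ioo t ht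
      · exact hf.continuousAt (Icc_mem_nhds ht.1 ht.2)
    have hz : HasDerivAt (fun t => ∫ s in (0 : ℝ)..t, f s) 0 t := by
      refine (hasDerivAt_const t (0 : E)).congr_of_eventuallyEq ?_
      filter_upwards [hm] with s hs using h s ⟨hs.1.le, hs.2.le⟩
    exact hd.unique hz
  refine h1.of_subset_closure hf continuousOn_const Ioo_subset_Icc_self ?_
  rw [closure_Ioo hT.ne]

lemma eqOn_zero_of_iterInt_eq_zero {f : ℝ → E} {T : ℝ} (hT : 0 < T)
    (hf : ContinuousOn f (Icc 0 T)) (h : ∀ t ∈ Icc (0 : ℝ) T, iterInt 1 f t = 0) :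
    EqOn f 0 (Icc 0 T) := by
  have hi := integrableOn_of_continuousOn hf
  refine eqOn_zero_of_integral_eq_zero hT hf fun t ht => ?_
  rw [← iterInt_zero]
  exact eqOn_zero_of_integral_eq_zero hT (continuousOn_iterInt hi 0)
    (fun s hs => by rw [← iterInt_succ hi hs.1 hs.2]; exact h s hs) ht

end Uniqueness

/-! ### The continuous problem multiplied by the resolvent. -/

section ContinuousProblem

variable {H : Type*} [NormedAddCommGroup H] [InnerProductSpace ℝ H] [CompleteSpace H]
  {R : H →L[ℝ] H} {α T : ℝ}

lemma intervalIntegrable_rlKernel (hα1 : α < 1) (t : ℝ) :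
    IntervalIntegrable (fun s : ℝ => s ^ (-α)) volume 0 t :=
  intervalIntegral.intervalIntegrable_rpow' (by linarith)

lemma rlIntegral_eq_vconv (V : ℝ → H) (t : ℝ) :
    rlIntegral (1 - α) V t =
      vconv (ContinuousLinearMap.lsmul ℝ ℝ) (fun s => (Real.Gamma (1 - α))⁻¹ * s ^ (-α)) V t := by
  rw [rlIntegral, vconv, ← intervalIntegral.integral_smul]
  refine intervalIntegral.integral_congr fun s _ => ?_
  change _ = ((Real.Gamma (1 - α))⁻¹ * (t - s) ^ (-α)) • V s
  rw [smul_smul, show 1 - α - 1 = -α by ring]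

lemma continuousOn_rlIntegral (hα1 : α < 1) {V : ℝ → H} (hV : ContinuousOn V (Icc 0 T))
    (hV0 : V 0 = 0) : ContinuousOn (rlIntegral (1 - α) V) (Icc 0 T) := by
  have h : rlIntegral (1 - α) V = vconv (ContinuousLinearMap.lsmul ℝ ℝ : ℝ →L[ℝ] H →L[ℝ] H).flip V
      fun s => (Real.Gamma (1 - α))⁻¹ * s ^ (-α) := by
    funext t
    rw [rlIntegral_eq_vconv, ← vconv_flip]
  rw [h]
  refine continuousOn_vconv _ hV hV0 ?_
  rcases le_or_gt T 0 with hT | hT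
  · rw [Ioc_eq_empty (not_lt.2 hT)]; exact integrableOn_empty
  exact (intervalIntegrable_iff_integrableOn_Ioc_of_le hT.le).1
    ((intervalIntegrable_rlKernel hα1 T).const_mul _)

/-- This is the left side of the equation after multiplication by R and one integration in time:
evaluated at R, the kernel is (1 - R) plus the Riemann–Liouville kernel times R. -/
lemma vconv_fracKernelMap (hR : IsSymmContraction R) (hα1 : α < 1) {V : ℝ → H}
    (hV : ContinuousOn V (Icc 0 T)) {t : ℝ} (ht : t ∈ Icc 0 T) :
    vconv (funCalc R) (fracKernelMap α) V t =
      R (rlIntegral (1 - α) V t) + ((∫ s in (0 : ℝ)..t, V s) - R (∫ s in (0 : ℝ)..t, V s)) := by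
  have hi : IntervalIntegrable V volume 0 t := by
    rw [intervalIntegrable_iff_integrableOn_Ioc_of_le ht.1]
    exact integrableOn_of_continuousOn (hV.mono (Icc_subset_Icc_right ht.2))
  have hk : IntervalIntegrable
      (fun s => ((Real.Gamma (1 - α))⁻¹ * (t - s) ^ (-α)) • V s) volume 0 t := by
    have h1 : IntervalIntegrable (fun s => (Real.Gamma (1 - α))⁻¹ * (t - s) ^ (-α))
        volume 0 t := by
      have := (((intervalIntegrable_rlKernel hα1 t).const_mul (Real.Gamma (1 - α))⁻¹).comp_sub_left
        t).symm
      simpa using this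
    rw [intervalIntegrable_iff_integrableOn_Icc_of_le ht.1] at h1 ⊢
    exact h1.smul_continuousOn (hV.mono (Icc_subset_Icc_right ht.2)) isCompact_Icc
  have h1 : ∀ s, funCalc R (fracKernelMap α (t - s)) (V s) = (V s - R (V s)) +
      R (((Real.Gamma (1 - α))⁻¹ * (t - s) ^ (-α)) • V s) := by
    intro s
    rw [fracKernelMap, map_add, map_sub, map_smul, hR.funCalc_one, hR.funCalc_coordFun, map_smul]
    rfl
  have hRi : IntervalIntegrable (fun s => R (V s)) volume 0 t := ⟨R.integrable_comp hi.1,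
    R.integrable_comp hi.2⟩
  have hRk : IntervalIntegrable (fun s => R (((Real.Gamma (1 - α))⁻¹ * (t - s) ^ (-α)) • V s))
      volume 0 t := ⟨R.integrable_comp hk.1, R.integrable_comp hk.2⟩
  rw [vconv]
  simp_rw [h1]
  rw [intervalIntegral.integral_add (hi.sub hRi) hRk, intervalIntegral.integral_sub hi hRi,
    R.intervalIntegral_comp_comm hi, R.intervalIntegral_comp_comm hk, rlIntegral_eq_vconv, add_comm]
  rfl

/-- The integrated form of the subdiffusion equation, in terms of the resolvent `R`. -/
lemma vconv_fracKernelMap_eq (hR : IsSymmContraction R) (hα1 : α < 1) {v : H} {g V : ℝ → H}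
    (hg : ContinuousOn g (Icc 0 T)) (hV : ContinuousOn V (Icc 0 T)) (hV0 : V 0 = 0)
    (heq : ∀ t ∈ Ioc (0 : ℝ) T, ∃ DV AV : H,
      HasDerivWithinAt (rlIntegral (1 - α) V) DV (Icc 0 T) t ∧
      V t + v = R (V t + v - AV) ∧ DV - AV = g t) {t : ℝ} (ht : t ∈ Icc 0 T) :
    vconv (funCalc R) (fracKernelMap α) V t =
      iterInt 0 (fun s => R (g s)) t - monomialFun 1 t • (v - R v) := by
  have hi : ∀ {f : ℝ → H}, ContinuousOn f (Icc 0 T) → IntervalIntegrable f volume 0 t := by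
    intro f hf
    rw [intervalIntegrable_iff_integrableOn_Ioc_of_le ht.1]
    exact integrableOn_of_continuousOn (hf.mono (Icc_subset_Icc_right ht.2))
  have hRc : ∀ {f : ℝ → H}, ContinuousOn f (Icc 0 T) → ContinuousOn (fun s => R (f s)) (Icc 0 T) :=
    fun hf => R.continuous.comp_continuousOn hf
  have h0 : rlIntegral (1 - α) V 0 = 0 := by simp [rlIntegral]
  -- The identity u = R(u - Au) for u = V + v gives R A u = R u - u, so the R-image of the
  -- derivative DV is the integrand, in which A no longer occurs.
  have hftc : ∫ s in (0 : ℝ)..t, ((R (g s) - (v - R v)) - (V s - R (V s))) =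
      R (rlIntegral (1 - α) V t) - R (rlIntegral (1 - α) V 0) := by
    refine intervalIntegral.integral_eq_sub_of_hasDerivAt_of_le ht.1
      ((hRc (continuousOn_rlIntegral hα1 hV hV0)).mono (Icc_subset_Icc_right ht.2))
      (fun s hs => ?_) (hi (((hRc hg).sub continuousOn_const).sub (hV.sub (hRc hV))))
    have hs' : s ∈ Ioo 0 T := ⟨hs.1, hs.2.trans_le ht.2⟩
    obtain ⟨DV, AV, hd, hr, he⟩ := heq s ⟨hs'.1, hs'.2.le⟩
    have hd' := R.hasFDerivAt.comp_hasDerivAt s (hd.hasDerivAt (Icc_mem_nhds hs'.1 hs'.2))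
    refine hd'.congr_deriv ?_
    rw [← he, map_sub]
    rw [map_sub, map_add] at hr
    have : R AV = R (V s) + R v - (V s + v) := by rw [hr]; abel
    rw [this]
    abel
  rw [h0, map_zero, sub_zero, intervalIntegral.integral_sub
    ((hi (hRc hg)).sub intervalIntegrable_const) ((hi hV).sub (hi (hRc hV))),
    intervalIntegral.integral_sub (hi (hRc hg)) intervalIntegrable_const,
    intervalIntegral.integral_sub (hi hV) (hi (hRc hV)), intervalIntegral.integral_const,
    R.intervalIntegral_comp_comm (hi hV)] at hftc
  rw [vconv_fracKernelMap hR hα1 hV ht, ← hftc, iterInt_zero]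
  simp [monomialFun]

/-- Convolve the integrated equation with the kernel of index 0. By
`vconv_solutionKernel_fracKernelMap` the left side becomes convolution of V with t R, the double
integral of R V. On the right, the Taylor expansion of g produces kernels two indices higher. Both
sides are therefore double integrals of the claimed continuous functions, and equality follows by
uniqueness. -/
theorem apply_solution_eq (hR : IsSymmContraction R) (hα0 : 0 < α) (hα1 : α < 1) (hT : 0 < T)
    {v : H} {g gk V : ℝ → H} {a : ℕ → H} {n : ℕ} (hgk : IntegrableOn gk (Ioc 0 T))
    (hgt : ∀ t ∈ Icc (0 : ℝ) T, g t =
      ∑ l ∈ Finset.range (n + 1), monomialFun l t • a l + iterInt n gk t)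
    (hg : ContinuousOn g (Icc 0 T)) (hV : ContinuousOn V (Icc 0 T)) (hV0 : V 0 = 0)
    (heq : ∀ t ∈ Ioc (0 : ℝ) T, ∃ DV AV : H,
      HasDerivWithinAt (rlIntegral (1 - α) V) DV (Icc 0 T) t ∧
      V t + v = R (V t + v - AV) ∧ DV - AV = g t) {t : ℝ} (ht : t ∈ Icc 0 T) :
    R (V t) = ∑ l ∈ Finset.range (n + 1), funCalc R (solutionKernel hα0 hα1 l t) (R (a l)) +
      vconv (funCalc R) (solutionKernel hα0 hα1 n) (fun s => R (gk s)) t -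
      funCalc R (solutionKernel hα0 hα1 0 t) (v - R v) := by
  have hRgk : IntegrableOn (fun s => R (gk s)) (Ioc 0 T) := R.integrable_comp hgk
  have hRg : ∀ t ∈ Icc (0 : ℝ) T, R (g t) =
      ∑ l ∈ Finset.range (n + 1), monomialFun l t • R (a l) + iterInt n (fun s => R (gk s)) t := by
    intro t ht
    rw [hgt t ht, map_add, map_sum, iterInt_apply, iterInt_apply,
      ← R.intervalIntegral_comp_comm (intervalIntegrable_iterInt hgk ht.1 ht.2 n)]
    simp_rw [map_smul]
  set Z : ℝ → H := fun t => ∑ l ∈ Finset.range (n + 1), funCalc R (solutionKernel hα0 hα1 l t)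
    (R (a l)) + vconv (funCalc R) (solutionKernel hα0 hα1 n) (fun s => R (gk s)) t -
      funCalc R (solutionKernel hα0 hα1 0 t) (v - R v) with hZ
  have hc1 : ∀ l (u : H), Continuous fun t => funCalc R (solutionKernel hα0 hα1 l t) u :=
    fun l u => ((funCalc R).continuous.comp (continuous_solutionKernel hα0 hα1 l)).clm_apply
      continuous_const
  have hc2 : ContinuousOn (vconv (funCalc R) (solutionKernel hα0 hα1 n) fun s => R (gk s))
      (Icc 0 T) := continuousOn_vconv _ (continuous_solutionKernel hα0 hα1 n).continuousOn
    (solutionKernel_zero hα0 hα1 n) hRgk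
  have hc3 : Continuous fun t => ∑ l ∈ Finset.range (n + 1),
      funCalc R (solutionKernel hα0 hα1 l t) (R (a l)) :=
    continuous_finsetSum _ fun l _ => hc1 l _
  have hZc : ContinuousOn Z (Icc 0 T) := (hc3.continuousOn.add hc2).sub (hc1 0 _).continuousOn
  have hRV : ContinuousOn (fun t => R (V t)) (Icc 0 T) := R.continuous.comp_continuousOn hV
  refine sub_eq_zero.1 (eqOn_zero_of_iterInt_eq_zero hT (hRV.sub hZc) (fun t ht => ?_) ht)
  have e1 : iterInt 1 Z t = ∑ l ∈ Finset.range (n + 1),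
      funCalc R (solutionKernel hα0 hα1 (1 + l + 1) t) (R (a l)) +
      vconv (funCalc R) (solutionKernel hα0 hα1 (1 + n + 1)) (fun s => R (gk s)) t -
      funCalc R (solutionKernel hα0 hα1 (1 + 0 + 1) t) (v - R v) := by
    have hc4 : ContinuousOn (fun t => ∑ l ∈ Finset.range (n + 1),
      funCalc R (solutionKernel hα0 hα1 l t) (R (a l)) +
      vconv (funCalc R) (solutionKernel hα0 hα1 n) (fun s => R (gk s)) t) (Icc 0 T) :=
      hc3.continuousOn.add hc2
    rw [hZ, iterInt_sub (integrableOn_of_continuousOn hc4)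
      (integrableOn_of_continuousOn (hc1 0 _).continuousOn) ht.1 ht.2,
      iterInt_add (integrableOn_of_continuousOn hc3.continuousOn)
      (integrableOn_of_continuousOn hc2) ht.1 ht.2,
      iterInt_finsetSum _ (fun l _ => integrableOn_of_continuousOn (hc1 l _).continuousOn) ht.1 ht.2,
      iterInt_funCalc_apply _ _ _ ht.1, iterInt_vconv_solutionKernel hRgk ht.1 ht.2]
    simp_rw [iterInt_funCalc_apply _ _ _ ht.1]
  have e2 : iterInt 1 (fun t => R (V t)) t =
      vconv (funCalc R) (solutionKernel hα0 hα1 0) (vconv (funCalc R) (fracKernelMap α) V) t := by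
    rw [← vconv_assoc (ContinuousLinearMap.mul ℝ C(Icc (0 : ℝ) 1, ℝ)) (funCalc R) (funCalc R)
      (funCalc R) (fun x y z => hR.funCalc_mul_apply x y z)
      (continuous_solutionKernel hα0 hα1 0).continuousOn (integrableOn_fracKernelMap hα1 T)
      (integrableOn_of_continuousOn hV) ht.1 ht.2, iterInt_apply]
    refine Eq.trans ?_ (vconv_congr (f := fun s => s • coordFun) (funCalc R) ht.1 (fun s hs _ =>
      (vconv_solutionKernel_fracKernelMap hα0 hα1 hs.le).symm) fun _ _ _ => rfl)
    refine intervalIntegral.integral_congr fun s _ => ?_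
    simp only [map_smul, hR.funCalc_coordFun, monomialFun]
    simp
  have e3 : vconv (funCalc R) (solutionKernel hα0 hα1 0) (vconv (funCalc R) (fracKernelMap α) V) t =
      iterInt 1 Z t := by
    rw [vconv_congr (g' := fun s => (∑ l ∈ Finset.range (n + 1), monomialFun (0 + l + 1) s • R (a l)
      + iterInt (0 + n + 1) (fun s => R (gk s)) s) - monomialFun 1 s • (v - R v)) (funCalc R) ht.1
      (fun _ _ _ => rfl) fun s h0 h1 => by
        rw [vconv_fracKernelMap_eq hR hα1 hg hV hV0 heq ⟨h0.le, h1.trans ht.2⟩,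
          iterInt_taylor hRgk hRg ⟨h0.le, h1.trans ht.2⟩], e1]
    have hc4 : ∀ l, ContinuousOn (fun s => monomialFun (0 + l + 1) s • R (a l)) (Icc 0 t) :=
      fun l => ((continuous_monomialFun _).smul continuous_const).continuousOn
    have hc5 := continuousOn_iterInt (hRgk.mono_set (Ioc_subset_Ioc_right ht.2)) (0 + n + 1)
    have hc6 : ContinuousOn (fun s => monomialFun 1 s • (v - R v)) (Icc 0 t) :=
      ((continuous_monomialFun _).smul continuous_const).continuousOn
    have hi4 := fun l => intervalIntegrable_funCalc_apply (R := R) (hα0 := hα0) (hα1 := hα1)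
      (hc4 l) ht.1 0
    have hi5 := intervalIntegrable_funCalc_apply (R := R) (hα0 := hα0) (hα1 := hα1) hc5 ht.1 0
    have hi6 := intervalIntegrable_funCalc_apply (R := R) (hα0 := hα0) (hα1 := hα1) hc6 ht.1 0
    have hi7 := IntervalIntegrable.sum (Finset.range (n + 1)) fun l _ => hi4 l
    rw [vconv]
    simp_rw [map_sub, map_add, map_sum]
    simp only [Finset.sum_fn] at hi7
    rw [intervalIntegral.integral_sub (hi7.add hi5) hi6, intervalIntegral.integral_add hi7 hi5,
      intervalIntegral.integral_finsetSum fun l _ => hi4 l]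
    simp_rw [← map_sub]
    have e4 := fun (u : H) j => vconv_solutionKernel_monomialFun_smul (R := R) (hα0 := hα0)
      (hα1 := hα1) u 0 j ht.1
    have e5 := vconv_solutionKernel_iterInt (R := R) (hα0 := hα0) (hα1 := hα1) hRgk ht.1 ht.2 0
      (0 + n + 1)
    unfold vconv at e4 e5
    rw [e4, e5]
    simp_rw [e4]
    simp only [zero_add, add_zero, add_comm 1]
    rfl
  change iterInt 1 (fun t => R (V t) - Z t) t = 0
  rw [iterInt_sub (integrableOn_of_continuousOn hRV) (integrableOn_of_continuousOn hZc) ht.1 ht.2,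
    e2, e3, sub_self]

end ContinuousProblem

/-! ### Representation of the discrete solution -/

section Quadrature

variable {E : Type*} [NormedAddCommGroup E] [NormedSpace ℝ E]

lemma bdfQuadrature_smul_const (τ β : ℝ) (k : ℕ) (c : ℕ → ℝ) (a : E) (n : ℕ) :
    bdfQuadrature τ β k (fun i => c i • a) n = bdfQuadrature τ β k c n • a := by
  simp only [bdfQuadrature, smul_assoc, Finset.sum_smul]

lemma bdfQuadrature_add (τ β : ℝ) (k : ℕ) (f f' : ℕ → E) (n : ℕ) :
    bdfQuadrature τ β k (fun i => f i + f' i) n =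
      bdfQuadrature τ β k f n + bdfQuadrature τ β k f' n := by
  simp only [bdfQuadrature, smul_add, Finset.sum_add_distrib]

lemma bdfQuadrature_sum (τ β : ℝ) (k : ℕ) {ι : Type*} (s : Finset ι) (f : ι → ℕ → E) (n : ℕ) :
    bdfQuadrature τ β k (fun i => ∑ l ∈ s, f l i) n = ∑ l ∈ s, bdfQuadrature τ β k (f l) n := by
  simp only [bdfQuadrature, Finset.smul_sum]
  rw [Finset.sum_comm]

lemma bdfQuadrature_congr (τ β : ℝ) (k : ℕ) {f f' : ℕ → E} {n : ℕ} (h : ∀ i ≤ n, f i = f' i) :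
    bdfQuadrature τ β k f n = bdfQuadrature τ β k f' n := by
  unfold bdfQuadrature
  congr 1
  exact Finset.sum_congr rfl fun j _ => by rw [h _ (Nat.sub_le _ _)]

lemma bdfQuadrature_integral [CompleteSpace E] (τ β : ℝ) (k : ℕ) {f : ℕ → ℝ → E}
    {μ : Measure ℝ} (hf : ∀ i, Integrable (f i) μ) (n : ℕ) :
    bdfQuadrature τ β k (fun i => ∫ s, f i s ∂μ) n =
      ∫ s, bdfQuadrature τ β k (fun i => f i s) n ∂μ := by
  simp only [bdfQuadrature]
  rw [integral_smul, integral_finsetSum (f := fun j s => bdfWeight β k j • f (n - j) s) _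
    fun j _ => (hf (n - j)).smul (bdfWeight β k j)]
  simp_rw [integral_smul]

end Quadrature

/-- The values of `∂^m_{τ,k}` on the truncated powers `(t - s)₊^{l+m} / (l+m)!`, up to the
factor `τ^l`. -/
def dataCoeff (k m : ℕ) (τ : ℝ) (l : ℕ) (s : ℝ) (n : ℕ) : ℝ :=
  PowerSeries.coeff n (((bdfPoly k ^ m : Polynomial ℝ) : PowerSeries ℝ) *
    sampleSeries (monomialFun (l + m)) (s / τ))

/-- Rescaling time by τ extracts τ^{l+m} from the truncated power; the prefactor τ^{-m} of the
quadrature leaves τ^l. -/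
lemma bdfQuadrature_truncated_power (k m : ℕ) {τ : ℝ} (hτ : 0 < τ) (l : ℕ) (s : ℝ) (n : ℕ) :
    bdfQuadrature τ m k (fun i : ℕ => if s ≤ i * τ then monomialFun (l + m) (i * τ - s) else 0) n =
      τ ^ l * dataCoeff k m τ l s n := by
  rw [bdfQuadrature, dataCoeff, PowerSeries.coeff_mul,
    Finset.Nat.sum_antidiagonal_eq_sum_range_succ_mk, Finset.mul_sum, Finset.smul_sum]
  refine Finset.sum_congr rfl fun j _ => ?_
  rw [bdfWeight_natCast, coeff_sampleSeries, Polynomial.coeff_coe, Real.rpow_neg hτ.le,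
    Real.rpow_natCast, smul_eq_mul, smul_eq_mul]
  simp only [div_le_iff₀ hτ]
  split_ifs
  · have : monomialFun (l + m) (((n - j : ℕ) : ℝ) * τ - s) =
        τ ^ (l + m) * monomialFun (l + m) (((n - j : ℕ) : ℝ) - s / τ) := by
      rw [monomialFun, monomialFun, mul_div_assoc', ← mul_pow]
      congr 2
      field_simp
    rw [this, pow_add]
    field_simp
  · ring

lemma dataCoeff_eq_zero (k m : ℕ) {τ : ℝ} (hτ : 0 < τ) (l : ℕ) {s : ℝ} {n : ℕ} (h : n * τ < s) :
    dataCoeff k m τ l s n = 0 := by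
  have h1 := bdfQuadrature_truncated_power k m hτ l s n
  rw [bdfQuadrature_congr (f' := fun _ => (0 : ℝ) • (0 : ℝ)), bdfQuadrature_smul_const,
    smul_zero] at h1
  · rcases mul_eq_zero.1 h1.symm with h | h
    · exact absurd h (by positivity)
    · exact h
  · intro i hi
    rw [if_neg, smul_zero]
    have : (i : ℝ) ≤ n := by exact_mod_cast hi
    nlinarith

/-- The response of the discrete solution operator to a truncated power. -/
def dataKernel (α : ℝ) (k m : ℕ) (τ : ℝ) (l : ℕ) (s : ℝ) (n : ℕ) : C(Icc (0 : ℝ) 1, ℝ) :=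
  ∑ i ∈ Finset.range (n + 1), (τ ^ l * dataCoeff k m τ l s (n - i)) • discreteKernel α k τ i

lemma dataKernel_eq_zero (α : ℝ) (k m : ℕ) {τ : ℝ} (hτ : 0 < τ) (l : ℕ) {s : ℝ} {n : ℕ}
    (h : n * τ < s) : dataKernel α k m τ l s n = 0 := by
  refine Finset.sum_eq_zero fun i _ => ?_
  rw [dataCoeff_eq_zero k m hτ l, mul_zero, zero_smul]
  have : ((n - i : ℕ) : ℝ) ≤ n := by exact_mod_cast Nat.sub_le _ _
  nlinarith

lemma IsSpectralWeight.congr {W W' : ℝ → ℝ} (h : IsSpectralWeight W)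
    (he : ∀ r, 0 < r → W' r = W r) : IsSpectralWeight W' := by
  obtain ⟨M, hM⟩ := h.bound
  exact ⟨h.1.congr he, M, fun r hr => by rw [he r hr]; exact hM r hr⟩

/-- Both kernels are superpositions with the same spectral density, so the fractional error reduces
to scalar BDF errors with ρ = rτ and starting point s/τ. The rescaling to unit step produces
τ^{l+1}. -/
lemma dataKernel_sub {α : ℝ} (hα0 : 0 < α) (hα1 : α < 1) {k : ℕ} (hk1 : 1 ≤ k) (hk : k ≤ 6) (m : ℕ)
    {τ : ℝ} (hτ : 0 < τ) (l : ℕ) (s : ℝ) (n : ℕ) :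
    IsSpectralWeight (fun r => τ ^ (l + 1) * PowerSeries.coeff n (odeError k m l (r * τ) (s / τ))) ∧
    dataKernel α k m τ l s n - (if s ≤ n * τ then solutionKernel hα0 hα1 l (n * τ - s) else 0) =
      superpose α
        fun r => τ ^ (l + 1) * PowerSeries.coeff n (odeError k m l (r * τ) (s / τ)) := by
  set W₁ : ℝ → ℝ := fun r => ∑ i ∈ Finset.range (n + 1), (τ ^ l * dataCoeff k m τ l s (n - i)) *
    (τ * PowerSeries.coeff i (bdfResolvent k (r * τ))) with hW₁
  set W₂ : ℝ → ℝ := fun r => if s ≤ n * τ then expIntegral r (l + 1) (n * τ - s) else 0 with hW₂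
  have h1 : ∀ i ∈ Finset.range (n + 1), IsSpectralWeight fun r =>
      (τ ^ l * dataCoeff k m τ l s (n - i)) *
      (τ * PowerSeries.coeff i (bdfResolvent k (r * τ))) := fun i _ =>
    (isSpectralWeight_discreteKernel hk1 hk hτ i).const_mul _
  have hw1 : IsSpectralWeight W₁ := isSpectralWeight_sum _ h1
  have hw2 : IsSpectralWeight W₂ := by
    rw [hW₂]
    split_ifs with h
    · exact isSpectralWeight_expIntegral l (by linarith)
    · exact isSpectralWeight_zero
  have he : ∀ r, 0 < r → τ ^ (l + 1) * PowerSeries.coeff n (odeError k m l (r * τ) (s / τ)) =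
      W₁ r + (-1) * W₂ r := by
    intro r hr
    have e1 : τ ^ (l + 1) * PowerSeries.coeff n (sampleSeries (expIntegral (r * τ) (l + 1)) (s / τ)) =
        W₂ r := by
      simp only [coeff_sampleSeries, hW₂, div_le_iff₀ hτ]
      split_ifs
      · rw [← expIntegral_scale hr.ne' hτ.ne']
        congr 1
        field_simp
      · rw [mul_zero]
    rw [odeError, map_sub, mul_sub, e1, mul_comm (_ * _) (bdfResolvent _ _), PowerSeries.coeff_mul,
      Finset.Nat.sum_antidiagonal_eq_sum_range_succ_mk, Finset.mul_sum, neg_one_mul,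
      ← sub_eq_add_neg]
    congr 1
    refine Finset.sum_congr rfl fun i _ => ?_
    rw [dataCoeff]
    ring
  have hw := (hw1.add (hw2.const_mul (-1))).congr he
  refine ⟨hw, ?_⟩
  rw [superpose_congr hα0 hα1 hw (hw1.add (hw2.const_mul (-1))) he,
    superpose_add hα0 hα1 hw1 (hw2.const_mul (-1)), superpose_const_mul hα0 hα1 hw2,
    superpose_sum hα0 hα1 _ h1, neg_one_smul, ← sub_eq_add_neg]
  congr 1
  · refine Finset.sum_congr rfl fun i _ => ?_
    rw [superpose_const_mul hα0 hα1 (isSpectralWeight_discreteKernel hk1 hk hτ i)]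
    rfl
  · split_ifs with h
    · rw [solutionKernel_eq_superpose hα0 hα1 l (by linarith)]
      congr 1
      funext r
      simp only [hW₂, if_pos h]
    · have : W₂ = fun _ => 0 := by funext r; simp only [hW₂, if_neg h]
      rw [this]
      ext x
      rw [superpose_apply hα0 hα1 isSpectralWeight_zero]
      simp

section Discrete

variable {H : Type*} [NormedAddCommGroup H] [InnerProductSpace ℝ H] [CompleteSpace H]
  {R : H →L[ℝ] H} {α T τ : ℝ} {k m : ℕ}

lemma sum_fracWeight_apply (hR : IsSymmContraction R) (V : ℕ → H) (n : ℕ) :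
    ∑ j ∈ Finset.range (n + 1), funCalc R (fracWeight α k τ j) (V (n - j)) =
      (V n - R (V n)) + R (bdfQuadrature τ α k V n) := by
  have h : ∀ j, funCalc R (fracWeight α k τ j) (V (n - j)) =
      (if j = 0 then V n - R (V n) else 0) + (τ ^ (-α) * bdfWeight α k j) • R (V (n - j)) := by
    intro j
    rw [fracWeight, map_add, map_smul, hR.funCalc_coordFun]
    split_ifs with hj
    · rw [map_sub, hR.funCalc_one, hR.funCalc_coordFun, hj]; rfl
    · rw [map_zero]; rfl
  simp_rw [h]
  rw [Finset.sum_add_distrib, Finset.sum_ite_eq' , if_pos (by simp), bdfQuadrature, map_smul,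
    map_sum, Finset.smul_sum]
  simp_rw [map_smul, smul_smul]

/-- Discrete Duhamel formula. Convolve the scheme with the discrete kernel, regroup the double
convolution, and use that kernel and weights convolve to x at index 0 and to zero elsewhere. -/
lemma apply_eq_sum_discreteKernel (hR : IsSymmContraction R) (hα0 : 0 < α) (hα1 : α < 1)
    (hk1 : 1 ≤ k) (hk : k ≤ 6) (hτ : 0 < τ) {V D : ℕ → H} {n : ℕ}
    (h : ∀ i ≤ n, ∑ j ∈ Finset.range (i + 1), funCalc R (fracWeight α k τ j) (V (i - j)) = D i) :
    R (V n) = ∑ i ∈ Finset.range (n + 1), funCalc R (discreteKernel α k τ i) (D (n - i)) := by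
  have e1 : ∑ i ∈ Finset.range (n + 1), funCalc R (discreteKernel α k τ i) (D (n - i)) =
      ∑ p ∈ Finset.HasAntidiagonal.antidiagonal n, ∑ q ∈ Finset.HasAntidiagonal.antidiagonal p.2,
        funCalc R (discreteKernel α k τ p.1 * fracWeight α k τ q.1) (V q.2) := by
    rw [Finset.Nat.sum_antidiagonal_eq_sum_range_succ_mk]
    refine Finset.sum_congr rfl fun i _ => ?_
    rw [← h _ (Nat.sub_le _ _), map_sum, Finset.Nat.sum_antidiagonal_eq_sum_range_succ_mk]
    exact Finset.sum_congr rfl fun j _ => (hR.funCalc_mul_apply _ _ _).symm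
  have e2 : ∑ p ∈ Finset.HasAntidiagonal.antidiagonal n,
      ∑ q ∈ Finset.HasAntidiagonal.antidiagonal p.2,
        funCalc R (discreteKernel α k τ p.1 * fracWeight α k τ q.1) (V q.2) =
      ∑ p ∈ Finset.HasAntidiagonal.antidiagonal n, ∑ q ∈ Finset.HasAntidiagonal.antidiagonal p.1,
        funCalc R (discreteKernel α k τ q.1 * fracWeight α k τ q.2) (V p.2) := by
    rw [Finset.sum_sigma', Finset.sum_sigma']
    refine Finset.sum_nbij' (fun x => ⟨(x.1.1 + x.2.1, x.2.2), (x.1.1, x.2.1)⟩)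
      (fun x => ⟨(x.2.1, x.2.2 + x.1.2), (x.2.2, x.1.2)⟩) ?_ ?_ ?_ ?_ ?_
    · rintro ⟨⟨a, b⟩, ⟨c, e⟩⟩ hx
      simp only [Finset.mem_sigma, Finset.HasAntidiagonal.mem_antidiagonal] at hx ⊢
      obtain ⟨rfl, rfl⟩ := hx
      exact ⟨by rw [add_assoc], trivial⟩
    · rintro ⟨⟨a, b⟩, ⟨c, e⟩⟩ hx
      simp only [Finset.mem_sigma, Finset.HasAntidiagonal.mem_antidiagonal] at hx ⊢
      obtain ⟨rfl, rfl⟩ := hx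
      exact ⟨by rw [add_assoc], trivial⟩
    · rintro ⟨⟨a, b⟩, ⟨c, e⟩⟩ hx
      simp only [Finset.mem_sigma, Finset.HasAntidiagonal.mem_antidiagonal] at hx ⊢
      obtain ⟨-, rfl⟩ := hx
      rfl
    · rintro ⟨⟨a, b⟩, ⟨c, e⟩⟩ hx
      simp only [Finset.mem_sigma, Finset.HasAntidiagonal.mem_antidiagonal] at hx ⊢
      obtain ⟨-, rfl⟩ := hx
      rfl
    · rintro ⟨⟨a, b⟩, ⟨c, e⟩⟩ hx
      rfl
  rw [e1, e2, Finset.Nat.sum_antidiagonal_eq_sum_range_succ_mk]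
  have e3 : ∀ i, ∑ q ∈ Finset.HasAntidiagonal.antidiagonal i,
      funCalc R (discreteKernel α k τ q.1 * fracWeight α k τ q.2) (V (n - i)) =
      if i = 0 then R (V n) else 0 := by
    intro i
    have := sum_discreteKernel_mul_fracWeight hα0 hα1 hk1 hk hτ i
    rw [← _root_.sum_apply, ← map_sum, Finset.Nat.sum_antidiagonal_eq_sum_range_succ_mk]
    simp only
    rw [this]
    split_ifs with hi
    · rw [hR.funCalc_coordFun, hi]; rfl
    · rw [map_zero]; rfl
  simp_rw [e3]
  rw [Finset.sum_ite_eq', if_pos (by simp)]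

end Discrete

section Discrete

variable {H : Type*} [NormedAddCommGroup H] [InnerProductSpace ℝ H] [CompleteSpace H]
  {R : H →L[ℝ] H} {α T τ : ℝ} {k m : ℕ}

lemma integrableOn_truncated_power_smul {gk : ℝ → H} (hgk : IntegrableOn gk (Ioc 0 T)) (p : ℕ)
    (t : ℝ) : IntegrableOn (fun s => (if s ≤ t then monomialFun p (t - s) else 0) • gk s)
      (Ioc 0 T) := by
  have h1 : IntegrableOn gk (Icc 0 T) := (integrableOn_Icc_iff_integrableOn_Ioc (by simp)).2 hgk
  have h2 := (h1.continuousOn_smul (f := fun s => monomialFun p (t - s))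
    (((continuous_monomialFun p).comp (continuous_const.sub continuous_id)).continuousOn)
    isCompact_Icc).mono_set (Ioc_subset_Icc_self)
  have h3 : Integrable _ (volume.restrict (Ioc 0 T)) := h2
  refine (h3.indicator (measurableSet_Iic (a := t))).congr (Eventually.of_forall fun s => ?_)
  simp only [indicator, mem_Iic]
  split_ifs <;> simp

lemma iterInt_eq_integral_truncated_power (gk : ℝ → H) (p : ℕ) {t : ℝ} (ht0 : 0 ≤ t)
    (htT : t ≤ T) : iterInt p gk t =
      ∫ s in Ioc 0 T, (if s ≤ t then monomialFun p (t - s) else 0) • gk s := by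
  rw [iterInt_apply, intervalIntegral.integral_of_le ht0,
    ← inter_eq_self_of_subset_right (Ioc_subset_Ioc_right htT), ← setIntegral_indicator
    measurableSet_Ioc]
  refine setIntegral_congr_fun measurableSet_Ioc fun s hs => ?_
  simp only [indicator, mem_Ioc, hs.1, true_and]
  split_ifs <;> simp

lemma integrableOn_dataCoeff_smul (hτ : 0 < τ) {gk : ℝ → H} (hgk : IntegrableOn gk (Ioc 0 T))
    (l n : ℕ) :
    IntegrableOn (fun s => (τ ^ l * dataCoeff k m τ l s n) • gk s) (Ioc 0 T) := by
  simp_rw [← bdfQuadrature_truncated_power k m hτ, bdfQuadrature, smul_assoc, Finset.sum_smul,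
    smul_assoc]
  exact (integrable_finsetSum _ fun j _ =>
    (integrableOn_truncated_power_smul hgk _ _).smul (bdfWeight m k j)).smul (τ ^ (-(m : ℝ)))

lemma bdfQuadrature_source (hτ : 0 < τ) {gk : ℝ → H} (hgk : IntegrableOn gk (Ioc 0 T))
    {a : ℕ → H} {G : ℕ → H} {q n : ℕ} (hn : n * τ ≤ T)
    (hG : ∀ i ≤ n, G i = ∑ l ∈ Finset.range (q + 1), monomialFun (l + m) (i * τ) • a l +
      iterInt (q + m) gk (i * τ)) :
    bdfQuadrature τ m k G n = ∑ l ∈ Finset.range (q + 1), (τ ^ l * dataCoeff k m τ l 0 n) • a l +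
      ∫ s in Ioc 0 T, (τ ^ q * dataCoeff k m τ q s n) • gk s := by
  have h0 : ∀ l, bdfQuadrature τ m k (fun i : ℕ => monomialFun (l + m) (i * τ)) n =
      τ ^ l * dataCoeff k m τ l 0 n := by
    intro l
    rw [← bdfQuadrature_truncated_power k m hτ]
    refine bdfQuadrature_congr _ _ _ fun i _ => ?_
    rw [if_pos (by positivity), sub_zero]
  rw [bdfQuadrature_congr (f' := fun i : ℕ =>
      ∑ l ∈ Finset.range (q + 1), monomialFun (l + m) (i * τ) • a l +
      ∫ s in Ioc 0 T, (if s ≤ i * τ then monomialFun (q + m) (i * τ - s) else 0) • gk s),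
    bdfQuadrature_add, bdfQuadrature_sum, bdfQuadrature_integral]
  · simp_rw [bdfQuadrature_smul_const, h0, bdfQuadrature_truncated_power k m hτ]
  · exact fun i => integrableOn_truncated_power_smul hgk _ _
  · intro i hi
    rw [hG i hi, iterInt_eq_integral_truncated_power (T := T) gk _ (by positivity)]
    have : (i : ℝ) ≤ n := by exact_mod_cast hi
    nlinarith

lemma integrableOn_funCalc_dataKernel (hτ : 0 < τ) {gk : ℝ → H} (hgk : IntegrableOn gk (Ioc 0 T))
    (l n : ℕ) :
    IntegrableOn (fun s => funCalc R (dataKernel α k m τ l s n) (gk s)) (Ioc 0 T) := by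
  have h : ∀ s, funCalc R (dataKernel α k m τ l s n) (gk s) = ∑ i ∈ Finset.range (n + 1),
      funCalc R (discreteKernel α k τ i) ((τ ^ l * dataCoeff k m τ l s (n - i)) • gk s) := by
    intro s
    rw [dataKernel, map_sum, _root_.sum_apply]
    refine Finset.sum_congr rfl fun i _ => ?_
    rw [map_smul, map_smul]; rfl
  simp_rw [h]
  exact integrable_finsetSum _ fun i _ =>
    (funCalc R (discreteKernel α k τ i)).integrable_comp (integrableOn_dataCoeff_smul hτ hgk l _)

lemma sum_funCalc_discreteKernel (u : H) (l : ℕ) (s : ℝ) (n : ℕ) :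
    ∑ i ∈ Finset.range (n + 1), funCalc R (discreteKernel α k τ i)
      ((τ ^ l * dataCoeff k m τ l s (n - i)) • u) = funCalc R (dataKernel α k m τ l s n) u := by
  rw [dataKernel, map_sum, _root_.sum_apply]
  refine Finset.sum_congr rfl fun i _ => ?_
  rw [map_smul, map_smul]; rfl

/-- The data are combinations of powers starting at 0 and, through the integral remainder, of
truncated powers starting at s. Linearity expresses the discrete solution by the responses to these,
in the same form as the continuous solution. -/
theorem apply_discrete_solution_eq (hR : IsSymmContraction R) (hα0 : 0 < α) (hα1 : α < 1)
    (hk1 : 1 ≤ k) (hk : k ≤ 6) (hm : 1 ≤ m) (hτ : 0 < τ) {v : H} {gk : ℝ → H}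
    (hgk : IntegrableOn gk (Ioc 0 T)) {a : ℕ → H} {G V : ℕ → H} {q n : ℕ} (hn : n * τ ≤ T)
    (hG : ∀ i ≤ n, G i = ∑ l ∈ Finset.range (q + 1), monomialFun (l + m) (i * τ) • a l +
      iterInt (q + m) gk (i * τ))
    (hV0 : V 0 = 0)
    (heq : ∀ i : ℕ, 1 ≤ i → i ≤ n → ∃ AV : H,
      V i + bdfQuadrature τ m k (fun j => (j * τ) ^ m / (m.factorial : ℝ)) i • v =
        R (V i + bdfQuadrature τ m k (fun j => (j * τ) ^ m / (m.factorial : ℝ)) i • v - AV) ∧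
      bdfQuadrature τ α k V i - AV = bdfQuadrature τ m k G i) :
    R (V n) = ∑ l ∈ Finset.range (q + 1), funCalc R (dataKernel α k m τ l 0 n) (R (a l)) +
      (∫ s in Ioc 0 T, funCalc R (dataKernel α k m τ q s n) (R (gk s))) -
      funCalc R (dataKernel α k m τ 0 0 n) (v - R v) := by
  have hRgk : IntegrableOn (fun s => R (gk s)) (Ioc 0 T) := R.integrable_comp hgk
  set μ : ℕ → ℝ := fun i => τ ^ 0 * dataCoeff k m τ 0 0 i with hμ
  have hμ' : ∀ i, bdfQuadrature τ m k (fun j : ℕ => ((j : ℝ) * τ) ^ m / (m.factorial : ℝ)) i = μ i := by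
    intro i
    rw [hμ]
    simp only
    rw [← bdfQuadrature_truncated_power k m hτ]
    refine bdfQuadrature_congr _ _ _ fun j _ => ?_
    rw [if_pos (by positivity), sub_zero, zero_add, monomialFun]
  have hle : ∀ i ≤ n, (i : ℝ) * τ ≤ T := by
    intro i hi
    have : (i : ℝ) ≤ n := by exact_mod_cast hi
    nlinarith
  -- The Duhamel formula also needs the equation at i = 0, where the scheme imposes none: V⁰ = 0,
  -- and by m ≥ 1 the values G 0 and μ 0 vanish too.
  have hD : ∀ i ≤ n, ∑ j ∈ Finset.range (i + 1), funCalc R (fracWeight α k τ j) (V (i - j)) =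
      R (bdfQuadrature τ m k G i) - μ i • (v - R v) := by
    intro i hi
    rw [sum_fracWeight_apply hR]
    rcases Nat.eq_zero_or_pos i with rfl | hi0
    · have hG0 : G 0 = 0 := by
        rw [hG 0 hi]
        have : ∀ l, monomialFun (l + m) 0 = 0 := fun l => by
          rw [monomialFun, zero_pow (by omega), zero_div]
        simp [iterInt_apply, this]
      have hμ0 : μ 0 = 0 := by
        rw [← hμ']
        simp [bdfQuadrature, show m ≠ 0 by omega]
      rw [hV0, hμ0]
      simp [bdfQuadrature, hV0, hG0]
    · obtain ⟨AV, h1, h2⟩ := heq i hi0 hi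
      rw [hμ', map_sub, map_add, map_smul] at h1
      rw [← h2, map_sub]
      have : R AV = R (V i) + μ i • R v - (V i + μ i • v) := by rw [h1]; abel
      rw [this, smul_sub]
      abel
  rw [apply_eq_sum_discreteKernel hR hα0 hα1 hk1 hk hτ hD]
  have hsrc : ∀ i ∈ Finset.range (n + 1), funCalc R (discreteKernel α k τ i)
      (R (bdfQuadrature τ m k G (n - i)) - μ (n - i) • (v - R v)) =
      ∑ l ∈ Finset.range (q + 1), funCalc R (discreteKernel α k τ i)
        ((τ ^ l * dataCoeff k m τ l 0 (n - i)) • R (a l)) +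
      (∫ s in Ioc 0 T, funCalc R (discreteKernel α k τ i)
        ((τ ^ q * dataCoeff k m τ q s (n - i)) • R (gk s))) -
      funCalc R (discreteKernel α k τ i) ((τ ^ 0 * dataCoeff k m τ 0 0 (n - i)) • (v - R v)) := by
    intro i _
    rw [bdfQuadrature_source hτ hgk (hle _ (Nat.sub_le _ _))
      (fun j hj => hG j (hj.trans (Nat.sub_le _ _))), map_add, map_sum,
      ← R.integral_comp_comm (integrableOn_dataCoeff_smul hτ hgk _ _)]
    simp only [map_smul R]
    rw [map_sub, map_add, map_sum, ← ContinuousLinearMap.integral_comp_comm _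
      (integrableOn_dataCoeff_smul hτ hRgk _ _)]
  rw [Finset.sum_congr rfl hsrc, Finset.sum_sub_distrib, Finset.sum_add_distrib,
    ← integral_finsetSum _ fun i _ => (funCalc R (discreteKernel α k τ i)).integrable_comp
      (integrableOn_dataCoeff_smul hτ hRgk _ _), Finset.sum_comm]
  simp_rw [sum_funCalc_discreteKernel]

end Discrete

/-! ### The error estimate -/

section ErrorEstimate

variable {H : Type*} [NormedAddCommGroup H] [InnerProductSpace ℝ H] [CompleteSpace H]
  {R : H →L[ℝ] H} {α T τ : ℝ} {m q : ℕ}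

/-- The difference of the discrete and the continuous response to a truncated power. -/
def errorKernel (α : ℝ) (k m : ℕ) (τ : ℝ) (l : ℕ) (s : ℝ) (n : ℕ) : C(Icc (0 : ℝ) 1, ℝ) :=
  superpose α fun r => τ ^ (l + 1) * PowerSeries.coeff n (odeError k m l (r * τ) (s / τ))

lemma IsSymmContraction.funCalc_comm (hR : IsSymmContraction R) (f : C(Icc (0 : ℝ) 1, ℝ)) (u : H) :
    funCalc R f (R u) = R (funCalc R f u) := by
  have h := hR.funCalc_mul_apply f coordFun u
  rw [mul_comm, hR.funCalc_mul_apply, hR.funCalc_coordFun] at h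
  exact h.symm

lemma norm_errorKernel_le (hα0 : 0 < α) (hα1 : α < 1) {k : ℕ} (hk1 : 1 ≤ k) (hk : k ≤ 6)
    (hτ : 0 < τ) {l n : ℕ} {s M : ℝ}
    (h : ∀ x ∈ Icc (0 : ℝ) 1, |∫ r in Ioi 0, spectralDensity α r x *
      (τ ^ (l + 1) * PowerSeries.coeff n (odeError k m l (r * τ) (s / τ)))| ≤ M) :
    ‖errorKernel α k m τ l s n‖ ≤ M := by
  have hw := (dataKernel_sub hα0 hα1 hk1 hk m hτ l s n).1
  rw [ContinuousMap.norm_le _ ((abs_nonneg _).trans (h 0 (by simp)))]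
  intro x
  rw [errorKernel, superpose_apply hα0 hα1 hw]
  exact h x x.2

lemma IsSymmContraction.norm_funCalc_apply_le (hR : IsSymmContraction R)
    {f : C(Icc (0 : ℝ) 1, ℝ)} {M : ℝ} (h : ‖f‖ ≤ M) (u : H) : ‖funCalc R f u‖ ≤ M * ‖u‖ :=
  (funCalc R f).le_of_opNorm_le ((hR.norm_funCalc_le f).trans h) u

lemma integral_dataKernel_sub_vconv (hα0 : 0 < α) (hα1 : α < 1) {k : ℕ} (hk1 : 1 ≤ k)
    (hk : k ≤ 6) (hτ : 0 < τ) {gk : ℝ → H} (hgk : IntegrableOn gk (Ioc 0 T)) (l : ℕ) {n : ℕ}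
    (hn : n * τ ≤ T) :
    IntegrableOn (fun s => funCalc R (errorKernel α k m τ l s n) (gk s)) (Ioc 0 (n * τ)) ∧
    (∫ s in Ioc 0 T, funCalc R (dataKernel α k m τ l s n) (gk s)) -
      vconv (funCalc R) (solutionKernel hα0 hα1 l) gk (n * τ) =
      ∫ s in Ioc 0 (n * τ), funCalc R (errorKernel α k m τ l s n) (gk s) := by
  have ht : 0 ≤ n * τ := by positivity
  have hgk' : IntegrableOn gk (Ioc 0 (n * τ)) := hgk.mono_set (Ioc_subset_Ioc_right hn)
  have h1 : ∫ s in Ioc 0 T, funCalc R (dataKernel α k m τ l s n) (gk s) =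
      ∫ s in Ioc 0 (n * τ), funCalc R (dataKernel α k m τ l s n) (gk s) := by
    refine setIntegral_eq_of_subset_of_forall_sdiff_eq_zero measurableSet_Ioc
      (Ioc_subset_Ioc_right hn) fun s hs => ?_
    rw [dataKernel_eq_zero α k m hτ l, map_zero]
    · rfl
    · by_contra hc
      exact hs.2 ⟨hs.1.1, not_lt.1 hc⟩
  have hi1 := integrableOn_funCalc_dataKernel (R := R) (α := α) (k := k) (m := m) hτ hgk' l n
  have hi2 : IntegrableOn (fun s => funCalc R (solutionKernel hα0 hα1 l (n * τ - s)) (gk s))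
      (Ioc 0 (n * τ)) := by
    have hc : Continuous fun s => solutionKernel hα0 hα1 l (n * τ - s) :=
      (continuous_solutionKernel hα0 hα1 l).comp (continuous_const.sub continuous_id)
    obtain ⟨C, hC⟩ := isCompact_Icc.exists_bound_of_continuousOn (hc.continuousOn (s := Icc 0 (n * τ)))
    refine Integrable.mono' (hgk'.norm.const_mul (‖funCalc R‖ * C))
      ((funCalc R).aestronglyMeasurable_comp₂ hc.aestronglyMeasurable hgk'.aestronglyMeasurable)
      ((ae_restrict_iff' measurableSet_Ioc).2 (Eventually.of_forall fun s hs => ?_))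
    refine ((funCalc R).le_opNorm₂ _ _).trans ?_
    have := hC s (Ioc_subset_Icc_self hs)
    gcongr
  have he : EqOn (fun s => funCalc R (errorKernel α k m τ l s n) (gk s))
      (fun s => funCalc R (dataKernel α k m τ l s n) (gk s) -
        funCalc R (solutionKernel hα0 hα1 l (n * τ - s)) (gk s)) (Ioc 0 (n * τ)) := by
    intro s hs
    have h := (dataKernel_sub hα0 hα1 hk1 hk m hτ l s n).2
    rw [if_pos hs.2] at h
    simp only
    rw [errorKernel, ← h, map_sub]
    rfl
  refine ⟨IntegrableOn.congr_fun (hi1.sub hi2) he.symm measurableSet_Ioc, ?_⟩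
  rw [h1, vconv, intervalIntegral.integral_of_le ht, ← integral_sub hi1 hi2]
  exact (setIntegral_congr_fun measurableSet_Ioc he).symm

/-- The error is E + S + I. Here S and I are error kernels evaluated at R and applied to the Taylor
coefficients and the remainder of g, so sup bounds over x apply. The rest E, due to v, is known only
through R E. -/
theorem norm_error_le (hR : IsSymmContraction R) (hinj : ∀ u, R u = 0 → u = 0)
    (hα0 : 0 < α) (hα1 : α < 1) (hq : q + 1 ≤ 6) (hm : 1 ≤ m) (hT : 0 < T) (hτ : 0 < τ)
    {v : H} {g gk V : ℝ → H} {a : ℕ → H} (hgk : IntegrableOn gk (Ioc 0 T))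
    (hgt : ∀ t ∈ Icc (0 : ℝ) T, g t =
      ∑ l ∈ Finset.range (q + 1), monomialFun l t • a l + iterInt q gk t)
    (hg : ContinuousOn g (Icc 0 T)) (hV : ContinuousOn V (Icc 0 T)) (hV0 : V 0 = 0)
    (heq : ∀ t ∈ Ioc (0 : ℝ) T, ∃ DV AV : H,
      HasDerivWithinAt (rlIntegral (1 - α) V) DV (Icc 0 T) t ∧
      V t + v = R (V t + v - AV) ∧ DV - AV = g t)
    {U : ℕ → H} {n : ℕ} (hn : n * τ ≤ T) (hU0 : U 0 = 0)
    (hUeq : ∀ i : ℕ, 1 ≤ i → i ≤ n → ∃ AV : H,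
      U i + bdfQuadrature τ m (q + 1) (fun j => (j * τ) ^ m / (m.factorial : ℝ)) i • v =
        R (U i + bdfQuadrature τ m (q + 1) (fun j => (j * τ) ^ m / (m.factorial : ℝ)) i • v - AV) ∧
      bdfQuadrature τ α (q + 1) U i - AV =
        bdfQuadrature τ m (q + 1) (fun j => rlIntegral m g (j * τ)) i)
    {M₀ c : ℝ} {M : ℕ → ℝ} (hM₀ : 0 ≤ M₀)
    (h0 : ∀ x ∈ Icc (0 : ℝ) 1, (1 - x) * |∫ r in Ioi 0, spectralDensity α r x *
      (τ * PowerSeries.coeff n (odeError (q + 1) m 0 (r * τ) 0))| ≤ M₀ * x)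
    (h1 : ∀ l < q + 1, ∀ x ∈ Icc (0 : ℝ) 1, |∫ r in Ioi 0, spectralDensity α r x *
      (τ ^ (l + 1) * PowerSeries.coeff n (odeError (q + 1) m l (r * τ) 0))| ≤ M l)
    (h2 : ∀ x ∈ Icc (0 : ℝ) 1, ∀ s : ℝ, 0 ≤ s → s < n * τ →
      |∫ r in Ioi 0, spectralDensity α r x *
        (τ ^ (q + 1) * PowerSeries.coeff n (odeError (q + 1) m q (r * τ) (s / τ)))| ≤
        c * (n * τ - s) ^ (α - 1))
    (hwi : IntervalIntegrable (fun s => (n * τ - s) ^ (α - 1) * ‖gk s‖) volume 0 (n * τ)) :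
    ‖U n - V (n * τ)‖ ≤ M₀ * ‖v‖ + ∑ l ∈ Finset.range (q + 1), M l * ‖a l‖ +
      c * ∫ s in (0 : ℝ)..n * τ, (n * τ - s) ^ (α - 1) * ‖gk s‖ := by
  set t : ℝ := n * τ with ht
  have ht0 : 0 ≤ t := by positivity
  have hk1 : 1 ≤ q + 1 := by omega
  have hRgk : IntegrableOn (fun s => R (gk s)) (Ioc 0 T) := R.integrable_comp hgk
  have hle : ∀ i ≤ n, (i : ℝ) * τ ∈ Icc 0 T := by
    intro i hi
    have : (i : ℝ) ≤ n := by exact_mod_cast hi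
    exact ⟨by positivity, by nlinarith⟩
  have e1 := apply_solution_eq hR hα0 hα1 hT hgk hgt hg hV hV0 heq (t := t) ⟨ht0, hn⟩
  have e2 := apply_discrete_solution_eq hR hα0 hα1 hk1 hq hm hτ hgk hn
    (a := a) (q := q) (fun i hi => by
      rw [rlIntegral_natCast hm, iterInt_taylor hgk hgt (hle i hi),
        show m - 1 + q + 1 = q + m by omega]
      congr 1
      refine Finset.sum_congr rfl fun l _ => ?_
      rw [show m - 1 + l + 1 = l + m by omega]) hU0 hUeq
  have hE0 : ∀ l, dataKernel α (q + 1) m τ l 0 n - solutionKernel hα0 hα1 l t =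
      errorKernel α (q + 1) m τ l 0 n := by
    intro l
    have h := (dataKernel_sub hα0 hα1 hk1 hq m hτ l 0 n).2
    rwa [if_pos ht0, sub_zero] at h
  have hi := (integral_dataKernel_sub_vconv (R := R) (m := m) hα0 hα1 hk1 hq hτ hgk q hn).1
  have hintR := (integral_dataKernel_sub_vconv (R := R) (m := m) hα0 hα1 hk1 hq hτ hRgk q hn).2
  set S : H := ∑ l ∈ Finset.range (q + 1), funCalc R (errorKernel α (q + 1) m τ l 0 n) (a l) with hS
  set I : H := ∫ s in Ioc 0 t, funCalc R (errorKernel α (q + 1) m τ q s n) (gk s) with hI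
  have hRI : ∫ s in Ioc 0 t, funCalc R (errorKernel α (q + 1) m τ q s n) (R (gk s)) = R I := by
    rw [hI, ← R.integral_comp_comm hi]
    simp_rw [hR.funCalc_comm]
    rfl
  -- The initial value enters as the kernel times (1 - R) v, so the function to be compared with M₀
  -- x carries the factor 1 - x of `h0`.
  have e3 : R (U n - V t - S - I) = funCalc R
      (-(errorKernel α (q + 1) m τ 0 0 n * (1 - coordFun))) v := by
    have e4 : R (U n - V t) = R S + R I -
        funCalc R (errorKernel α (q + 1) m τ 0 0 n) (v - R v) := by
      have eS : R S = ∑ l ∈ Finset.range (q + 1), funCalc R (dataKernel α (q + 1) m τ l 0 n) (R (a l))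
          - ∑ l ∈ Finset.range (q + 1), funCalc R (solutionKernel hα0 hα1 l t) (R (a l)) := by
        rw [hS, map_sum, ← Finset.sum_sub_distrib]
        refine Finset.sum_congr rfl fun l _ => ?_
        rw [← hR.funCalc_comm, ← hE0, map_sub]
        rfl
      have eI : R I = (∫ s in Ioc 0 T, funCalc R (dataKernel α (q + 1) m τ q s n) (R (gk s))) -
          vconv (funCalc R) (solutionKernel hα0 hα1 q) (fun s => R (gk s)) t :=
        hRI.symm.trans hintR.symm
      have eK : funCalc R (errorKernel α (q + 1) m τ 0 0 n) (v - R v) =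
          funCalc R (dataKernel α (q + 1) m τ 0 0 n) (v - R v) -
          funCalc R (solutionKernel hα0 hα1 0 t) (v - R v) := by
        rw [← hE0, map_sub (funCalc R), _root_.sub_apply]
      rw [map_sub, e1, e2, eS, eI, eK]
      abel
    rw [map_sub, map_sub R (U n - V t), e4, map_neg, _root_.neg_apply, hR.funCalc_mul_apply,
      map_sub (funCalc R), hR.funCalc_one, hR.funCalc_coordFun]
    change R S + R I - funCalc R (errorKernel α (q + 1) m τ 0 0 n) (v - R v) - R S - R I =
      -funCalc R (errorKernel α (q + 1) m τ 0 0 n) (v - R v)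
    abel
  have b0 : ‖U n - V t - S - I‖ ≤ M₀ * ‖v‖ := by
    refine hR.norm_le_of_apply_eq hinj hM₀ (fun x => ?_) e3
    have hx := h0 x x.2
    have hw := (dataKernel_sub hα0 hα1 hk1 hq m hτ 0 0 n).1
    rw [ContinuousMap.neg_apply, abs_neg, ContinuousMap.mul_apply, abs_mul, errorKernel,
      superpose_apply hα0 hα1 hw, ContinuousMap.sub_apply, ContinuousMap.one_apply, coordFun_apply,
      abs_of_nonneg (by linarith [x.2.2] : 0 ≤ 1 - (x : ℝ)), mul_comm, zero_div, zero_add, pow_one]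
    exact hx
  have b1 : ‖S‖ ≤ ∑ l ∈ Finset.range (q + 1), M l * ‖a l‖ := by
    refine (norm_sum_le _ _).trans (Finset.sum_le_sum fun l hl => ?_)
    refine hR.norm_funCalc_apply_le (norm_errorKernel_le hα0 hα1 hk1 hq hτ fun x hx => ?_) _
    rw [zero_div]
    exact h1 l (Finset.mem_range.1 hl) x hx
  have b2 : ‖I‖ ≤ c * ∫ s in (0 : ℝ)..t, (t - s) ^ (α - 1) * ‖gk s‖ := by
    -- The kernel bound is available for s < t only, hence the open interval; the endpoint has
    -- measure zero.
    rw [intervalIntegrable_iff_integrableOn_Ioo_of_le ht0] at hwi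
    rw [hI, intervalIntegral.integral_of_le ht0, integral_Ioc_eq_integral_Ioo,
      integral_Ioc_eq_integral_Ioo, ← integral_const_mul]
    refine norm_integral_le_of_norm_le (hwi.const_mul c)
      ((ae_restrict_iff' measurableSet_Ioo).2 (Eventually.of_forall fun s hs => ?_))
    rw [← mul_assoc]
    exact hR.norm_funCalc_apply_le (norm_errorKernel_le hα0 hα1 hk1 hq hτ fun x hx =>
      h2 x hx s hs.1.le hs.2) _
  calc ‖U n - V t‖ = ‖(U n - V t - S - I) + S + I‖ := by congr 1; abel
    _ ≤ ‖U n - V t - S - I‖ + ‖S‖ + ‖I‖ := norm_add₃_le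
    _ ≤ _ := by gcongr

lemma sourceFactor_nonneg (α : ℝ) (k m l : ℕ) {τ t : ℝ} (hτ : 0 ≤ τ) (ht : 0 ≤ t) :
    0 ≤ sourceFactor α k m l τ t := by
  unfold sourceFactor
  split_ifs <;> positivity

lemma initialFactor_nonneg (k m : ℕ) {τ t : ℝ} (hτ : 0 ≤ τ) (ht : 0 ≤ t) :
    0 ≤ initialFactor k m τ t := by
  unfold initialFactor
  split_ifs <;> positivity

end ErrorEstimate

end Subdiffusion

end

/-! ### The error estimate for the ID m-BDF k scheme. -/

theorem theorem3p1 {𝕜 : Type*} [RCLike 𝕜] (α : ℝ) (hα0 : 0 < α) (hα1 : α < 1)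
    (k m : ℕ) (hm : 1 ≤ m) (hmk : m ≤ k) (hk : k ≤ 6) :
    ∃ c : ℝ, 0 < c ∧
      ∀ (d : ℕ) (_ : 1 ≤ d) (Ω : TopologicalSpace.Opens (EuclideanSpace ℝ (Fin d)))
        (_ : Subdiffusion.IsConvexPolyhedralDomain Ω)
        (T : ℝ) (_ : 0 < T)
        (v : Subdiffusion.L2 𝕜 Ω) (g gk : ℝ → Subdiffusion.L2 𝕜 Ω)
        (_ : Subdiffusion.SourceRegularity α T k g gk)
        (V : ℝ → Subdiffusion.L2 𝕜 Ω) (_ : Subdiffusion.IsSolution α T v g V)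
        (N : ℕ) (_ : 1 ≤ N) (τ : ℝ) (_ : τ = T / N)
        (Vd : ℕ → Subdiffusion.L2 𝕜 Ω)
        (_ : Subdiffusion.IsDiscreteSolution α τ N k m v g Vd)
        (n : ℕ) (_ : 1 ≤ n) (_ : n ≤ N) (t : ℝ) (_ : t = n * τ),
        ‖Vd n - V t‖ ≤
          c * Subdiffusion.initialFactor k m τ t * ‖v‖
          + c * ∑ l ∈ Finset.range k,
              Subdiffusion.sourceFactor α k m l τ t * ‖iteratedDerivWithin l g (Icc 0 T) 0‖
          + c * τ ^ k * ∫ s in (0 : ℝ)..t, (t - s) ^ (α - 1) * ‖gk s‖ := by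
  obtain ⟨q, rfl⟩ : ∃ q, k = q + 1 := ⟨k - 1, by omega⟩
  have hk1 : 1 ≤ q + 1 := by omega
  obtain ⟨c₀, hc₀, h₀⟩ := Subdiffusion.exists_initial_kernel_error_le hα0 hα1 hk1 hk hm
  obtain ⟨c₁, hc₁, h₁⟩ := Subdiffusion.exists_remainder_kernel_error_le hα0 hα1 hk1 hk m
  choose! b hb h₂ using fun (l : ℕ) (hl : l < q + 1) =>
    Subdiffusion.exists_source_kernel_error_le hα0 hα1 hk1 hk hm hl
  have hbsum : ∀ l ∈ Finset.range (q + 1), b l ≤ ∑ l ∈ Finset.range (q + 1), b l := fun l hl =>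
    Finset.single_le_sum (fun i hi => (hb i (Finset.mem_range.1 hi)).le) hl
  have hbn : 0 ≤ ∑ l ∈ Finset.range (q + 1), b l :=
    Finset.sum_nonneg fun i hi => (hb i (Finset.mem_range.1 hi)).le
  -- The sum of all kernel constants dominates each of them. It is fixed before the domain, the data
  -- and the step size, because the scalar estimates are uniform in x ∈ [0,1] and in τ.
  refine ⟨c₀ + c₁ + ∑ l ∈ Finset.range (q + 1), b l, by positivity, ?_⟩
  intro d _ Ω _ T hT v g gk hg V hV N hN τ hτN Vd hVd n hn1 hnN t ht
  have hN0 : (0 : ℝ) < N := by exact_mod_cast hN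
  have hτ : 0 < τ := by rw [hτN]; positivity
  have hn0 : (0 : ℝ) < n := by exact_mod_cast hn1
  have ht0 : 0 < t := by rw [ht]; positivity
  have htT : n * τ ≤ T := by
    have h1 : (n : ℝ) ≤ N := by exact_mod_cast hnN
    calc n * τ ≤ N * τ := by gcongr
      _ = T := by rw [hτN]; field_simp
  have hgk : IntegrableOn gk (Ioc 0 T) :=
    (intervalIntegrable_iff_integrableOn_Ioc_of_le hT.le).1 hg.integrable
  have hgc : ContDiffOn ℝ q g (Icc 0 T) := hg.contDiffOn
  have key := Subdiffusion.norm_error_le (R := Subdiffusion.dirichletResolvent 𝕜 Ω)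
    Subdiffusion.isSymmContraction_dirichletResolvent
    (fun _ => Subdiffusion.eq_zero_of_dirichletResolvent_eq_zero) hα0 hα1 hk hm hT hτ hgk
    (a := fun l => iteratedDerivWithin l g (Icc 0 T) 0)
    (fun s hs => Subdiffusion.taylor_integral hT hgc hgk hg.weakDeriv hs)
    hgc.continuousOn hV.continuousOn hV.initial (v := v)
    (fun s hs => by
      obtain ⟨DV, AV, h1, h2, h3⟩ := hV.equation s hs
      exact ⟨DV, AV, h1, h2.eq_dirichletResolvent, h3⟩)
    (U := Vd) htT hVd.initial
    (fun i hi hin => by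
      obtain ⟨AV, h1, h2⟩ := hVd.equation i hi (hin.trans hnN)
      exact ⟨AV, h1.eq_dirichletResolvent, h2⟩)
    (mul_nonneg hc₀.le (Subdiffusion.initialFactor_nonneg (q + 1) m hτ.le (ht ▸ ht0.le)))
    (fun x hx => h₀ x hx τ hτ n hn1) (fun l hl x hx => h₂ l hl x hx τ hτ n hn1)
    (fun x hx s hs0 hs => h₁ x hx τ hτ n s hs0 hs) (hg.weighted _ ⟨ht ▸ ht0, htT⟩)
  rw [← ht] at key
  refine key.trans ?_
  have hw : 0 ≤ ∫ s in (0 : ℝ)..t, (t - s) ^ (α - 1) * ‖gk s‖ :=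
    intervalIntegral.integral_nonneg ht0.le fun s hs =>
      mul_nonneg (Real.rpow_nonneg (by linarith [hs.2]) _) (norm_nonneg _)
  have hi := Subdiffusion.initialFactor_nonneg (q + 1) m hτ.le ht0.le
  rw [Finset.mul_sum]
  refine add_le_add (add_le_add ?_ (Finset.sum_le_sum fun l hl => ?_)) ?_
  · gcongr
    linarith
  · have hs := Subdiffusion.sourceFactor_nonneg α (q + 1) m l hτ.le ht0.le
    rw [← mul_assoc]
    gcongr
    linarith [hbsum l hl]
  · gcongr
    linarith
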